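/- **Setting.** Let $-\infty\le a<b\le\infty$, let $f\in C^\infty(a,b)$ be positive, and let $S=(a,b)\times S^1$ carry the metric $ds^2=dr^2+f(r)^2d\varphi^2$. For a central potential $V=V(r)\in C^\infty(a,b)$ consider the motion with Lagrangian $\frac12(\dot r^2+f(r)^2\dot\varphi^2)-V(r)$, with first integral $K=f(r)^2\dot\varphi$ (angular momentum). A trajectory is *bounded* if it is defined for all $t\in\mathbb R$ and its image lies in some $[r_1,r_2]\times S^1\subset S$; it is *singular* if $K=0$; its orbit (image) is *circular* if it is a whole circle $\{r_0\}\times S^1$, and *closed* if the motion on $S$ is periodic. A circular orbit $\{r_0\}\times S^1$ with momentum $K_0\neq0$ is *strongly stable* if $V+K_0^2/(2f^2)$ has a nondegenerate local minimum at $r_0$, and *orbitally stable* if its phase orbit is (Lyapunov) orbitally stable for the system restricted to the level $K=K_0$. Consider the conditions * $(\exists)$: there is a bounded nonsingular noncircular orbit $\gamma$; * $(\forall)$: every bounded nonsingular orbit is closed; * $(\exists)^{loc}$: there is a strongly stable circular orbit; * $(\forall)^{loc}$: for every strongly stable circular orbit $\{r_0\}\times S^1$ and every momentum $K_0$ at which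 it is strongly stable there is $\varepsilon>0$ such that every bounded nonsingular orbit in $[r_0-\varepsilon,r_0+\varepsilon]\times S^1$ with momentum in $(K_0-\varepsilon,K_0+\varepsilon)$ is closed; * $(\forall)^{s\text{-}loc}$: every bounded nonsingular orbit in $[\inf r|_\gamma,\sup r|_\gamma]\times S^1$ with the same momentum as $\gamma$ is closed. $V$ is *closing* if $(\exists),(\forall)$ hold; *locally closing* if $(\exists)^{loc},(\forall)^{loc}$ hold; *semilocally closing* if $(\forall)^{loc}$ holds and there is an orbit $\gamma$ as in $(\exists)$ for which $(\forall)^{s\text{-}loc}$ holds; *strongly closing* if every circle $\{r\}\times S^1$ is a strongly stable circular orbit and $(\forall)^{loc}$ holds; *weakly closing* if every circle $\{r\}\times S^1$ is an orbitally stable circular orbit and the analogue of $(\forall)^{loc}$ holds for all orbitally stable circular orbits and momenta. **Bertrand surfaces.** For $c,d\in\mathbb R$ put $Q_{c,d}(\theta)=\theta^2+c-d\theta^{-2}$ and $I_{c,d}=\{\theta<0: Q_{c,d}(\theta)>0,\ Q_{c,d}'(\theta)\ne0\}$. This set consists of $k_{c,d}$ maximal intervals $I_{c,d,k}$, where $k_{c,d}=1$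 for $d\ge0$ and $k_{c,d}=2$ for $d<0$; $k=1$ denotes the interval unbounded below, and $k=2$ (for $d<0$) the one with right end $0$. Let $r_{c,d}$ be any chosen antiderivative of $1/Q_{c,d}$ on $I_{c,d}$, $\theta_{c,d,k}$ the inverse of $r_{c,d}|_{I_{c,d,k}}$, and $f_{c,d,k}(r)=Q_{c,d}(\theta_{c,d,k}(r))^{-1/2}$. The Bertrand surface $S_{c,d,k}$ with parameter $\mu>0$ is $r_{c,d}(I_{c,d,k})\times S^1$ with the metric $ds_{\mu,c,d}^2=dr^2+\mu^{-2}f_{c,d,k}(r)^2d\varphi^2$. Let $\gamma:[0,2\pi]\to\mathbb R^2$, $\gamma(\phi)=(c_\phi,d_\phi)$, be a (not necessarily continuous) curve whose image meets every set $\{(sc,s^2d): s>0\}$, $(c,d)\in\mathbb R^2$, in exactly one point. **Theorem.** (A) Every $C^\infty$ closing central potential on $S$ is semilocally closing, every strongly closing one is weakly closing, every weakly closing one is semilocally closing, and every semilocally closing one is locally closing. (B) Suppose that $f$ has no critical points on $(a,b)$. Then every $C^\infty$ locally closing central potential is closing and strongly closing, and the following are equivalent: * (a) $S$ has a $C^\infty$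 closing central potential; * (b) there are $\mu\in\mathbb Q_{>0}$, $c,d\in\mathbb R$ and a smooth function $\theta(r)$ on $(a,b)$ without zeros, $\theta'>0$, such that $$ds^2=\frac{d\theta^2}{Q_{c,d}(\theta)^2}+\frac{d\varphi^2}{\mu^2Q_{c,d}(\theta)};$$ equivalently, with the same $\mu,c,d,\theta$, there are $r_0\in\mathbb R$, $\eta=\pm1$, $k\in\{1,k_{c,d}\}$ such that for all $r\in(a,b)$: $\eta(r-r_0)\in r_{c,d}(I_{c,d,k})$, $f(r)=\frac1\mu f_{c,d,k}(\eta(r-r_0))$ and $\theta(r)=\eta\,\theta_{c,d,k}(\eta(r-r_0))$; equivalently (as regards $\mu,c,d,r_0,\eta,k$), $(r,\varphi)\mapsto(\eta(r-r_0),\varphi)$ is an isometric $S^1$-equivariant embedding of $(S,ds^2)$ into $(S_{c,d,k},ds^2_{\mu,c,d})$; * (c) there are $\mu\in\mathbb Q_{>0}$, $\lambda\in\mathbb R\setminus\{0\}$, $\phi\in[0,2\pi]$, $r_0\in\mathbb R$, $k\in\{1,k_{\gamma(\phi)}\}$, with $|\lambda|=1$ if $\gamma(\phi)=(0,0)$,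 such that for all $r\in(a,b)$: $\lambda(r-r_0)\in r_{\gamma(\phi)}(I_{\gamma(\phi),k})$ and $f(r)=\frac1{\mu|\lambda|}f_{\gamma(\phi),k}(\lambda(r-r_0))$; equivalently, with the same parameters, $(r,\varphi)\mapsto(\lambda(r-r_0),\varphi)$ is an isometric $S^1$-equivariant embedding of $(S,\lambda^2ds^2)$ into $(S_{\gamma(\phi),k},ds^2_{\mu,\gamma(\phi)})$. The parameters $(\mu,c,d,r_0,\eta,k)$ and the function $\theta$ in (b) are unique. The parameters $(\mu,\lambda,r_0,k)$ and the point $\gamma(\phi)$ in (c) are unique, and $\phi$ itself is unique if $\gamma$ is injective. The numbers $\mu$ and $k$ in (b) and (c) coincide, $\eta=\lambda/|\lambda|$, $c=\lambda^2c_\phi$, $d=\lambda^4d_\phi$ and $\theta(r)=\lambda\,\theta_{\gamma(\phi),k}(\lambda(r-r_0))$ with $r_0$ from (c). The numbers $r_0$ in (b) and (c) coincide as well if the antiderivatives are chosen so that $r_{s^2c,s^4d}(s\theta)=s^{-1}r_{c,d}(\theta)$ for all $s>0$, $(c,d)\in\mathbb R^2$, $\theta\in I_{c,d}$. If (b) holds,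 then $V$ is a $C^\infty$ closing central potential if and only if $$V(r)=V_i(r)=(-1)^i\frac{A_i}{i}|\theta(r)|^{2-i^2}+B_i,\qquad r\in(a,b),$$ where $i\in\{1,2\}$ if $d=0$ and $i=2$ if $d\neq0$, and $A_i,B_i\in\mathbb R$ are constants with $A_1>0$ for $i=1$, and $A_2(\theta(r)^4+d)>0$ on $(a,b)$ for $i=2$. (C) Let $f$ have no critical points, let (b) hold and let $V=V_i$ be such a potential. Then every bounded nonsingular noncircular orbit is given by a periodic function $r=r(\varphi)$ with minimal positive period $2\pi\mu/i$. For every $r\in(a,b)$ the circle $\{r\}\times S^1$ is a circular orbit exactly for the values $$K=\pm\frac1\mu\sqrt{\frac{A_i}{|\theta(r)|^{i^2}+d}}$$ of the angular momentum. There is a boundary circle $\{\hat r\}\times S^1$ ($\hat r\in\{a,b\}$ finite) on which $\inf f$ is attained as a limit, and for any boundary circle this is equivalent to $\sup A_i|\theta|$ being attained there, and to $\inf V_i$ being attained there (possibly as infinite limits); that is, this circle is the attracting centre. -/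

import Mathlib

open Set Filter Topology
open scoped ContDiff

noncomputable section

/-! ### Abstract surfaces of revolution -/

/-- An abstract surface of revolution `(a, b) × S¹`, `-∞ ≤ a < b ≤ ∞`, with the Riemannian metric
`dr² + f(r)² dφ²`, where `f` is smooth and positive on `(a, b)`. -/
structure RevSurface where
  a : EReal
  b : EReal
  f : ℝ → ℝ
  a_lt_b : a < b
  f_smooth : ContDiffOn ℝ ∞ f {r : ℝ | a < (r : EReal) ∧ (r : EReal) < b}
  f_pos : ∀ r : ℝ, a < (r : EReal) → (r : EReal) < b → 0 < f r

namespace RevSurface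

/-- The interval `(a, b)` of values of the coordinate `r`. -/
def I (S : RevSurface) : Set ℝ := {r : ℝ | S.a < (r : EReal) ∧ (r : EReal) < S.b}

/-- `V` is a smooth central potential on the surface (a smooth function of `r ∈ (a, b)`). -/
def SmoothPotential (S : RevSurface) (V : ℝ → ℝ) : Prop := ContDiffOn ℝ ∞ V S.I

/-- The curve `t ↦ (r t, φ t mod 2π)`, `t ∈ J`, solves the equations of motion, that is the
Euler-Lagrange equations of `(ṙ² + f(r)² φ̇²) / 2 - V(r)`. The angle is lifted to `ℝ`. -/
structure IsMotion (S : RevSurface) (V : ℝ → ℝ) (J : Set ℝ) (r φ : ℝ → ℝ) : Prop where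
  mem : ∀ t ∈ J, r t ∈ S.I
  r_smooth : ContDiffOn ℝ 2 r J
  φ_smooth : ContDiffOn ℝ 2 φ J
  radial : ∀ t ∈ J,
    deriv (deriv r) t = S.f (r t) * deriv S.f (r t) * deriv φ t ^ 2 - deriv V (r t)
  angular : ∀ t ∈ J, deriv (fun s => S.f (r s) ^ 2 * deriv φ s) t = 0

/-- The angular momentum integral `f(r)² φ̇` has the value `K` on the curve. -/
def HasMomentum (S : RevSurface) (J : Set ℝ) (r φ : ℝ → ℝ) (K : ℝ) : Prop :=
  ∀ t ∈ J, S.f (r t) ^ 2 * deriv φ t = K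

/-- A bounded trajectory: defined for all times, with image in a compact ring
`[r₁, r₂] × S¹` contained in `(a, b) × S¹`. -/
def IsBoundedTrajectory (S : RevSurface) (V : ℝ → ℝ) (r φ : ℝ → ℝ) : Prop :=
  S.IsMotion V univ r φ ∧ ∃ r₁ ∈ S.I, ∃ r₂ ∈ S.I, ∀ t, r t ∈ Icc r₁ r₂

end RevSurface

/-- The orbit: the image of the trajectory in `ℝ × S¹`. -/
def orbitOf (r φ : ℝ → ℝ) : Set (ℝ × Real.Angle) :=
  range fun t => (r t, (φ t : Real.Angle))

/-- The point of the phase space, in the coordinates `(r, φ mod 2π, ṙ, φ̇)`. -/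
def phasePoint (r φ : ℝ → ℝ) (t : ℝ) : ℝ × Real.Angle × ℝ × ℝ :=
  (r t, (φ t : Real.Angle), deriv r t, deriv φ t)

/-- The orbit is closed: the motion on the surface is periodic. -/
def IsClosedOrbit (r φ : ℝ → ℝ) : Prop :=
  ∃ T > 0, ∀ t, r (t + T) = r t ∧ (φ (t + T) : Real.Angle) = (φ t : Real.Angle)

/-- The orbit is circular: it coincides with an orbit of the rotation group. -/
def IsCircularOrbit (r φ : ℝ → ℝ) : Prop :=
  ∃ r₀ : ℝ, orbitOf r φ = {r₀} ×ˢ univ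

namespace RevSurface

/-- `(r, φ)` is a circular trajectory on `{r₀} × S¹` with angular momentum `K₀`. -/
def IsCircularTrajectory (S : RevSurface) (V : ℝ → ℝ) (r₀ K₀ : ℝ) (r φ : ℝ → ℝ) : Prop :=
  S.IsMotion V univ r φ ∧ S.HasMomentum univ r φ K₀ ∧ orbitOf r φ = {r₀} ×ˢ univ

/-- The circle `{r₀} × S¹` is a circular orbit with angular momentum `K₀`. -/
def CircularAt (S : RevSurface) (V : ℝ → ℝ) (r₀ K₀ : ℝ) : Prop :=
  ∃ r φ, S.IsCircularTrajectory V r₀ K₀ r φ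

/-- The effective potential `V + K² / (2 f²)`. -/
def effPotential (S : RevSurface) (V : ℝ → ℝ) (K : ℝ) (r : ℝ) : ℝ :=
  V r + K ^ 2 / (2 * S.f r ^ 2)

/-- The circle `{r₀} × S¹` is a strongly stable circular orbit at the angular momentum `K₀ ≠ 0`:
the effective potential has a nondegenerate local minimum at `r₀`. -/
def StronglyStableAt (S : RevSurface) (V : ℝ → ℝ) (r₀ K₀ : ℝ) : Prop :=
  S.CircularAt V r₀ K₀ ∧ K₀ ≠ 0 ∧ IsLocalMin (S.effPotential V K₀) r₀ ∧
    0 < deriv (deriv (S.effPotential V K₀)) r₀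

/-- The circle `{r₀} × S¹`, run through with angular momentum `K₀`, is orbitally stable for the
restriction of the system to the level set `K = K₀` in the phase space. -/
def OrbitallyStableAt (S : RevSurface) (V : ℝ → ℝ) (r₀ K₀ : ℝ) : Prop :=
  ∃ r φ, S.IsCircularTrajectory V r₀ K₀ r φ ∧
    ∀ ε > 0, ∃ δ > 0, ∀ (J : Set ℝ) (r' φ' : ℝ → ℝ), IsOpen J → J.OrdConnected → (0 : ℝ) ∈ J →
      S.IsMotion V J r' φ' → S.HasMomentum J r' φ' K₀ →
      phasePoint r' φ' 0 ∈ Metric.thickening δ (range (phasePoint r φ)) →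
      ∀ t ∈ J, 0 ≤ t → phasePoint r' φ' t ∈ Metric.thickening ε (range (phasePoint r φ))

/-- The local closing condition at all circular orbits `{r₀} × S¹` with angular momentum `K₀` in a
given class `P r₀ K₀`. -/
def LocallyClosesAt (S : RevSurface) (V : ℝ → ℝ) (P : ℝ → ℝ → Prop) : Prop :=
  ∀ r₀ ∈ S.I, ∀ K₀, P r₀ K₀ → ∃ ε > 0, ∀ (r φ : ℝ → ℝ) (K : ℝ),
    S.IsBoundedTrajectory V r φ → S.HasMomentum univ r φ K → K ≠ 0 →
    (∀ t, r t ∈ Icc (r₀ - ε) (r₀ + ε)) → K ∈ Ioo (K₀ - ε) (K₀ + ε) → IsClosedOrbit r φ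

/-- `(r, φ)` is a bounded nonsingular (`K ≠ 0`) noncircular trajectory with momentum `K`. -/
def IsOscillation (S : RevSurface) (V : ℝ → ℝ) (r φ : ℝ → ℝ) (K : ℝ) : Prop :=
  S.IsBoundedTrajectory V r φ ∧ S.HasMomentum univ r φ K ∧ K ≠ 0 ∧ ¬ IsCircularOrbit r φ

/-! ### The five closing notions -/

/-- Closing potential. -/
def IsClosing (S : RevSurface) (V : ℝ → ℝ) : Prop :=
  (∃ r φ K, S.IsOscillation V r φ K) ∧
  ∀ r φ K, S.IsBoundedTrajectory V r φ → S.HasMomentum univ r φ K → K ≠ 0 → IsClosedOrbit r φ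

/-- Locally closing potential. -/
def IsLocallyClosing (S : RevSurface) (V : ℝ → ℝ) : Prop :=
  (∃ r₀ ∈ S.I, ∃ K₀, S.StronglyStableAt V r₀ K₀) ∧ S.LocallyClosesAt V (S.StronglyStableAt V)

/-- Semilocally closing potential. -/
def IsSemilocallyClosing (S : RevSurface) (V : ℝ → ℝ) : Prop :=
  (∃ r₁ φ₁ K₁, S.IsOscillation V r₁ φ₁ K₁ ∧
    ∀ r φ, S.IsBoundedTrajectory V r φ → S.HasMomentum univ r φ K₁ →
      (∀ t, r t ∈ Icc (sInf (range r₁)) (sSup (range r₁))) → IsClosedOrbit r φ) ∧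
  S.LocallyClosesAt V (S.StronglyStableAt V)

/-- Strongly closing potential. -/
def IsStronglyClosing (S : RevSurface) (V : ℝ → ℝ) : Prop :=
  (∀ r₀ ∈ S.I, ∃ K₀, S.StronglyStableAt V r₀ K₀) ∧ S.LocallyClosesAt V (S.StronglyStableAt V)

/-- Weakly closing potential. -/
def IsWeaklyClosing (S : RevSurface) (V : ℝ → ℝ) : Prop :=
  (∀ r₀ ∈ S.I, ∃ K₀, S.OrbitallyStableAt V r₀ K₀) ∧ S.LocallyClosesAt V (S.OrbitallyStableAt V)

end RevSurface

/-! ### Isometric equivariant embeddings -/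

/-- The metric `dr² + f(r)² dφ²` at a point with radial coordinate `r`, as a bilinear form in the
coordinates `(dr, dφ)`. -/
def revMetric (f : ℝ → ℝ) (r : ℝ) (u v : ℝ × ℝ) : ℝ := u.1 * v.1 + f r ^ 2 * (u.2 * v.2)

/-- `F` is an `S¹`-equivariant embedding of `(I × S¹, l² (dr² + f² dφ²))` into
`(J × S¹, dr² + g² dφ²)` that is isometric. The differential of `F` is computed on the universal
cover `I × ℝ`, through a smooth lift `G` of `F`. -/
structure IsEquivariantIsometricEmbedding (I : Set ℝ) (f : ℝ → ℝ) (l : ℝ) (J : Set ℝ) (g : ℝ → ℝ)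
    (F : ℝ × Real.Angle → ℝ × Real.Angle) : Prop where
  mapsTo : MapsTo F (I ×ˢ univ) (J ×ˢ univ)
  injOn : InjOn F (I ×ˢ univ)
  equivariant : ∀ r ∈ I, ∀ φ α : Real.Angle, F (r, φ + α) = ((F (r, φ)).1, (F (r, φ)).2 + α)
  isometric : ∃ G : ℝ × ℝ → ℝ × ℝ, ContDiffOn ℝ ∞ G (I ×ˢ univ) ∧
    (∀ p ∈ I ×ˢ (univ : Set ℝ), F (p.1, (p.2 : Real.Angle)) = ((G p).1, ((G p).2 : Real.Angle))) ∧
    ∀ p ∈ I ×ˢ (univ : Set ℝ), ∀ u v : ℝ × ℝ,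
      revMetric g (G p).1 (fderiv ℝ G p u) (fderiv ℝ G p v) = l ^ 2 * revMetric f p.1 u v

/-! ### Maximal Bertrand surfaces -/

/-- `Q_{c,d}(θ) = θ² + c - d θ⁻²`. -/
def bertrandQ (c d θ : ℝ) : ℝ := θ ^ 2 + c - d / θ ^ 2

/-- `I_{c,d} = {θ < 0 | Q_{c,d}(θ) > 0, Q_{c,d}'(θ) ≠ 0}`. -/
def bertrandDomain (c d : ℝ) : Set ℝ :=
  {θ | θ < 0 ∧ 0 < bertrandQ c d θ ∧ deriv (bertrandQ c d) θ ≠ 0}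

/-- The number `k_{c,d}` of maximal intervals of `I_{c,d}`: two if `d < 0`, otherwise one. -/
def bertrandCount (d : ℝ) : ℕ := if d < 0 then 2 else 1

/-- The maximal intervals `I_{c,d,k}` of `I_{c,d}`: for `k = 1` the one that is unbounded below,
for `k = 2` (used only if `d < 0`) the one with right end `0`. -/
def bertrandInterval (c d : ℝ) (k : ℕ) : Set ℝ :=
  if k = 1 then {θ | Iic θ ⊆ bertrandDomain c d} else {θ | θ < 0 ∧ Ico θ 0 ⊆ bertrandDomain c d}

/-- `R c d` is, for all `c, d`, an antiderivative `r_{c,d}` of `1 / Q_{c,d}` on `I_{c,d}`. -/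
def IsBertrandPrimitive (R : ℝ → ℝ → ℝ → ℝ) : Prop :=
  ∀ c d, ∀ θ ∈ bertrandDomain c d, HasDerivAt (R c d) (1 / bertrandQ c d θ) θ

/-- The antiderivatives `r_{c,d}` are chosen compatibly with the rescalings
`(c, d, θ) ↦ (s² c, s⁴ d, s θ)`, `s > 0`. -/
def IsScaleCompatible (R : ℝ → ℝ → ℝ → ℝ) : Prop :=
  ∀ s > 0, ∀ c d, ∀ θ ∈ bertrandDomain c d, R (s ^ 2 * c) (s ^ 4 * d) (s * θ) = s⁻¹ * R c d θ

/-- The interval `r_{c,d}(I_{c,d,k})` of values of `r` on the Bertrand surface `S_{c,d,k}`. -/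
def bertrandRange (R : ℝ → ℝ → ℝ → ℝ) (c d : ℝ) (k : ℕ) : Set ℝ :=
  R c d '' bertrandInterval c d k

/-- `θ_{c,d,k}`, the inverse function of the restriction of `r_{c,d}` to `I_{c,d,k}`. -/
def bertrandTheta (R : ℝ → ℝ → ℝ → ℝ) (c d : ℝ) (k : ℕ) : ℝ → ℝ :=
  Function.invFunOn (R c d) (bertrandInterval c d k)

/-- `f_{c,d,k}(r) = Q_{c,d}(θ_{c,d,k}(r))^{-1/2}`; the metric of the Bertrand surface `S_{c,d,k}`
with parameter `μ` is `dr² + (f_{c,d,k}(r) / μ)² dφ²`. -/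
def bertrandF (R : ℝ → ℝ → ℝ → ℝ) (c d : ℝ) (k : ℕ) (r : ℝ) : ℝ :=
  1 / √(bertrandQ c d (bertrandTheta R c d k r))

/-- The (not necessarily continuous) curve `γ : [0, 2π] → ℝ²` meets every set
`{(s c, s² d) | s > 0}` in exactly one point. -/
def IsScaleSection (γ : ℝ → ℝ × ℝ) : Prop :=
  ∀ c d : ℝ, ∃! p : ℝ × ℝ, p ∈ γ '' Icc 0 (2 * Real.pi) ∧ ∃ s > 0, p = (s * c, s ^ 2 * d)

namespace RevSurface

/-- The coordinate `θ = θ(r)` has no zeros, `θ' > 0`, and in the coordinates `(θ, φ mod 2π)` the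
metric is `dθ² / Q_{c,d}(θ)² + dφ² / (μ² Q_{c,d}(θ))`. -/
def HasMetricForm (S : RevSurface) (μ c d : ℝ) (θ : ℝ → ℝ) : Prop :=
  ContDiffOn ℝ ∞ θ S.I ∧ ∀ r ∈ S.I, θ r ≠ 0 ∧ 0 < deriv θ r ∧
    deriv θ r ^ 2 / bertrandQ c d (θ r) ^ 2 = 1 ∧ S.f r ^ 2 = 1 / (μ ^ 2 * bertrandQ c d (θ r))

/-- `f(r) = f_{c,d,k}(η (r - r₀)) / μ` and `θ(r) = η θ_{c,d,k}(η (r - r₀))` on `(a, b)`, where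
`η = ±1` and `η (r - r₀)` stays in `r_{c,d}(I_{c,d,k})`. -/
def IsBertrandRep (S : RevSurface) (R : ℝ → ℝ → ℝ → ℝ) (μ : ℚ) (c d r₀ η : ℝ) (k : ℕ)
    (θ : ℝ → ℝ) : Prop :=
  0 < μ ∧ (η = 1 ∨ η = -1) ∧ (k = 1 ∨ k = bertrandCount d) ∧
  ∀ r ∈ S.I, η * (r - r₀) ∈ bertrandRange R c d k ∧
    S.f r = 1 / (μ : ℝ) * bertrandF R c d k (η * (r - r₀)) ∧
    θ r = η * bertrandTheta R c d k (η * (r - r₀))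

/-- `(S, ds²)` embeds isometrically and equivariantly into the Bertrand surface `S_{c,d,k}` with
parameter `μ` by `(r, φ) ↦ (η (r - r₀), φ)`. -/
def EmbedsInBertrand (S : RevSurface) (R : ℝ → ℝ → ℝ → ℝ) (μ : ℚ) (c d r₀ η : ℝ) (k : ℕ) :
    Prop :=
  0 < μ ∧ (η = 1 ∨ η = -1) ∧ (k = 1 ∨ k = bertrandCount d) ∧
  IsEquivariantIsometricEmbedding S.I S.f 1 (bertrandRange R c d k)
    (fun x => 1 / (μ : ℝ) * bertrandF R c d k x) (fun p => (η * (p.1 - r₀), p.2))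

/-- The admissible parameters `(μ, l, τ, r₀, k)` of the normalized family, `l` being the
similarity coefficient and `τ` the parameter on the curve `γ`. -/
def NormalizedParameters (γ : ℝ → ℝ × ℝ) (μ : ℚ) (l τ : ℝ) (k : ℕ) : Prop :=
  0 < μ ∧ l ≠ 0 ∧ τ ∈ Icc 0 (2 * Real.pi) ∧ (k = 1 ∨ k = bertrandCount (γ τ).2) ∧
  (γ τ = (0, 0) → |l| = 1)

/-- `f(r) = f_{γ(τ),k}(l (r - r₀)) / (μ |l|)` on `(a, b)`, where `l (r - r₀)` stays in
`r_{γ(τ)}(I_{γ(τ),k})`. -/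
def IsNormalizedRep (S : RevSurface) (R : ℝ → ℝ → ℝ → ℝ) (γ : ℝ → ℝ × ℝ) (μ : ℚ)
    (l τ r₀ : ℝ) (k : ℕ) : Prop :=
  NormalizedParameters γ μ l τ k ∧
  ∀ r ∈ S.I, l * (r - r₀) ∈ bertrandRange R (γ τ).1 (γ τ).2 k ∧
    S.f r = 1 / ((μ : ℝ) * |l|) * bertrandF R (γ τ).1 (γ τ).2 k (l * (r - r₀))

/-- `(S, l² ds²)` embeds isometrically and equivariantly into the normalized Bertrand surface
`S_{γ(τ),k}` with parameter `μ` by `(r, φ) ↦ (l (r - r₀), φ)`. -/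
def EmbedsInNormalized (S : RevSurface) (R : ℝ → ℝ → ℝ → ℝ) (γ : ℝ → ℝ × ℝ) (μ : ℚ)
    (l τ r₀ : ℝ) (k : ℕ) : Prop :=
  NormalizedParameters γ μ l τ k ∧
  IsEquivariantIsometricEmbedding S.I S.f l (bertrandRange R (γ τ).1 (γ τ).2 k)
    (fun x => 1 / (μ : ℝ) * bertrandF R (γ τ).1 (γ τ).2 k x) (fun p => (l * (p.1 - r₀), p.2))

/-- On `(a, b)` the potential is `V_i = (-1)^i A |θ|^{2 - i²} / i + B`, where `i ∈ {1, 2}`, `i = 2`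
if `d ≠ 0`, and the constants satisfy `A > 0` for `i = 1`, `A (θ⁴ + d) > 0` for `i = 2`. -/
def IsBertrandPotential (S : RevSurface) (d : ℝ) (θ : ℝ → ℝ) (i : ℕ) (A B : ℝ) (V : ℝ → ℝ) :
    Prop :=
  (i = 1 ∨ i = 2) ∧ (d ≠ 0 → i = 2) ∧ (i = 1 → 0 < A) ∧
  (i = 2 → ∀ r ∈ S.I, 0 < A * (θ r ^ 4 + d)) ∧
  ∀ r ∈ S.I, V r = (-1) ^ i * A * |θ r| ^ (2 - (i : ℤ) ^ 2) / i + B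

/-- `{e} × S¹` is a boundary circle of the surface and `l` is the filter of neighbourhoods of `e`
in `(a, b)`. -/
def IsBoundaryCircle (S : RevSurface) (e : ℝ) (l : Filter ℝ) : Prop :=
  ((e : EReal) = S.a ∧ l = 𝓝[>] e) ∨ ((e : EReal) = S.b ∧ l = 𝓝[<] e)

/-- The infimum of `g` over `(a, b)` (possibly `-∞`) is the limit of `g` along `l`. -/
def InfAt (S : RevSurface) (g : ℝ → ℝ) (l : Filter ℝ) : Prop :=
  Tendsto (fun r => (g r : EReal)) l (𝓝 (⨅ r ∈ S.I, (g r : EReal)))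

/-- The supremum of `g` over `(a, b)` (possibly `+∞`) is the limit of `g` along `l`. -/
def SupAt (S : RevSurface) (g : ℝ → ℝ) (l : Filter ℝ) : Prop :=
  Tendsto (fun r => (g r : EReal)) l (𝓝 (⨆ r ∈ S.I, (g r : EReal)))

end RevSurface

end

noncomputable section

/-! ### Calculus on the line -/

/-! Along a motion with momentum K ≠ 0 the angle can serve as time. In the coordinate x with dx =
dr/f² the orbit x(φ) obeys Newton's equation with potential P = V/K² + 1/(2f²) (`orbitPotential`),
and an oscillation between x₁ and x₂ is closed only if its period in φ is a rational multiple of 2π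
(`exists_oscillation`). Writing P(x) - P(x₁) = (x - x₁)(x - x₂)D(x), with D a second divided
difference, and letting x run sinusoidally from x₁ to x₂, one gets the period ∫₀^{2π} ds/√(2D),
which is continuous in the energy. A continuous function with values in 2πℚ is constant, so
closedness of all orbits in a well makes the well isochronous. A finite constant period forces a
nondegenerate bottom (`IsWell.nondegenerate`); its value there is 2π/√P'' (`IsWell.period_value`),
so √P'' is rational; and the vanishing of its second order term in the amplitude is 5P'''² =
3P''P'''' (`IsWell.isochronous_relation`, `RevSurface.closing_relations`).

Let w and g be the x-derivatives of V and of 1/(2f²). The circle at x is an orbit for 1/K² = -g/w.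
After this substitution P'' = g' - gw'/w; its root is rational at every strongly stable circle,
hence locally constant, P'' = β², and the second relation reduces to 4w'² = 3ww'', so w = ±(mx +
n)⁻³. If f has no critical points, the set of strongly stable circles is open and, by these
formulas, relatively closed, so they hold on the whole surface
(`RevSurface.exists_affine_of_locallyClosing`). Solving the remaining linear equation for g, with m
= 0 or m ≠ 0, gives the two potentials and shows that 1/(μ²f²) is Q_{c,d} of an affine function θ of
x (`RevSurface.exists_bertrandPotential_of_locallyClosing`).

Conversely, on such a surface |θ|^i is a harmonic oscillation of frequency i/μ as a function of the
angle (`RevSurface.BertrandData.harmonic`), so for rational μ all bounded nonsingular orbits close,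
and the minimal periods can be read off.

Uniqueness of the parameters rests on θ' = 1/(μ²f²): two admissible coordinates are affinely
related, and the resulting polynomial identity fixes all constants
(`RevSurface.HasMetricForm.unique`). The representations by pieces of Bertrand surfaces are obtained
by integrating dr = dθ/Q, and the normalised ones by the scaling of Q. The centre lies at finite
distance because θ blows up in finite time while Q stays away from zero (`bertrand_incomplete`).

For the implications valid on every surface: strong stability gives orbital stability by
conservation of energy, and under strong closing every circular orbit is strongly stable
(`RevSurface.stronglyStableAt_of_circularAt`). A small radial kick of an orbitally stable circle
produces an oscillation. Finally, inside an interval where all orbits of one momentum close, the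
effective potential can only be a well with a nondegenerate bottom
(`RevSurface.exists_stronglyStableAt_of_closed`). -/

theorem contDiffOn_of_hasDerivAt_comp {g F : ℝ → ℝ} {l : ℝ} {s t : Set ℝ} (hs : IsOpen s)
    (hF : ContDiffOn ℝ ∞ F t) (hst : MapsTo g s t)
    (h : ∀ x ∈ s, HasDerivAt g (l * F (g x)) x) : ContDiffOn ℝ ∞ g s := by
  -- Bootstrap: once `g` is `C^n`, so is its derivative `l * F (g x)`, hence `g` is `C^(n+1)`.
  rw [contDiffOn_infty]
  intro n
  induction n with
  | zero =>
    exact contDiffOn_zero.2 fun x hx => (h x hx).continuousAt.continuousWithinAt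
  | succ n ih =>
    push_cast
    rw [contDiffOn_succ_iff_deriv_of_isOpen hs]
    refine ⟨fun x hx => (h x hx).differentiableAt.differentiableWithinAt, by simp, ?_⟩
    have : ContDiffOn ℝ n (fun x => l * F (g x)) s :=
      contDiffOn_const.mul ((hF.of_le (by exact_mod_cast le_top)).comp ih hst)
    exact this.congr fun x hx => (h x hx).deriv

/-- A function with derivative bounded below by a positive constant is invertible. -/
theorem exists_inverse_of_hasDerivAt {F n : ℝ → ℝ} {c : ℝ} (hc : 0 < c)
    (hF : ∀ s, HasDerivAt F (n s) s) (h : ∀ s, c ≤ n s) :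
    ∃ σ : ℝ → ℝ, (∀ t, F (σ t) = t) ∧ (∀ s, σ (F s) = s) ∧
      ∀ t, HasDerivAt σ (n (σ t))⁻¹ t := by
  have hn : ∀ s, 0 < n s := fun s => hc.trans_le (h s)
  have hmono := strictMono_of_hasDerivAt_pos hF hn
  have hcont : Continuous F := continuous_iff_continuousAt.2 fun s => (hF s).continuousAt
  have hd : ∀ s, HasDerivAt (fun s => F s - c * s) (n s - c * 1) s := fun s =>
    (hF s).sub ((hasDerivAt_id s).const_mul c)
  -- The uniform lower bound makes `F` grow at least linearly at both ends, hence surjective;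
  -- positivity of the derivative alone would not do.
  have hm2 : Monotone fun s => F s - c * s := by
    refine monotone_of_deriv_nonneg (fun s => (hd s).differentiableAt) fun s => ?_
    rw [(hd s).deriv]
    linarith [h s]
  have htop : Tendsto F atTop atTop := by
    have : Tendsto (fun s => F 0 + c * s) atTop atTop :=
      tendsto_atTop_add_const_left _ _ (tendsto_id.const_mul_atTop hc)
    refine tendsto_atTop_mono' _ ?_ this
    filter_upwards [eventually_ge_atTop 0] with s hs
    have := hm2 hs
    simp only at this
    linarith
  have hbot : Tendsto F atBot atBot := by
    have : Tendsto (fun s => F 0 + c * s) atBot atBot :=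
      tendsto_atBot_add_const_left _ _ (tendsto_id.const_mul_atBot hc)
    refine tendsto_atBot_mono' _ ?_ this
    filter_upwards [eventually_le_atBot 0] with s hs
    have := hm2 hs
    simp only at this
    linarith
  have hsurj : Function.Surjective F := hcont.surjective htop hbot
  let e : ℝ ≃o ℝ := StrictMono.orderIsoOfSurjective F hmono hsurj
  refine ⟨e.symm, fun t => e.apply_symm_apply t, fun s => e.symm_apply_apply s, fun t => ?_⟩
  refine HasDerivAt.of_local_left_inverse e.symm.continuous.continuousAt (hF _) (hn _).ne' ?_
  exact Eventually.of_forall fun y => e.apply_symm_apply y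

/-- A nonconstant continuous image of a connected set contains an interval, hence an irrational
number. This turns closedness of all orbits into constancy of the period. -/
theorem eqOn_of_continuousOn_rat {X : Type*} [TopologicalSpace X] {s : Set X}
    (hs : IsPreconnected s) {g : X → ℝ}
    (hg : ContinuousOn g s) (hq : ∀ x ∈ s, ∃ q : ℚ, g x = q) {x y : X} (hx : x ∈ s) (hy : y ∈ s) :
    g x = g y := by
  have key : ∀ x ∈ s, ∀ y ∈ s, ¬ g x < g y := by
    intro x hx y hy hlt
    obtain ⟨r, hr, h1, h2⟩ := exists_irrational_btwn hlt
    obtain ⟨z, hz, hzr⟩ := (hs.image g hg).ordConnected.out (mem_image_of_mem g hx)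
      (mem_image_of_mem g hy) ⟨h1.le, h2.le⟩
    obtain ⟨q, hq⟩ := hq z hz
    exact hr ⟨q, by rw [← hq, hzr]⟩
  exact le_antisymm (not_lt.1 (key y hy x hx)) (not_lt.1 (key x hx y hy))

/-- A function with zero derivative on an open interval is constant. -/
theorem eq_of_hasDerivAt_zero {s : Set ℝ} (hs : IsOpen s) (hs' : IsPreconnected s) {g : ℝ → ℝ}
    (h : ∀ x ∈ s, HasDerivAt g 0 x) {x y : ℝ} (hx : x ∈ s) (hy : y ∈ s) : g x = g y :=
  hs.is_const_of_deriv_eq_zero hs' (fun z hz => (h z hz).differentiableAt.differentiableWithinAt)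
    (fun z hz => (h z hz).deriv) hx hy

/-- A continuous function which never meets the ends of an interval before leaving it stays
inside. -/
theorem mem_Ioo_of_no_exit {r : ℝ → ℝ} {α ζ T : ℝ} (hT : 0 ≤ T) (hr : ContinuousOn r (Icc 0 T))
    (h0 : r 0 ∈ Ioo α ζ)
    (h : ∀ t ∈ Icc 0 T, (∀ s ∈ Ico 0 t, r s ∈ Ioo α ζ) → r t ≠ α ∧ r t ≠ ζ) : r T ∈ Ioo α ζ := by
  by_contra hcon
  set B := Icc 0 T ∩ r ⁻¹' (Ioo α ζ)ᶜ with hB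
  have hBc : IsClosed B := hr.preimage_isClosed_of_isClosed isClosed_Icc isOpen_Ioo.isClosed_compl
  have hBn : B.Nonempty := ⟨T, ⟨hT, le_rfl⟩, hcon⟩
  have hBb : BddBelow B := ⟨0, fun x hx => hx.1.1⟩
  have hmem := hBc.csInf_mem hBn hBb
  set t := sInf B with ht
  have hlt : ∀ s ∈ Ico 0 t, r s ∈ Ioo α ζ := by
    intro s hs
    by_contra hs'
    exact (not_le.2 hs.2) (csInf_le hBb ⟨⟨hs.1, hs.2.le.trans hmem.1.2⟩, hs'⟩)
  have ht0 : 0 < t := by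
    rcases hmem.1.1.lt_or_eq with h1 | h1
    · exact h1
    · exact absurd (h1 ▸ h0) hmem.2
  obtain ⟨h1, h2⟩ := h t hmem.1 hlt
  -- At the first exit time the value is a limit of values inside the interval, so it can only be
  -- one of the two ends.
  have hcl : r t ∈ closure (Ioo α ζ) := by
    have : ContinuousWithinAt r (Ico 0 t) t :=
      (hr t hmem.1).mono fun s hs => ⟨hs.1, hs.2.le.trans hmem.1.2⟩
    refine this.mem_closure ?_ hlt
    rw [closure_Ico ht0.ne]
    exact ⟨ht0.le, le_rfl⟩
  have hαζ : α < ζ := h0.1.trans h0.2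
  rw [closure_Ioo hαζ.ne] at hcl
  exact hmem.2 ⟨lt_of_le_of_ne hcl.1 (Ne.symm h1), lt_of_le_of_ne hcl.2 h2⟩

/-! ### Newton's equation on the line -/

open scoped NNReal

theorem lipschitzWith_newtonField {h : ℝ → ℝ} {L : ℝ≥0} {s : Set ℝ} (hh : LipschitzOnWith L h s) :
    LipschitzOnWith (max 1 L) (fun p : ℝ × ℝ => (p.2, h p.1)) (s ×ˢ univ) := by
  refine LipschitzOnWith.prodMk (LipschitzWith.prod_snd.lipschitzOnWith) ?_
  have := hh.comp (LipschitzWith.prod_fst (α := ℝ) (β := ℝ)).lipschitzOnWith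
    (fun p (hp : p ∈ s ×ˢ (univ : Set ℝ)) => hp.1)
  rwa [mul_one] at this

/-- An equilibrium is the only solution through it. -/
theorem eq_of_equilibrium {h r v : ℝ → ℝ} {L : ℝ≥0} {s : Set ℝ} (hh : LipschitzOnWith L h s)
    (hrs : ∀ t, r t ∈ s) (hr : ∀ t, HasDerivAt r (v t) t) (hv : ∀ t, HasDerivAt v (h (r t)) t)
    {t₀ : ℝ} (h0 : v t₀ = 0) (h1 : h (r t₀) = 0) (t : ℝ) : r t = r t₀ := by
  have := ODE_solution_unique_univ (v := fun _ p => (p.2, h p.1)) (s := fun _ => s ×ˢ univ)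
    (K := max 1 L) (t₀ := t₀) (f := fun t => (r t, v t)) (g := fun _ => (r t₀, 0))
    (fun _ => lipschitzWith_newtonField hh)
    (fun t => ⟨(hr t).prodMk (hv t), hrs t, trivial⟩)
    (fun t => ⟨by
      simp only [h1]
      exact hasDerivAt_const t ((r t₀, 0) : ℝ × ℝ), hrs t₀, trivial⟩) (by simp [h0])
  exact congrArg Prod.fst (congrFun this t)

/-- Newton's equation with a bounded Lipschitz force has global solutions. -/
theorem exists_newton_solution {h : ℝ → ℝ} {L H : ℝ≥0} (hh : LipschitzWith L h)
    (hH : ∀ x, |h x| ≤ H) (x₀ v₀ : ℝ) :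
    ∃ r v : ℝ → ℝ, r 0 = x₀ ∧ v 0 = v₀ ∧ (∀ t, HasDerivAt r (v t) t) ∧
      ∀ t, HasDerivAt v (h (r t)) t := by
  have hloc : ∀ T : ℝ, 0 < T → ∃ γ : ℝ → ℝ × ℝ, γ 0 = (x₀, v₀) ∧
      ∀ t ∈ Ioo (-T) T, HasDerivAt γ ((γ t).2, h (γ t).1) t := by
    intro T hT
    -- During a time `T` the speed cannot exceed `|v₀| + H * T`. Clamping the velocity at this bound
    -- makes the field bounded, so that the Picard-Lindelöf solution exists on all of `[-T, T]`, and
    -- the clamp turns out never to act.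
    obtain ⟨M, hMv⟩ : ∃ M : ℝ≥0, (M : ℝ) = |v₀| + H * T :=
      ⟨‖v₀‖₊ + H * ⟨T, hT.le⟩, by push_cast; rfl⟩
    let cl : ℝ → ℝ := fun x => max (-M) (min x M)
    have hcl : LipschitzWith 1 cl := (LipschitzWith.id.min_const _).const_max _
    have hclb : ∀ x, |cl x| ≤ M := fun x => by
      rw [abs_le]
      refine ⟨le_max_left _ _, max_le (by linarith [M.2]) (min_le_right _ _)⟩
    have hcle : ∀ x : ℝ, |x| ≤ M → cl x = x := fun x hx => by
      rw [abs_le] at hx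
      simp only [cl]
      rw [min_eq_left hx.2, max_eq_right hx.1]
    let F : ℝ → ℝ × ℝ → ℝ × ℝ := fun _ p => (cl p.2, h p.1)
    have hF : LipschitzWith (max 1 L) (F 0) := by
      refine LipschitzWith.prodMk ?_ ?_
      · have := hcl.comp (LipschitzWith.prod_snd (α := ℝ) (β := ℝ))
        rwa [mul_one] at this
      · have := hh.comp (LipschitzWith.prod_fst (α := ℝ) (β := ℝ))
        rwa [mul_one] at this
    have h0 : (0 : ℝ) ∈ Icc (-T) T := ⟨by linarith, hT.le⟩
    have hPL : IsPicardLindelof F (tmin := -T) (tmax := T) ⟨0, h0⟩ (x₀, v₀)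
        (max M H * ⟨T, hT.le⟩) 0 (max M H) (max 1 L) := by
      refine ⟨fun t _ => hF.lipschitzOnWith, fun x _ => continuousOn_const, fun t _ x _ => ?_, ?_⟩
      · have e : ((max M H : ℝ≥0) : ℝ) = max (M : ℝ) (H : ℝ) := rfl
        rw [e]
        exact max_le_max (hclb _) (hH _)
      · simp only [sub_zero, zero_sub, neg_neg, max_self, NNReal.coe_zero]
        exact le_rfl
    obtain ⟨γ, hγ0, hγ⟩ := hPL.exists_eq_forall_mem_Icc_hasDerivWithinAt₀
    have hγ0' : γ 0 = (x₀, v₀) := hγ0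
    have hγ' : ∀ t ∈ Ioo (-T) T, HasDerivAt γ (F t (γ t)) t := fun t ht =>
      (hγ t (Ioo_subset_Icc_self ht)).hasDerivAt (Icc_mem_nhds ht.1 ht.2)
    refine ⟨γ, hγ0', fun t ht => ?_⟩
    have hsnd : ∀ t ∈ Ioo (-T) T, HasDerivAt (fun s => (γ s).2) (h (γ t).1) t := fun t ht =>
      (hasFDerivAt_snd (𝕜 := ℝ) (p := γ t)).comp_hasDerivAt t (hγ' t ht)
    have hb : ‖(γ t).2 - (γ 0).2‖ ≤ H * ‖t - 0‖ :=
      (convex_Ioo (-T) T).norm_image_sub_le_of_norm_hasDerivWithin_le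
        (fun s hs => (hsnd s hs).hasDerivWithinAt) (fun s _ => hH _)
        ⟨by linarith, hT⟩ ht
    have hv : |(γ t).2| ≤ M := by
      rw [hγ0'] at hb
      simp only [Real.norm_eq_abs, sub_zero] at hb
      have h3 : |t| ≤ T := abs_le.2 ⟨ht.1.le, ht.2.le⟩
      have h4 : (H : ℝ) * |t| ≤ H * T := mul_le_mul_of_nonneg_left h3 H.2
      have h5 := abs_sub_abs_le_abs_sub (γ t).2 v₀
      rw [hMv]; linarith
    have := hγ' t ht
    have e : F t (γ t) = ((γ t).2, h (γ t).1) := by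
      show (cl (γ t).2, h (γ t).1) = _
      rw [hcle _ hv]
    rwa [e] at this
  choose! γ hγ0 hγ using hloc
  have huniq : ∀ T T' : ℝ, 0 < T → T ≤ T' → EqOn (γ T) (γ T') (Ioo (-T) T) := by
    intro T T' hT hTT'
    refine ODE_solution_unique_of_mem_Ioo (v := fun _ p => (p.2, h p.1)) (s := fun _ => univ)
      (K := max 1 L) (t₀ := 0) (fun t _ => ?_) ⟨by linarith, hT⟩
      (fun t ht => ⟨hγ T hT t ht, trivial⟩)
      (fun t ht => ⟨hγ T' (by linarith) t ⟨by linarith [ht.1], by linarith [ht.2]⟩, trivial⟩)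
      (by rw [hγ0 T hT, hγ0 T' (by linarith)])
    simpa using lipschitzWith_newtonField (hh.lipschitzOnWith (s := univ))
  -- The global solution at time `s` is read off from the local solution on `(-|s| - 1, |s| + 1)`;
  -- near a given `t` all of these agree with the one of size `|t| + 2`.
  have hglob : ∀ t, HasDerivAt (fun s => γ (|s| + 1) s) ((γ (|t| + 1) t).2, h (γ (|t| + 1) t).1) t := by
    intro t
    have hp : (0 : ℝ) < |t| + 2 := by positivity
    have e : ∀ s, |s| < |t| + 1 → γ (|s| + 1) s = γ (|t| + 2) s := fun s hs =>
      huniq (|s| + 1) (|t| + 2) (by positivity) (by linarith)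
        (abs_lt.1 (by linarith : |s| < |s| + 1))
    have h1 := hγ (|t| + 2) hp t (abs_lt.1 (by linarith))
    rw [e t (by linarith)]
    refine h1.congr_of_eventuallyEq ?_
    have : ∀ᶠ s in 𝓝 t, |s| < |t| + 1 :=
      continuous_abs.continuousAt.eventually_lt continuousAt_const (by linarith)
    filter_upwards [this] with s hs using e s hs
  refine ⟨fun t => (γ (|t| + 1) t).1, fun t => (γ (|t| + 1) t).2, ?_, ?_, fun t => ?_, fun t => ?_⟩
  · simp only [hγ0 (|0| + 1) (by simp)]
  · simp only [hγ0 (|0| + 1) (by simp)]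
  · exact (HasFDerivAt.comp_hasDerivAt (f := fun s => γ (|s| + 1) s) t
      (hasFDerivAt_fst (𝕜 := ℝ) (p := γ (|t| + 1) t)) (hglob t))
  · exact (HasFDerivAt.comp_hasDerivAt (f := fun s => γ (|s| + 1) s) t
      (hasFDerivAt_snd (𝕜 := ℝ) (p := γ (|t| + 1) t)) (hglob t))

/-- Newton's equation with a force that is Lipschitz on a compact interval has a global solution
if the force is continued outside by constants. -/
theorem exists_newton_solution_continued {h : ℝ → ℝ} {L : ℝ≥0} {α ζ : ℝ} (hαζ : α ≤ ζ)
    (hh : LipschitzOnWith L h (Icc α ζ)) (x₀ v₀ : ℝ) :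
    LipschitzWith L (fun x => h (max α (min x ζ))) ∧
    ∃ r v : ℝ → ℝ, r 0 = x₀ ∧ v 0 = v₀ ∧ (∀ t, HasDerivAt r (v t) t) ∧
      ∀ t, HasDerivAt v (h (max α (min (r t) ζ))) t := by
  have hc : LipschitzWith L fun x => h (max α (min x ζ)) := by
    have h1 : LipschitzWith 1 fun x : ℝ => max α (min x ζ) := (LipschitzWith.id.min_const _).const_max _
    have := hh.comp (h1.lipschitzOnWith (s := univ))
      (fun x _ => ⟨le_max_left _ _, max_le hαζ (min_le_right _ _)⟩)
    rw [mul_one] at this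
    exact lipschitzOnWith_univ.1 this
  obtain ⟨H, hH⟩ := (isCompact_Icc (a := α) (b := ζ)).exists_bound_of_continuousOn hh.continuousOn
  have hH0 : 0 ≤ H := (norm_nonneg _).trans (hH α ⟨le_rfl, hαζ⟩)
  exact ⟨hc, exists_newton_solution (H := ⟨H, hH0⟩) hc
    (fun x => hH _ ⟨le_max_left _ _, max_le hαζ (min_le_right _ _)⟩) x₀ v₀⟩

/-! ### Second divided differences -/

/-- The Hermite-Genocchi form of the second divided difference, at `x₁, x₂, x`, of a function
with second derivative `g`. -/
def hermiteD (g : ℝ → ℝ) (x₁ x₂ x : ℝ) : ℝ :=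
  ∫ u in (0 : ℝ)..1, ∫ v in (0 : ℝ)..1, u * g (x₁ + u * (x₂ - x₁) + u * v * (x - x₂))

/-- The integral form, unlike the difference quotient, is not singular when nodes collide. This
allows the period to be followed down to the bottom of a well. -/
theorem continuous_hermiteD {g : ℝ → ℝ} (hg : Continuous g) {X : Type*} [TopologicalSpace X]
    {a b c : X → ℝ} (ha : Continuous a) (hb : Continuous b) (hc : Continuous c) :
    Continuous fun p => hermiteD g (a p) (b p) (c p) := by
  have key : Continuous fun p : ℝ × ℝ × ℝ => hermiteD g p.1 p.2.1 p.2.2 := by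
    unfold hermiteD
    refine intervalIntegral.continuous_parametric_intervalIntegral_of_continuous'
      (f := fun (p : ℝ × ℝ × ℝ) u => ∫ v in (0 : ℝ)..1,
        u * g (p.1 + u * (p.2.1 - p.1) + u * v * (p.2.2 - p.2.1))) ?_ 0 1
    refine intervalIntegral.continuous_parametric_intervalIntegral_of_continuous'
      (f := fun (p : (ℝ × ℝ × ℝ) × ℝ) v =>
        p.2 * g (p.1.1 + p.2 * (p.1.2.1 - p.1.1) + p.2 * v * (p.1.2.2 - p.1.2.1))) ?_ 0 1
    simp only [Function.uncurry_def]
    fun_prop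
  exact key.comp (ha.prodMk (hb.prodMk hc))

theorem hermiteD_self {g : ℝ → ℝ} (x : ℝ) : hermiteD g x x x = g x / 2 := by
  simp [hermiteD]
  ring

theorem segment_mem_Icc {x₁ x₂ x u v : ℝ} (h : x₁ ≤ x₂) (hx : x ∈ Icc x₁ x₂) (hu : u ∈ Icc (0 : ℝ) 1)
    (hv : v ∈ Icc (0 : ℝ) 1) : x₁ + u * (x₂ - x₁) + u * v * (x - x₂) ∈ Icc x₁ x₂ := by
  obtain ⟨hu0, hu1⟩ := hu
  obtain ⟨hv0, hv1⟩ := hv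
  obtain ⟨hx1, hx2⟩ := hx
  constructor
  · have : 0 ≤ u * ((1 - v) * (x₂ - x₁) + v * (x - x₁)) :=
      mul_nonneg hu0 (add_nonneg (mul_nonneg (by linarith) (by linarith))
        (mul_nonneg hv0 (by linarith)))
    linarith
  · have h1 : 0 ≤ (1 - u) * (x₂ - x₁) := mul_nonneg (by linarith) (by linarith)
    have h2 : 0 ≤ u * v * (x₂ - x) := mul_nonneg (mul_nonneg hu0 hv0) (by linarith)
    linarith

theorem integral_deriv_segment {P P' : ℝ → ℝ} {x₁ x₂ x : ℝ}
    (h1 : ∀ y ∈ Icc x₁ x₂, HasDerivAt P (P' y) y) (hc : ContinuousOn P' (Icc x₁ x₂))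
    (hx : x ∈ Icc x₁ x₂) :
    (x - x₁) * ∫ u in (0 : ℝ)..1, P' (x₁ + u * (x - x₁)) = P x - P x₁ := by
  have hm : ∀ u ∈ uIcc (0 : ℝ) 1, x₁ + u * (x - x₁) ∈ Icc x₁ x₂ := by
    intro u hu
    rw [uIcc_of_le zero_le_one] at hu
    have ha : 0 ≤ u * (x - x₁) := mul_nonneg hu.1 (by linarith [hx.1])
    have hb : 0 ≤ (1 - u) * (x - x₁) := mul_nonneg (by linarith [hu.2]) (by linarith [hx.1])
    exact ⟨by linarith, by linarith [hx.2]⟩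
  rw [← intervalIntegral.integral_const_mul]
  rw [intervalIntegral.integral_eq_sub_of_hasDerivAt (f := fun u => P (x₁ + u * (x - x₁)))]
  · simp
  · intro u hu
    have hd : HasDerivAt (fun u : ℝ => x₁ + u * (x - x₁)) (x - x₁) u := by
      simpa using ((hasDerivAt_id u).mul_const (x - x₁)).const_add x₁
    have := (h1 _ (hm u hu)).comp u hd
    rwa [mul_comm] at this
  · apply ContinuousOn.intervalIntegrable
    exact continuousOn_const.mul (hc.comp (by fun_prop) hm)

/-- The integral over `v` undoes one derivative and the integral over `u` the other. Since `P x₁ = P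
x₂`, the mean of `P'` over the whole interval vanishes, and only the part from `x₁` to `x` remains.
-/
theorem hermiteD_spec {P P' g : ℝ → ℝ} {x₁ x₂ x : ℝ} (h12 : x₁ < x₂) (hg : Continuous g)
    (h1 : ∀ y ∈ Icc x₁ x₂, HasDerivAt P (P' y) y) (h2 : ∀ y ∈ Icc x₁ x₂, HasDerivAt P' (g y) y)
    (hP : P x₁ = P x₂) (hx : x ∈ Icc x₁ x₂) :
    P x - P x₁ = (x - x₁) * (x - x₂) * hermiteD g x₁ x₂ x := by
  have hc : ContinuousOn P' (Icc x₁ x₂) := HasDerivAt.continuousOn h2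
  have hx2 : x₂ ∈ Icc x₁ x₂ := ⟨h12.le, le_rfl⟩
  have hinner : ∀ u ∈ uIcc (0 : ℝ) 1,
      (x - x₂) * ∫ v in (0 : ℝ)..1, u * g (x₁ + u * (x₂ - x₁) + u * v * (x - x₂)) =
      P' (x₁ + u * (x - x₁)) - P' (x₁ + u * (x₂ - x₁)) := by
    intro u hu
    rw [uIcc_of_le zero_le_one] at hu
    rw [← intervalIntegral.integral_const_mul,
      intervalIntegral.integral_eq_sub_of_hasDerivAt
        (f := fun v => P' (x₁ + u * (x₂ - x₁) + u * v * (x - x₂)))]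
    · simp only [mul_one, mul_zero, zero_mul, add_zero]
      have e : x₁ + u * (x₂ - x₁) + u * (x - x₂) = x₁ + u * (x - x₁) := by ring
      rw [e]
    · intro v hv
      rw [uIcc_of_le zero_le_one] at hv
      have hd : HasDerivAt (fun v : ℝ => x₁ + u * (x₂ - x₁) + u * v * (x - x₂))
          (u * (x - x₂)) v := by
        have := (((hasDerivAt_id v).const_mul u).mul_const (x - x₂)).const_add (x₁ + u * (x₂ - x₁))
        simpa using this
      have := (h2 _ (segment_mem_Icc h12.le hx hu hv)).comp v hd
      refine this.congr_deriv ?_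
      ring
    · exact Continuous.intervalIntegrable (by fun_prop) _ _
  have hi : ∀ y ∈ Icc x₁ x₂, IntervalIntegrable (fun u => P' (x₁ + u * (y - x₁)))
      MeasureTheory.volume 0 1 := by
    intro y hy
    apply ContinuousOn.intervalIntegrable
    refine hc.comp (by fun_prop) fun u hu => ?_
    rw [uIcc_of_le zero_le_one] at hu
    have := segment_mem_Icc h12.le hy hu (v := 1) ⟨zero_le_one, le_rfl⟩
    convert this using 1
    ring
  have e1 := integral_deriv_segment h1 hc hx
  have e2 := integral_deriv_segment h1 hc hx2
  rw [hP, sub_self] at e2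
  have e3 : ∫ u in (0 : ℝ)..1, P' (x₁ + u * (x₂ - x₁)) = 0 :=
    (mul_eq_zero.1 e2).resolve_left (by linarith)
  rw [mul_assoc, hermiteD, ← intervalIntegral.integral_const_mul,
    intervalIntegral.integral_congr hinner, intervalIntegral.integral_sub (hi x hx) (hi x₂ hx2),
    e3, sub_zero, e1]

theorem hermiteD_eq_zero {g : ℝ → ℝ} {x₁ x₂ x : ℝ} (h : x₁ ≤ x₂) (hx : x ∈ Icc x₁ x₂)
    (hg : ∀ y ∈ Icc x₁ x₂, g y = 0) : hermiteD g x₁ x₂ x = 0 := by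
  unfold hermiteD
  rw [intervalIntegral.integral_congr (g := fun _ => 0)]
  · simp
  intro u hu
  rw [uIcc_of_le zero_le_one] at hu
  dsimp only
  rw [intervalIntegral.integral_congr (g := fun _ => 0)]
  · simp
  intro v hv
  rw [uIcc_of_le zero_le_one] at hv
  dsimp only
  rw [hg _ (segment_mem_Icc h hx hu hv), mul_zero]

/-- The difference quotient at `c` is `h` itself, so continuity of `h` suffices. A divided
difference is known only to be continuous, so the product rule is not available for it. -/
theorem hasDerivWithinAt_sub_mul {h : ℝ → ℝ} {s : Set ℝ} {c : ℝ} (hh : ContinuousWithinAt h s c) :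
    HasDerivWithinAt (fun x => (x - c) * h x) (h c) s c := by
  rw [hasDerivWithinAt_iff_tendsto_slope]
  refine (hh.mono sdiff_subset).tendsto.congr' ?_
  filter_upwards [self_mem_nhdsWithin] with x hx
  have : x - c ≠ 0 := sub_ne_zero.2 hx.2
  rw [slope_def_field]
  field_simp
  ring

/-- If `P < P x₁ = P x₂` inside `(x₁, x₂)` with nonzero slopes at the ends, then the second divided
difference is positive. -/
theorem hermiteD_pos {P P' g : ℝ → ℝ} {x₁ x₂ x : ℝ} (h12 : x₁ < x₂) (hg : Continuous g)
    (h1 : ∀ y ∈ Icc x₁ x₂, HasDerivAt P (P' y) y) (h2 : ∀ y ∈ Icc x₁ x₂, HasDerivAt P' (g y) y)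
    (hP : P x₁ = P x₂) (hin : ∀ y ∈ Ioo x₁ x₂, P y < P x₁) (hl : P' x₁ < 0) (hr : 0 < P' x₂)
    (hx : x ∈ Icc x₁ x₂) : 0 < hermiteD g x₁ x₂ x := by
  have hspec := fun y hy => hermiteD_spec (x := y) h12 hg h1 h2 hP hy
  have hDc : Continuous fun y => hermiteD g x₁ x₂ y :=
    continuous_hermiteD hg continuous_const continuous_const continuous_id
  have hx1 : x₁ ∈ Icc x₁ x₂ := ⟨le_rfl, h12.le⟩
  have hx2 : x₂ ∈ Icc x₁ x₂ := ⟨h12.le, le_rfl⟩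
  have hu := uniqueDiffOn_Icc h12
  rcases hx.1.eq_or_lt with he | hlt
  -- At an end the factorisation of `P - P x₁` is differentiated: the slope there is the length of
  -- the interval times the divided difference, up to a sign, and the slope is known not to vanish.
  · subst he
    have ha : HasDerivWithinAt (fun y => (y - x₁) * ((y - x₂) * hermiteD g x₁ x₂ y))
        ((x₁ - x₂) * hermiteD g x₁ x₂ x₁) (Icc x₁ x₂) x₁ :=
      hasDerivWithinAt_sub_mul (h := fun y => (y - x₂) * hermiteD g x₁ x₂ y)
        (by fun_prop)
    have hb : HasDerivWithinAt (fun y => (y - x₁) * ((y - x₂) * hermiteD g x₁ x₂ y))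
        (P' x₁) (Icc x₁ x₂) x₁ :=
      ((h1 _ hx1).sub_const (P x₁)).hasDerivWithinAt.congr
        (fun y hy => by simp only [hspec y hy]; ring) (by simp)
    have := (hu x₁ hx1).eq_deriv _ ha hb
    nlinarith
  rcases hx.2.eq_or_lt with he | hlt2
  · subst he
    have ha : HasDerivWithinAt (fun y => (y - x) * ((y - x₁) * hermiteD g x₁ x y))
        ((x - x₁) * hermiteD g x₁ x x) (Icc x₁ x) x :=
      hasDerivWithinAt_sub_mul (h := fun y => (y - x₁) * hermiteD g x₁ x y)
        (by fun_prop)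
    have hb : HasDerivWithinAt (fun y => (y - x) * ((y - x₁) * hermiteD g x₁ x y))
        (P' x) (Icc x₁ x) x :=
      ((h1 _ hx2).sub_const (P x₁)).hasDerivWithinAt.congr
        (fun y hy => by simp only [hspec y hy]; ring) (by simp [hP])
    have := (hu x hx2).eq_deriv _ ha hb
    nlinarith
  · have := hspec x hx
    have h3 := hin x ⟨hlt, hlt2⟩
    have h4 : (x - x₁) * (x₂ - x) > 0 := mul_pos (by linarith) (by linarith)
    by_contra hcon
    have : 0 ≤ (x - x₁) * (x₂ - x) * (-hermiteD g x₁ x₂ x) := mul_nonneg h4.le (by linarith)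
    linarith

/-! ### The period of an oscillation -/

/-- The point at the phase `s` of an oscillation between `x₁` and `x₂`. -/
def wellPoint (x₁ x₂ s : ℝ) : ℝ := (x₁ + x₂) / 2 + (x₂ - x₁) / 2 * Real.sin s

/-- The period of the oscillation between `x₁` and `x₂` in the potential with second
derivative `g`. -/
def wellPeriod (g : ℝ → ℝ) (x₁ x₂ : ℝ) : ℝ :=
  ∫ s in (0 : ℝ)..2 * Real.pi, 1 / √(2 * hermiteD g x₁ x₂ (wellPoint x₁ x₂ s))

theorem wellPoint_mem {x₁ x₂ : ℝ} (h : x₁ ≤ x₂) (s : ℝ) : wellPoint x₁ x₂ s ∈ Icc x₁ x₂ := by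
  have h1 := Real.sin_le_one s
  have h2 := Real.neg_one_le_sin s
  unfold wellPoint
  constructor <;> nlinarith

/-- The sinusoidal substitution cancels the square root singularities of the integral of `dx / √(2
(E - P))` at the turning points, so the integrand is jointly continuous in the energy and the phase.
-/
theorem continuous_wellPeriod {g : ℝ → ℝ} (hg : Continuous g) {X₁ X₂ : ℝ → ℝ} {s : Set ℝ}
    (h1 : Continuous X₁) (h2 : Continuous X₂)
    (hpos : ∀ E ∈ s, ∀ σ, 0 < hermiteD g (X₁ E) (X₂ E) (wellPoint (X₁ E) (X₂ E) σ)) :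
    ContinuousOn (fun E => wellPeriod g (X₁ E) (X₂ E)) s := by
  rw [continuousOn_iff_continuous_domRestrict]
  refine intervalIntegral.continuous_parametric_intervalIntegral_of_continuous'
    (f := fun (E : s) σ => 1 / √(2 * hermiteD g (X₁ E) (X₂ E) (wellPoint (X₁ E) (X₂ E) σ))) ?_ _ _
  simp only [Function.uncurry_def]
  have hc : Continuous fun p : s × ℝ =>
      hermiteD g (X₁ p.1) (X₂ p.1) (wellPoint (X₁ p.1) (X₂ p.1) p.2) := by
    refine continuous_hermiteD hg (by fun_prop) (by fun_prop) ?_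
    unfold wellPoint
    fun_prop
  refine continuous_const.div (by fun_prop) fun p => ?_
  exact (Real.sqrt_pos.2 (mul_pos two_pos (hpos p.1 p.1.2 p.2))).ne'

/-- The inverse is continued by constants beyond the range of levels, so that the turning points
become continuous functions on the whole line. -/
theorem exists_continuous_inverse {P : ℝ → ℝ} {p a : ℝ} (hpa : p < a)
    (hc : ContinuousOn P (Icc p a)) (hm : StrictMonoOn P (Icc p a)) :
    ∃ X : ℝ → ℝ, Continuous X ∧ (∀ E ∈ Icc (P p) (P a), X E ∈ Icc p a ∧ P (X E) = E) ∧
      X (P p) = p := by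
  have hle : P p ≤ P a := (hm ⟨le_rfl, hpa.le⟩ ⟨hpa.le, le_rfl⟩ hpa).le
  have himg : P '' Icc p a = Icc (P p) (P a) := by
    refine subset_antisymm ?_ (intermediate_value_Icc hpa.le hc)
    rintro _ ⟨y, hy, rfl⟩
    exact ⟨hm.monotoneOn ⟨le_rfl, hpa.le⟩ hy hy.1, hm.monotoneOn hy ⟨hpa.le, le_rfl⟩ hy.2⟩
  let e : Icc p a ≃o Icc (P p) (P a) := (hm.orderIso P _).trans (OrderIso.setCongr _ _ himg)
  have he : ∀ y, ((e y : Icc (P p) (P a)) : ℝ) = P y := fun y => rfl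
  have hspec : ∀ E ∈ Icc (P p) (P a),
      IccExtend hle (fun E => (e.symm E : ℝ)) E ∈ Icc p a ∧
        P (IccExtend hle (fun E => (e.symm E : ℝ)) E) = E := by
    intro E hE
    rw [IccExtend_of_mem _ _ hE]
    refine ⟨(e.symm ⟨E, hE⟩).2, ?_⟩
    rw [← he, e.apply_symm_apply]
  refine ⟨IccExtend hle fun E => (e.symm E : ℝ), ?_, hspec, ?_⟩
  · exact (continuous_subtype_val.comp e.symm.continuous).Icc_extend'
  · have := hspec (P p) ⟨le_rfl, hle⟩
    exact hm.injOn this.1 ⟨le_rfl, hpa.le⟩ this.2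

/-- A potential well on `[a₁, a₂]`: `P` strictly decreases on `[a₁, p₁]`, is constant on `[p₁, p₂]`
and strictly increases on `[p₂, a₂]`, without critical points outside `[p₁, p₂]`. -/
structure IsWell (P P' g : ℝ → ℝ) (a₁ p₁ p₂ a₂ : ℝ) : Prop where
  lt₁ : a₁ < p₁
  le : p₁ ≤ p₂
  lt₂ : p₂ < a₂
  cont : Continuous g
  deriv₁ : ∀ y ∈ Icc a₁ a₂, HasDerivAt P (P' y) y
  deriv₂ : ∀ y ∈ Icc a₁ a₂, HasDerivAt P' (g y) y
  neg : ∀ y ∈ Ico a₁ p₁, P' y < 0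
  pos : ∀ y ∈ Ioc p₂ a₂, 0 < P' y
  const : ∀ y ∈ Icc p₁ p₂, P y = P p₁
  ends : P a₁ = P a₂

/-! ### Wells: turning points, constancy of the period, nondegeneracy of the bottom. -/

namespace IsWell

variable {P P' g : ℝ → ℝ} {a₁ p₁ p₂ a₂ : ℝ}

theorem strictAntiOn (w : IsWell P P' g a₁ p₁ p₂ a₂) : StrictAntiOn P (Icc a₁ p₁) := by
  have hsub : Icc a₁ p₁ ⊆ Icc a₁ a₂ := Icc_subset_Icc le_rfl (w.le.trans w.lt₂.le)
  refine strictAntiOn_of_deriv_neg (convex_Icc _ _)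
    (HasDerivAt.continuousOn fun y hy => w.deriv₁ y (hsub hy)) fun y hy => ?_
  rw [interior_Icc] at hy
  rw [(w.deriv₁ y (hsub (Ioo_subset_Icc_self hy))).deriv]
  exact w.neg y ⟨hy.1.le, hy.2⟩

theorem strictMonoOn (w : IsWell P P' g a₁ p₁ p₂ a₂) : StrictMonoOn P (Icc p₂ a₂) := by
  have hsub : Icc p₂ a₂ ⊆ Icc a₁ a₂ := Icc_subset_Icc (w.lt₁.le.trans w.le) le_rfl
  refine strictMonoOn_of_deriv_pos (convex_Icc _ _)
    (HasDerivAt.continuousOn fun y hy => w.deriv₁ y (hsub hy)) fun y hy => ?_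
  rw [interior_Icc] at hy
  rw [(w.deriv₁ y (hsub (Ioo_subset_Icc_self hy))).deriv]
  exact w.pos y ⟨hy.1, hy.2.le⟩

theorem bottom_lt (w : IsWell P P' g a₁ p₁ p₂ a₂) : P p₁ < P a₁ :=
  w.strictAntiOn ⟨le_rfl, w.lt₁.le⟩ ⟨w.lt₁.le, le_rfl⟩ w.lt₁

/-- The ends `X₁ E, X₂ E` of the oscillation with energy `E`. -/
theorem exists_ends (w : IsWell P P' g a₁ p₁ p₂ a₂) :
    ∃ X₁ X₂ : ℝ → ℝ, Continuous X₁ ∧ Continuous X₂ ∧ X₁ (P p₁) = p₁ ∧ X₂ (P p₁) = p₂ ∧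
      ∀ E ∈ Ioc (P p₁) (P a₁), X₁ E ∈ Ico a₁ p₁ ∧ X₂ E ∈ Ioc p₂ a₂ ∧ P (X₁ E) = E ∧
        P (X₂ E) = E := by
  have e2 : P p₂ = P p₁ := w.const p₂ ⟨w.le, le_rfl⟩
  obtain ⟨X₂, h2c, h2s, h20⟩ := exists_continuous_inverse w.lt₂
    (HasDerivAt.continuousOn fun y hy => w.deriv₁ y ⟨(w.lt₁.le.trans w.le).trans hy.1, hy.2⟩)
    w.strictMonoOn
  -- The descending branch becomes an ascending one under the reflection `y ↦ -y`.
  have hanti := w.strictAntiOn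
  have hneg : StrictMonoOn (fun y => P (-y)) (Icc (-p₁) (-a₁)) := by
    intro x hx y hy hxy
    exact hanti ⟨by linarith [hy.2], by linarith [hy.1]⟩ ⟨by linarith [hx.2], by linarith [hx.1]⟩
      (by linarith)
  have hcont : ContinuousOn (fun y => P (-y)) (Icc (-p₁) (-a₁)) := by
    have : ContinuousOn P (Icc a₁ p₁) :=
      HasDerivAt.continuousOn fun y hy => w.deriv₁ y ⟨hy.1, hy.2.trans (w.le.trans w.lt₂.le)⟩
    exact this.comp continuous_neg.continuousOn
      fun y hy => ⟨by linarith [hy.2], by linarith [hy.1]⟩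
  obtain ⟨X₁, h1c, h1s, h10⟩ := exists_continuous_inverse (neg_lt_neg w.lt₁) hcont hneg
  simp only [neg_neg] at h1s h10
  rw [e2, ← w.ends] at h2s
  rw [e2] at h20
  refine ⟨fun E => -X₁ E, X₂, h1c.neg, h2c, by simp [h10], h20, fun E hE => ?_⟩
  obtain ⟨h1a, h1b⟩ := h1s E (Ioc_subset_Icc_self hE)
  obtain ⟨h2a, h2b⟩ := h2s E (Ioc_subset_Icc_self hE)
  refine ⟨⟨by linarith [h1a.2], lt_of_le_of_ne (by linarith [h1a.1]) ?_⟩,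
    ⟨lt_of_le_of_ne h2a.1 ?_, h2a.2⟩, h1b, h2b⟩
  · intro h
    simp only at h
    rw [h] at h1b
    exact hE.1.ne h1b
  · intro h
    rw [← h, e2] at h2b
    exact hE.1.ne h2b

theorem lt_of_mem (w : IsWell P P' g a₁ p₁ p₂ a₂) {x₁ x₂ y : ℝ} (h1 : x₁ ∈ Ico a₁ p₁)
    (h2 : x₂ ∈ Ioc p₂ a₂) (hP : P x₁ = P x₂) (hy : y ∈ Ioo x₁ x₂) : P y < P x₁ := by
  rcases le_or_gt y p₁ with h | h
  · exact w.strictAntiOn ⟨h1.1, h1.2.le⟩ ⟨h1.1.trans hy.1.le, h⟩ hy.1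
  rcases le_or_gt p₂ y with h' | h'
  · rw [hP]
    exact w.strictMonoOn ⟨h', hy.2.le.trans h2.2⟩ ⟨h2.1.le, h2.2⟩ hy.2
  · rw [w.const y ⟨h.le, h'.le⟩]
    exact w.strictAntiOn ⟨h1.1, h1.2.le⟩ ⟨w.lt₁.le, le_rfl⟩ h1.2

theorem hermiteD_pos (w : IsWell P P' g a₁ p₁ p₂ a₂) {x₁ x₂ y : ℝ} (h1 : x₁ ∈ Ico a₁ p₁)
    (h2 : x₂ ∈ Ioc p₂ a₂) (hP : P x₁ = P x₂) (hy : y ∈ Icc x₁ x₂) : 0 < hermiteD g x₁ x₂ y := by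
  have hsub : Icc x₁ x₂ ⊆ Icc a₁ a₂ := Icc_subset_Icc h1.1 h2.2
  exact _root_.hermiteD_pos (h1.2.trans_le (w.le.trans h2.1.le)) w.cont
    (fun y hy => w.deriv₁ y (hsub hy)) (fun y hy => w.deriv₂ y (hsub hy)) hP
    (fun y hy => w.lt_of_mem h1 h2 hP hy) (w.neg _ h1) (w.pos _ h2) hy

end IsWell

namespace IsWell

variable {P P' g : ℝ → ℝ} {a₁ p₁ p₂ a₂ : ℝ}

/-- If all periods are rational multiples of `2π`, they coincide. -/
theorem period_eq (w : IsWell P P' g a₁ p₁ p₂ a₂)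
    (hq : ∀ x₁ ∈ Ico a₁ p₁, ∀ x₂ ∈ Ioc p₂ a₂, P x₁ = P x₂ →
      ∃ c : ℚ, wellPeriod g x₁ x₂ = 2 * Real.pi * c)
    {X₁ X₂ : ℝ → ℝ} (h1 : Continuous X₁) (h2 : Continuous X₂)
    (hX : ∀ E ∈ Ioc (P p₁) (P a₁), X₁ E ∈ Ico a₁ p₁ ∧ X₂ E ∈ Ioc p₂ a₂ ∧ P (X₁ E) = E ∧
        P (X₂ E) = E) {E : ℝ} (hE : E ∈ Ioc (P p₁) (P a₁)) :
    wellPeriod g (X₁ E) (X₂ E) = wellPeriod g (X₁ (P a₁)) (X₂ (P a₁)) := by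
  have hc := continuous_wellPeriod w.cont h1 h2 (s := Ioc (P p₁) (P a₁)) fun E hE σ => by
    obtain ⟨ha, hb, hc, hd⟩ := hX E hE
    exact w.hermiteD_pos ha hb (hc.trans hd.symm)
      (wellPoint_mem (ha.2.le.trans (w.le.trans hb.1.le)) σ)
  have hc' : ContinuousOn (fun E => wellPeriod g (X₁ E) (X₂ E) / (2 * Real.pi))
    (Ioc (P p₁) (P a₁)) := hc.div_const _
  have := eqOn_of_continuousOn_rat isPreconnected_Ioc hc' (fun E hE => by
    obtain ⟨ha, hb, hc, hd⟩ := hX E hE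
    obtain ⟨c, hc⟩ := hq _ ha _ hb (hc.trans hd.symm)
    refine ⟨c, ?_⟩
    rw [hc]
    field_simp) hE (show P a₁ ∈ Ioc (P p₁) (P a₁) from ⟨w.bottom_lt, le_rfl⟩)
  have hpi := Real.pi_pos
  field_simp at this
  exact this

theorem eventually_mem_Ioc (w : IsWell P P' g a₁ p₁ p₂ a₂) :
    ∀ᶠ E in 𝓝[>] (P p₁), E ∈ Ioc (P p₁) (P a₁) := by
  filter_upwards [Ioc_mem_nhdsGT w.bottom_lt] with E hE using hE

/-- If the bottom is a single point, `g p₁ / 2` is a limit of positive divided differences over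
shrinking oscillations. If it is a genuine interval, `P` is constant on it and `g` vanishes there.
-/
theorem bottom_nonneg (w : IsWell P P' g a₁ p₁ p₂ a₂) : 0 ≤ g p₁ ∧ (p₁ < p₂ → g p₁ = 0) ∧
    ∀ y ∈ Icc p₁ p₂, g y = g p₁ := by
  have hI : ∀ y ∈ Ioo p₁ p₂, y ∈ Ioo a₁ a₂ := fun y hy =>
    ⟨w.lt₁.trans hy.1, hy.2.trans w.lt₂⟩
  have hP' : ∀ y ∈ Ioo p₁ p₂, P' y = 0 := by
    intro y hy
    have h1 := w.deriv₁ y (Ioo_subset_Icc_self (hI y hy))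
    have h2 : HasDerivAt P 0 y := by
      refine (hasDerivAt_const y (P p₁)).congr_of_eventuallyEq ?_
      filter_upwards [Ioo_mem_nhds hy.1 hy.2] with z hz using w.const z (Ioo_subset_Icc_self hz)
    exact h1.unique h2
  have hg : ∀ y ∈ Ioo p₁ p₂, g y = 0 := by
    intro y hy
    have h1 := w.deriv₂ y (Ioo_subset_Icc_self (hI y hy))
    have h2 : HasDerivAt P' 0 y := by
      refine (hasDerivAt_const y (0 : ℝ)).congr_of_eventuallyEq ?_
      filter_upwards [Ioo_mem_nhds hy.1 hy.2] with z hz using hP' z hz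
    exact h1.unique h2
  have hgc : p₁ < p₂ → ∀ y ∈ Icc p₁ p₂, g y = 0 := by
    intro hlt y hy
    have : EqOn g (fun _ => 0) (closure (Ioo p₁ p₂)) :=
      EqOn.closure hg w.cont continuous_const
    rw [closure_Ioo hlt.ne] at this
    exact this hy
  rcases w.le.eq_or_lt with he | hlt
  · refine ⟨?_, fun h => absurd he h.ne, fun y hy => ?_⟩
    · obtain ⟨X₁, X₂, h1, h2, h10, h20, hX⟩ := w.exists_ends
      have hc : Continuous fun E => hermiteD g (X₁ E) (X₂ E) (X₁ E) :=
        continuous_hermiteD w.cont h1 h2 h1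
      have ht := (hc.tendsto (P p₁)).mono_left (nhdsWithin_le_nhds (s := Ioi (P p₁)))
      rw [h10, h20, ← he, hermiteD_self] at ht
      have : 0 ≤ g p₁ / 2 := by
        refine ge_of_tendsto ht ?_
        filter_upwards [w.eventually_mem_Ioc] with E hE
        obtain ⟨ha, hb, hc, hd⟩ := hX E hE
        exact (w.hermiteD_pos ha hb (hc.trans hd.symm)
          ⟨le_rfl, ha.2.le.trans (w.le.trans hb.1.le)⟩).le
      linarith
    · rw [← he] at hy
      rw [le_antisymm hy.2 hy.1]
  · have h0 := hgc hlt p₁ ⟨le_rfl, hlt.le⟩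
    exact ⟨h0.ge, fun _ => h0, fun y hy => by rw [hgc hlt y hy, h0]⟩

/-- If all periods are rational multiples of `2π`, the bottom is a nondegenerate minimum. -/
theorem nondegenerate (w : IsWell P P' g a₁ p₁ p₂ a₂)
    (hq : ∀ x₁ ∈ Ico a₁ p₁, ∀ x₂ ∈ Ioc p₂ a₂, P x₁ = P x₂ →
      ∃ c : ℚ, wellPeriod g x₁ x₂ = 2 * Real.pi * c) : p₁ = p₂ ∧ 0 < g p₁ := by
  by_contra hcon
  obtain ⟨hb0, hb1, hb2⟩ := w.bottom_nonneg
  have hz : g p₁ = 0 := by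
    by_contra hne
    have hpos : 0 < g p₁ := lt_of_le_of_ne hb0 (Ne.symm hne)
    have : ¬ p₁ < p₂ := fun h => hne (hb1 h)
    exact hcon ⟨le_antisymm w.le (not_lt.1 this), hpos⟩
  -- If the second derivative vanished at the bottom (in particular if there were a plateau), the
  -- divided differences would tend to zero, uniformly in the phase, as the energy sinks to the
  -- bottom, and the period would tend to infinity instead of being constant.
  obtain ⟨X₁, X₂, h1, h2, h10, h20, hX⟩ := w.exists_ends
  have hpi := Real.pi_pos
  set T₀ := wellPeriod g (X₁ (P a₁)) (X₂ (P a₁)) with hT₀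
  set D : ℝ → ℝ → ℝ := fun E s => hermiteD g (X₁ E) (X₂ E) (wellPoint (X₁ E) (X₂ E) s) with hD
  have hDc : Continuous fun p : ℝ × ℝ => D p.1 p.2 := by
    refine continuous_hermiteD w.cont (by fun_prop) (by fun_prop) ?_
    unfold wellPoint
    fun_prop
  have hD0 : ∀ s, D (P p₁) s = 0 := by
    intro s
    simp only [hD, h10, h20]
    exact hermiteD_eq_zero w.le (wellPoint_mem w.le s) fun y hy => by rw [hb2 y hy, hz]
  -- The choice makes `2π / √(2δ)` equal to `|T₀| + 1`, so divided differences below `δ` force a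
  -- period larger than the common value `T₀`.
  obtain ⟨δ, hδ, hδT⟩ : ∃ δ : ℝ, 0 < δ ∧ T₀ < 2 * Real.pi / √(2 * δ) := by
    refine ⟨(2 * Real.pi / (|T₀| + 1)) ^ 2 / 2, by positivity, ?_⟩
    have : 2 * ((2 * Real.pi / (|T₀| + 1)) ^ 2 / 2) = (2 * Real.pi / (|T₀| + 1)) ^ 2 := by ring
    rw [this, Real.sqrt_sq (by positivity)]
    have e : 2 * Real.pi / (2 * Real.pi / (|T₀| + 1)) = |T₀| + 1 := by field_simp
    rw [e]
    linarith [le_abs_self T₀]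
  have hev : ∀ᶠ E in 𝓝 (P p₁), ∀ s ∈ Icc (0 : ℝ) (2 * Real.pi), D E s < δ := by
    refine isCompact_Icc.eventually_forall_of_forall_eventually
      (P := fun E s => D E s < δ) fun s _ => ?_
    have : ContinuousAt (fun p : ℝ × ℝ => D p.1 p.2) (P p₁, s) := hDc.continuousAt
    refine this.eventually_lt continuousAt_const ?_
    simp only [hD0]
    exact hδ
  obtain ⟨E, hE, hEI⟩ := ((hev.filter_mono nhdsWithin_le_nhds).and w.eventually_mem_Ioc).exists
  obtain ⟨ha, hb, hc, hd⟩ := hX E hEI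
  have hpos : ∀ s, 0 < D E s := fun s => w.hermiteD_pos ha hb (hc.trans hd.symm)
    (wellPoint_mem (ha.2.le.trans (w.le.trans hb.1.le)) s)
  have hper := w.period_eq hq h1 h2 hX hEI
  have hge : ∫ s in (0 : ℝ)..2 * Real.pi, 1 / √(2 * δ) ≤ wellPeriod g (X₁ E) (X₂ E) := by
    refine intervalIntegral.integral_mono_on (by positivity) (by simp) ?_ fun s hs => ?_
    · have hDE : Continuous fun s => D E s := hDc.comp (Continuous.prodMk continuous_const continuous_id)
      refine Continuous.intervalIntegrable (continuous_const.div
        (continuous_const.mul hDE).sqrt fun s => ?_) _ _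
      exact (Real.sqrt_pos.2 (mul_pos two_pos (hpos s))).ne'
    · refine one_div_le_one_div_of_le (Real.sqrt_pos.2 (mul_pos two_pos (hpos s))) ?_
      exact Real.sqrt_le_sqrt (by linarith [hE s hs])
  rw [hper, intervalIntegral.integral_const] at hge
  simp only [sub_zero, smul_eq_mul] at hge
  rw [mul_one_div] at hge
  linarith

/-- If all periods are rational multiples of `2π`, their common value is given by the second
derivative at the minimum. -/
theorem period_value (w : IsWell P P' g a₁ p₁ p₂ a₂)
    (hq : ∀ x₁ ∈ Ico a₁ p₁, ∀ x₂ ∈ Ioc p₂ a₂, P x₁ = P x₂ →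
      ∃ c : ℚ, wellPeriod g x₁ x₂ = 2 * Real.pi * c)
    {x₁ x₂ : ℝ} (hx₁ : x₁ ∈ Ico a₁ p₁) (hx₂ : x₂ ∈ Ioc p₂ a₂) (hxP : P x₁ = P x₂) :
    wellPeriod g x₁ x₂ = 2 * Real.pi / √(g p₁) := by
  obtain ⟨he, hgp⟩ := w.nondegenerate hq
  obtain ⟨X₁, X₂, h1, h2, h10, h20, hX⟩ := w.exists_ends
  -- At the bottom all nodes coincide and the integrand is constant, so the period integral extends
  -- continuously to the lowest energy, with value `2π / √(g p₁)`.
  have hD0 : ∀ s, hermiteD g (X₁ (P p₁)) (X₂ (P p₁)) (wellPoint (X₁ (P p₁)) (X₂ (P p₁)) s) =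
      g p₁ / 2 := by
    intro s
    have : wellPoint p₁ p₁ s = p₁ := by simp [wellPoint]
    rw [h10, h20, ← he, this, hermiteD_self]
  have hc := continuous_wellPeriod w.cont h1 h2 (s := Icc (P p₁) (P a₁)) fun E hE σ => by
    rcases hE.1.eq_or_lt with h | h
    · rw [← h, hD0]; linarith
    obtain ⟨ha, hb, hc, hd⟩ := hX E ⟨h, hE.2⟩
    exact w.hermiteD_pos ha hb (hc.trans hd.symm)
      (wellPoint_mem (ha.2.le.trans (w.le.trans hb.1.le)) σ)
  have hlim : Tendsto (fun E => wellPeriod g (X₁ E) (X₂ E)) (𝓝[>] (P p₁))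
      (𝓝 (wellPeriod g (X₁ (P p₁)) (X₂ (P p₁)))) := by
    have := (hc (P p₁) ⟨le_rfl, w.bottom_lt.le⟩).mono Ioc_subset_Icc_self
    have h3 := this.tendsto
    rwa [nhdsWithin_Ioc_eq_nhdsGT w.bottom_lt] at h3
  have hlim2 : Tendsto (fun E => wellPeriod g (X₁ E) (X₂ E)) (𝓝[>] (P p₁))
      (𝓝 (wellPeriod g (X₁ (P a₁)) (X₂ (P a₁)))) := by
    refine tendsto_const_nhds.congr' ?_
    filter_upwards [w.eventually_mem_Ioc] with E hE using (w.period_eq hq h1 h2 hX hE).symm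
  have heq := tendsto_nhds_unique hlim hlim2
  have hv : wellPeriod g (X₁ (P p₁)) (X₂ (P p₁)) = 2 * Real.pi / √(g p₁) := by
    unfold wellPeriod
    simp only [hD0]
    rw [intervalIntegral.integral_const]
    simp only [sub_zero, smul_eq_mul, mul_one_div]
    congr 2
    ring
  have hxE : P x₁ ∈ Ioc (P p₁) (P a₁) := by
    refine ⟨w.strictAntiOn ⟨hx₁.1, hx₁.2.le⟩ ⟨w.lt₁.le, le_rfl⟩ hx₁.2, ?_⟩
    exact w.strictAntiOn.antitoneOn ⟨le_rfl, w.lt₁.le⟩ ⟨hx₁.1, hx₁.2.le⟩ hx₁.1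
  obtain ⟨ha, hb, hc, hd⟩ := hX _ hxE
  have e1 : X₁ (P x₁) = x₁ :=
    w.strictAntiOn.injOn ⟨ha.1, ha.2.le⟩ ⟨hx₁.1, hx₁.2.le⟩ hc
  have e2 : X₂ (P x₁) = x₂ :=
    w.strictMonoOn.injOn ⟨hb.1.le, hb.2⟩ ⟨hx₂.1.le, hx₂.2⟩ (hd.trans hxP)
  have h5 := w.period_eq hq h1 h2 hX hxE
  rw [e1, e2] at h5
  rw [h5, ← heq, hv]

end IsWell

/-! ### Second order expansion of the period -/

theorem integral_cubic (c₀ c₁ c₂ c₃ : ℝ) :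
    ∫ u in (0 : ℝ)..1, (c₀ + c₁ * u + c₂ * u ^ 2 + c₃ * u ^ 3) = c₀ + c₁ / 2 + c₂ / 3 + c₃ / 4 := by
  have h : ∀ f : ℝ → ℝ, Continuous f → IntervalIntegrable f MeasureTheory.volume 0 1 :=
    fun f hf => hf.intervalIntegrable _ _
  rw [intervalIntegral.integral_add (h _ (by fun_prop)) (h _ (by fun_prop)),
    intervalIntegral.integral_add (h _ (by fun_prop)) (h _ (by fun_prop)),
    intervalIntegral.integral_add (h _ (by fun_prop)) (h _ (by fun_prop))]
  have h1 : ∫ u in (0 : ℝ)..1, c₁ * u = c₁ * ((1 ^ 2 - 0 ^ 2) / 2) := by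
    rw [intervalIntegral.integral_const_mul, integral_id]
  rw [h1]
  simp only [intervalIntegral.integral_const_mul, intervalIntegral.integral_const, integral_pow]
  simp
  ring

/-- The underlying potential is `B y² / 2 + α y³ + b y⁴` in the variable shifted by `p`, and the
second divided differences of `y²`, `y³`, `y⁴` are the complete homogeneous symmetric polynomials of
degrees 0, 1, 2 in the nodes. -/
theorem hermiteD_quadratic (B α b p x₁ x₂ x : ℝ) :
    hermiteD (fun y => B + 6 * α * (y - p) + 12 * b * (y - p) ^ 2) x₁ x₂ x =
      B / 2 + α * ((x₁ - p) + (x₂ - p) + (x - p)) +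
        b * ((x₁ - p) ^ 2 + (x₂ - p) ^ 2 + (x - p) ^ 2 + (x₁ - p) * (x₂ - p) +
          (x₁ - p) * (x - p) + (x₂ - p) * (x - p)) := by
  unfold hermiteD
  have h1 : ∀ u : ℝ, ∫ v in (0 : ℝ)..1, u * (B + 6 * α * (x₁ + u * (x₂ - x₁) + u * v * (x - x₂) - p)
      + 12 * b * (x₁ + u * (x₂ - x₁) + u * v * (x - x₂) - p) ^ 2) =
      0 + (B + 6 * α * (x₁ - p) + 12 * b * (x₁ - p) ^ 2) * u +
        (6 * α * (x₂ - x₁) + 24 * b * (x₁ - p) * (x₂ - x₁) +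
          (6 * α * (x - x₂) + 24 * b * (x₁ - p) * (x - x₂)) / 2) * u ^ 2 +
        (12 * b * (x₂ - x₁) ^ 2 + 24 * b * (x₂ - x₁) * (x - x₂) / 2 +
          12 * b * (x - x₂) ^ 2 / 3) * u ^ 3 := by
    intro u
    have h2 : ∀ v : ℝ, u * (B + 6 * α * (x₁ + u * (x₂ - x₁) + u * v * (x - x₂) - p)
      + 12 * b * (x₁ + u * (x₂ - x₁) + u * v * (x - x₂) - p) ^ 2) =
      u * (B + 6 * α * (x₁ + u * (x₂ - x₁) - p) + 12 * b * (x₁ + u * (x₂ - x₁) - p) ^ 2) +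
      u * (6 * α * u * (x - x₂) + 24 * b * (x₁ + u * (x₂ - x₁) - p) * u * (x - x₂)) * v +
      (u * 12 * b * u ^ 2 * (x - x₂) ^ 2) * v ^ 2 + 0 * v ^ 3 := fun v => by ring
    simp only [h2]
    rw [integral_cubic]
    ring
  simp only [h1]
  rw [integral_cubic]
  ring

theorem abs_hermiteD_sub_le {g h : ℝ → ℝ} (hg : Continuous g) (hh : Continuous h) {x₁ x₂ x e : ℝ}
    (h12 : x₁ ≤ x₂) (hx : x ∈ Icc x₁ x₂) (he : ∀ y ∈ Icc x₁ x₂, |g y - h y| ≤ e) :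
    |hermiteD g x₁ x₂ x - hermiteD h x₁ x₂ x| ≤ e := by
  have he0 : 0 ≤ e := (abs_nonneg _).trans (he x hx)
  have hin : ∀ k : ℝ → ℝ, Continuous k → ∀ u : ℝ, IntervalIntegrable
      (fun v => u * k (x₁ + u * (x₂ - x₁) + u * v * (x - x₂))) MeasureTheory.volume 0 1 :=
    fun k hk u => Continuous.intervalIntegrable (by fun_prop) _ _
  have hout : ∀ k : ℝ → ℝ, Continuous k → IntervalIntegrable
      (fun u => ∫ v in (0 : ℝ)..1, u * k (x₁ + u * (x₂ - x₁) + u * v * (x - x₂)))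
      MeasureTheory.volume 0 1 := by
    intro k hk
    refine Continuous.intervalIntegrable ?_ _ _
    refine intervalIntegral.continuous_parametric_intervalIntegral_of_continuous'
      (f := fun u v => u * k (x₁ + u * (x₂ - x₁) + u * v * (x - x₂))) ?_ 0 1
    simp only [Function.uncurry_def]
    fun_prop
  unfold hermiteD
  rw [← intervalIntegral.integral_sub (hout g hg) (hout h hh)]
  have := intervalIntegral.norm_integral_le_of_norm_le_const (a := (0 : ℝ)) (b := 1) (C := e)
    (f := fun u => (∫ v in (0 : ℝ)..1, u * g (x₁ + u * (x₂ - x₁) + u * v * (x - x₂))) -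
      ∫ v in (0 : ℝ)..1, u * h (x₁ + u * (x₂ - x₁) + u * v * (x - x₂))) fun u hu => by
    rw [uIoc_of_le zero_le_one] at hu
    rw [← intervalIntegral.integral_sub (hin g hg u) (hin h hh u)]
    have := intervalIntegral.norm_integral_le_of_norm_le_const (a := (0 : ℝ)) (b := 1) (C := e)
      (f := fun v => u * g (x₁ + u * (x₂ - x₁) + u * v * (x - x₂)) -
        u * h (x₁ + u * (x₂ - x₁) + u * v * (x - x₂))) fun v hv => by
      rw [uIoc_of_le zero_le_one] at hv
      rw [← mul_sub, norm_mul, Real.norm_eq_abs, Real.norm_eq_abs, abs_of_pos hu.1]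
      have h1 := he _ (segment_mem_Icc h12 hx (Ioc_subset_Icc_self hu) (Ioc_subset_Icc_self hv))
      exact (mul_le_mul hu.2 h1 (abs_nonneg _) zero_le_one).trans (by rw [one_mul])
    simpa using this
  simpa using this

/-- With `w = √(1 + u)` and `p` the second Taylor polynomial, `1 / w - p` is `1 - w² p²` over `w (1
+ w p)`. The numerator is divisible by `u³` with cofactor at most 2, and the denominator is at least
1/2. -/
theorem abs_inv_sqrt_sub_le {u : ℝ} (hu : |u| ≤ 1 / 2) :
    |1 / √(1 + u) - (1 - u / 2 + 3 / 8 * u ^ 2)| ≤ 4 * |u| ^ 3 := by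
  obtain ⟨h1, h2⟩ := abs_le.1 hu
  set w := √(1 + u) with hw
  have hw2 : w ^ 2 = 1 + u := Real.sq_sqrt (by linarith)
  have hw0 : 1 / 2 ≤ w := Real.le_sqrt_of_sq_le (by linarith)
  have hwp : 0 < w := by linarith
  set p := 1 - u / 2 + 3 / 8 * u ^ 2 with hp
  have hp0 : 0 < p := by nlinarith [sq_nonneg u]
  have e1 : 1 / w - p = (1 - w ^ 2 * p ^ 2) / (w * (1 + w * p)) := by
    field_simp
    ring
  have e2 : 1 - w ^ 2 * p ^ 2 = -u ^ 3 * (5 / 8 - 15 / 64 * u + 9 / 64 * u ^ 2) := by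
    rw [hw2, hp]; ring
  have h3 : |5 / 8 - 15 / 64 * u + 9 / 64 * u ^ 2| ≤ 2 := by
    rw [abs_le]; constructor <;> nlinarith
  have h4 : 1 / 2 ≤ w * (1 + w * p) := by nlinarith [mul_pos hwp hp0]
  rw [e1, e2, abs_div, abs_mul, abs_neg, abs_pow, abs_of_pos (by linarith : 0 < w * (1 + w * p)),
    div_le_iff₀ (by linarith)]
  have h5 : 0 ≤ |u| ^ 3 := by positivity
  nlinarith [mul_le_mul_of_nonneg_left h3 h5, mul_le_mul_of_nonneg_left h4 h5]

open Asymptotics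

/-- If all periods of the oscillations near a nondegenerate minimum coincide, the third and the
fourth derivative of the potential at the minimum satisfy an algebraic relation. -/
theorem IsWell.isochronous_relation {P P' g : ℝ → ℝ} {a₁ p a₂ : ℝ}
    (w : IsWell P P' g a₁ p p a₂) {B α b : ℝ} (hB : 0 < B) (hP'0 : P' p = 0)
    (hexp : (fun y => g y - (B + 6 * α * (y - p) + 12 * b * (y - p) ^ 2)) =o[𝓝 p]
      fun y => (y - p) ^ 2)
    (hT : ∀ x₁ ∈ Ico a₁ p, ∀ x₂ ∈ Ioc p a₂, P x₁ = P x₂ →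
      wellPeriod g x₁ x₂ = 2 * Real.pi / √B) : 5 * α ^ 2 = 2 * b * B := by
  obtain ⟨X₁, X₂, h1, h2, h10, h20, hX⟩ := w.exists_ends
  -- All expansions are in the half-width `A` of the oscillation as the energy tends to the bottom;
  -- `m` is the displacement of its midpoint from `p`.
  set l := 𝓝[>] (P p) with hl
  set A : ℝ → ℝ := fun E => (X₂ E - X₁ E) / 2 with hA
  set m : ℝ → ℝ := fun E => (X₁ E + X₂ E) / 2 - p with hm
  have hlI := w.eventually_mem_Ioc
  have hA0 : Tendsto A l (𝓝 0) := by
    have : Continuous A := by fun_prop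
    have h := this.tendsto (P p)
    simp only [hA, h10, h20, sub_self, zero_div] at h
    exact h.mono_left nhdsWithin_le_nhds
  have hAp : ∀ E ∈ Ioc (P p) (P a₁), 0 < A E := fun E hE => by
    obtain ⟨ha, hb, _, _⟩ := hX E hE
    simp only [hA]; linarith [ha.2, hb.1]
  have hmA : ∀ E ∈ Ioc (P p) (P a₁), |m E| ≤ A E := fun E hE => by
    obtain ⟨ha, hb, _, _⟩ := hX E hE
    simp only [hA, hm]
    rw [abs_le]
    constructor <;> linarith [ha.2, hb.1]
  -- points of the oscillation are within `2 A` of `p`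
  have hclose : ∀ E ∈ Ioc (P p) (P a₁), ∀ y ∈ Icc (X₁ E) (X₂ E), |y - p| ≤ 2 * A E := by
    intro E hE y hy
    obtain ⟨ha, hb, _, _⟩ := hX E hE
    simp only [hA]
    rw [abs_le]
    constructor <;> linarith [ha.2, hb.1, hy.1, hy.2]
  have hunif : ∀ {F : ℝ → ℝ}, (F =o[𝓝 p] fun y => (y - p) ^ 2) → ∀ η > 0, ∀ᶠ E in l,
      ∀ y ∈ Icc (X₁ E) (X₂ E), |F y| ≤ η * A E ^ 2 := by
    intro F hF η hη
    have h3 := isLittleO_iff.1 hF (show 0 < η / 4 by positivity)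
    obtain ⟨δ, hδ, h4⟩ := Metric.eventually_nhds_iff.1 h3
    have h5 : ∀ᶠ E in l, A E < δ / 2 := hA0.eventually_lt_const (by linarith)
    filter_upwards [h5, hlI] with E hE1 hE2 y hy
    have h6 := hclose E hE2 y hy
    have h7 := h4 (y := y) (by rw [Real.dist_eq]; linarith)
    rw [Real.norm_eq_abs, Real.norm_eq_abs, abs_of_nonneg (sq_nonneg (y - p))] at h7
    have h8 : (y - p) ^ 2 ≤ (2 * A E) ^ 2 := sq_le_sq' (abs_le.1 h6).1 (abs_le.1 h6).2
    nlinarith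
  -- expansion of the first derivative
  have hpI : Icc a₁ a₂ ∈ 𝓝 p := Icc_mem_nhds w.lt₁ w.lt₂
  have hP'exp : (fun y => P' y - (B * (y - p) + 3 * α * (y - p) ^ 2)) =o[𝓝 p]
      fun y => (y - p) ^ 2 := by
    have hd : ∀ y ∈ Icc a₁ a₂, HasDerivWithinAt
        (fun y => P' y - (B * (y - p) + 3 * α * (y - p) ^ 2)) (g y - (B + 6 * α * (y - p)))
        (Icc a₁ a₂) y := by
      intro y hy
      have hs : HasDerivAt (fun y => y - p) 1 y := (hasDerivAt_id y).sub_const p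
      have := (w.deriv₂ y hy).sub ((hs.const_mul B).add ((hs.pow 2).const_mul (3 * α)))
      refine (this.congr_deriv ?_).hasDerivWithinAt
      simp; ring
    have hlo : (fun y => g y - (B + 6 * α * (y - p))) =o[𝓝[Icc a₁ a₂] p] fun y => (y - p) ^ 1 := by
      have hs : Tendsto (fun y => y - p) (𝓝 p) (𝓝 0) := by
        have : Continuous fun y => y - p := by fun_prop
        simpa using this.tendsto p
      have h21 : (fun y => (y - p) ^ 2) =o[𝓝 p] fun y => (y - p) ^ 1 :=
        (isLittleO_pow_pow (𝕜 := ℝ) (by norm_num : 1 < 2)).comp_tendsto hs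
      have := (hexp.trans h21).add (h21.const_mul_left (12 * b))
      refine (this.mono nhdsWithin_le_nhds).congr_left fun y => ?_
      ring
    have h3 := (convex_Icc a₁ a₂).isLittleO_pow_succ_real ⟨w.lt₁.le, w.lt₂.le⟩ hd hlo
    rw [nhdsWithin_eq_nhds.2 hpI] at h3
    refine h3.congr_left fun y => ?_
    simp [hP'0]
  -- Both ends lie on the same level, so the mean of `P'` over the oscillation vanishes. Inserting
  -- the quadratic expansion of `P'` gives a relation between midpoint and amplitude.
  have hmid : (fun E => B * m E + 3 * α * m E ^ 2 + α * A E ^ 2) =o[l] fun E => A E ^ 2 := by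
    rw [isLittleO_iff]
    intro η hη
    filter_upwards [hunif hP'exp η hη, hlI] with E hE hEI
    obtain ⟨ha, hb, hPa, hPb⟩ := hX E hEI
    have hlt : X₁ E < X₂ E := ha.2.trans hb.1
    have hsub : Icc (X₁ E) (X₂ E) ⊆ Icc a₁ a₂ := Icc_subset_Icc ha.1 hb.2
    have hcP' : ContinuousOn P' (Icc (X₁ E) (X₂ E)) :=
      HasDerivAt.continuousOn fun y hy => w.deriv₂ y (hsub hy)
    have h3 := integral_deriv_segment (fun y hy => w.deriv₁ y (hsub hy)) hcP'
      (⟨hlt.le, le_rfl⟩ : X₂ E ∈ Icc (X₁ E) (X₂ E))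
    rw [hPa, hPb, sub_self] at h3
    have h4 : ∫ u in (0 : ℝ)..1, P' (X₁ E + u * (X₂ E - X₁ E)) = 0 :=
      (mul_eq_zero.1 h3).resolve_left (by linarith)
    have hmem : ∀ u ∈ Icc (0 : ℝ) 1, X₁ E + u * (X₂ E - X₁ E) ∈ Icc (X₁ E) (X₂ E) := by
      intro u hu
      have := segment_mem_Icc hlt.le (⟨hlt.le, le_rfl⟩ : X₂ E ∈ Icc (X₁ E) (X₂ E)) hu
        (v := 0) ⟨le_rfl, zero_le_one⟩
      simpa using this
    have h5 : ∫ u in (0 : ℝ)..1, (B * (X₁ E + u * (X₂ E - X₁ E) - p) +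
        3 * α * (X₁ E + u * (X₂ E - X₁ E) - p) ^ 2) = B * m E + 3 * α * m E ^ 2 + α * A E ^ 2 := by
      have h6 : ∀ u : ℝ, B * (X₁ E + u * (X₂ E - X₁ E) - p) +
        3 * α * (X₁ E + u * (X₂ E - X₁ E) - p) ^ 2 =
        (B * (X₁ E - p) + 3 * α * (X₁ E - p) ^ 2) +
        (B * (X₂ E - X₁ E) + 6 * α * (X₁ E - p) * (X₂ E - X₁ E)) * u +
        (3 * α * (X₂ E - X₁ E) ^ 2) * u ^ 2 + 0 * u ^ 3 := fun u => by ring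
      simp only [h6]
      rw [integral_cubic]
      simp only [hm, hA]
      ring
    have h7 : ∫ u in (0 : ℝ)..1, (P' (X₁ E + u * (X₂ E - X₁ E)) -
        (B * (X₁ E + u * (X₂ E - X₁ E) - p) +
        3 * α * (X₁ E + u * (X₂ E - X₁ E) - p) ^ 2)) =
        -(B * m E + 3 * α * m E ^ 2 + α * A E ^ 2) := by
      rw [intervalIntegral.integral_sub, h4, h5, zero_sub]
      · apply ContinuousOn.intervalIntegrable
        refine hcP'.comp (by fun_prop) fun u hu => hmem u ?_
        rwa [uIcc_of_le zero_le_one] at hu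
      · exact Continuous.intervalIntegrable (by fun_prop) _ _
    have h8 := intervalIntegral.norm_integral_le_of_norm_le_const (a := (0 : ℝ)) (b := 1)
      (C := η * A E ^ 2) (f := fun u => P' (X₁ E + u * (X₂ E - X₁ E)) -
        (B * (X₁ E + u * (X₂ E - X₁ E) - p) +
        3 * α * (X₁ E + u * (X₂ E - X₁ E) - p) ^ 2)) fun u hu => by
      rw [uIoc_of_le zero_le_one] at hu
      exact hE _ (hmem u (Ioc_subset_Icc_self hu))
    rw [h7, norm_neg] at h8
    rw [Real.norm_of_nonneg (sq_nonneg (A E))]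
    simpa using h8
  have hmO1 : m =O[l] A := by
    refine IsBigO.of_bound 1 ?_
    filter_upwards [hlI] with E hE
    rw [one_mul, Real.norm_eq_abs, Real.norm_of_nonneg (hAp E hE).le]
    exact hmA E hE
  have hmO2 : m =O[l] fun E => A E ^ 2 := by
    have e : m = fun E => B⁻¹ * ((B * m E + 3 * α * m E ^ 2 + α * A E ^ 2) -
        3 * α * m E ^ 2 - α * A E ^ 2) := by
      funext E
      field_simp
      ring
    rw [e]
    refine IsBigO.const_mul_left (IsBigO.sub (hmid.isBigO.sub ?_) ?_) _
    · exact (hmO1.pow 2).const_mul_left _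
    · exact (isBigO_refl _ _).const_mul_left _
  have hmAo : m =o[l] A := by
    refine hmO2.trans_isLittleO ?_
    have := (isLittleO_pow_pow (𝕜 := ℝ) (by norm_num : 1 < 2)).comp_tendsto hA0
    simpa [Function.comp_def] using this
  have hm2 : (fun E => m E ^ 2) =o[l] fun E => A E ^ 2 := hmAo.pow (by norm_num)
  -- To second order the asymmetry `α` displaces the midpoint by `-α A² / B`.
  have hmhat : (fun E => m E + α / B * A E ^ 2) =o[l] fun E => A E ^ 2 := by
    have := (hmid.sub (hm2.const_mul_left (3 * α))).const_mul_left B⁻¹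
    refine this.congr_left fun E => ?_
    field_simp
    ring
  -- expansion of the integrand, uniform in the phase
  set L : Filter (ℝ × ℝ) := l ×ˢ ⊤ with hL
  have hfst : Tendsto Prod.fst L l := tendsto_fst
  set q : ℝ × ℝ → ℝ := fun z => 2 * hermiteD g (X₁ z.1) (X₂ z.1) (wellPoint (X₁ z.1) (X₂ z.1) z.2)
    with hq
  set σ : ℝ × ℝ → ℝ := fun z => Real.sin z.2 with hσ
  set A' : ℝ × ℝ → ℝ := fun z => A z.1 with hA'
  set m' : ℝ × ℝ → ℝ := fun z => m z.1 with hm'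
  have hσO : σ =O[L] fun _ => (1 : ℝ) := by
    refine IsBigO.of_bound 1 (Eventually.of_forall fun z => ?_)
    simpa using Real.abs_sin_le_one z.2
  have hA'0 : Tendsto A' L (𝓝 0) := hA0.comp hfst
  have hm'o : m' =o[L] A' := hmAo.comp_tendsto hfst
  have hm'2 : (fun z => m' z ^ 2) =o[L] fun z => A' z ^ 2 := hm2.comp_tendsto hfst
  have hm'hat : (fun z => m' z + α / B * A' z ^ 2) =o[L] fun z => A' z ^ 2 :=
    hmhat.comp_tendsto hfst
  have hqexp : (fun z => q z - (B + 2 * α * (3 * m' z + A' z * σ z) +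
      2 * b * (6 * m' z ^ 2 + 4 * (m' z * (A' z * σ z)) + A' z ^ 2 + A' z ^ 2 * σ z ^ 2))) =o[L]
      fun z => A' z ^ 2 := by
    rw [isLittleO_iff]
    intro η hη
    have h3 := (hunif hexp (η / 2) (by positivity)).and hlI
    filter_upwards [h3.prod_inl ⊤] with z hz
    obtain ⟨hz1, hz2⟩ := hz
    obtain ⟨ha, hb, _, _⟩ := hX _ hz2
    have hle : X₁ z.1 ≤ X₂ z.1 := (ha.2.trans hb.1).le
    have h4 := abs_hermiteD_sub_le w.cont
      (by fun_prop : Continuous fun y => B + 6 * α * (y - p) + 12 * b * (y - p) ^ 2) hle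
      (wellPoint_mem hle z.2) hz1
    rw [hermiteD_quadratic] at h4
    rw [Real.norm_eq_abs, Real.norm_of_nonneg (sq_nonneg _)]
    have e : q z - (B + 2 * α * (3 * m' z + A' z * σ z) +
      2 * b * (6 * m' z ^ 2 + 4 * (m' z * (A' z * σ z)) + A' z ^ 2 + A' z ^ 2 * σ z ^ 2)) =
      2 * (hermiteD g (X₁ z.1) (X₂ z.1) (wellPoint (X₁ z.1) (X₂ z.1) z.2) -
      (B / 2 + α * ((X₁ z.1 - p) + (X₂ z.1 - p) + (wellPoint (X₁ z.1) (X₂ z.1) z.2 - p)) +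
        b * ((X₁ z.1 - p) ^ 2 + (X₂ z.1 - p) ^ 2 + (wellPoint (X₁ z.1) (X₂ z.1) z.2 - p) ^ 2 +
          (X₁ z.1 - p) * (X₂ z.1 - p) +
          (X₁ z.1 - p) * (wellPoint (X₁ z.1) (X₂ z.1) z.2 - p) +
          (X₂ z.1 - p) * (wellPoint (X₁ z.1) (X₂ z.1) z.2 - p)))) := by
      simp only [hq, hm', hA', hσ, hm, hA, wellPoint]
      ring
    rw [e, abs_mul, abs_two]
    linarith
  -- The second order coefficient of twice the divided difference: `-6 α² / B` comes from the
  -- displacement of the midpoint, `2b (1 + σ²)` from the quartic term of the potential.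
  set c : ℝ × ℝ → ℝ := fun z => -6 * α ^ 2 / B + 2 * b * (1 + σ z ^ 2) with hc
  have hr2 : (fun z => q z - B - 2 * α * (A' z * σ z) - A' z ^ 2 * c z) =o[L]
      fun z => A' z ^ 2 := by
    have h3 : (fun z => m' z * (A' z * σ z)) =o[L] fun z => A' z ^ 2 := by
      have : (fun z => A' z * σ z) =O[L] fun z => A' z * 1 := (isBigO_refl A' L).mul hσO
      have := hm'o.mul_isBigO this
      refine this.congr_right fun z => by ring
    have := ((hqexp.add (hm'hat.const_mul_left (6 * α))).add (hm'2.const_mul_left (12 * b))).add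
      (h3.const_mul_left (8 * b))
    refine this.congr_left fun z => ?_
    simp only [hc]
    field_simp
    ring
  have hcO : c =O[L] fun _ => (1 : ℝ) := by
    have h3 : (fun z => σ z ^ 2) =O[L] fun _ => (1 : ℝ) := by simpa using hσO.pow 2
    exact (isBigO_const_const _ one_ne_zero _).add
      (((isBigO_const_const _ one_ne_zero _).add h3).const_mul_left _)
  set u : ℝ × ℝ → ℝ := fun z => (q z - B) / B with hu
  set v : ℝ × ℝ → ℝ := fun z => 2 * α / B * (A' z * σ z) with hv
  have hA2O : (fun z => A' z ^ 2 * c z) =O[L] fun z => A' z ^ 2 := by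
    have := (isBigO_refl (fun z => A' z ^ 2) L).mul hcO
    simpa using this
  have huv : (fun z => u z - v z) =O[L] fun z => A' z ^ 2 := by
    have := (hr2.isBigO.add hA2O).const_mul_left B⁻¹
    refine this.congr_left fun z => ?_
    simp only [hu, hv]
    field_simp
    ring
  have hvO : v =O[L] A' := by
    have := ((isBigO_refl A' L).mul hσO).const_mul_left (2 * α / B)
    simpa using this
  have hA21 : (fun z => A' z ^ 2) =o[L] A' := by
    have := (isLittleO_pow_pow (𝕜 := ℝ) (by norm_num : 1 < 2)).comp_tendsto hA'0
    simpa [Function.comp_def] using this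
  have hA32 : (fun z => A' z ^ 3) =o[L] fun z => A' z ^ 2 :=
    (isLittleO_pow_pow (𝕜 := ℝ) (by norm_num : 2 < 3)).comp_tendsto hA'0
  have huO : u =O[L] A' := by
    have := (huv.trans hA21.isBigO).add hvO
    refine this.congr_left fun z => by ring
  have hu0 : Tendsto u L (𝓝 0) := huO.trans_tendsto hA'0
  have hφ : (fun z => 1 / √(1 + u z) - (1 - u z / 2 + 3 / 8 * u z ^ 2)) =o[L]
      fun z => A' z ^ 2 := by
    have h3 : (fun z => 1 / √(1 + u z) - (1 - u z / 2 + 3 / 8 * u z ^ 2)) =O[L]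
        fun z => u z ^ 3 := by
      refine IsBigO.of_bound 4 ?_
      have : ∀ᶠ z in L, |u z| < 1 / 2 := by
        have := hu0.abs
        rw [abs_zero] at this
        exact this.eventually_lt_const (by norm_num)
      filter_upwards [this] with z hz
      rw [Real.norm_eq_abs, Real.norm_eq_abs, abs_pow]
      exact abs_inv_sqrt_sub_le hz.le
    exact (h3.trans (huO.pow 3)).trans_isLittleO hA32
  have hu2 : (fun z => u z ^ 2 - v z ^ 2) =o[L] fun z => A' z ^ 2 := by
    have h3 : (fun z => (u z - v z) * (u z + v z)) =O[L] fun z => A' z ^ 2 * A' z :=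
      huv.mul (huO.add hvO)
    refine (h3.trans_isLittleO ?_).congr_left fun z => by ring
    exact hA32.congr_left fun z => by ring
  have htot : (fun z => √B / √(q z) - (1 - (v z + A' z ^ 2 * c z / B) / 2 + 3 / 8 * v z ^ 2)) =o[L]
      fun z => A' z ^ 2 := by
    have h3 := (hφ.sub (hr2.const_mul_left (1 / (2 * B)))).add (hu2.const_mul_left (3 / 8))
    refine h3.congr_left fun z => ?_
    have e : 1 / √(1 + u z) = √B / √(q z) := by
      have : 1 + u z = q z / B := by simp only [hu]; field_simp; ring
      rw [this, Real.sqrt_div' _ hB.le, one_div_div]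
    rw [e]
    simp only [hu, hv]
    field_simp
    ring
  -- After integration over the phase, `κ π A²` is the second order deviation of the normalised
  -- period from `2π`. The period is constant, so `κ = 0`, which is the claim.
  set κ : ℝ := 15 / 2 * α ^ 2 / B ^ 2 - 3 * b / B with hκ
  have hbound : ∀ η > 0, |κ| * Real.pi ≤ 2 * Real.pi * η := by
    intro η hη
    have h3 := (isLittleO_iff.1 htot hη)
    have h4 : ∀ᶠ E in l, ∀ s, |√B / √(q (E, s)) - (1 - (v (E, s) + A E ^ 2 * c (E, s) / B) / 2 +
        3 / 8 * v (E, s) ^ 2)| ≤ η * A E ^ 2 := by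
      rw [hL, ← principal_univ, eventually_prod_principal_iff] at h3
      filter_upwards [h3] with E hE s
      have := hE s (mem_univ _)
      rwa [Real.norm_eq_abs, Real.norm_of_nonneg (sq_nonneg _)] at this
    obtain ⟨E, hE, hEI⟩ := (h4.and hlI).exists
    obtain ⟨ha, hb, hPa, hPb⟩ := hX E hEI
    have hpos : ∀ s, 0 < q (E, s) := fun s => mul_pos two_pos (w.hermiteD_pos ha hb
      (hPa.trans hPb.symm) (wellPoint_mem (ha.2.trans hb.1).le s))
    have hqc : Continuous fun s => q (E, s) := by
      refine continuous_const.mul (continuous_hermiteD (a := fun _ => X₁ E) (b := fun _ => X₂ E)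
        w.cont continuous_const continuous_const ?_)
      unfold wellPoint
      fun_prop
    have hI1 : IntervalIntegrable (fun s => √B / √(q (E, s))) MeasureTheory.volume 0
        (2 * Real.pi) := by
      refine Continuous.intervalIntegrable (continuous_const.div hqc.sqrt fun s => ?_) _ _
      exact (Real.sqrt_pos.2 (hpos s)).ne'
    have hper : ∫ s in (0 : ℝ)..2 * Real.pi, √B / √(q (E, s)) = 2 * Real.pi := by
      have h5 := hT _ ha _ hb (hPa.trans hPb.symm)
      unfold wellPeriod at h5
      have e : ∀ s, √B / √(q (E, s)) = √B * (1 / √(q (E, s))) := fun s => by ring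
      simp only [e]
      rw [intervalIntegral.integral_const_mul]
      simp only [hq]
      rw [h5]
      have := (Real.sqrt_pos.2 hB).ne'
      field_simp
    have e3 : ∀ s, 1 - (v (E, s) + A E ^ 2 * c (E, s) / B) / 2 + 3 / 8 * v (E, s) ^ 2 =
        (1 + A E ^ 2 * (3 * α ^ 2 / B ^ 2 - b / B)) + (-(α / B * A E)) * Real.sin s +
          (A E ^ 2 * (3 / 2 * α ^ 2 / B ^ 2 - b / B)) * Real.sin s ^ 2 := by
      intro s
      simp only [hv, hc, hσ, hA']
      field_simp
      ring
    have hpoly : ∫ s in (0 : ℝ)..2 * Real.pi, (1 - (v (E, s) + A E ^ 2 * c (E, s) / B) / 2 +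
        3 / 8 * v (E, s) ^ 2) = 2 * Real.pi + A E ^ 2 * (κ * Real.pi) := by
      simp only [e3]
      have hi : ∀ f : ℝ → ℝ, Continuous f → IntervalIntegrable f MeasureTheory.volume 0
        (2 * Real.pi) := fun f hf => hf.intervalIntegrable _ _
      rw [intervalIntegral.integral_add (hi _ (by fun_prop)) (hi _ (by fun_prop)),
        intervalIntegral.integral_add (hi _ (by fun_prop)) (hi _ (by fun_prop)),
        intervalIntegral.integral_const_mul, intervalIntegral.integral_const_mul,
        intervalIntegral.integral_const, integral_sin, integral_sin_sq]
      simp only [Real.sin_zero, Real.sin_two_pi, Real.cos_zero, Real.cos_two_pi, smul_eq_mul, hκ]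
      ring
    have hI2 : IntervalIntegrable (fun s => 1 - (v (E, s) + A E ^ 2 * c (E, s) / B) / 2 +
        3 / 8 * v (E, s) ^ 2) MeasureTheory.volume 0 (2 * Real.pi) := by
      simp only [e3]
      exact Continuous.intervalIntegrable (by fun_prop) _ _
    have h6 := intervalIntegral.norm_integral_le_of_norm_le_const (a := (0 : ℝ))
      (b := 2 * Real.pi) (C := η * A E ^ 2) (f := fun s => √B / √(q (E, s)) -
        (1 - (v (E, s) + A E ^ 2 * c (E, s) / B) / 2 + 3 / 8 * v (E, s) ^ 2))
      fun s _ => hE s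
    rw [intervalIntegral.integral_sub hI1 hI2, hper, hpoly, sub_add_cancel_left, norm_neg,
      Real.norm_eq_abs, abs_mul, abs_mul, sub_zero, abs_of_pos Real.pi_pos,
      abs_of_pos (by positivity : 0 < 2 * Real.pi), abs_of_nonneg (sq_nonneg _)] at h6
    have h7 : 0 < A E ^ 2 := pow_pos (hAp E hEI) 2
    have h8 : A E ^ 2 * (|κ| * Real.pi) ≤ A E ^ 2 * (2 * Real.pi * η) := by linarith
    exact le_of_mul_le_mul_left h8 h7
  have hκ0 : κ = 0 := by
    by_contra hne
    have h3 := hbound (|κ| / 4) (by positivity)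
    have := mul_pos (abs_pos.2 hne) Real.pi_pos
    nlinarith
  rw [hκ] at hκ0
  field_simp at hκ0
  linarith

/-! ### Motions on a surface of revolution -/

namespace RevSurface

variable (S : RevSurface) {V : ℝ → ℝ}

theorem isOpen_I : IsOpen S.I := by
  have h1 : IsOpen {r : ℝ | S.a < (r : EReal)} :=
    isOpen_lt continuous_const continuous_coe_real_ereal
  have h2 : IsOpen {r : ℝ | (r : EReal) < S.b} :=
    isOpen_lt continuous_coe_real_ereal continuous_const
  exact h1.inter h2

theorem ordConnected_I : S.I.OrdConnected :=
  ⟨fun _ hx _ hy _ hz => ⟨hx.1.trans_le (EReal.coe_le_coe_iff.2 hz.1),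
    (EReal.coe_le_coe_iff.2 hz.2).trans_lt hy.2⟩⟩

theorem isPreconnected_I : IsPreconnected S.I := S.ordConnected_I.isPreconnected

theorem nonempty_I : S.I.Nonempty := by
  obtain ⟨x, h1, h2⟩ := EReal.lt_iff_exists_real_btwn.1 S.a_lt_b
  exact ⟨x, h1, h2⟩

variable {S}

theorem f_pos' {r : ℝ} (hr : r ∈ S.I) : 0 < S.f r := S.f_pos r hr.1 hr.2

theorem contDiffOn_f : ContDiffOn ℝ ∞ S.f S.I := S.f_smooth

theorem hasDerivAt_of_smooth {F : ℝ → ℝ} (hF : ContDiffOn ℝ ∞ F S.I) {r : ℝ} (hr : r ∈ S.I) :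
    HasDerivAt F (deriv F r) r :=
  ((hF.differentiableOn (by simp)).differentiableAt (S.isOpen_I.mem_nhds hr)).hasDerivAt

theorem hasDerivAt_f {r : ℝ} (hr : r ∈ S.I) : HasDerivAt S.f (deriv S.f r) r :=
  hasDerivAt_of_smooth contDiffOn_f hr

theorem contDiffOn_deriv {F : ℝ → ℝ} {s : Set ℝ} (hs : IsOpen s) (hF : ContDiffOn ℝ ∞ F s) :
    ContDiffOn ℝ ∞ (deriv F) s :=
  ((contDiffOn_infty_iff_deriv_of_isOpen hs).1 hF).2

/-- The derivative of the effective potential. -/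
def effDeriv (S : RevSurface) (V : ℝ → ℝ) (K r : ℝ) : ℝ :=
  deriv V r - K ^ 2 * deriv S.f r / S.f r ^ 3

theorem contDiffOn_effPotential (hV : S.SmoothPotential V) (K : ℝ) :
    ContDiffOn ℝ ∞ (S.effPotential V K) S.I := by
  refine ContDiffOn.add hV (contDiffOn_const.div
    (contDiffOn_const.mul (contDiffOn_f.pow 2)) fun r hr => ?_)
  have := f_pos' hr
  positivity

theorem hasDerivAt_effPotential (hV : S.SmoothPotential V) (K : ℝ) {r : ℝ} (hr : r ∈ S.I) :
    HasDerivAt (S.effPotential V K) (S.effDeriv V K r) r := by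
  have hf := f_pos' hr
  have h1 := ((hasDerivAt_f hr).pow 2).const_mul 2
  have h2 := (hasDerivAt_of_smooth hV hr).add
    ((hasDerivAt_const r (K ^ 2)).div h1 (by simp; positivity))
  refine h2.congr_deriv ?_
  simp only [effDeriv, Pi.pow_apply]
  field_simp
  ring

theorem contDiffOn_effDeriv (hV : S.SmoothPotential V) (K : ℝ) :
    ContDiffOn ℝ ∞ (S.effDeriv V K) S.I :=
  (contDiffOn_deriv S.isOpen_I (contDiffOn_effPotential hV K)).congr fun _ hr =>
    (hasDerivAt_effPotential hV K hr).deriv.symm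

theorem continuousOn_effDeriv (hV : S.SmoothPotential V) (K : ℝ) :
    ContinuousOn (S.effDeriv V K) S.I := (contDiffOn_effDeriv hV K).continuousOn

theorem hasDerivAt_momentum {J : Set ℝ} {r φ : ℝ → ℝ} {K : ℝ} (hJ : IsOpen J)
    (hm : S.IsMotion V J r φ) (hK : S.HasMomentum J r φ K) {t : ℝ} (ht : t ∈ J) :
    HasDerivAt φ (K / S.f (r t) ^ 2) t := by
  have h1 : HasDerivAt φ (deriv φ t) t :=
    ((hm.φ_smooth.differentiableOn (by simp)).differentiableAt (hJ.mem_nhds ht)).hasDerivAt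
  have hf := f_pos' (hm.mem t ht)
  refine h1.congr_deriv ?_
  rw [eq_div_iff (by positivity), ← hK t ht]
  ring

theorem hasDerivAt_radius {J : Set ℝ} {r φ : ℝ → ℝ} (hJ : IsOpen J)
    (hm : S.IsMotion V J r φ) {t : ℝ} (ht : t ∈ J) : HasDerivAt r (deriv r t) t :=
  ((hm.r_smooth.differentiableOn (by simp)).differentiableAt (hJ.mem_nhds ht)).hasDerivAt

theorem hasDerivAt_velocity {J : Set ℝ} {r φ : ℝ → ℝ} {K : ℝ} (hJ : IsOpen J)
    (hm : S.IsMotion V J r φ) (hK : S.HasMomentum J r φ K) {t : ℝ} (ht : t ∈ J) :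
    HasDerivAt (deriv r) (-S.effDeriv V K (r t)) t := by
  have h2 : ContDiffOn ℝ (1 + 1) r J := by
    have := hm.r_smooth
    norm_num
    exact this
  have h1 : ContDiffOn ℝ 1 (deriv r) J := ((contDiffOn_succ_iff_deriv_of_isOpen hJ).1 h2).2.2
  have h3 : HasDerivAt (deriv r) (deriv (deriv r) t) t :=
    ((h1.differentiableOn (by simp)).differentiableAt (hJ.mem_nhds ht)).hasDerivAt
  refine h3.congr_deriv ?_
  have hf := f_pos' (hm.mem t ht)
  rw [hm.radial t ht, (hasDerivAt_momentum hJ hm hK ht).deriv, effDeriv]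
  field_simp
  ring

/-- The equations of motion in terms of the effective potential. -/
theorem isMotion_of_hasDerivAt (hV : S.SmoothPotential V) {J : Set ℝ} {r v φ : ℝ → ℝ} {K : ℝ}
    (hJ : IsOpen J) (hI : ∀ t ∈ J, r t ∈ S.I) (hr : ∀ t ∈ J, HasDerivAt r (v t) t)
    (hv : ∀ t ∈ J, HasDerivAt v (-S.effDeriv V K (r t)) t)
    (hφ : ∀ t ∈ J, HasDerivAt φ (K / S.f (r t) ^ 2) t) :
    S.IsMotion V J r φ ∧ S.HasMomentum J r φ K := by
  have hrc : ContinuousOn r J := HasDerivAt.continuousOn hr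
  have hr1 : ContDiffOn ℝ 1 r J := by
    rw [show (1 : WithTop ℕ∞) = 0 + 1 by simp, contDiffOn_succ_iff_deriv_of_isOpen hJ]
    refine ⟨fun t ht => (hr t ht).differentiableAt.differentiableWithinAt, by simp, ?_⟩
    rw [contDiffOn_zero]
    exact (HasDerivAt.continuousOn hv).congr fun t ht => (hr t ht).deriv
  have hd2 : ∀ t ∈ J, deriv (deriv r) t = -S.effDeriv V K (r t) := by
    intro t ht
    have : deriv r =ᶠ[𝓝 t] v := by
      filter_upwards [hJ.mem_nhds ht] with s hs using (hr s hs).deriv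
    rw [this.deriv_eq, (hv t ht).deriv]
  have key : ∀ {F G : ℝ → ℝ}, (∀ t ∈ J, HasDerivAt F (G t) t) → ContDiffOn ℝ 1 G J →
      ContDiffOn ℝ 2 F J := by
    intro F G h1 h2
    rw [show (2 : WithTop ℕ∞) = 1 + 1 by norm_num, contDiffOn_succ_iff_deriv_of_isOpen hJ]
    exact ⟨fun t ht => (h1 t ht).differentiableAt.differentiableWithinAt, by simp,
      h2.congr fun t ht => (h1 t ht).deriv⟩
  refine ⟨⟨hI, key hr ?_, key hφ ?_, fun t ht => ?_, fun t ht => ?_⟩, fun t ht => ?_⟩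
  · rw [show (1 : WithTop ℕ∞) = 0 + 1 by simp, contDiffOn_succ_iff_deriv_of_isOpen hJ]
    refine ⟨fun t ht => (hv t ht).differentiableAt.differentiableWithinAt, by simp, ?_⟩
    rw [contDiffOn_zero]
    exact (((continuousOn_effDeriv hV K).comp hrc hI).neg).congr fun t ht => (hv t ht).deriv
  · refine contDiffOn_const.div (((contDiffOn_f.of_le (by simp)).comp hr1 hI).pow 2) fun t ht => ?_
    have := f_pos' (hI t ht)
    positivity
  · rw [hd2 t ht, (hφ t ht).deriv, effDeriv]
    have hf := f_pos' (hI t ht)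
    field_simp
    ring
  · have : (fun s => S.f (r s) ^ 2 * deriv φ s) =ᶠ[𝓝 t] fun _ => K := by
      filter_upwards [hJ.mem_nhds ht] with s hs
      have hf := f_pos' (hI s hs)
      rw [(hφ s hs).deriv]
      field_simp
    rw [this.deriv_eq, deriv_const]
  · rw [(hφ t ht).deriv]
    have hf := f_pos' (hI t ht)
    field_simp

/-- Conservation of energy. -/
theorem energy_eq (hV : S.SmoothPotential V) {J : Set ℝ} {r φ : ℝ → ℝ} {K : ℝ} (hJ : IsOpen J)
    (hJ' : IsPreconnected J) (hm : S.IsMotion V J r φ) (hK : S.HasMomentum J r φ K)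
    {s t : ℝ} (hs : s ∈ J) (ht : t ∈ J) :
    deriv r s ^ 2 / 2 + S.effPotential V K (r s) = deriv r t ^ 2 / 2 + S.effPotential V K (r t) := by
  refine eq_of_hasDerivAt_zero hJ hJ'
    (g := fun t => deriv r t ^ 2 / 2 + S.effPotential V K (r t)) (fun u hu => ?_) hs ht
  have h1 := hasDerivAt_radius hJ hm hu
  have h2 := hasDerivAt_velocity hJ hm hK hu
  have h3 := (hasDerivAt_effPotential hV K (hm.mem u hu)).comp u h1
  refine (((h2.pow 2).div_const 2).add h3).congr_deriv ?_
  simp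
  ring

theorem circularTrajectory_radius {r₀ K₀ : ℝ} {r φ : ℝ → ℝ}
    (h : S.IsCircularTrajectory V r₀ K₀ r φ) (t : ℝ) : r t = r₀ := by
  have : (r t, (φ t : Real.Angle)) ∈ ({r₀} ×ˢ univ : Set (ℝ × Real.Angle)) := by
    rw [← h.2.2]
    exact ⟨t, rfl⟩
  exact this.1

theorem circularTrajectory_spec {r₀ K₀ : ℝ} {r φ : ℝ → ℝ}
    (h : S.IsCircularTrajectory V r₀ K₀ r φ) : r₀ ∈ S.I ∧ K₀ ≠ 0 ∧ S.effDeriv V K₀ r₀ = 0 := by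
  have hr := circularTrajectory_radius h
  have hI : r₀ ∈ S.I := hr 0 ▸ h.1.mem 0 trivial
  refine ⟨hI, ?_, ?_⟩
  -- With zero momentum the angle is constant, so the orbit would be a point rather than a circle.
  · rintro rfl
    have hφ : ∀ t, HasDerivAt φ 0 t := fun t => by
      simpa using hasDerivAt_momentum isOpen_univ h.1 h.2.1 (mem_univ t)
    have hconst : ∀ t, φ t = φ 0 := fun t =>
      is_const_of_deriv_eq_zero (fun s => (hφ s).differentiableAt) (fun s => (hφ s).deriv) t 0
    have hall : ∀ x : Real.Angle, (φ 0 : Real.Angle) = x := by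
      intro x
      have : (r₀, x) ∈ orbitOf r φ := by rw [h.2.2]; exact ⟨rfl, trivial⟩
      obtain ⟨t, ht⟩ := this
      rw [← hconst t]
      exact congrArg Prod.snd ht
    have := (hall 0).symm.trans (hall (Real.pi : Real.Angle))
    exact Real.Angle.pi_ne_zero this.symm
  · have h1 := hasDerivAt_velocity isOpen_univ h.1 h.2.1 (mem_univ 0)
    have h2 : r = fun _ => r₀ := funext hr
    have h3 : deriv r = fun _ => 0 := by rw [h2]; funext t; simp
    have h4 : HasDerivAt (deriv r) 0 0 := by rw [h3]; exact hasDerivAt_const _ _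
    have := h1.unique h4
    rw [hr 0] at this
    linarith

theorem exists_circularTrajectory (hV : S.SmoothPotential V) {r₀ K₀ : ℝ} (hr : r₀ ∈ S.I)
    (hK : K₀ ≠ 0) (h : S.effDeriv V K₀ r₀ = 0) :
    S.IsCircularTrajectory V r₀ K₀ (fun _ => r₀) (fun t => K₀ / S.f r₀ ^ 2 * t) := by
  have hf := f_pos' hr
  obtain ⟨h1, h2⟩ := isMotion_of_hasDerivAt (K := K₀) (J := univ) (r := fun _ => r₀)
    (v := fun _ => 0) (φ := fun t => K₀ / S.f r₀ ^ 2 * t) hV isOpen_univ (fun _ _ => hr)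
    (fun t _ => hasDerivAt_const t r₀) (fun t _ => by rw [h, neg_zero]; exact hasDerivAt_const t 0)
    (fun t _ => by simpa using (hasDerivAt_id t).const_mul (K₀ / S.f r₀ ^ 2))
  refine ⟨h1, h2, ?_⟩
  ext ⟨x, a⟩
  simp only [orbitOf, mem_range, Prod.mk.injEq, mem_prod, mem_singleton_iff, mem_univ, and_true]
  constructor
  · rintro ⟨t, ht, _⟩
    exact ht.symm
  · rintro rfl
    induction a using Real.Angle.induction_on with
    | _ y =>
      refine ⟨y * S.f x ^ 2 / K₀, rfl, ?_⟩
      congr 1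
      field_simp

theorem circularAt_iff (hV : S.SmoothPotential V) {r₀ K₀ : ℝ} (hr : r₀ ∈ S.I) :
    S.CircularAt V r₀ K₀ ↔ K₀ ≠ 0 ∧ S.effDeriv V K₀ r₀ = 0 :=
  ⟨fun ⟨_, _, h⟩ => (circularTrajectory_spec h).2,
    fun h => ⟨_, _, exists_circularTrajectory hV hr h.1 h.2⟩⟩

theorem deriv_deriv_effPotential (hV : S.SmoothPotential V) (K : ℝ) {r : ℝ} (hr : r ∈ S.I) :
    deriv (deriv (S.effPotential V K)) r = deriv (S.effDeriv V K) r := by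
  have : deriv (S.effPotential V K) =ᶠ[𝓝 r] S.effDeriv V K := by
    filter_upwards [S.isOpen_I.mem_nhds hr] with s hs using (hasDerivAt_effPotential hV K hs).deriv
  exact this.deriv_eq

theorem stronglyStableAt_iff (hV : S.SmoothPotential V) {r₀ K₀ : ℝ} (hr : r₀ ∈ S.I) :
    S.StronglyStableAt V r₀ K₀ ↔
      K₀ ≠ 0 ∧ S.effDeriv V K₀ r₀ = 0 ∧ 0 < deriv (S.effDeriv V K₀) r₀ := by
  unfold StronglyStableAt
  rw [circularAt_iff hV hr, deriv_deriv_effPotential hV K₀ hr]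
  constructor
  · rintro ⟨⟨h1, h2⟩, -, -, h3⟩
    exact ⟨h1, h2, h3⟩
  · rintro ⟨h1, h2, h3⟩
    refine ⟨⟨h1, h2⟩, h1, ?_, h3⟩
    have hd := hasDerivAt_effPotential hV K₀ hr
    refine isLocalMin_of_deriv_deriv_pos ?_ ?_ hd.continuousAt
    · rwa [deriv_deriv_effPotential hV K₀ hr]
    · rw [hd.deriv, h2]

theorem isCircularOrbit_of_const {r φ : ℝ → ℝ} {K : ℝ} (hm : S.IsMotion V univ r φ)
    (hK : S.HasMomentum univ r φ K) (hK0 : K ≠ 0) {r₀ : ℝ} (hr : ∀ t, r t = r₀) :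
    IsCircularOrbit r φ := by
  have hI : r₀ ∈ S.I := hr 0 ▸ hm.mem 0 trivial
  have hf := f_pos' hI
  have hφ : ∀ t, HasDerivAt φ (K / S.f r₀ ^ 2) t := fun t => by
    have := hasDerivAt_momentum isOpen_univ hm hK (mem_univ t)
    rwa [hr t] at this
  have hlin : ∀ t, φ t - K / S.f r₀ ^ 2 * t = φ 0 := by
    intro t
    have h1 : ∀ s, HasDerivAt (fun s => φ s - K / S.f r₀ ^ 2 * s) 0 s := fun s => by
      have := (hφ s).sub ((hasDerivAt_id s).const_mul (K / S.f r₀ ^ 2))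
      refine this.congr_deriv ?_
      simp
    have := is_const_of_deriv_eq_zero (fun s => (h1 s).differentiableAt) (fun s => (h1 s).deriv) t 0
    simpa using this
  refine ⟨r₀, ?_⟩
  ext ⟨x, a⟩
  simp only [orbitOf, mem_range, Prod.mk.injEq, mem_prod, mem_singleton_iff, mem_univ, and_true]
  constructor
  · rintro ⟨t, ht, _⟩
    rw [← ht, hr]
  · rintro rfl
    induction a using Real.Angle.induction_on with
    | _ y =>
      refine ⟨(y - φ 0) * S.f x ^ 2 / K, hr _, ?_⟩
      congr 1
      have := hlin ((y - φ 0) * S.f x ^ 2 / K)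
      field_simp at this
      linarith

theorem not_isCircularOrbit {r φ : ℝ → ℝ} {s t : ℝ} (h : r s ≠ r t) : ¬ IsCircularOrbit r φ := by
  rintro ⟨r₀, hr⟩
  have key : ∀ u, r u = r₀ := fun u => by
    have : (r u, (φ u : Real.Angle)) ∈ ({r₀} ×ˢ univ : Set (ℝ × Real.Angle)) := by
      rw [← hr]
      exact ⟨u, rfl⟩
    exact this.1
  exact h ((key s).trans (key t).symm)

end RevSurface

/-! ### Trajectories of given energy -/

/-- One-sided limits of the derivative give the one-sided derivatives. This is needed at turning
points, where the energy relation fixes only the square of the velocity. -/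
theorem hasDerivAt_of_eventually_hasDerivAt_ne {f g : ℝ → ℝ} {x : ℝ}
    (h : ∀ᶠ y in 𝓝[≠] x, HasDerivAt f (g y) y) (hf : ContinuousAt f x)
    (hg : ContinuousAt g x) : HasDerivAt f (g x) x := by
  rw [eventually_nhdsWithin_iff] at h
  obtain ⟨ε, hε, hb⟩ := Metric.eventually_nhds_iff.1 h
  have hR : ∀ y ∈ Ioo x (x + ε), HasDerivAt f (g y) y := fun y hy =>
    hb (by rw [Real.dist_eq, abs_of_pos (by linarith [hy.1])]; linarith [hy.2]) hy.1.ne'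
  have hL : ∀ y ∈ Ioo (x - ε) x, HasDerivAt f (g y) y := fun y hy =>
    hb (by rw [Real.dist_eq, abs_of_neg (by linarith [hy.2])]; linarith [hy.1]) hy.2.ne
  have A : HasDerivWithinAt f (g x) (Ici x) x := by
    refine hasDerivWithinAt_Ici_of_tendsto_deriv (s := Ioo x (x + ε))
      (fun y hy => (hR y hy).differentiableAt.differentiableWithinAt) hf.continuousWithinAt
      (Ioo_mem_nhdsGT (by linarith)) ?_
    refine (tendsto_inf_left hg).congr' ?_
    filter_upwards [Ioo_mem_nhdsGT (by linarith : x < x + ε)] with y hy using (hR y hy).deriv.symm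
  have B : HasDerivWithinAt f (g x) (Iic x) x := by
    refine hasDerivWithinAt_Iic_of_tendsto_deriv (s := Ioo (x - ε) x)
      (fun y hy => (hL y hy).differentiableAt.differentiableWithinAt) hf.continuousWithinAt
      (Ioo_mem_nhdsLT (by linarith)) ?_
    refine (tendsto_inf_left hg).congr' ?_
    filter_upwards [Ioo_mem_nhdsLT (by linarith : x - ε < x)] with y hy using (hL y hy).deriv.symm
  simpa using B.union A

/-- A function is determined by the derivative of its square, off its zeros. -/
theorem hasDerivAt_of_sq {v h : ℝ → ℝ} {a t : ℝ} (hv : Continuous v) (hvt : v t ≠ 0)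
    (hh : ∀ s, v s ^ 2 = h s) (hd : HasDerivAt h (2 * v t * a) t) : HasDerivAt v a t := by
  rcases hvt.lt_or_gt with hneg | hpos
  · have h1 : v =ᶠ[𝓝 t] fun s => -√(h s) := by
      filter_upwards [hv.continuousAt.eventually_lt_const hneg] with s hs
      rw [← hh, Real.sqrt_sq_eq_abs, abs_of_neg hs, neg_neg]
    have h2 : h t ≠ 0 := by rw [← hh]; positivity
    refine ((hd.sqrt h2).neg.congr_of_eventuallyEq h1).congr_deriv ?_
    rw [← hh, Real.sqrt_sq_eq_abs, abs_of_neg hneg]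
    field_simp
  · have h1 : v =ᶠ[𝓝 t] fun s => √(h s) := by
      filter_upwards [hv.continuousAt.eventually_const_lt hpos] with s hs
      rw [← hh, Real.sqrt_sq_eq_abs, abs_of_pos hs]
    have h2 : h t ≠ 0 := by rw [← hh]; positivity
    refine ((hd.sqrt h2).congr_of_eventuallyEq h1).congr_deriv ?_
    rw [← hh, Real.sqrt_sq_eq_abs, abs_of_pos hpos]
    field_simp

namespace RevSurface

variable (S : RevSurface) {V : ℝ → ℝ}

/-! ### The coordinate in which the orbits satisfy Newton's equation -/

/-- A base point in `(a, b)`. -/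
def basePoint : ℝ := S.nonempty_I.some

/-- The coordinate `x` with `dx = dr / f²`. -/
def toX (r : ℝ) : ℝ := ∫ s in S.basePoint..r, 1 / S.f s ^ 2

/-- The interval of values of the coordinate `x`. -/
def X : Set ℝ := S.toX '' S.I

/-- The radius as a function of the coordinate `x`. -/
def ofX : ℝ → ℝ := Function.invFunOn S.toX S.I

variable {S}

theorem hasDerivAt_toX {r : ℝ} (hr : r ∈ S.I) : HasDerivAt S.toX (1 / S.f r ^ 2) r := by
  have hc : ContinuousOn (fun s => 1 / S.f s ^ 2) S.I :=
    continuousOn_const.div (contDiffOn_f.continuousOn.pow 2) fun s hs => by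
      have := f_pos' hs
      positivity
  have hsub : uIcc S.basePoint r ⊆ S.I := S.ordConnected_I.uIcc_subset S.nonempty_I.some_mem hr
  refine intervalIntegral.integral_hasDerivAt_right ((hc.mono hsub).intervalIntegrable) ?_
    (hc.continuousAt (S.isOpen_I.mem_nhds hr))
  exact hc.stronglyMeasurableAtFilter S.isOpen_I r hr

theorem strictMonoOn_toX : StrictMonoOn S.toX S.I := by
  refine strictMonoOn_of_deriv_pos S.ordConnected_I.convex
    (HasDerivAt.continuousOn fun r hr => hasDerivAt_toX hr) fun r hr => ?_
  rw [S.isOpen_I.interior_eq] at hr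
  rw [(hasDerivAt_toX hr).deriv]
  have := f_pos' hr
  positivity

theorem toX_mem {r : ℝ} (hr : r ∈ S.I) : S.toX r ∈ S.X := mem_image_of_mem _ hr

theorem ofX_mem {x : ℝ} (hx : x ∈ S.X) : S.ofX x ∈ S.I := Function.invFunOn_mem hx

theorem toX_ofX {x : ℝ} (hx : x ∈ S.X) : S.toX (S.ofX x) = x := Function.invFunOn_eq hx

theorem ofX_toX {r : ℝ} (hr : r ∈ S.I) : S.ofX (S.toX r) = r :=
  strictMonoOn_toX.injOn (ofX_mem (toX_mem hr)) hr (toX_ofX (toX_mem hr))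

theorem strictMonoOn_ofX : StrictMonoOn S.ofX S.X := by
  intro x hx y hy hxy
  by_contra h
  have := strictMonoOn_toX.monotoneOn (ofX_mem hy) (ofX_mem hx) (not_lt.1 h)
  rw [toX_ofX hx, toX_ofX hy] at this
  exact absurd hxy (not_lt.2 this)

theorem ordConnected_X : S.X.OrdConnected :=
  (S.isPreconnected_I.image _ (HasDerivAt.continuousOn fun _ hr => hasDerivAt_toX hr)).ordConnected

theorem exists_Icc_nhds {s : Set ℝ} (hs : IsOpen s) {r : ℝ} (hr : r ∈ s) :
    ∃ u v, u < r ∧ r < v ∧ Icc u v ⊆ s := by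
  obtain ⟨ε, hε, h⟩ := Metric.isOpen_iff.1 hs r hr
  refine ⟨r - ε / 2, r + ε / 2, by linarith, by linarith, fun y hy => h ?_⟩
  rw [Metric.mem_ball, Real.dist_eq, abs_lt]
  constructor <;> linarith [hy.1, hy.2]

theorem isOpen_X : IsOpen S.X := by
  rw [isOpen_iff_mem_nhds]
  rintro _ ⟨r, hr, rfl⟩
  obtain ⟨u, v, hu, hv, huv⟩ := exists_Icc_nhds S.isOpen_I hr
  have h1 := strictMonoOn_toX (huv ⟨le_rfl, (hu.trans hv).le⟩) hr hu
  have h2 := strictMonoOn_toX hr (huv ⟨(hu.trans hv).le, le_rfl⟩) hv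
  refine mem_of_superset (Icc_mem_nhds h1 h2) ?_
  exact ordConnected_X.out (toX_mem (huv ⟨le_rfl, (hu.trans hv).le⟩))
    (toX_mem (huv ⟨(hu.trans hv).le, le_rfl⟩))

theorem continuousAt_ofX {x : ℝ} (hx : x ∈ S.X) : ContinuousAt S.ofX x := by
  refine strictMonoOn_ofX.continuousAt_of_image_mem_nhds (isOpen_X.mem_nhds hx) ?_
  have : S.ofX '' S.X = S.I := by
    ext r
    constructor
    · rintro ⟨y, hy, rfl⟩
      exact ofX_mem hy
    · exact fun hr => ⟨S.toX r, toX_mem hr, ofX_toX hr⟩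
  rw [this]
  exact S.isOpen_I.mem_nhds (ofX_mem hx)

theorem hasDerivAt_ofX {x : ℝ} (hx : x ∈ S.X) : HasDerivAt S.ofX (S.f (S.ofX x) ^ 2) x := by
  have hf := f_pos' (ofX_mem hx)
  have := HasDerivAt.of_local_left_inverse (continuousAt_ofX hx) (hasDerivAt_toX (ofX_mem hx))
    (by positivity) (by
      filter_upwards [isOpen_X.mem_nhds hx] with y hy using toX_ofX hy)
  simpa using this

theorem contDiffOn_ofX : ContDiffOn ℝ ∞ S.ofX S.X :=
  contDiffOn_of_hasDerivAt_comp (F := fun r => S.f r ^ 2) (l := 1) isOpen_X (contDiffOn_f.pow 2)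
    (fun _ hx => ofX_mem hx) fun x hx => by simpa using hasDerivAt_ofX hx

/-- The potential of Newton's equation of the orbits with momentum `K` in the coordinate `x`. -/
def orbitPotential (S : RevSurface) (V : ℝ → ℝ) (K x : ℝ) : ℝ :=
  S.effPotential V K (S.ofX x) / K ^ 2

/-- The derivative of the potential of the orbits. -/
def orbitDeriv (S : RevSurface) (V : ℝ → ℝ) (K x : ℝ) : ℝ :=
  S.effDeriv V K (S.ofX x) * S.f (S.ofX x) ^ 2 / K ^ 2

theorem contDiffOn_comp_ofX {F : ℝ → ℝ} (hF : ContDiffOn ℝ ∞ F S.I) :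
    ContDiffOn ℝ ∞ (fun x => F (S.ofX x)) S.X :=
  hF.comp contDiffOn_ofX fun _ hx => ofX_mem hx

theorem hasDerivAt_orbitPotential (hV : S.SmoothPotential V) (K : ℝ) {x : ℝ} (hx : x ∈ S.X) :
    HasDerivAt (S.orbitPotential V K) (S.orbitDeriv V K x) x :=
  ((hasDerivAt_effPotential hV K (ofX_mem hx)).comp x (hasDerivAt_ofX hx)).div_const _

theorem contDiffOn_orbitDeriv (hV : S.SmoothPotential V) (K : ℝ) :
    ContDiffOn ℝ ∞ (S.orbitDeriv V K) S.X :=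
  ((contDiffOn_comp_ofX (contDiffOn_effDeriv hV K)).mul
    ((contDiffOn_comp_ofX contDiffOn_f).pow 2)).div_const _

theorem hasDerivAt_of_smooth_X {F : ℝ → ℝ} (hF : ContDiffOn ℝ ∞ F S.X) {x : ℝ} (hx : x ∈ S.X) :
    HasDerivAt F (deriv F x) x :=
  ((hF.differentiableOn (by simp)).differentiableAt (isOpen_X.mem_nhds hx)).hasDerivAt

/-- The trajectory of a given energy which oscillates between `x₁` and `x₂`. -/
theorem exists_oscillation (hV : S.SmoothPotential V) {K : ℝ} (hK : K ≠ 0) {x₁ x₂ : ℝ}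
    (h12 : x₁ < x₂) (hX : Icc x₁ x₂ ⊆ S.X) {g : ℝ → ℝ} (hg : Continuous g)
    (hpos : ∀ x ∈ Icc x₁ x₂, 0 < hermiteD g x₁ x₂ x)
    (hspec : ∀ x ∈ Icc x₁ x₂, S.orbitPotential V K x - S.orbitPotential V K x₁ =
      (x - x₁) * (x - x₂) * hermiteD g x₁ x₂ x) :
    ∃ r φ : ℝ → ℝ, S.IsBoundedTrajectory V r φ ∧ S.HasMomentum univ r φ K ∧
      (∀ t, r t ∈ Icc (S.ofX x₁) (S.ofX x₂)) ∧ (∃ t, r t = S.ofX x₁) ∧ (∃ t, r t = S.ofX x₂) ∧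
      (IsClosedOrbit r φ → ∃ c : ℚ, wellPeriod g x₁ x₂ = 2 * Real.pi * c) := by
  -- The motion is built from the phase `s`: the position is `ξ s`, the elapsed time is the integral
  -- of `N` along `ξ`, and the angle is the integral of `1 / Q` with the sign of `K`. Conservation
  -- of energy dictates `Q`, and `dφ/dt = K / f²` dictates `N`. Inverting the time function `F`
  -- gives the trajectory.
  set ξ : ℝ → ℝ := wellPoint x₁ x₂ with hξ
  have hξm : ∀ s, ξ s ∈ Icc x₁ x₂ := wellPoint_mem h12.le
  have hξX : ∀ s, ξ s ∈ S.X := fun s => hX (hξm s)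
  have hξd : ∀ s, HasDerivAt ξ ((x₂ - x₁) / 2 * Real.cos s) s := fun s =>
    ((Real.hasDerivAt_sin s).const_mul ((x₂ - x₁) / 2)).const_add ((x₁ + x₂) / 2)
  have hξc : Continuous ξ := continuous_iff_continuousAt.2 fun s => (hξd s).continuousAt
  have hDc : Continuous fun x => hermiteD g x₁ x₂ x :=
    continuous_hermiteD hg continuous_const continuous_const continuous_id
  set Q : ℝ → ℝ := fun x => √(2 * hermiteD g x₁ x₂ x) with hQ
  have hQc : Continuous Q := (continuous_const.mul hDc).sqrt
  have hQp : ∀ x ∈ Icc x₁ x₂, 0 < Q x := fun x hx =>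
    Real.sqrt_pos.2 (mul_pos two_pos (hpos x hx))
  have hK' : 0 < |K| := abs_pos.2 hK
  set N : ℝ → ℝ := fun x => S.f (S.ofX x) ^ 2 / (|K| * Q x) with hN
  have hfc : ContinuousOn (fun x => S.f (S.ofX x)) S.X :=
    (contDiffOn_comp_ofX contDiffOn_f).continuousOn
  have hNc : ContinuousOn N (Icc x₁ x₂) :=
    ((hfc.mono hX).pow 2).div (continuousOn_const.mul hQc.continuousOn) fun x hx =>
      (mul_pos hK' (hQp x hx)).ne'
  have hNp : ∀ x ∈ Icc x₁ x₂, 0 < N x := fun x hx =>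
    div_pos (pow_pos (f_pos' (ofX_mem (hX hx))) 2) (mul_pos hK' (hQp x hx))
  obtain ⟨x₀, hx₀, hmin⟩ := isCompact_Icc.exists_isMinOn (nonempty_Icc.2 h12.le) hNc
  have hnc : Continuous fun s => N (ξ s) := hNc.comp_continuous hξc hξm
  have hint : ∀ {F : ℝ → ℝ}, Continuous F → ∀ s, HasDerivAt (fun s => ∫ u in (0 : ℝ)..s, F u)
      (F s) s := fun hF s => intervalIntegral.integral_hasDerivAt_right
        (hF.intervalIntegrable _ _) (hF.stronglyMeasurableAtFilter _ _) hF.continuousAt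
  obtain ⟨σ, hσ1, hσ2, hσd⟩ := exists_inverse_of_hasDerivAt (hNp x₀ hx₀) (hint hnc)
    fun s => hmin (hξm s)
  have hσc : Continuous σ := continuous_iff_continuousAt.2 fun t => (hσd t).continuousAt
  set F : ℝ → ℝ := fun s => ∫ u in (0 : ℝ)..s, N (ξ u) with hF
  have hσF : ∀ s, σ (F s) = s := hσ2
  set ψ : ℝ → ℝ := fun s => 1 / Q (ξ s) with hψ
  have hψc : Continuous ψ := continuous_const.div (hQc.comp hξc) fun s => (hQp _ (hξm s)).ne'
  set Ψ : ℝ → ℝ := fun s => ∫ u in (0 : ℝ)..s, ψ u with hΨ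
  set r : ℝ → ℝ := fun t => S.ofX (ξ (σ t)) with hr
  set φ : ℝ → ℝ := fun t => K / |K| * Ψ (σ t) with hφ
  set v : ℝ → ℝ := fun t => |K| * ((x₂ - x₁) / 2 * Real.cos (σ t)) * Q (ξ (σ t)) with hv
  have hrd : ∀ t, HasDerivAt r (v t) t := by
    intro t
    have h1 := (hasDerivAt_ofX (hξX (σ t))).comp t ((hξd (σ t)).comp t (hσd t))
    refine h1.congr_deriv ?_
    have hf := f_pos' (ofX_mem (hξX (σ t)))
    have hq := hQp _ (hξm (σ t))
    simp only [hv, hN]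
    field_simp
  have hφd : ∀ t, HasDerivAt φ (K / S.f (r t) ^ 2) t := by
    intro t
    have h1 := ((hint hψc (σ t)).comp t (hσd t)).const_mul (K / |K|)
    refine h1.congr_deriv ?_
    have hf := f_pos' (ofX_mem (hξX (σ t)))
    have hq := hQp _ (hξm (σ t))
    simp only [hψ, hN, hr]
    field_simp
  have hvc : Continuous v := by
    have := hQc.comp (hξc.comp hσc)
    simp only [Function.comp_def] at this
    fun_prop
  have hrI : ∀ t, r t ∈ S.I := fun t => ofX_mem (hξX (σ t))
  have hrc : Continuous r := continuous_iff_continuousAt.2 fun t => (hrd t).continuousAt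
  have henergy : ∀ t, v t ^ 2 = 2 * (K ^ 2 * S.orbitPotential V K x₁ - S.effPotential V K (r t)) := by
    intro t
    have h1 := hspec _ (hξm (σ t))
    have h2 : S.effPotential V K (r t) = K ^ 2 * S.orbitPotential V K (ξ (σ t)) := by
      simp only [orbitPotential, hr]
      field_simp
    have h3 : Q (ξ (σ t)) ^ 2 = 2 * hermiteD g x₁ x₂ (ξ (σ t)) :=
      Real.sq_sqrt (mul_pos two_pos (hpos _ (hξm _))).le
    rw [h2, ← mul_sub, ← neg_sub (S.orbitPotential V K (ξ (σ t))), h1]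
    simp only [hv]
    rw [mul_pow, mul_pow, mul_pow, sq_abs, h3, Real.cos_sq']
    simp only [hξ, wellPoint]
    ring
  have hacc : Continuous fun t => -S.effDeriv V K (r t) :=
    ((continuousOn_effDeriv hV K).comp_continuous hrc hrI).neg
  have hvd0 : ∀ t, v t ≠ 0 → HasDerivAt v (-S.effDeriv V K (r t)) t := by
    intro t ht
    refine hasDerivAt_of_sq hvc ht henergy ?_
    have h1 := (((hasDerivAt_effPotential hV K (hrI t)).comp t (hrd t)).const_sub
      (K ^ 2 * S.orbitPotential V K x₁)).const_mul 2
    refine h1.congr_deriv ?_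
    ring
  have hvd : ∀ t, HasDerivAt v (-S.effDeriv V K (r t)) t := by
    intro t
    -- Away from the turning points the acceleration follows by differentiating the energy relation
    -- for `v²`. The zeros of `v` are isolated, as `cos (σ t)` has nonzero derivative there, so the
    -- formula extends to them by continuity.
    by_cases ht : v t = 0
    · refine hasDerivAt_of_eventually_hasDerivAt_ne (g := fun t => -S.effDeriv V K (r t)) ?_
        hvc.continuousAt hacc.continuousAt
      have hcos : HasDerivAt (fun t => Real.cos (σ t)) (-Real.sin (σ t) * (N (ξ (σ t)))⁻¹) t :=
        (Real.hasDerivAt_cos (σ t)).comp t (hσd t)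
      have hc0 : Real.cos (σ t) = 0 := by
        have hq := hQp _ (hξm (σ t))
        have h2 : (x₂ - x₁) / 2 ≠ 0 := by
          have : 0 < x₂ - x₁ := by linarith
          positivity
        simp only [hv, mul_eq_zero, hK'.ne', hq.ne', h2, false_or, or_false] at ht
        exact ht
      have hs0 : Real.sin (σ t) ≠ 0 := by
        intro h
        have := Real.sin_sq_add_cos_sq (σ t)
        rw [h, hc0] at this
        norm_num at this
      have hne := hcos.eventually_ne (c := 0)
        (mul_ne_zero (neg_ne_zero.2 hs0) (inv_ne_zero (hNp _ (hξm _)).ne'))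
      filter_upwards [hne] with s hs
      refine hvd0 s ?_
      have hq := hQp _ (hξm (σ s))
      have h2 : (x₂ - x₁) / 2 ≠ 0 := by
        have : 0 < x₂ - x₁ := by linarith
        positivity
      simp only [hv]
      exact mul_ne_zero (mul_ne_zero hK'.ne' (mul_ne_zero h2 hs)) hq.ne'
    · exact hvd0 t ht
  obtain ⟨hmot, hmom⟩ := isMotion_of_hasDerivAt (K := K) (J := univ) hV isOpen_univ
    (fun t _ => hrI t) (fun t _ => hrd t) (fun t _ => hvd t) fun t _ => hφd t
  have hx1 : x₁ ∈ S.X := hX ⟨le_rfl, h12.le⟩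
  have hx2 : x₂ ∈ S.X := hX ⟨h12.le, le_rfl⟩
  have hrange : ∀ t, r t ∈ Icc (S.ofX x₁) (S.ofX x₂) := fun t =>
    ⟨strictMonoOn_ofX.monotoneOn hx1 (hξX _) (hξm _).1,
      strictMonoOn_ofX.monotoneOn (hξX _) hx2 (hξm _).2⟩
  refine ⟨r, φ, ⟨hmot, _, ofX_mem hx1, _, ofX_mem hx2, hrange⟩, hmom, hrange,
    ⟨F (-(Real.pi / 2)), ?_⟩, ⟨F (Real.pi / 2), ?_⟩, ?_⟩
  · simp only [hr, hσF, hξ, wellPoint, Real.sin_neg, Real.sin_pi_div_two]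
    congr 1
    ring
  · simp only [hr, hσF, hξ, wellPoint, Real.sin_pi_div_two]
    congr 1
    ring
  -- The comparison starts at the outer turning point, of phase `π / 2`. One period of the motion
  -- returns to `sin = 1`, that is, completes `j > 0` full turns of the phase. The angle has then
  -- changed by `± j` times the period integral, which must be a multiple of `2π`.
  · rintro ⟨T, hT, hper⟩
    obtain ⟨h1, h2⟩ := hper (F (Real.pi / 2))
    set s₁ := σ (F (Real.pi / 2) + T) with hs₁
    have hσm : StrictMono σ := strictMono_of_hasDerivAt_pos hσd
      fun t => inv_pos.2 (hNp _ (hξm _))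
    have hs₁lt : Real.pi / 2 < s₁ := by
      have := hσm (show F (Real.pi / 2) < F (Real.pi / 2) + T by linarith)
      rwa [hσF] at this
    have hsin : Real.sin s₁ = 1 := by
      have h3 : ξ s₁ = ξ (Real.pi / 2) := by
        have : r (F (Real.pi / 2) + T) = S.ofX (ξ s₁) := rfl
        rw [this] at h1
        have e : r (F (Real.pi / 2)) = S.ofX (ξ (Real.pi / 2)) := by simp only [hr, hσF]
        rw [e] at h1
        exact strictMonoOn_ofX.injOn (hξX _) (hξX _) h1
      simp only [hξ, wellPoint, Real.sin_pi_div_two] at h3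
      have h4 : (x₂ - x₁) / 2 * Real.sin s₁ = (x₂ - x₁) / 2 * 1 := by linarith
      exact mul_left_cancel₀ (by linarith) h4
    obtain ⟨j, hj⟩ := Real.sin_eq_one_iff.1 hsin
    have hj0 : (0 : ℝ) < j := by
      have := Real.pi_pos
      have h5 : 0 < (j : ℝ) * (2 * Real.pi) := by linarith
      exact (mul_pos_iff_of_pos_right (by positivity)).1 h5
    obtain ⟨n, hn⟩ := Real.Angle.angle_eq_iff_two_pi_dvd_sub.1 h2
    have hψp : Function.Periodic ψ (2 * Real.pi) := by
      intro s
      simp only [hψ, hξ, wellPoint, Real.sin_add_two_pi]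
    have hΨj : Ψ s₁ - Ψ (Real.pi / 2) = j * wellPeriod g x₁ x₂ := by
      have e1 := intervalIntegral.integral_interval_sub_left (a := (0 : ℝ)) (b := s₁)
        (c := Real.pi / 2) (hψc.intervalIntegrable (μ := MeasureTheory.volume) _ _)
        (hψc.intervalIntegrable _ _)
      rw [hΨ]
      simp only
      rw [e1, ← hj]
      have e2 := hψp.intervalIntegral_add_zsmul_eq j (Real.pi / 2)
        (fun t₁ t₂ => hψc.intervalIntegrable t₁ t₂)
      rw [zsmul_eq_mul, zsmul_eq_mul] at e2
      rw [e2]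
      have e3 := hψp.intervalIntegral_add_eq 0 (Real.pi / 2)
      rw [zero_add] at e3
      rw [← e3]
      rfl
    have h6 : φ (F (Real.pi / 2) + T) - φ (F (Real.pi / 2)) =
        K / |K| * (j * wellPeriod g x₁ x₂) := by
      rw [← hΨj]
      simp only [hφ, hσF]
      rw [hs₁]
      ring
    rw [h6] at hn
    have hKK : K / |K| = 1 ∨ K / |K| = -1 := by
      rcases hK.lt_or_gt with h | h
      · right; rw [abs_of_neg h]; field_simp
      · left; rw [abs_of_pos h]; field_simp
    rcases hKK with h | h
    · refine ⟨n / j, ?_⟩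
      push_cast
      rw [h, one_mul] at hn
      field_simp
      linarith
    · refine ⟨-n / j, ?_⟩
      push_cast
      rw [h] at hn
      field_simp
      linarith

end RevSurface

/-! ### Wells of the orbit potential -/

/-- The continuation of a function from `[u, v]` by constants. -/
def clampExtend (u v : ℝ) (F : ℝ → ℝ) (x : ℝ) : ℝ := F (max u (min x v))

theorem clampExtend_of_mem {u v x : ℝ} {F : ℝ → ℝ} (hx : x ∈ Icc u v) : clampExtend u v F x = F x := by
  rw [clampExtend, min_eq_left hx.2, max_eq_right hx.1]

theorem continuous_clampExtend {u v : ℝ} {F : ℝ → ℝ} (huv : u ≤ v) (hF : ContinuousOn F (Icc u v)) :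
    Continuous (clampExtend u v F) :=
  hF.comp_continuous (by fun_prop) fun x => ⟨le_max_left _ _, max_le huv (min_le_right _ _)⟩

theorem taylor_two_isLittleO {F F' : ℝ → ℝ} {F'' x₀ : ℝ} (h1 : ∀ᶠ y in 𝓝 x₀, HasDerivAt F (F' y) y)
    (h2 : HasDerivAt F' F'' x₀) :
    (fun y => F y - (F x₀ + F' x₀ * (y - x₀) + F'' / 2 * (y - x₀) ^ 2)) =o[𝓝 x₀]
      fun y => (y - x₀) ^ 2 := by
  obtain ⟨ε, hε, hb⟩ := Metric.eventually_nhds_iff_ball.1 h1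
  have hd : ∀ y ∈ Metric.ball x₀ ε, HasDerivWithinAt
      (fun y => F y - (F x₀ + F' x₀ * (y - x₀) + F'' / 2 * (y - x₀) ^ 2))
      (F' y - F' x₀ - F'' * (y - x₀)) (Metric.ball x₀ ε) y := by
    intro y hy
    have hs : HasDerivAt (fun y => y - x₀) 1 y := (hasDerivAt_id y).sub_const x₀
    have := (hb y hy).sub (((hs.const_mul (F' x₀)).const_add (F x₀)).add
      ((hs.pow 2).const_mul (F'' / 2)))
    refine (this.congr_deriv ?_).hasDerivWithinAt
    simp; ring
  have hlo : (fun y => F' y - F' x₀ - F'' * (y - x₀)) =o[𝓝[Metric.ball x₀ ε] x₀]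
      fun y => (y - x₀) ^ 1 := by
    have := (hasDerivAt_iff_isLittleO.1 h2).mono nhdsWithin_le_nhds (l := 𝓝[Metric.ball x₀ ε] x₀)
    simp only [smul_eq_mul] at this
    refine (this.congr_left fun y => by ring).congr_right fun y => by ring
  have h3 := (convex_ball x₀ ε).isLittleO_pow_succ_real (Metric.mem_ball_self hε) hd hlo
  rw [nhdsWithin_eq_nhds.2 (Metric.ball_mem_nhds x₀ hε)] at h3
  refine h3.congr_left fun y => ?_
  simp

/-- Near a nondegenerate minimum there are arbitrarily small wells. -/
theorem exists_small_well {P P' g : ℝ → ℝ} {u v x₀ : ℝ} (hu : u < x₀) (hv : x₀ < v)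
    (hg : Continuous g) (h1 : ∀ y ∈ Icc u v, HasDerivAt P (P' y) y)
    (h2 : ∀ y ∈ Icc u v, HasDerivAt P' (g y) y) (h0 : P' x₀ = 0) (hpos : 0 < g x₀) :
    ∃ a₁ a₂, Icc a₁ a₂ ⊆ Icc u v ∧ IsWell P P' g a₁ x₀ x₀ a₂ := by
  have hev : ∀ᶠ y in 𝓝 x₀, 0 < g y ∧ y ∈ Ioo u v :=
    (hg.continuousAt.eventually_const_lt hpos).and (Ioo_mem_nhds hu hv)
  obtain ⟨ε, hε, hb⟩ := Metric.eventually_nhds_iff_ball.1 hev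
  set u' := x₀ - ε / 2 with hu'
  set v' := x₀ + ε / 2 with hv'
  have hmem : ∀ y ∈ Icc u' v', 0 < g y ∧ y ∈ Ioo u v := fun y hy => hb y (by
    rw [Metric.mem_ball, Real.dist_eq, abs_lt]
    constructor <;> linarith [hy.1, hy.2])
  have hsub : Icc u' v' ⊆ Icc u v := fun y hy => Ioo_subset_Icc_self (hmem y hy).2
  have hmono : StrictMonoOn P' (Icc u' v') := by
    refine strictMonoOn_of_deriv_pos (convex_Icc _ _)
      (HasDerivAt.continuousOn fun y hy => h2 y (hsub hy)) fun y hy => ?_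
    have hy' := interior_subset hy
    rw [(h2 y (hsub hy')).deriv]
    exact (hmem y hy').1
  have hx₀ : x₀ ∈ Icc u' v' := ⟨by linarith, by linarith⟩
  have hneg : ∀ y ∈ Ico u' x₀, P' y < 0 := fun y hy => by
    have := hmono ⟨hy.1, by linarith [hy.2]⟩ hx₀ hy.2
    rwa [h0] at this
  have hpos' : ∀ y ∈ Ioc x₀ v', 0 < P' y := fun y hy => by
    have := hmono hx₀ ⟨by linarith [hy.1], hy.2⟩ hy.1
    rwa [h0] at this
  have hPc : ContinuousOn P (Icc u' v') := HasDerivAt.continuousOn fun y hy => h1 y (hsub hy)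
  have hanti : StrictAntiOn P (Icc u' x₀) := by
    refine strictAntiOn_of_deriv_neg (convex_Icc _ _)
      (hPc.mono (Icc_subset_Icc_right hx₀.2)) fun y hy => ?_
    rw [interior_Icc] at hy
    rw [(h1 y (hsub ⟨hy.1.le, hy.2.le.trans hx₀.2⟩)).deriv]
    exact hneg y ⟨hy.1.le, hy.2⟩
  have hmonoP : StrictMonoOn P (Icc x₀ v') := by
    refine strictMonoOn_of_deriv_pos (convex_Icc _ _)
      (hPc.mono (Icc_subset_Icc_left hx₀.1)) fun y hy => ?_
    rw [interior_Icc] at hy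
    rw [(h1 y (hsub ⟨hx₀.1.trans hy.1.le, hy.2.le⟩)).deriv]
    exact hpos' y ⟨hy.1, hy.2.le⟩
  have build : ∀ a₁ ∈ Ico u' x₀, ∀ a₂ ∈ Ioc x₀ v', P a₁ = P a₂ →
      ∃ a₁ a₂, Icc a₁ a₂ ⊆ Icc u v ∧ IsWell P P' g a₁ x₀ x₀ a₂ := by
    intro a₁ ha₁ a₂ ha₂ he
    have hs : Icc a₁ a₂ ⊆ Icc u v := (Icc_subset_Icc ha₁.1 ha₂.2).trans hsub
    exact ⟨a₁, a₂, hs, ⟨ha₁.2, le_rfl, ha₂.1, hg, fun y hy => h1 y (hs hy),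
      fun y hy => h2 y (hs hy), fun y hy => hneg y ⟨ha₁.1.trans hy.1, hy.2⟩,
      fun y hy => hpos' y ⟨hy.1, hy.2.trans ha₂.2⟩,
      fun y hy => by rw [le_antisymm hy.2 hy.1], he⟩⟩
  have hu'lt : u' < x₀ := by linarith
  have hv'lt : x₀ < v' := by linarith
  have hPu : P x₀ < P u' := hanti ⟨le_rfl, hu'lt.le⟩ ⟨hu'lt.le, le_rfl⟩ hu'lt
  have hPv : P x₀ < P v' := hmonoP ⟨le_rfl, hv'lt.le⟩ ⟨hv'lt.le, le_rfl⟩ hv'lt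
  -- The end at the lower level is kept, and the other side is shortened until it reaches the same
  -- level.
  rcases le_total (P u') (P v') with h | h
  · obtain ⟨a₂, ha₂, he⟩ := intermediate_value_Icc hv'lt.le (hPc.mono (Icc_subset_Icc_left hx₀.1))
      ⟨hPu.le, h⟩
    refine build u' ⟨le_rfl, hu'lt⟩ a₂ ⟨lt_of_le_of_ne ha₂.1 ?_, ha₂.2⟩ he.symm
    rintro rfl
    exact hPu.ne he
  · obtain ⟨a₁, ha₁, he⟩ := intermediate_value_Icc' hu'lt.le (hPc.mono (Icc_subset_Icc_right hx₀.2))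
      ⟨hPv.le, h⟩
    refine build a₁ ⟨ha₁.1, lt_of_le_of_ne ha₁.2 ?_⟩ v' ⟨hv'lt, le_rfl⟩ he
    rintro rfl
    exact hPv.ne he

namespace RevSurface

variable {S : RevSurface} {V : ℝ → ℝ}

/-- In a well of the orbit potential there are trajectories of each energy; if they are closed, the
periods are rational multiples of `2π`. -/
theorem oscillation_of_well (hV : S.SmoothPotential V) {K : ℝ} (hK : K ≠ 0) {g : ℝ → ℝ}
    {a₁ p₁ p₂ a₂ : ℝ} (w : IsWell (S.orbitPotential V K) (S.orbitDeriv V K) g a₁ p₁ p₂ a₂)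
    (hX : Icc a₁ a₂ ⊆ S.X) {x₁ x₂ : ℝ} (h1 : x₁ ∈ Ico a₁ p₁) (h2 : x₂ ∈ Ioc p₂ a₂)
    (hP : S.orbitPotential V K x₁ = S.orbitPotential V K x₂) :
    ∃ r φ : ℝ → ℝ, S.IsOscillation V r φ K ∧
      (∀ t, r t ∈ Icc (S.ofX x₁) (S.ofX x₂)) ∧
      (IsClosedOrbit r φ → ∃ c : ℚ, wellPeriod g x₁ x₂ = 2 * Real.pi * c) := by
  have h12 : x₁ < x₂ := h1.2.trans_le (w.le.trans h2.1.le)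
  have hsub : Icc x₁ x₂ ⊆ Icc a₁ a₂ := Icc_subset_Icc h1.1 h2.2
  obtain ⟨r, φ, hb, hm, hr, ⟨s, hs⟩, ⟨t, ht⟩, hc⟩ := exists_oscillation hV hK h12 (hsub.trans hX)
    w.cont (fun x hx => w.hermiteD_pos h1 h2 hP hx) (fun x hx => hermiteD_spec h12 w.cont
      (fun y hy => w.deriv₁ y (hsub hy)) (fun y hy => w.deriv₂ y (hsub hy)) hP hx)
  refine ⟨r, φ, ⟨hb, hm, hK, not_isCircularOrbit (s := s) (t := t) ?_⟩, hr, hc⟩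
  rw [hs, ht]
  exact (strictMonoOn_ofX (hX (hsub ⟨le_rfl, h12.le⟩)) (hX (hsub ⟨h12.le, le_rfl⟩)) h12).ne

/-- Small wells near a nondegenerate minimum of the orbit potential. -/
theorem exists_well_near (hV : S.SmoothPotential V) {K x₀ : ℝ} (hx₀ : x₀ ∈ S.X)
    (h0 : S.orbitDeriv V K x₀ = 0) (hpos : 0 < deriv (S.orbitDeriv V K) x₀) {ε : ℝ} (hε : 0 < ε) :
    ∃ (g : ℝ → ℝ) (a₁ a₂ : ℝ), Icc a₁ a₂ ⊆ S.X ∧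
      IsWell (S.orbitPotential V K) (S.orbitDeriv V K) g a₁ x₀ x₀ a₂ ∧
      g =ᶠ[𝓝 x₀] deriv (S.orbitDeriv V K) ∧
      Icc (S.ofX a₁) (S.ofX a₂) ⊆ Icc (S.ofX x₀ - ε) (S.ofX x₀ + ε) := by
  have hopen : IsOpen (S.X ∩ S.ofX ⁻¹' (Ioo (S.ofX x₀ - ε) (S.ofX x₀ + ε))) :=
    (contDiffOn_ofX.continuousOn).isOpen_inter_preimage isOpen_X isOpen_Ioo
  obtain ⟨u, v, hu, hv, huv⟩ := exists_Icc_nhds hopen (r := x₀)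
    ⟨hx₀, by simp [hε], by simp [hε]⟩
  have hsX : Icc u v ⊆ S.X := fun y hy => (huv hy).1
  have hsm := contDiffOn_orbitDeriv hV K
  have hdc : ContinuousOn (deriv (S.orbitDeriv V K)) (Icc u v) :=
    ((contDiffOn_deriv isOpen_X hsm).continuousOn).mono hsX
  set g := clampExtend u v (deriv (S.orbitDeriv V K)) with hg
  have hgeq : ∀ y ∈ Icc u v, g y = deriv (S.orbitDeriv V K) y := fun y hy => clampExtend_of_mem hy
  obtain ⟨a₁, a₂, hs, w⟩ := exists_small_well hu hv
    (continuous_clampExtend (hu.trans hv).le hdc)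
    (fun y hy => hasDerivAt_orbitPotential hV K (hsX hy))
    (fun y hy => by
      have := hasDerivAt_of_smooth_X hsm (hsX hy)
      rwa [← hgeq y hy] at this) h0 (by
      rw [clampExtend_of_mem ⟨hu.le, hv.le⟩]
      exact hpos)
  have ha12 : a₁ ≤ a₂ := (w.lt₁.trans w.lt₂).le
  refine ⟨g, a₁, a₂, hs.trans hsX, w, ?_, ?_⟩
  · filter_upwards [Icc_mem_nhds hu hv] with y hy using hgeq y hy
  · have e1 := (huv (hs ⟨le_rfl, ha12⟩)).2
    have e2 := (huv (hs ⟨ha12, le_rfl⟩)).2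
    exact Icc_subset_Icc e1.1.le e2.2.le

/-- If all orbits near a strongly stable circle with the same momentum are closed, the frequency of
small oscillations is rational and the isochronous relation holds. -/
theorem closing_relations (hV : S.SmoothPotential V) {K x₀ : ℝ} (hK : K ≠ 0) (hx₀ : x₀ ∈ S.X)
    (h0 : S.orbitDeriv V K x₀ = 0) (hpos : 0 < deriv (S.orbitDeriv V K) x₀) {ε : ℝ} (hε : 0 < ε)
    (hcl : ∀ r φ : ℝ → ℝ, S.IsBoundedTrajectory V r φ → S.HasMomentum univ r φ K →
      (∀ t, r t ∈ Icc (S.ofX x₀ - ε) (S.ofX x₀ + ε)) → IsClosedOrbit r φ) :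
    (∃ β : ℚ, √(deriv (S.orbitDeriv V K) x₀) = β) ∧
    5 * deriv (deriv (S.orbitDeriv V K)) x₀ ^ 2 =
      3 * deriv (S.orbitDeriv V K) x₀ * deriv (deriv (deriv (S.orbitDeriv V K))) x₀ := by
  obtain ⟨g, a₁, a₂, hX, w, hgeq, hsub⟩ := exists_well_near hV hx₀ h0 hpos hε
  have hq : ∀ x₁ ∈ Ico a₁ x₀, ∀ x₂ ∈ Ioc x₀ a₂,
      S.orbitPotential V K x₁ = S.orbitPotential V K x₂ →
      ∃ c : ℚ, wellPeriod g x₁ x₂ = 2 * Real.pi * c := by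
    intro x₁ h1 x₂ h2 hP
    obtain ⟨r, φ, ⟨hb, hm, _, _⟩, hr, hc⟩ := oscillation_of_well hV hK w hX h1 h2 hP
    refine hc (hcl r φ hb hm fun t => hsub ?_)
    have ha1 : a₁ ∈ S.X := hX ⟨le_rfl, (w.lt₁.trans w.lt₂).le⟩
    have ha2 : a₂ ∈ S.X := hX ⟨(w.lt₁.trans w.lt₂).le, le_rfl⟩
    have hx1 : x₁ ∈ S.X := hX ⟨h1.1, (h1.2.trans w.lt₂).le⟩
    have hx2 : x₂ ∈ S.X := hX ⟨(w.lt₁.trans h2.1).le, h2.2⟩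
    exact ⟨(strictMonoOn_ofX.monotoneOn ha1 hx1 h1.1).trans (hr t).1,
      (hr t).2.trans (strictMonoOn_ofX.monotoneOn hx2 ha2 h2.2)⟩
  have hB : g x₀ = deriv (S.orbitDeriv V K) x₀ := hgeq.eq_of_nhds
  have hval : ∀ x₁ ∈ Ico a₁ x₀, ∀ x₂ ∈ Ioc x₀ a₂,
      S.orbitPotential V K x₁ = S.orbitPotential V K x₂ →
      wellPeriod g x₁ x₂ = 2 * Real.pi / √(deriv (S.orbitDeriv V K) x₀) := fun x₁ h1 x₂ h2 hP => by
    rw [w.period_value hq h1 h2 hP, hB]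
  constructor
  · have h1 : a₁ ∈ Ico a₁ x₀ := ⟨le_rfl, w.lt₁⟩
    have h2 : a₂ ∈ Ioc x₀ a₂ := ⟨w.lt₂, le_rfl⟩
    obtain ⟨c, hc⟩ := hq a₁ h1 a₂ h2 w.ends
    rw [hval a₁ h1 a₂ h2 w.ends, div_eq_mul_inv] at hc
    have h3 := mul_left_cancel₀ (by positivity) hc
    refine ⟨c⁻¹, ?_⟩
    push_cast
    rw [← h3, inv_inv]
  · have hsm := contDiffOn_orbitDeriv hV K
    have hsm1 := contDiffOn_deriv isOpen_X hsm
    have hsm2 := contDiffOn_deriv isOpen_X hsm1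
    have ht := taylor_two_isLittleO (F := deriv (S.orbitDeriv V K))
      (F' := deriv (deriv (S.orbitDeriv V K))) (x₀ := x₀)
      (by filter_upwards [isOpen_X.mem_nhds hx₀] with y hy using hasDerivAt_of_smooth_X hsm1 hy)
      (hasDerivAt_of_smooth_X hsm2 hx₀)
    -- Third and fourth derivatives of the potential at `x₀` are `6α` and `24b`, so `5 α² = 2 b B`
    -- is the required relation.
    have := w.isochronous_relation (B := deriv (S.orbitDeriv V K) x₀)
      (α := deriv (deriv (S.orbitDeriv V K)) x₀ / 6)
      (b := deriv (deriv (deriv (S.orbitDeriv V K))) x₀ / 24) hpos h0 (by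
        refine ht.congr' ?_ EventuallyEq.rfl
        filter_upwards [hgeq] with y hy
        rw [hy]
        ring) hval
    linarith

end RevSurface

/-! ### Stability of circular orbits -/

namespace RevSurface

variable {S : RevSurface} {V : ℝ → ℝ}

/-- At a critical point only the term in which `effDeriv` is differentiated survives, so the change
from `r` to `x` multiplies the second derivative by a positive factor and preserves nondegeneracy.
-/
theorem deriv_orbitDeriv_of_eq_zero (hV : S.SmoothPotential V) {K x : ℝ} (hx : x ∈ S.X)
    (h0 : S.effDeriv V K (S.ofX x) = 0) :
    deriv (S.orbitDeriv V K) x = deriv (S.effDeriv V K) (S.ofX x) * S.f (S.ofX x) ^ 4 / K ^ 2 := by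
  have hI := ofX_mem hx
  have h1 := (hasDerivAt_of_smooth (contDiffOn_effDeriv hV K) hI).comp x (hasDerivAt_ofX hx)
  have h2 := ((hasDerivAt_f hI).comp x (hasDerivAt_ofX hx)).pow 2
  have h3 := (h1.mul h2).div_const (K ^ 2)
  refine (h3.congr_deriv ?_).deriv
  simp only [Function.comp, h0, Pi.pow_apply]
  ring

theorem orbitDeriv_eq_zero_iff {K x : ℝ} (hx : x ∈ S.X) (hK : K ≠ 0) :
    S.orbitDeriv V K x = 0 ↔ S.effDeriv V K (S.ofX x) = 0 := by
  have := f_pos' (ofX_mem hx)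
  simp [orbitDeriv, hK, this.ne']

theorem stronglyStableAt_ofX_iff (hV : S.SmoothPotential V) {K x : ℝ} (hx : x ∈ S.X) (hK : K ≠ 0) :
    S.StronglyStableAt V (S.ofX x) K ↔
      S.orbitDeriv V K x = 0 ∧ 0 < deriv (S.orbitDeriv V K) x := by
  rw [stronglyStableAt_iff hV (ofX_mem hx), orbitDeriv_eq_zero_iff hx hK]
  have hf := f_pos' (ofX_mem hx)
  constructor
  · rintro ⟨_, h1, h2⟩
    refine ⟨h1, ?_⟩
    rw [deriv_orbitDeriv_of_eq_zero hV hx h1]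
    positivity
  · rintro ⟨h1, h2⟩
    refine ⟨hK, h1, ?_⟩
    rw [deriv_orbitDeriv_of_eq_zero hV hx h1] at h2
    by_contra hc
    have : deriv (S.effDeriv V K) (S.ofX x) * S.f (S.ofX x) ^ 4 / K ^ 2 ≤ 0 :=
      div_nonpos_of_nonpos_of_nonneg
        (mul_nonpos_of_nonpos_of_nonneg (not_lt.1 hc) (by positivity)) (by positivity)
    linarith

theorem OrbitallyStableAt.circularAt {r₀ K₀ : ℝ} (h : S.OrbitallyStableAt V r₀ K₀) :
    S.CircularAt V r₀ K₀ := by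
  obtain ⟨r, φ, h, _⟩ := h
  exact ⟨r, φ, h⟩

/-- The neighbourhoods of the phase orbit of a circular trajectory. -/
theorem mem_thickening_phase_iff {r₀ K₀ : ℝ} {r φ : ℝ → ℝ}
    (h : S.IsCircularTrajectory V r₀ K₀ r φ) {δ : ℝ} (r' φ' : ℝ → ℝ) (t : ℝ) :
    phasePoint r' φ' t ∈ Metric.thickening δ (range (phasePoint r φ)) ↔
      |r' t - r₀| < δ ∧ |deriv r' t| < δ ∧ |deriv φ' t - K₀ / S.f r₀ ^ 2| < δ := by
  have hr := circularTrajectory_radius h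
  have hdr : ∀ s, deriv r s = 0 := fun s => by
    rw [show r = fun _ => r₀ from funext hr]
    simp
  have hdφ : ∀ s, deriv φ s = K₀ / S.f r₀ ^ 2 := fun s => by
    rw [(hasDerivAt_momentum isOpen_univ h.1 h.2.1 (mem_univ s)).deriv, hr]
  rw [Metric.mem_thickening_iff]
  simp only [mem_range, exists_exists_eq_and, phasePoint, Prod.dist_eq, max_lt_iff, hr, hdr, hdφ,
    Real.dist_eq, sub_zero]
  constructor
  · rintro ⟨s, h1, _, h3, h4⟩
    exact ⟨h1, h3, h4⟩
  -- The circular orbit passes through every angle, so the angular coordinate imposes no condition.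
  · rintro ⟨h1, h3, h4⟩
    have : (r₀, (φ' t : Real.Angle)) ∈ orbitOf r φ := by
      rw [h.2.2]
      exact ⟨rfl, trivial⟩
    obtain ⟨s, hs⟩ := this
    refine ⟨s, h1, ?_, h3, h4⟩
    rw [show (φ s : Real.Angle) = (φ' t : Real.Angle) from congrArg Prod.snd hs, dist_self]
    exact (abs_nonneg _).trans_lt h1

/-- On the level `K = K₀` the energy of the radial motion is a Lyapunov function: the well of the
effective potential confines the radius, the energy bounds the radial velocity, and the angular
velocity `K₀ / f²` is a continuous function of the radius. -/
theorem StronglyStableAt.orbitallyStableAt (hV : S.SmoothPotential V) {r₀ K₀ : ℝ} (hr₀ : r₀ ∈ S.I)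
    (h : S.StronglyStableAt V r₀ K₀) : S.OrbitallyStableAt V r₀ K₀ := by
  obtain ⟨hK, h0, hpos⟩ := (stronglyStableAt_iff hV hr₀).1 h
  have hct := exists_circularTrajectory hV hr₀ hK h0
  refine ⟨_, _, hct, fun ε hε => ?_⟩
  set W := S.effPotential V K₀ with hW
  have hWd : ∀ r ∈ S.I, HasDerivAt W (S.effDeriv V K₀ r) r := fun r hr =>
    hasDerivAt_effPotential hV K₀ hr
  have hdd := hasDerivAt_of_smooth (contDiffOn_effDeriv hV K₀) hr₀
  have hlow : ∀ᶠ r in 𝓝 r₀, r ≠ r₀ → W r₀ < W r := by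
    have ht := taylor_two_isLittleO (F := W) (F' := S.effDeriv V K₀) (x₀ := r₀)
      (by filter_upwards [S.isOpen_I.mem_nhds hr₀] with y hy using hWd y hy) hdd
    have := ht.def (c := deriv (S.effDeriv V K₀) r₀ / 4) (by positivity)
    filter_upwards [this] with r hr hne
    rw [h0, Real.norm_eq_abs, Real.norm_eq_abs, abs_of_nonneg (sq_nonneg (r - r₀))] at hr
    have h1 := (abs_le.1 hr).1
    have h2 : 0 < (r - r₀) ^ 2 := by
      have := sub_ne_zero.2 hne
      positivity
    nlinarith
  have hfreq : ∀ᶠ r in 𝓝 r₀, |K₀ / S.f r ^ 2 - K₀ / S.f r₀ ^ 2| < ε := by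
    have hc : ContinuousAt (fun r => |K₀ / S.f r ^ 2 - K₀ / S.f r₀ ^ 2|) r₀ := by
      have h1 := (hasDerivAt_f hr₀).continuousAt
      have h2 := f_pos' hr₀
      exact (((continuousAt_const.div (h1.pow 2) (pow_pos h2 2).ne').sub continuousAt_const).abs)
    exact hc.eventually_lt_const (by simpa using hε)
  have hnear : ∀ᶠ r in 𝓝 r₀, |r - r₀| < ε := by
    have hc : ContinuousAt (fun r => |r - r₀|) r₀ := by fun_prop
    exact hc.eventually_lt_const (by simpa using hε)
  obtain ⟨ρ, hρ, hb⟩ := Metric.eventually_nhds_iff.1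
    (((hlow.and hfreq).and hnear).and (S.isOpen_I.mem_nhds hr₀))
  have hb' : ∀ r, |r - r₀| ≤ ρ / 2 → (r ≠ r₀ → W r₀ < W r) ∧
      |K₀ / S.f r ^ 2 - K₀ / S.f r₀ ^ 2| < ε ∧ |r - r₀| < ε ∧ r ∈ S.I := fun r hr => by
    have := hb (y := r) (by rw [Real.dist_eq]; linarith)
    exact ⟨this.1.1.1, this.1.1.2, this.1.2, this.2⟩
  have e1 := (hb' (r₀ - ρ / 2) (by rw [show r₀ - ρ / 2 - r₀ = -(ρ / 2) by ring, abs_neg,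
    abs_of_pos (by linarith)])).1 (by linarith)
  have e2 := (hb' (r₀ + ρ / 2) (by rw [show r₀ + ρ / 2 - r₀ = ρ / 2 by ring,
    abs_of_pos (by linarith)])).1 (by linarith)
  -- With energy below `η` the radius cannot reach `r₀ ± ρ / 2`, by the first two entries, and the
  -- radial speed stays below `ε`, by the third.
  set η := min (min (W (r₀ - ρ / 2)) (W (r₀ + ρ / 2))) (W r₀ + ε ^ 2 / 2) with hη
  have hη0 : W r₀ < η := lt_min (lt_min e1 e2) (by nlinarith)
  have hEc : ContinuousAt (fun p : ℝ × ℝ => p.2 ^ 2 / 2 + W p.1) (r₀, 0) :=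
    ((continuousAt_snd.pow 2).div_const 2).add
      (ContinuousAt.comp (f := Prod.fst) (x := ((r₀, 0) : ℝ × ℝ)) (g := W)
        (by exact (hWd r₀ hr₀).continuousAt) continuousAt_fst)
  obtain ⟨δ₁, hδ₁, hE⟩ := Metric.eventually_nhds_iff.1
    (hEc.eventually_lt_const (u := η) (by simpa using hη0))
  refine ⟨min δ₁ (ρ / 2), by positivity, fun J r φ hJ hJc h0J hm hmK hst t ht ht0 => ?_⟩
  rw [mem_thickening_phase_iff hct] at hst ⊢
  have hE0 : deriv r 0 ^ 2 / 2 + W (r 0) < η := by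
    refine hE (y := (r 0, deriv r 0)) ?_
    rw [Prod.dist_eq, max_lt_iff, Real.dist_eq, Real.dist_eq, sub_zero]
    exact ⟨hst.1.trans_le (min_le_left _ _), hst.2.1.trans_le (min_le_left _ _)⟩
  have hEt : ∀ s ∈ J, deriv r s ^ 2 / 2 + W (r s) < η := fun s hs => by
    rw [energy_eq hV hJ hJc.isPreconnected hm hmK hs h0J]
    exact hE0
  have h00 := abs_lt.1 (hst.1.trans_le (min_le_right _ _))
  have hrt : r t ∈ Ioo (r₀ - ρ / 2) (r₀ + ρ / 2) := by
    refine mem_Ioo_of_no_exit ht0 (fun s hs => ?_) ⟨by linarith, by linarith⟩ fun s hs _ => ?_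
    · exact (hasDerivAt_radius hJ hm (hJc.out h0J ht hs)).continuousAt.continuousWithinAt
    · have h1 := hEt s (hJc.out h0J ht hs)
      have h2 : η ≤ W (r₀ - ρ / 2) := (min_le_left _ _).trans (min_le_left _ _)
      have h3 : η ≤ W (r₀ + ρ / 2) := (min_le_left _ _).trans (min_le_right _ _)
      constructor <;> intro he <;> rw [he] at h1 <;> nlinarith [sq_nonneg (deriv r s)]
  have hrt' : |r t - r₀| ≤ ρ / 2 := by
    rw [abs_le]
    constructor <;> linarith [hrt.1, hrt.2]
  obtain ⟨g1, g2, g3, _⟩ := hb' (r t) hrt'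
  refine ⟨g3, ?_, ?_⟩
  · have h1 := hEt t ht
    have h2 : η ≤ W r₀ + ε ^ 2 / 2 := min_le_right _ _
    have h3 : W r₀ ≤ W (r t) := by
      by_cases hne : r t = r₀
      · rw [hne]
      · exact (g1 hne).le
    exact abs_lt_of_sq_lt_sq (by linarith) hε.le
  · rw [(hasDerivAt_momentum hJ hm hmK ht).deriv]
    exact g2

theorem stronglyStableAt_congr_sq (hV : S.SmoothPotential V) {r₀ K₀ K₁ : ℝ} (hr₀ : r₀ ∈ S.I)
    (h : S.StronglyStableAt V r₀ K₁) (hK : K₀ ^ 2 = K₁ ^ 2) : S.StronglyStableAt V r₀ K₀ := by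
  have he : S.effDeriv V K₀ = S.effDeriv V K₁ := by
    funext r
    rw [effDeriv, effDeriv, hK]
  rw [stronglyStableAt_iff hV hr₀] at h ⊢
  rw [he]
  refine ⟨?_, h.2⟩
  rintro rfl
  exact h.1 (by simpa using hK.symm)

/-- If the potential closes near the strongly stable orbits, all circular orbits on a circle which
is strongly stable at some momentum are strongly stable. -/
theorem stronglyStableAt_of_circularAt (hV : S.SmoothPotential V)
    (hcl : S.LocallyClosesAt V (S.StronglyStableAt V)) {r₀ K₀ K₁ : ℝ} (hr₀ : r₀ ∈ S.I)
    (h1 : S.StronglyStableAt V r₀ K₁) (h0 : S.CircularAt V r₀ K₀) : S.StronglyStableAt V r₀ K₀ := by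
  obtain ⟨hK1, hz1, hpos1⟩ := (stronglyStableAt_iff hV hr₀).1 h1
  obtain ⟨hK0, hz0⟩ := (circularAt_iff hV hr₀).1 h0
  have hf := f_pos' hr₀
  -- Off the critical points of `f` the circle determines `K²`, and the effective potential depends
  -- only on `K²`. Only critical points of `f` need the closing condition.
  by_cases hfd : deriv S.f r₀ = 0
  swap
  · refine stronglyStableAt_congr_sq hV hr₀ h1 ?_
    have h2 : (K₀ ^ 2 - K₁ ^ 2) * deriv S.f r₀ / S.f r₀ ^ 3 = 0 := by
      unfold effDeriv at hz0 hz1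
      have : (K₀ ^ 2 - K₁ ^ 2) * deriv S.f r₀ / S.f r₀ ^ 3 = K₀ ^ 2 * deriv S.f r₀ / S.f r₀ ^ 3 -
        K₁ ^ 2 * deriv S.f r₀ / S.f r₀ ^ 3 := by ring
      rw [this]
      linarith
    rw [div_eq_zero_iff] at h2
    rcases h2 with h2 | h2
    · rcases mul_eq_zero.1 h2 with h3 | h3
      · linarith
      · exact absurd h3 hfd
    · exact absurd h2 (by positivity)
  -- At a critical point of `f` that carries a circular orbit, `V` is critical too, so the circle is
  -- an orbit for every nonzero momentum. The squared frequency of small oscillations is then the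
  -- function `Z` of the momentum below, and the closing condition makes its root rational for all
  -- momenta near `K₁`.
  have hV0 : deriv V r₀ = 0 := by
    simpa [effDeriv, hfd] using hz0
  have hz : ∀ K, S.effDeriv V K r₀ = 0 := fun K => by simp [effDeriv, hfd, hV0]
  set A := deriv (deriv V) r₀ with hA
  set B := deriv (deriv S.f) r₀ with hB
  have hdd : ∀ K, deriv (S.effDeriv V K) r₀ = A - K ^ 2 * B / S.f r₀ ^ 3 := by
    intro K
    have e1 := hasDerivAt_of_smooth (contDiffOn_deriv S.isOpen_I hV) hr₀
    have e2 := hasDerivAt_of_smooth (contDiffOn_deriv S.isOpen_I (contDiffOn_f (S := S))) hr₀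
    have e3 := e1.sub ((e2.const_mul (K ^ 2)).div ((hasDerivAt_f hr₀).pow 3)
      (by simp; positivity))
    refine (e3.congr_deriv ?_).deriv
    simp only [hfd, Pi.pow_apply]
    field_simp
    ring
  obtain ⟨ε, hε, hcl'⟩ := hcl r₀ hr₀ K₁ h1
  set x₀ := S.toX r₀ with hx₀
  have hxX : x₀ ∈ S.X := toX_mem hr₀
  have hox : S.ofX x₀ = r₀ := ofX_toX hr₀
  have hval : ∀ K, K ≠ 0 → deriv (S.orbitDeriv V K) x₀ =
      A * S.f r₀ ^ 4 / K ^ 2 - B * S.f r₀ := fun K hK => by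
    rw [deriv_orbitDeriv_of_eq_zero hV hxX (by rw [hox, hz]), hox, hdd]
    field_simp
  set Z : ℝ → ℝ := fun K => A * S.f r₀ ^ 4 / K ^ 2 - B * S.f r₀ with hZ
  have hZc : ContinuousAt Z K₁ := by
    refine ContinuousAt.sub (continuousAt_const.div (by fun_prop) (by positivity)) continuousAt_const
  have hZ1 : 0 < Z K₁ := by
    change 0 < A * S.f r₀ ^ 4 / K₁ ^ 2 - B * S.f r₀
    rw [← hval K₁ hK1]
    rw [← hox] at h1
    exact ((stronglyStableAt_ofX_iff hV hxX hK1).1 h1).2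
  obtain ⟨δ, hδ, hb⟩ := Metric.eventually_nhds_iff.1 (((hZc.eventually_const_lt hZ1).and
    (isOpen_ne.mem_nhds hK1)).and (Ioo_mem_nhds (a := K₁ - ε) (b := K₁ + ε) (by linarith)
      (by linarith)))
  set s := Ioo (K₁ - δ) (K₁ + δ) with hs
  have hsb : ∀ K ∈ s, (0 < Z K ∧ K ≠ 0) ∧ K ∈ Ioo (K₁ - ε) (K₁ + ε) := fun K hK =>
    hb (by rw [Real.dist_eq, abs_lt]; constructor <;> linarith [hK.1, hK.2])
  have hrat : ∀ K ∈ s, ∃ q : ℚ, √(Z K) = q := by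
    intro K hK
    obtain ⟨⟨g1, g2⟩, g3⟩ := hsb K hK
    have := (closing_relations hV g2 hxX ((orbitDeriv_eq_zero_iff hxX g2).2 (by rw [hox, hz]))
      (by rw [hval K g2]; exact g1) hε (fun r φ hr hφ hin => by
        rw [hox] at hin
        exact hcl' r φ K hr hφ g2 hin g3)).1
    rwa [hval K g2] at this
  have hcont : ContinuousOn (fun K => √(Z K)) s := fun K hK => by
    have := (hsb K hK).1.2
    refine ContinuousAt.continuousWithinAt (ContinuousAt.sqrt ?_)
    exact ContinuousAt.sub (continuousAt_const.div (by fun_prop) (by positivity)) continuousAt_const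
  -- The rational function `√Z` is locally constant, and `A / K²` is constant near `K₁` only for `A
  -- = 0`. The sign of the second derivative is then the same for all nonzero momenta.
  have hA0 : A = 0 := by
    have m1 : K₁ ∈ s := ⟨by linarith, by linarith⟩
    have key : ∀ K ∈ s, A / K ^ 2 = A / K₁ ^ 2 := by
      intro K hK
      have h2 := eqOn_of_continuousOn_rat isPreconnected_Ioo hcont hrat hK m1
      have h3 : Z K = Z K₁ := by
        rw [← Real.sq_sqrt (hsb K hK).1.1.le, ← Real.sq_sqrt hZ1.le, h2]
      have h4 : A / K ^ 2 * S.f r₀ ^ 4 = A / K₁ ^ 2 * S.f r₀ ^ 4 := by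
        have e : ∀ K : ℝ, A / K ^ 2 * S.f r₀ ^ 4 = A * S.f r₀ ^ 4 / K ^ 2 := fun K => by ring
        rw [e, e]
        simp only [hZ] at h3
        linarith
      exact mul_right_cancel₀ (by positivity) h4
    by_contra hne
    have hsq : ∀ K ∈ s, K ^ 2 = K₁ ^ 2 := fun K hK => by
      have h2 := key K hK
      have h5 := (hsb K hK).1.2
      rw [div_eq_div_iff (by positivity) (by positivity)] at h2
      exact (mul_left_cancel₀ hne h2).symm
    have e1 := hsq (K₁ + δ / 2) ⟨by linarith, by linarith⟩
    have e2 := hsq (K₁ - δ / 2) ⟨by linarith, by linarith⟩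
    nlinarith
  refine (stronglyStableAt_iff hV hr₀).2 ⟨hK0, hz0, ?_⟩
  rw [hdd, hA0] at hpos1 ⊢
  have h5 : 0 < (-B / S.f r₀ ^ 3) * K₁ ^ 2 := by
    have : (-B / S.f r₀ ^ 3) * K₁ ^ 2 = 0 - K₁ ^ 2 * B / S.f r₀ ^ 3 := by ring
    rwa [this]
  have h6 : 0 < -B / S.f r₀ ^ 3 := pos_of_mul_pos_left h5 (sq_nonneg _)
  have : 0 - K₀ ^ 2 * B / S.f r₀ ^ 3 = (-B / S.f r₀ ^ 3) * K₀ ^ 2 := by ring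
  rw [this]
  positivity

/-- Energy conservation shows that the strongly stable circles are orbitally stable, and
`stronglyStableAt_of_circularAt` shows that no further circular orbits have to be tested. -/
theorem IsStronglyClosing.isWeaklyClosing (hV : S.SmoothPotential V) (h : S.IsStronglyClosing V) :
    S.IsWeaklyClosing V := by
  refine ⟨fun r₀ hr₀ => ?_, fun r₀ hr₀ K₀ hK₀ => ?_⟩
  · obtain ⟨K, hK⟩ := h.1 r₀ hr₀
    exact ⟨K, hK.orbitallyStableAt hV hr₀⟩
  · obtain ⟨K, hK⟩ := h.1 r₀ hr₀
    exact h.2 r₀ hr₀ K₀ (stronglyStableAt_of_circularAt hV h.2 hr₀ hK hK₀.circularAt)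

/-- A solution of the radial equation starting near a circular orbit which is orbitally stable. -/
theorem abs_sub_lt_of_stable (hV : S.SmoothPotential V) {r₀ K₀ ρ δ : ℝ} {rc φc : ℝ → ℝ}
    (hc : S.IsCircularTrajectory V r₀ K₀ rc φc) (hρ : 0 < ρ) (hI : Icc (r₀ - ρ) (r₀ + ρ) ⊆ S.I)
    (hδ : 0 < δ)
    (hst : ∀ (J : Set ℝ) (r' φ' : ℝ → ℝ), IsOpen J → J.OrdConnected → (0 : ℝ) ∈ J →
      S.IsMotion V J r' φ' → S.HasMomentum J r' φ' K₀ →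
      phasePoint r' φ' 0 ∈ Metric.thickening δ (range (phasePoint rc φc)) →
      ∀ t ∈ J, 0 ≤ t → phasePoint r' φ' t ∈ Metric.thickening (ρ / 2) (range (phasePoint rc φc)))
    {r v φ : ℝ → ℝ} (h0 : r 0 = r₀) (h1 : |v 0| < δ) (hr : ∀ t, HasDerivAt r (v t) t)
    (hv : ∀ t, r t ∈ Icc (r₀ - ρ) (r₀ + ρ) → HasDerivAt v (-S.effDeriv V K₀ (r t)) t)
    (hφ : ∀ t, r t ∈ Icc (r₀ - ρ) (r₀ + ρ) → HasDerivAt φ (K₀ / S.f (r t) ^ 2) t)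
    {t : ℝ} (ht : 0 ≤ t) : r t ∈ Ioo (r₀ - ρ) (r₀ + ρ) := by
  have hrc : Continuous r := continuous_iff_continuousAt.2 fun t => (hr t).continuousAt
  have h0m : r 0 ∈ Ioo (r₀ - ρ) (r₀ + ρ) := by
    rw [h0]
    constructor <;> linarith
  -- The equations of motion are known only while the radius stays within `ρ`. On the connected
  -- component `J` of such times the curve is a genuine motion, so stability keeps it within `ρ /
  -- 2`; by continuity it cannot be at distance `ρ` at the end of `J`.
  set O := r ⁻¹' Ioo (r₀ - ρ) (r₀ + ρ) with hO
  have hOo : IsOpen O := isOpen_Ioo.preimage hrc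
  set J := connectedComponentIn O 0 with hJ
  have hJo : IsOpen J := hOo.connectedComponentIn
  have hJO : J ⊆ O := connectedComponentIn_subset _ _
  have hJp : IsPreconnected J := isPreconnected_connectedComponentIn
  have h0J : (0 : ℝ) ∈ J := mem_connectedComponentIn h0m
  have hJi : ∀ s ∈ J, r s ∈ Icc (r₀ - ρ) (r₀ + ρ) := fun s hs => Ioo_subset_Icc_self (hJO hs)
  obtain ⟨hm, hk⟩ := isMotion_of_hasDerivAt (φ := φ) (K := K₀) hV hJo (fun s hs => hI (hJi s hs))
    (fun s _ => hr s) (fun s hs => hv s (hJi s hs)) (fun s hs => hφ s (hJi s hs))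
  have hin : phasePoint r φ 0 ∈ Metric.thickening δ (range (phasePoint rc φc)) := by
    rw [mem_thickening_phase_iff hc, h0, (hr 0).deriv, (hφ 0 (hJi 0 h0J)).deriv, h0]
    simpa [hδ] using h1
  have hJs : ∀ s ∈ J, 0 ≤ s → |r s - r₀| < ρ / 2 := fun s hs hs0 => by
    have := hst J r φ hJo hJp.ordConnected h0J hm hk hin s hs hs0
    rw [mem_thickening_phase_iff hc] at this
    exact this.1
  refine mem_Ioo_of_no_exit ht hrc.continuousOn h0m fun s hs hin => ?_
  have hsub : ∀ u ∈ Ico 0 s, u ∈ J := fun u hu =>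
    (isPreconnected_Icc.subset_connectedComponentIn (x := (0 : ℝ)) (s := Icc 0 u)
      ⟨le_rfl, hu.1⟩ fun w hw => hin w ⟨hw.1, hw.2.trans_lt hu.2⟩) ⟨hu.1, le_rfl⟩
  have hle : |r s - r₀| ≤ ρ / 2 := by
    rcases hs.1.eq_or_lt with h | h
    · rw [← h, h0, sub_self, abs_zero]
      linarith
    · have hcl : s ∈ closure (Ico 0 s) := by
        rw [closure_Ico h.ne]
        exact ⟨h.le, le_rfl⟩
      exact closure_minimal (s := Ico 0 s) (t := {u | |r u - r₀| ≤ ρ / 2})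
        (fun u hu => (hJs u (hsub u hu) hu.1).le)
        (isClosed_le (by fun_prop) continuous_const) hcl
  have := abs_le.1 hle
  constructor <;> intro he <;> rw [he] at this <;> linarith [this.1, this.2]

/-- The angle along a radial motion with a given momentum. -/
theorem exists_angle {α ζ : ℝ} (hαζ : α ≤ ζ) (hI : Icc α ζ ⊆ S.I) (K : ℝ) {r : ℝ → ℝ}
    (hr : Continuous r) :
    ∃ φ : ℝ → ℝ, ∀ t, r t ∈ Icc α ζ → HasDerivAt φ (K / S.f (r t) ^ 2) t := by
  have hncont : Continuous (clampExtend α ζ fun y => K / S.f y ^ 2) := by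
    refine continuous_clampExtend hαζ (continuousOn_const.div
      ((contDiffOn_f.continuousOn.mono hI).pow 2) fun y hy => ?_)
    have := f_pos' (hI hy)
    positivity
  refine ⟨fun t => ∫ s in (0 : ℝ)..t, clampExtend α ζ (fun y => K / S.f y ^ 2) (r s),
    fun t ht => ?_⟩
  have h2 := ((hncont.comp hr).integral_hasStrictDerivAt 0 t).hasDerivAt
  simp only [Function.comp, clampExtend_of_mem ht] at h2
  exact h2

theorem exists_lipschitzOnWith_effDeriv (hV : S.SmoothPotential V) (K : ℝ) {α ζ : ℝ}
    (hI : Icc α ζ ⊆ S.I) : ∃ L, LipschitzOnWith L (fun r => -S.effDeriv V K r) (Icc α ζ) :=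
  (((contDiffOn_effDeriv hV K).neg.of_le (n := ∞) (m := 1) (by simp)).mono
    hI).exists_lipschitzOnWith (by simp) (convex_Icc _ _) isCompact_Icc

/-- A small radial kick at fixed momentum turns an orbitally stable circle into an oscillation.
Stability confines it for positive times and, after time reversal, for negative ones, to a ring in
which the local closing condition applies. -/
theorem IsWeaklyClosing.isSemilocallyClosing (hV : S.SmoothPotential V) (h : S.IsWeaklyClosing V) :
    S.IsSemilocallyClosing V := by
  refine ⟨?_, fun r₀ hr₀ K₀ hK₀ => h.2 r₀ hr₀ K₀ (hK₀.orbitallyStableAt hV hr₀)⟩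
  obtain ⟨r₀, hr₀⟩ := S.nonempty_I
  obtain ⟨K₀, hK₀⟩ := h.1 r₀ hr₀
  obtain ⟨ε, hε, hcl⟩ := h.2 r₀ hr₀ K₀ hK₀
  obtain ⟨rc, φc, hc, hst⟩ := hK₀
  obtain ⟨-, hK0, -⟩ := circularTrajectory_spec hc
  obtain ⟨ρ', hρ', hball⟩ := Metric.isOpen_iff.1 S.isOpen_I r₀ hr₀
  set ρ := min ε (ρ' / 2) with hρd
  have hρ : 0 < ρ := by positivity
  have hρε : ρ ≤ ε := min_le_left _ _
  have hI : Icc (r₀ - ρ) (r₀ + ρ) ⊆ S.I := fun y hy => hball (by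
    have : ρ ≤ ρ' / 2 := min_le_right _ _
    rw [Metric.mem_ball, Real.dist_eq, abs_lt]
    constructor <;> linarith [hy.1, hy.2])
  obtain ⟨δ, hδ, hst'⟩ := hst (ρ / 2) (by positivity)
  obtain ⟨L, hL⟩ := exists_lipschitzOnWith_effDeriv hV K₀ hI
  -- The initial radial velocity `δ / 2` is small enough for the stability estimate and nonzero, so
  -- the orbit is not circular.
  obtain ⟨-, r, v, h0, h1, hr, hv'⟩ := exists_newton_solution_continued (by linarith) hL r₀ (δ / 2)
  have hv : ∀ t, r t ∈ Icc (r₀ - ρ) (r₀ + ρ) → HasDerivAt v (-S.effDeriv V K₀ (r t)) t := by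
    intro t ht
    have := hv' t
    rwa [min_eq_left ht.2, max_eq_right ht.1] at this
  have hrc : Continuous r := continuous_iff_continuousAt.2 fun t => (hr t).continuousAt
  obtain ⟨φ, hφ⟩ := exists_angle (by linarith) hI K₀ hrc
  have hpos : ∀ t, 0 ≤ t → r t ∈ Ioo (r₀ - ρ) (r₀ + ρ) := fun t ht =>
    abs_sub_lt_of_stable hV hc hρ hI hδ hst' h0 (by rw [h1, abs_of_pos (by positivity)]; linarith)
      hr hv hφ ht
  -- Reversing both time and angle preserves the momentum, so the forward estimate applies to the
  -- reversed motion.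
  have hneg : ∀ t, 0 ≤ t → r (-t) ∈ Ioo (r₀ - ρ) (r₀ + ρ) := fun t ht =>
    abs_sub_lt_of_stable (r := fun t => r (-t)) (v := fun t => -v (-t)) (φ := fun t => -φ (-t))
      hV hc hρ hI hδ hst' (by simpa using h0)
      (by simp only [neg_zero, abs_neg]; rw [h1, abs_of_pos (by positivity)]; linarith)
      (fun t => by
        have := (hr (-t)).comp t (hasDerivAt_neg t)
        exact this.congr_deriv (by ring))
      (fun t ht => by
        have := ((hv (-t) ht).comp t (hasDerivAt_neg t)).neg
        exact this.congr_deriv (by ring))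
      (fun t ht => by
        have := ((hφ (-t) ht).comp t (hasDerivAt_neg t)).neg
        exact this.congr_deriv (by ring)) ht
  have hall : ∀ t, r t ∈ Icc (r₀ - ρ) (r₀ + ρ) := fun t => by
    rcases le_total 0 t with h | h
    · exact Ioo_subset_Icc_self (hpos t h)
    · have := hneg (-t) (by linarith)
      rw [neg_neg] at this
      exact Ioo_subset_Icc_self this
  obtain ⟨hm, hk⟩ := isMotion_of_hasDerivAt (φ := φ) (K := K₀) hV isOpen_univ
    (fun t _ => hI (hall t)) (fun t _ => hr t) (fun t _ => hv t (hall t)) fun t _ => hφ t (hall t)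
  have hnc : ¬ IsCircularOrbit r φ := by
    rintro ⟨s, hs⟩
    have hcst : ∀ t, r t = s := fun t => by
      have : (r t, (φ t : Real.Angle)) ∈ ({s} ×ˢ univ : Set (ℝ × Real.Angle)) := by
        rw [← hs]
        exact ⟨t, rfl⟩
      exact this.1
    have h2 := hr 0
    rw [show r = fun _ => s from funext hcst, h1] at h2
    have := h2.unique (hasDerivAt_const 0 s)
    linarith
  refine ⟨r, φ, K₀, ⟨⟨hm, r₀ - ρ, hI ⟨le_rfl, by linarith⟩, r₀ + ρ, hI ⟨by linarith, le_rfl⟩, hall⟩,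
    hk, hK0, hnc⟩, fun r' φ' hb' hk' hin => hcl r' φ' K₀ hb' hk' hK0 (fun t => ?_)
    ⟨by linarith, by linarith⟩⟩
  have e1 : r₀ - ρ ≤ sInf (range r) := le_csInf (range_nonempty r) (by
    rintro _ ⟨t, rfl⟩
    exact (hall t).1)
  have e2 : sSup (range r) ≤ r₀ + ρ := csSup_le (range_nonempty r) (by
    rintro _ ⟨t, rfl⟩
    exact (hall t).2)
  constructor <;> linarith [(hin t).1, (hin t).2]

end RevSurface

/-! ### Monotonicity from regularity of first hits -/

theorem exists_first {F : ℝ → ℝ} {a b E : ℝ} (hab : a ≤ b) (hF : ContinuousOn F (Icc a b))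
    (ha : F a < E) (hb : E ≤ F b) : ∃ c ∈ Ioc a b, F c = E ∧ ∀ s ∈ Ico a c, F s < E := by
  set B := Icc a b ∩ F ⁻¹' {E} with hB
  have hBc : IsCompact B :=
    isCompact_Icc.of_isClosed_subset (hF.preimage_isClosed_of_isClosed isClosed_Icc isClosed_singleton)
      inter_subset_left
  have hBn : B.Nonempty := by
    obtain ⟨c, hc, hcE⟩ := intermediate_value_Icc hab hF ⟨ha.le, hb⟩
    exact ⟨c, hc, hcE⟩
  have hcB := hBc.sInf_mem hBn
  have hcE : F (sInf B) = E := hcB.2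
  refine ⟨sInf B, ⟨lt_of_le_of_ne hcB.1.1 fun h => ?_, hcB.1.2⟩, hcE, fun s hs => ?_⟩
  · rw [← h] at hcE
    exact ha.ne hcE
  · by_contra hc
    have hsb : s ≤ b := hs.2.le.trans hcB.1.2
    obtain ⟨c, hc1, hc2⟩ := intermediate_value_Icc hs.1 (hF.mono (Icc_subset_Icc le_rfl hsb))
      ⟨ha.le, not_lt.1 hc⟩
    have : sInf B ≤ c := csInf_le hBc.bddBelow ⟨⟨hc1.1, hc1.2.trans hsb⟩, hc2⟩
    linarith [hc1.2, hs.2]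

theorem exists_last {F : ℝ → ℝ} {a b E : ℝ} (hab : a ≤ b) (hF : ContinuousOn F (Icc a b))
    (ha : E ≤ F a) (hb : F b < E) : ∃ c ∈ Ico a b, F c = E ∧ ∀ s ∈ Ioc c b, F s < E := by
  obtain ⟨c, hc, h1, h2⟩ := exists_first (F := fun x => F (-x)) (a := -b) (b := -a) (E := E)
    (by linarith) (hF.comp continuousOn_neg fun x hx => ⟨by linarith [hx.2], by linarith [hx.1]⟩)
    (by simpa) (by simpa)
  refine ⟨-c, ⟨by linarith [hc.2], by linarith [hc.1]⟩, h1, fun s hs => ?_⟩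
  have := h2 (-s) ⟨by linarith [hs.2], by linarith [hs.1]⟩
  simpa using this

theorem HasDerivAt.nonneg_of_le_left {F : ℝ → ℝ} {d a b : ℝ} (h : HasDerivAt F d b) (hab : a < b)
    (hF : ∀ y ∈ Ioo a b, F y ≤ F b) : 0 ≤ d := by
  have h1 := (hasDerivAt_iff_tendsto_slope.1 h).mono_left
    (nhdsWithin_mono (s := Iio b) b fun y hy => ne_of_lt hy)
  refine ge_of_tendsto h1 ?_
  filter_upwards [Ioo_mem_nhdsLT hab] with y hy
  rw [slope_def_field]
  exact div_nonneg_of_nonpos (by linarith [hF y hy]) (by linarith [hy.2])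

theorem HasDerivAt.nonpos_of_le_right {F : ℝ → ℝ} {d a b : ℝ} (h : HasDerivAt F d a) (hab : a < b)
    (hF : ∀ y ∈ Ioo a b, F y ≤ F a) : d ≤ 0 := by
  have h1 := (hasDerivAt_iff_tendsto_slope.1 h).mono_left
    (nhdsWithin_mono (s := Ioi a) a fun y hy => ne_of_gt hy)
  refine le_of_tendsto h1 ?_
  filter_upwards [Ioo_mem_nhdsGT hab] with y hy
  rw [slope_def_field]
  exact div_nonpos_of_nonpos_of_nonneg (by linarith [hF y hy]) (by linarith [hy.1])

/-- A function whose derivative does not vanish where it attains a value for the first time is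
constant and then has positive derivative. -/
theorem exists_plateau {W W' : ℝ → ℝ} {p ζ : ℝ} (hp : p < ζ)
    (hd : ∀ y ∈ Icc p ζ, HasDerivAt W (W' y) y) (hmin : ∀ y ∈ Icc p ζ, W p ≤ W y)
    (hlt : W p < W ζ)
    (hreg : ∀ y ∈ Ioc p ζ, W p < W y → (∀ s ∈ Ico p y, W s < W y) → W' y ≠ 0) :
    ∃ q ∈ Ico p ζ, (∀ y ∈ Icc p q, W y = W p) ∧ ∀ y ∈ Ioc q ζ, 0 < W' y := by
  have hc : ContinuousOn W (Icc p ζ) := HasDerivAt.continuousOn hd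
  -- If `W` decreased somewhere, the first point at which it attains its maximum up to `y'` would be
  -- an interior local maximum and a first hit of its level, against the regularity assumption.
  have hmono : ∀ y ∈ Icc p ζ, ∀ y' ∈ Icc p ζ, y ≤ y' → W y ≤ W y' := by
    intro y hy y' hy' hyy
    by_contra hcon
    rw [not_le] at hcon
    obtain ⟨m, hm, hmax⟩ := isCompact_Icc.exists_isMaxOn (nonempty_Icc.2 hy'.1)
      (hc.mono (Icc_subset_Icc le_rfl hy'.2))
    have hym : W y ≤ W m := hmax ⟨hy.1, hyy⟩
    have hpm : W p < W m := ((hmin y' hy').trans_lt hcon).trans_le hym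
    obtain ⟨c, hc1, hc2, hc3⟩ := exists_first hm.1 (hc.mono (Icc_subset_Icc le_rfl (hm.2.trans hy'.2)))
      hpm le_rfl
    have hcy : c < y' := lt_of_le_of_ne (hc1.2.trans hm.2) fun h => by
      rw [h] at hc2
      linarith
    refine hreg c ⟨hc1.1, hcy.le.trans hy'.2⟩ (by rwa [hc2]) (by rwa [hc2]) ?_
    have hloc : IsLocalMax W c := by
      filter_upwards [Icc_mem_nhds hc1.1 hcy] with s hs
      rw [hc2]
      exact hmax hs
    exact hloc.hasDerivAt_eq_zero (hd c ⟨hc1.1.le, hcy.le.trans hy'.2⟩)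
  set B := Icc p ζ ∩ W ⁻¹' {W p} with hB
  have hBc : IsCompact B :=
    isCompact_Icc.of_isClosed_subset (hc.preimage_isClosed_of_isClosed isClosed_Icc isClosed_singleton)
      inter_subset_left
  have hq := hBc.sSup_mem ⟨p, ⟨le_rfl, hp.le⟩, rfl⟩
  have hqW : W (sSup B) = W p := hq.2
  refine ⟨sSup B, ⟨hq.1.1, lt_of_le_of_ne hq.1.2 fun h => ?_⟩, fun y hy => ?_, fun y hy => ?_⟩
  · rw [h] at hqW
    exact hlt.ne' hqW
  · have hy' : y ∈ Icc p ζ := ⟨hy.1, hy.2.trans hq.1.2⟩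
    exact le_antisymm ((hmono y hy' _ hq.1 hy.2).trans hqW.le) (hmin y hy')
  · have hpy : p < y := hq.1.1.trans_lt hy.1
    have hy' : y ∈ Icc p ζ := ⟨hpy.le, hy.2⟩
    have hWy : W p < W y := lt_of_le_of_ne (hmin y hy') fun h =>
      hy.1.not_ge (le_csSup hBc.bddAbove ⟨hy', h.symm⟩)
    -- By monotonicity the first hit of the level `W y` can only be `y` itself: an earlier one would
    -- be a local maximum. Regularity then applies at `y`.
    obtain ⟨c, hc1, hc2, hc3⟩ := exists_first hpy.le (hc.mono (Icc_subset_Icc le_rfl hy.2)) hWy le_rfl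
    have hcy : c = y := by
      by_contra hne
      have hlt : c < y := lt_of_le_of_ne hc1.2 hne
      refine hreg c ⟨hc1.1, hc1.2.trans hy.2⟩ (by rwa [hc2]) (by rwa [hc2]) ?_
      have hloc : IsLocalMax W c := by
        filter_upwards [Icc_mem_nhds hc1.1 hlt] with s hs
        rw [hc2]
        exact hmono s ⟨hs.1, hs.2.trans hy.2⟩ y hy' hs.2
      exact hloc.hasDerivAt_eq_zero (hd c ⟨hc1.1.le, hc1.2.trans hy.2⟩)
    rw [hcy] at hc3
    exact lt_of_le_of_ne ((hd y hy').nonneg_of_le_left hpy fun s hs => (hc3 s ⟨hs.1.le, hs.2⟩).le)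
      (hreg y ⟨hpy, hy.2⟩ hWy hc3).symm

/-! ### Turning points of closed motions, and the existence of strongly stable circles. -/

namespace RevSurface

variable {S : RevSurface} {V : ℝ → ℝ}

/-- The turning points of a periodic motion are regular. -/
theorem exists_turning_points (hV : S.SmoothPotential V) {r φ : ℝ → ℝ} {K : ℝ}
    (hb : S.IsBoundedTrajectory V r φ) (hk : S.HasMomentum univ r φ K) (hc : IsClosedOrbit r φ)
    (hne : ∃ s t, r s ≠ r t) :
    ∃ s t, (∀ u, r u ∈ Icc (r s) (r t)) ∧ r s < r t ∧ deriv r s = 0 ∧ deriv r t = 0 ∧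
      S.effDeriv V K (r s) ≠ 0 ∧ S.effDeriv V K (r t) ≠ 0 := by
  have hrd : ∀ t, HasDerivAt r (deriv r t) t := fun t => hasDerivAt_radius isOpen_univ hb.1 (mem_univ t)
  have hrc : Continuous r := continuous_iff_continuousAt.2 fun t => (hrd t).continuousAt
  obtain ⟨T, hT, hper⟩ := hc
  have hP : Function.Periodic r T := fun t => (hper t).1
  -- Periodicity reduces the range of `r` to a compact time interval, so its extrema are attained.
  have hcov : ∀ u, ∃ w ∈ Icc (0 : ℝ) (0 + T), r w = r u := fun u => by
    have : r u ∈ r '' Icc 0 (0 + T) := by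
      rw [hP.image_Icc hT]
      exact mem_range_self u
    exact this
  obtain ⟨s, -, hs⟩ := isCompact_Icc.exists_isMinOn (nonempty_Icc.2 (by linarith : (0 : ℝ) ≤ 0 + T))
    hrc.continuousOn
  obtain ⟨t, -, ht⟩ := isCompact_Icc.exists_isMaxOn (nonempty_Icc.2 (by linarith : (0 : ℝ) ≤ 0 + T))
    hrc.continuousOn
  have hall : ∀ u, r u ∈ Icc (r s) (r t) := fun u => by
    obtain ⟨w, hw, hwu⟩ := hcov u
    rw [← hwu]
    exact ⟨hs hw, ht hw⟩
  have hds : deriv r s = 0 :=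
    IsLocalMin.deriv_eq_zero (Eventually.of_forall fun u => (hall u).1)
  have hdt : deriv r t = 0 :=
    IsLocalMax.deriv_eq_zero (Eventually.of_forall fun u => (hall u).2)
  have hI : Icc (r s) (r t) ⊆ S.I :=
    S.ordConnected_I.out (hb.1.mem s trivial) (hb.1.mem t trivial)
  obtain ⟨L, hL⟩ := exists_lipschitzOnWith_effDeriv hV K hI
  -- A turning point at a critical point of the effective potential is an equilibrium of the radial
  -- equation, and the radius would be constant.
  have hconst : ∀ u, deriv r u = 0 → S.effDeriv V K (r u) ≠ 0 := fun u h1 h2 => by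
    have := eq_of_equilibrium hL hall hrd
      (fun t => hasDerivAt_velocity isOpen_univ hb.1 hk (mem_univ t)) h1 (by rw [h2, neg_zero])
    obtain ⟨a, b, hab⟩ := hne
    exact hab ((this a).trans (this b).symm)
  refine ⟨s, t, hall, lt_of_le_of_ne ((hall s).2) fun h => ?_, hds, hdt, hconst s hds, hconst t hdt⟩
  obtain ⟨a, b, hab⟩ := hne
  apply hab
  have h1 := hall a
  have h2 := hall b
  rw [h] at h1 h2
  exact (le_antisymm h1.2 h1.1).trans (le_antisymm h2.2 h2.1).symm

/-- If all trajectories between two points of a level are closed, the level is regular. -/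
theorem effDeriv_ne_zero_of_level (hV : S.SmoothPotential V) {K α ζ : ℝ}
    (hαζ : α < ζ) (hI : Icc α ζ ⊆ S.I) (hE : S.effPotential V K α = S.effPotential V K ζ)
    (hlt : ∀ y ∈ Ioo α ζ, S.effPotential V K y < S.effPotential V K ζ)
    (hcl : ∀ r φ : ℝ → ℝ, S.IsBoundedTrajectory V r φ → S.HasMomentum univ r φ K →
      (∀ t, r t ∈ Icc α ζ) → IsClosedOrbit r φ) :
    S.effDeriv V K α ≠ 0 ∧ S.effDeriv V K ζ ≠ 0 := by
  set W := S.effPotential V K with hW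
  have hWd : ∀ y ∈ Icc α ζ, HasDerivAt W (S.effDeriv V K y) y := fun y hy =>
    hasDerivAt_effPotential hV K (hI hy)
  have hα : α ∈ Icc α ζ := ⟨le_rfl, hαζ.le⟩
  have hζ : ζ ∈ Icc α ζ := ⟨hαζ.le, le_rfl⟩
  have hsα : S.effDeriv V K α ≤ 0 := (hWd α hα).nonpos_of_le_right hαζ fun y hy => by
    rw [hE]; exact (hlt y hy).le
  have hsζ : 0 ≤ S.effDeriv V K ζ := (hWd ζ hζ).nonneg_of_le_left hαζ fun y hy => (hlt y hy).le
  obtain ⟨L, hL⟩ := exists_lipschitzOnWith_effDeriv hV K hI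
  -- A solution is started at the midpoint with the energy of the level at the ends, with the force
  -- continued by constants outside. If an end were critical, the solution would approach it without
  -- ever turning there, which closedness forbids.
  set p := (α + ζ) / 2 with hp
  have hpm : p ∈ Ioo α ζ := ⟨by linarith, by linarith⟩
  obtain ⟨hLip, r, v, h0, h1, hr, hv⟩ := exists_newton_solution_continued hαζ.le hL p
    √(2 * (W ζ - W p))
  have hv0 : 0 < v 0 := by
    rw [h1]
    exact Real.sqrt_pos.2 (by linarith [hlt p hpm])
  have hrc : Continuous r := continuous_iff_continuousAt.2 fun t => (hr t).continuousAt
  have hcc := continuous_clampExtend hαζ.le ((continuousOn_effDeriv hV K).mono hI)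
  set c := clampExtend α ζ (S.effDeriv V K) with hcd
  have hci : ∀ a b, IntervalIntegrable c MeasureTheory.volume a b := fun a b => hcc.intervalIntegrable a b
  -- The potential of the continued force: it agrees with `W` on the interval and is affine outside,
  -- not decreasing in the outward direction.
  set U : ℝ → ℝ := fun x => W ζ + ∫ s in ζ..x, c s with hU
  have hUd : ∀ x, HasDerivAt U (c x) x := fun x =>
    ((hcc.integral_hasStrictDerivAt ζ x).hasDerivAt).const_add _
  have hUin : ∀ x ∈ Icc α ζ, U x = W x := by
    intro x hx
    have := intervalIntegral.integral_eq_sub_of_hasDerivAt (f := W) (f' := c) (a := ζ) (b := x)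
      (fun y hy => by
        have hy' : y ∈ Icc α ζ := (ordConnected_Icc.uIcc_subset hζ hx) hy
        rw [hcd, clampExtend_of_mem hy']
        exact hWd y hy') (hci _ _)
    simp only [hU]
    linarith
  have hUr : ∀ x, ζ ≤ x → U x = W ζ + S.effDeriv V K ζ * (x - ζ) := by
    intro x hx
    have : ∫ s in ζ..x, c s = ∫ s in ζ..x, S.effDeriv V K ζ := by
      refine intervalIntegral.integral_congr fun s hs => ?_
      rw [uIcc_of_le hx] at hs
      simp only [hcd, clampExtend]
      rw [min_eq_right hs.1, max_eq_right hαζ.le]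
    simp only [hU, this, intervalIntegral.integral_const, smul_eq_mul]
    ring
  have hUl : ∀ x, x ≤ α → U x = W ζ + S.effDeriv V K α * (x - α) := by
    intro x hx
    have h2 : ∫ s in α..x, c s = ∫ s in α..x, S.effDeriv V K α := by
      refine intervalIntegral.integral_congr fun s hs => ?_
      rw [uIcc_of_ge hx] at hs
      simp only [hcd, clampExtend]
      rw [min_eq_left (hs.2.trans hαζ.le), max_eq_left hs.2]
    have h3 := hUin α hα
    simp only [hU] at h3 ⊢
    rw [← intervalIntegral.integral_add_adjacent_intervals (hci ζ α) (hci α x), h2,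
      intervalIntegral.integral_const, smul_eq_mul, ← add_assoc, h3, hE]
    ring
  have hen : ∀ t, v t ^ 2 / 2 + U (r t) = W ζ := by
    intro t
    have : ∀ s, HasDerivAt (fun s => v s ^ 2 / 2 + U (r s)) 0 s := fun s => by
      have e := (((hv s).pow 2).div_const 2).add ((hUd (r s)).comp s (hr s))
      refine e.congr_deriv ?_
      simp only [hcd, clampExtend]
      ring
    have e := eq_of_hasDerivAt_zero isOpen_univ isPreconnected_univ (fun s _ => this s)
      (mem_univ t) (mem_univ 0)
    rw [e, h0, h1, hUin p (Ioo_subset_Icc_self hpm), Real.sq_sqrt (by linarith [hlt p hpm])]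
    ring
  have heq : ∀ t, v t = 0 → S.effDeriv V K (max α (min (r t) ζ)) = 0 → r t = p := by
    intro t e1 e2
    have := eq_of_equilibrium (s := univ) (t₀ := t) (hLip.lipschitzOnWith) (fun _ => trivial) hr hv
      e1 (by simp [e2]) 0
    rw [← this, h0]
  -- Outside the interval `U` is at least the total energy, so both velocity and force vanish there.
  -- Such a point is an equilibrium, which a solution starting at `p` cannot reach.
  have hin : ∀ t, r t ∈ Icc α ζ := by
    intro t
    have he := hen t
    by_contra hcon
    have hp' : r t ≠ p := fun h => hcon (by rw [h]; exact Ioo_subset_Icc_self hpm)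
    rcases lt_or_ge (r t) α with h | h
    · rw [hUl _ h.le] at he
      have e1 : 0 ≤ S.effDeriv V K α * (r t - α) := mul_nonneg_of_nonpos_of_nonpos hsα (by linarith)
      have e2 : v t ^ 2 = 0 := by nlinarith [sq_nonneg (v t)]
      have e3 : S.effDeriv V K α * (r t - α) = 0 := by linarith
      refine hp' (heq t (by simpa using e2) ?_)
      rw [min_eq_left (h.le.trans hαζ.le), max_eq_left h.le]
      exact (mul_eq_zero.1 e3).resolve_right (by linarith)
    · have h : ζ < r t := by
        by_contra h2
        exact hcon ⟨h, not_lt.1 h2⟩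
      rw [hUr _ h.le] at he
      have e1 : 0 ≤ S.effDeriv V K ζ * (r t - ζ) := mul_nonneg hsζ (by linarith)
      have e2 : v t ^ 2 = 0 := by nlinarith [sq_nonneg (v t)]
      have e3 : S.effDeriv V K ζ * (r t - ζ) = 0 := by linarith
      refine hp' (heq t (by simpa using e2) ?_)
      rw [min_eq_right h.le, max_eq_right hαζ.le]
      exact (mul_eq_zero.1 e3).resolve_right (by linarith)
  obtain ⟨φ, hφ⟩ := exists_angle hαζ.le hI K hrc
  obtain ⟨hm, hk⟩ := isMotion_of_hasDerivAt (φ := φ) (K := K) hV isOpen_univ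
    (fun t _ => hI (hin t)) (fun t _ => hr t) (fun t _ => by
      have := hv t
      rwa [min_eq_left (hin t).2, max_eq_right (hin t).1] at this) fun t _ => hφ t (hin t)
  have hb : S.IsBoundedTrajectory V r φ := ⟨hm, α, hI hα, ζ, hI hζ, hin⟩
  have hne : ∃ s t, r s ≠ r t := by
    by_contra! hcon
    have := hr 0
    rw [show r = fun _ => r 0 from funext fun t => hcon t 0] at this
    exact hv0.ne' (this.unique (hasDerivAt_const 0 (r 0)))
  obtain ⟨s, t, -, hst, hs, ht, hs', ht'⟩ := exists_turning_points hV hb hk (hcl r φ hb hk hin) hne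
  -- By energy conservation the velocity vanishes only at the ends, so the regular turning points of
  -- the closed motion are exactly the two ends.
  have hend : ∀ u, deriv r u = 0 → r u = α ∨ r u = ζ := by
    intro u hu
    have he := hen u
    rw [← (hr u).deriv, hu, hUin _ (hin u)] at he
    by_contra hcon
    rw [not_or] at hcon
    have := hlt (r u) ⟨lt_of_le_of_ne (hin u).1 (Ne.symm hcon.1), lt_of_le_of_ne (hin u).2 hcon.2⟩
    linarith
  have h2 : r s = α := (hend s hs).resolve_right fun h => by linarith [(hin t).2]
  have h3 : r t = ζ := (hend t ht).resolve_left fun h => by linarith [(hin s).1]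
  rw [h2] at hs'
  rw [h3] at ht'
  exact ⟨hs', ht'⟩

/-- An interval between regular turning points in which all trajectories with a given momentum are
closed contains a strongly stable circle. -/
theorem exists_stronglyStableAt_of_closed (hV : S.SmoothPotential V) {K α ζ : ℝ} (hK : K ≠ 0)
    (hαζ : α < ζ) (hI : Icc α ζ ⊆ S.I) (hE : S.effPotential V K α = S.effPotential V K ζ)
    (hlt : ∀ y ∈ Ioo α ζ, S.effPotential V K y < S.effPotential V K ζ)
    (hcl : ∀ r φ : ℝ → ℝ, S.IsBoundedTrajectory V r φ → S.HasMomentum univ r φ K →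
      (∀ t, r t ∈ Icc α ζ) → IsClosedOrbit r φ) :
    ∃ r₀ ∈ S.I, S.StronglyStableAt V r₀ K := by
  have hends := effDeriv_ne_zero_of_level hV hαζ hI hE hlt hcl
  have hlev : ∀ α' ∈ Icc α ζ, ∀ ζ' ∈ Icc α ζ, α' < ζ' →
      S.effPotential V K α' = S.effPotential V K ζ' →
      (∀ y ∈ Ioo α' ζ', S.effPotential V K y < S.effPotential V K ζ') →
      S.effDeriv V K α' ≠ 0 ∧ S.effDeriv V K ζ' ≠ 0 := fun α' h1 ζ' h2 h3 h4 h5 => by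
    have hs : Icc α' ζ' ⊆ Icc α ζ := Icc_subset_Icc h1.1 h2.2
    exact effDeriv_ne_zero_of_level hV h3 (hs.trans hI) h4 h5
      fun r φ hb hk hin => hcl r φ hb hk fun t => hs (hin t)
  set W := S.effPotential V K with hW
  have hWd : ∀ y ∈ Icc α ζ, HasDerivAt W (S.effDeriv V K y) y := fun y hy =>
    hasDerivAt_effPotential hV K (hI hy)
  have hWc : ContinuousOn W (Icc α ζ) := HasDerivAt.continuousOn hWd
  obtain ⟨p, hp, hmin⟩ := isCompact_Icc.exists_isMinOn (nonempty_Icc.2 hαζ.le) hWc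
  have hmin' : ∀ y ∈ Icc α ζ, W p ≤ W y := fun y hy => hmin hy
  have hpE : W p < W ζ := (hmin' ((α + ζ) / 2) ⟨by linarith, by linarith⟩).trans_lt
    (hlt _ ⟨by linarith, by linarith⟩)
  have hpα : α < p := lt_of_le_of_ne hp.1 fun h => by rw [← h, hE] at hpE; exact hpE.false
  have hpζ : p < ζ := lt_of_le_of_ne hp.2 fun h => by rw [h] at hpE; exact hpE.false
  have hsR : Icc p ζ ⊆ Icc α ζ := Icc_subset_Icc hp.1 le_rfl
  have hsL : Icc α p ⊆ Icc α ζ := Icc_subset_Icc le_rfl hp.2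
  -- A point `y` right of the minimum where a level is hit for the first time is paired with the
  -- last point left of the minimum on the same level. Between them the potential is below the
  -- level, so closedness makes the level regular.
  have hregR : ∀ y ∈ Ioc p ζ, W p < W y → (∀ s ∈ Ico p y, W s < W y) → S.effDeriv V K y ≠ 0 := by
    intro y hy h1 h2
    rcases hy.2.eq_or_lt with rfl | hyζ
    · exact hends.2
    have hy' : y ∈ Icc α ζ := ⟨hpα.le.trans hy.1.le, hy.2⟩
    obtain ⟨c, hc1, hc2, hc3⟩ := exists_last hp.1 (hWc.mono hsL)
      (by rw [hE]; exact (hlt y ⟨hpα.trans hy.1, hyζ⟩).le) h1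
    refine (hlev c ⟨hc1.1, hc1.2.le.trans hp.2⟩ y hy' (hc1.2.trans hy.1) hc2 fun s hs => ?_).2
    rcases le_total s p with h | h
    · exact hc3 s ⟨hs.1, h⟩
    · exact h2 s ⟨h, hs.2⟩
  have hregL : ∀ y ∈ Ico α p, W p < W y → (∀ s ∈ Ioc y p, W s < W y) → S.effDeriv V K y ≠ 0 := by
    intro y hy h1 h2
    rcases hy.1.eq_or_lt with rfl | hyα
    · exact hends.1
    have hy' : y ∈ Icc α ζ := ⟨hy.1, hy.2.le.trans hp.2⟩
    obtain ⟨c, hc1, hc2, hc3⟩ := exists_first hp.2 (hWc.mono hsR) h1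
      (hlt y ⟨hyα, hy.2.trans hpζ⟩).le
    refine (hlev y hy' c ⟨hp.1.trans hc1.1.le, hc1.2⟩ (hy.2.trans hc1.1) hc2.symm fun s hs => ?_).1
    rw [hc2]
    rcases le_total s p with h | h
    · exact h2 s ⟨hs.1, h⟩
    · exact hc3 s ⟨h, hs.2⟩
  -- Regularity of all levels leaves on each side of `p` only a plateau followed by strict growth.
  -- The two sides form a well, possibly with a flat bottom.
  obtain ⟨p₂, hp₂, hpl₂, hpos₂⟩ := exists_plateau hpζ (fun y hy => hWd y (hsR hy))
    (fun y hy => hmin' y (hsR hy)) hpE hregR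
  obtain ⟨q, hq, hpl₁, hpos₁⟩ := exists_plateau (W := fun y => W (-y))
    (W' := fun y => -S.effDeriv V K (-y)) (p := -p) (ζ := -α) (by linarith)
    (fun y hy => by
      have := (hWd (-y) ⟨by linarith [hy.2], by linarith [hy.1]⟩).comp y (hasDerivAt_neg y)
      exact this.congr_deriv (by ring))
    (fun y hy => by
      simp only [neg_neg]
      exact hmin' (-y) ⟨by linarith [hy.2], by linarith [hy.1]⟩)
    (by simpa [hE] using hpE)
    (fun y hy h1 h2 => by
      rw [neg_ne_zero]
      refine hregL (-y) ⟨by linarith [hy.2], by linarith [hy.1]⟩ (by simpa using h1) fun s hs => ?_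
      have := h2 (-s) ⟨by linarith [hs.2], by linarith [hs.1]⟩
      simpa using this)
  set p₁ := -q with hp₁
  have hp₁α : α < p₁ := by linarith [hq.2]
  have hp₁p : p₁ ≤ p := by linarith [hq.1]
  have hmemR : ∀ y ∈ Icc α ζ, S.toX y ∈ S.X := fun y hy => toX_mem (hI hy)
  have hα : α ∈ Icc α ζ := ⟨le_rfl, hαζ.le⟩
  have hζ : ζ ∈ Icc α ζ := ⟨hαζ.le, le_rfl⟩
  have hm1 : p₁ ∈ Icc α ζ := ⟨hp₁α.le, hp₁p.trans hp.2⟩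
  have hm2 : p₂ ∈ Icc α ζ := ⟨hp.1.trans hp₂.1, hp₂.2.le⟩
  have hX : Icc (S.toX α) (S.toX ζ) ⊆ S.X := ordConnected_X.out (hmemR α hα) (hmemR ζ hζ)
  have hle : ∀ y ∈ S.X, ∀ z ∈ Icc α ζ, (y ≤ S.toX z → S.ofX y ≤ z) ∧ (S.toX z ≤ y → z ≤ S.ofX y) ∧
      (y < S.toX z → S.ofX y < z) ∧ (S.toX z < y → z < S.ofX y) := fun y hy z hz => by
    have e := ofX_toX (hI hz)
    refine ⟨fun h => ?_, fun h => ?_, fun h => ?_, fun h => ?_⟩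
    · have := strictMonoOn_ofX.monotoneOn hy (hmemR z hz) h
      rwa [e] at this
    · have := strictMonoOn_ofX.monotoneOn (hmemR z hz) hy h
      rwa [e] at this
    · have := strictMonoOn_ofX hy (hmemR z hz) h
      rwa [e] at this
    · have := strictMonoOn_ofX (hmemR z hz) hy h
      rwa [e] at this
  have hbox : ∀ y ∈ Icc (S.toX α) (S.toX ζ), S.ofX y ∈ Icc α ζ := fun y hy =>
    ⟨(hle y (hX hy) α hα).2.1 hy.1, (hle y (hX hy) ζ hζ).1 hy.2⟩
  have hmono := S.strictMonoOn_toX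
  have hsm := contDiffOn_orbitDeriv hV K
  set g := clampExtend (S.toX α) (S.toX ζ) (deriv (S.orbitDeriv V K)) with hg
  have h12X : S.toX α < S.toX ζ := hmono (hI hα) (hI hζ) hαζ
  have hw : IsWell (S.orbitPotential V K) (S.orbitDeriv V K) g (S.toX α) (S.toX p₁) (S.toX p₂)
      (S.toX ζ) := by
    refine ⟨hmono (hI hα) (hI hm1) hp₁α, hmono.monotoneOn (hI hm1) (hI hm2) (hp₁p.trans hp₂.1),
      hmono (hI hm2) (hI hζ) hp₂.2, ?_, fun y hy => hasDerivAt_orbitPotential hV K (hX hy),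
      fun y hy => ?_, fun y hy => ?_, fun y hy => ?_, fun y hy => ?_, ?_⟩
    · exact continuous_clampExtend h12X.le
        ((contDiffOn_deriv isOpen_X hsm).continuousOn.mono hX)
    · rw [hg, clampExtend_of_mem hy]
      exact hasDerivAt_of_smooth_X hsm (hX hy)
    · have hy' : y ∈ Icc (S.toX α) (S.toX ζ) :=
        ⟨hy.1, hy.2.le.trans (hmono.monotoneOn (hI hm1) (hI hζ) hm1.2)⟩
      have hb := hbox y hy'
      have hlt1 := (hle y (hX hy') p₁ hm1).2.2.1 hy.2
      have h1 := hpos₁ (-S.ofX y) ⟨by linarith, by linarith [hb.1]⟩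
      rw [neg_neg] at h1
      have hf := f_pos' (hI hb)
      exact div_neg_of_neg_of_pos (mul_neg_of_neg_of_pos (by linarith) (by positivity))
        (by positivity)
    · have hy' : y ∈ Icc (S.toX α) (S.toX ζ) :=
        ⟨(hmono.monotoneOn (hI hα) (hI hm2) hm2.1).trans hy.1.le, hy.2⟩
      have hb := hbox y hy'
      have hlt1 := (hle y (hX hy') p₂ hm2).2.2.2 hy.1
      have h1 := hpos₂ (S.ofX y) ⟨hlt1, hb.2⟩
      have hf := f_pos' (hI hb)
      exact div_pos (mul_pos h1 (by positivity)) (by positivity)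
    · have hy' : y ∈ Icc (S.toX α) (S.toX ζ) :=
        ⟨(hmono.monotoneOn (hI hα) (hI hm1) hm1.1).trans hy.1,
          hy.2.trans (hmono.monotoneOn (hI hm2) (hI hζ) hm2.2)⟩
      have e1 := (hle y (hX hy') p₁ hm1).2.1 hy.1
      have e2 := (hle y (hX hy') p₂ hm2).1 hy.2
      have hval : ∀ z ∈ Icc p₁ p₂, W z = W p := fun z hz => by
        rcases le_total z p with h | h
        · have := hpl₁ (-z) ⟨by linarith, by linarith [hz.1]⟩
          simpa using this
        · exact hpl₂ z ⟨h, hz.2⟩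
      simp only [orbitPotential]
      rw [ofX_toX (hI hm1), ← hW, hval _ ⟨e1, e2⟩, hval p₁ ⟨le_rfl, hp₁p.trans hp₂.1⟩]
    · simp only [orbitPotential]
      rw [ofX_toX (hI hα), ofX_toX (hI hζ), ← hW, hE]
  -- Closedness makes all periods of this well rational multiples of `2π`, which excludes a flat or
  -- degenerate bottom.
  obtain ⟨-, hnd⟩ := hw.nondegenerate fun x₁ h1 x₂ h2 hP => by
    obtain ⟨r, φ, ⟨hb, hm, _, _⟩, hr, hc⟩ := oscillation_of_well hV hK hw hX h1 h2 hP
    refine hc (hcl r φ hb hm fun t => ?_)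
    have e1 := hbox x₁ ⟨h1.1, h1.2.le.trans (hmono.monotoneOn (hI hm1) (hI hζ) hm1.2)⟩
    have e2 := hbox x₂ ⟨(hmono.monotoneOn (hI hα) (hI hm2) hm2.1).trans h2.1.le, h2.2⟩
    exact ⟨e1.1.trans (hr t).1, (hr t).2.trans e2.2⟩
  have hpX : S.toX p₁ ∈ Icc (S.toX α) (S.toX ζ) :=
    ⟨hmono.monotoneOn (hI hα) (hI hm1) hm1.1, hmono.monotoneOn (hI hm1) (hI hζ) hm1.2⟩
  rw [hg, clampExtend_of_mem hpX] at hnd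
  refine ⟨p₁, hI hm1, ?_⟩
  have h0 : S.orbitDeriv V K (S.toX p₁) = 0 := by
    rw [orbitDeriv_eq_zero_iff (hX hpX) hK, ofX_toX (hI hm1)]
    have hloc : IsLocalMin W p₁ := by
      filter_upwards [Icc_mem_nhds hp₁α (hp₁p.trans_lt hpζ)] with z hz
      have : W p₁ = W p := by
        have := hpl₁ q ⟨hq.1, le_rfl⟩
        simpa using this
      rw [this]
      exact hmin' z hz
    exact hloc.hasDerivAt_eq_zero (hWd p₁ hm1)
  have := (stronglyStableAt_ofX_iff hV (hX hpX) hK).2 ⟨h0, hnd⟩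
  rwa [ofX_toX (hI hm1)] at this

/-- The given orbit is itself closed and hence has two turning points. Strictly between them the
effective potential is below the energy, since equality would produce an equilibrium on the orbit.
All orbits of this momentum between the turning points close, so a strongly stable circle lies
there. -/
theorem IsSemilocallyClosing.isLocallyClosing (hV : S.SmoothPotential V)
    (h : S.IsSemilocallyClosing V) : S.IsLocallyClosing V := by
  obtain ⟨⟨r, φ, K, ⟨hb, hk, hK, hnc⟩, hcl⟩, hloc⟩ := h
  refine ⟨?_, hloc⟩
  have hbd : ∀ t, r t ∈ Icc (sInf (range r)) (sSup (range r)) := by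
    obtain ⟨-, r₁, -, r₂, -, hin⟩ := hb
    exact fun t => ⟨csInf_le ⟨r₁, by rintro _ ⟨u, rfl⟩; exact (hin u).1⟩ (mem_range_self t),
      le_csSup ⟨r₂, by rintro _ ⟨u, rfl⟩; exact (hin u).2⟩ (mem_range_self t)⟩
  have hne : ∃ s t, r s ≠ r t := by
    by_contra! hcon
    exact hnc (isCircularOrbit_of_const hb.1 hk hK (r₀ := r 0) fun t => hcon t 0)
  obtain ⟨s, t, hall, hst, hs, ht, hs', ht'⟩ :=
    exists_turning_points hV hb hk (hcl r φ hb hk hbd) hne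
  have hI : Icc (r s) (r t) ⊆ S.I :=
    S.ordConnected_I.out (hb.1.mem s trivial) (hb.1.mem t trivial)
  have hrd : ∀ t, HasDerivAt r (deriv r t) t := fun t => hasDerivAt_radius isOpen_univ hb.1 (mem_univ t)
  have hrc : Continuous r := continuous_iff_continuousAt.2 fun t => (hrd t).continuousAt
  have hen : ∀ u, deriv r u ^ 2 / 2 + S.effPotential V K (r u) = S.effPotential V K (r t) :=
    fun u => by
      rw [energy_eq hV isOpen_univ isPreconnected_univ hb.1 hk (mem_univ u) (mem_univ t), ht]
      ring
  have hsurj : ∀ y ∈ Icc (r s) (r t), ∃ u, r u = y := fun y hy =>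
    mem_range_of_exists_le_of_exists_ge hrc ⟨s, hy.1⟩ ⟨t, hy.2⟩
  have hle : ∀ y ∈ Icc (r s) (r t), S.effPotential V K y ≤ S.effPotential V K (r t) := by
    intro y hy
    obtain ⟨u, rfl⟩ := hsurj y hy
    nlinarith [hen u, sq_nonneg (deriv r u)]
  obtain ⟨L, hL⟩ := exists_lipschitzOnWith_effDeriv hV K hI
  obtain ⟨r₀, hr₀, hst'⟩ := exists_stronglyStableAt_of_closed hV hK hst hI
    (by have := hen s; rw [hs] at this; linarith) (fun y hy => by
      refine lt_of_le_of_ne (hle y (Ioo_subset_Icc_self hy)) fun he => ?_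
      obtain ⟨u, hu⟩ := hsurj y (Ioo_subset_Icc_self hy)
      have h1 := hen u
      rw [hu, he] at h1
      have h2 : deriv r u = 0 := by nlinarith
      have hloc : IsLocalMax (S.effPotential V K) y := by
        filter_upwards [Icc_mem_nhds hy.1 hy.2] with z hz
        rw [he]
        exact hle z hz
      have h3 := hloc.hasDerivAt_eq_zero (hasDerivAt_effPotential hV K (hI (Ioo_subset_Icc_self hy)))
      have := eq_of_equilibrium hL hall hrd
        (fun t => hasDerivAt_velocity isOpen_univ hb.1 hk (mem_univ t)) h2 (by rw [hu, h3, neg_zero])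
      obtain ⟨a, b, hab⟩ := hne
      exact hab ((this a).trans (this b).symm))
    fun r' φ' hb' hk' hin => hcl r' φ' hb' hk' fun u =>
      ⟨(hbd s).1.trans (hin u).1, (hin u).2.trans (hbd t).2⟩
  exact ⟨r₀, hr₀, K, hst'⟩

theorem IsClosing.isSemilocallyClosing (h : S.IsClosing V) : S.IsSemilocallyClosing V := by
  obtain ⟨⟨r, φ, K, ho⟩, hc⟩ := h
  refine ⟨⟨r, φ, K, ho, fun r' φ' hb hk _ => hc r' φ' K hb hk ho.2.2.1⟩, fun r₀ _ K₀ _ =>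
    ⟨1, one_pos, fun r' φ' K' hb hk hK _ _ => hc r' φ' K' hb hk hK⟩⟩

end RevSurface

/-! ### The differential equation of isochronous families -/

/-- The first relation holds on an open set, so it can be differentiated twice. The brackets
containing higher derivatives of `g` are thereby expressed through `w`, and the second relation
becomes an equation for `w` alone. -/
theorem four_mul_sq_eq_of_isochronous {w g : ℝ → ℝ} {s : Set ℝ} (hs : IsOpen s)
    (hw : ContDiffOn ℝ ∞ w s) (hg : ContDiffOn ℝ ∞ g s) {D : ℝ} (hD0 : D ≠ 0)
    (hD : ∀ x ∈ s, deriv g x * w x - g x * deriv w x = D * w x)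
    (h5 : ∀ x ∈ s, 5 * (deriv (deriv g) x * w x - g x * deriv (deriv w) x) ^ 2 =
      3 * D * w x * (deriv (deriv (deriv g)) x * w x - g x * deriv (deriv (deriv w)) x))
    {x : ℝ} (hx : x ∈ s) : 4 * deriv w x ^ 2 = 3 * w x * deriv (deriv w) x := by
  have hd : ∀ {F : ℝ → ℝ}, ContDiffOn ℝ ∞ F s → ∀ y ∈ s, HasDerivAt F (deriv F y) y :=
    fun hF y hy => ((hF.differentiableOn (by simp)).differentiableAt (hs.mem_nhds hy)).hasDerivAt
  have hsm : ∀ {F : ℝ → ℝ}, ContDiffOn ℝ ∞ F s → ContDiffOn ℝ ∞ (deriv F) s :=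
    fun hF => ((contDiffOn_infty_iff_deriv_of_isOpen hs).1 hF).2
  have huniq : ∀ {F H : ℝ → ℝ} {a b y : ℝ}, y ∈ s → (∀ z ∈ s, F z = H z) → HasDerivAt F a y →
      HasDerivAt H b y → a = b := fun hy he h1 h2 =>
    h1.unique (h2.congr_of_eventuallyEq (by filter_upwards [hs.mem_nhds hy] with z hz using he z hz))
  have e1 : ∀ y ∈ s, deriv (deriv g) y * w y - g y * deriv (deriv w) y = D * deriv w y := by
    intro y hy
    have := huniq hy hD (((hd (hsm hg) y hy).mul (hd hw y hy)).sub
      ((hd hg y hy).mul (hd (hsm hw) y hy))) ((hd hw y hy).const_mul D)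
    linarith
  have e2 := huniq hx e1 (((hd (hsm (hsm hg)) x hx).mul (hd hw x hx)).sub
      ((hd hg x hx).mul (hd (hsm (hsm hw)) x hx))) ((hd (hsm hw) x hx).const_mul D)
  have e3 := h5 x hx
  have e4 := hD x hx
  have e5 := e1 x hx
  have e6 : w x * (deriv (deriv (deriv g)) x * w x - g x * deriv (deriv (deriv w)) x) =
      D * (2 * w x * deriv (deriv w) x - deriv w x ^ 2) := by
    linear_combination w x * e2 + deriv (deriv w) x * e4 - deriv w x * e5
  rw [e5] at e3
  have e7 : D ^ 2 * (4 * deriv w x ^ 2) = D ^ 2 * (3 * w x * deriv (deriv w) x) := by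
    linear_combination e3 / 2 + 3 * D / 2 * e6
  exact mul_left_cancel₀ (pow_ne_zero 2 hD0) e7

/-- The equation says that `w ^ (-1/3)` has vanishing second derivative. -/
theorem exists_affine_of_pos {w : ℝ → ℝ} {s : Set ℝ} (hs : IsOpen s) (hs' : IsPreconnected s)
    (hw : ContDiffOn ℝ ∞ w s) (hpos : ∀ x ∈ s, 0 < w x)
    (h : ∀ x ∈ s, 4 * deriv w x ^ 2 = 3 * w x * deriv (deriv w) x) :
    ∃ m n : ℝ, ∀ x ∈ s, 0 < m * x + n ∧ (m * x + n) ^ 3 * w x = 1 := by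
  rcases s.eq_empty_or_nonempty with rfl | ⟨x₀, hx₀⟩
  · exact ⟨0, 0, by simp⟩
  have hd : ∀ {F : ℝ → ℝ}, ContDiffOn ℝ ∞ F s → ∀ y ∈ s, HasDerivAt F (deriv F y) y :=
    fun hF y hy => ((hF.differentiableOn (by simp)).differentiableAt (hs.mem_nhds hy)).hasDerivAt
  have hsm : ContDiffOn ℝ ∞ (deriv w) s := ((contDiffOn_infty_iff_deriv_of_isOpen hs).1 hw).2
  set y : ℝ → ℝ := fun x => w x ^ (-(1 / 3) : ℝ) with hy
  set y' : ℝ → ℝ := fun x => -(1 / 3) * (deriv w x * w x ^ (-(4 / 3) : ℝ)) with hy'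
  have h1 : ∀ x ∈ s, HasDerivAt y (y' x) x := fun x hx => by
    have := (hd hw x hx).rpow_const (p := -(1 / 3)) (Or.inl (hpos x hx).ne')
    refine this.congr_deriv ?_
    rw [show (-(1 / 3) - 1 : ℝ) = -(4 / 3) by norm_num]
    simp only [hy']
    ring
  have h2 : ∀ x ∈ s, HasDerivAt y' 0 x := fun x hx => by
    have e := (((hd hsm x hx).mul ((hd hw x hx).rpow_const (p := -(4 / 3))
      (Or.inl (hpos x hx).ne')))).const_mul (-(1 / 3))
    refine e.congr_deriv ?_
    rw [show (-(4 / 3) : ℝ) = -(7 / 3) + 1 by norm_num, Real.rpow_add (hpos x hx), Real.rpow_one]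
    rw [show (-(7 / 3) + 1 - 1 : ℝ) = -(7 / 3) by norm_num]
    linear_combination w x ^ (-(7 / 3) : ℝ) * (1 / 9) * h x hx
  set m := y' x₀ with hm
  have h3 : ∀ x ∈ s, HasDerivAt (fun x => y x - m * x) 0 x := fun x hx => by
    have e := (h1 x hx).sub ((hasDerivAt_id x).const_mul m)
    refine e.congr_deriv ?_
    rw [eq_of_hasDerivAt_zero hs hs' h2 hx hx₀]
    ring
  refine ⟨m, y x₀ - m * x₀, fun x hx => ?_⟩
  have h4 := eq_of_hasDerivAt_zero hs hs' h3 hx hx₀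
  have h5 : m * x + (y x₀ - m * x₀) = y x := by linarith
  rw [h5]
  refine ⟨Real.rpow_pos_of_pos (hpos x hx) _, ?_⟩
  simp only [hy]
  rw [← Real.rpow_natCast, ← Real.rpow_mul (hpos x hx).le]
  norm_num
  rw [Real.rpow_neg_one]
  exact inv_mul_cancel₀ (hpos x hx).ne'

theorem exists_affine_of_ne_zero {w : ℝ → ℝ} {s : Set ℝ} (hs : IsOpen s) (hs' : IsPreconnected s)
    (hw : ContDiffOn ℝ ∞ w s) (hne : ∀ x ∈ s, w x ≠ 0)
    (h : ∀ x ∈ s, 4 * deriv w x ^ 2 = 3 * w x * deriv (deriv w) x) :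
    ∃ σ m n : ℝ, (σ = 1 ∨ σ = -1) ∧ ∀ x ∈ s, 0 < m * x + n ∧ (m * x + n) ^ 3 * w x = σ := by
  by_cases hpos : ∀ x ∈ s, 0 < w x
  · obtain ⟨m, n, hmn⟩ := exists_affine_of_pos hs hs' hw hpos h
    exact ⟨1, m, n, Or.inl rfl, hmn⟩
  push Not at hpos
  obtain ⟨x₀, hx₀, hle⟩ := hpos
  have hneg : ∀ x ∈ s, 0 < -w x := by
    intro x hx
    by_contra hcon
    have : (0 : ℝ) ∈ w '' s := hs'.intermediate_value hx₀ hx hw.continuousOn ⟨hle, by linarith⟩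
    obtain ⟨z, hz, hz0⟩ := this
    exact hne z hz hz0
  have hd1 : deriv (fun x => -w x) = fun x => -deriv w x := by
    funext x
    exact deriv.fun_neg
  obtain ⟨m, n, hmn⟩ := exists_affine_of_pos hs hs' hw.neg hneg fun x hx => by
    have := h x hx
    have e : deriv (deriv fun x => -w x) x = -deriv (deriv w) x := by
      rw [hd1]
      exact deriv.fun_neg
    rw [e, hd1]
    linear_combination this
  refine ⟨-1, m, n, Or.inr rfl, fun x hx => ⟨(hmn x hx).1, ?_⟩⟩
  have := (hmn x hx).2
  linarith

/-! ### Locally closing potentials on surfaces without critical points of `f`. -/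

namespace RevSurface

variable {S : RevSurface} {V : ℝ → ℝ}

/-- The derivative of the potential in the coordinate `x`. -/
def potDeriv (S : RevSurface) (V : ℝ → ℝ) (x : ℝ) : ℝ := deriv V (S.ofX x) * S.f (S.ofX x) ^ 2

/-- The derivative of `1 / (2 f²)` in the coordinate `x`. -/
def centDeriv (S : RevSurface) (x : ℝ) : ℝ := -deriv S.f (S.ofX x) / S.f (S.ofX x)

theorem contDiffOn_potDeriv (hV : S.SmoothPotential V) : ContDiffOn ℝ ∞ (S.potDeriv V) S.X :=
  (contDiffOn_comp_ofX (contDiffOn_deriv S.isOpen_I hV)).mul ((contDiffOn_comp_ofX contDiffOn_f).pow 2)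

theorem contDiffOn_centDeriv : ContDiffOn ℝ ∞ S.centDeriv S.X :=
  (contDiffOn_comp_ofX (contDiffOn_deriv S.isOpen_I contDiffOn_f)).neg.div
    (contDiffOn_comp_ofX contDiffOn_f) fun _ hx => (f_pos' (ofX_mem hx)).ne'

theorem hasDerivAt_pot (hV : S.SmoothPotential V) {x : ℝ} (hx : x ∈ S.X) :
    HasDerivAt (fun x => V (S.ofX x)) (S.potDeriv V x) x :=
  (hasDerivAt_of_smooth hV (ofX_mem hx)).comp x (hasDerivAt_ofX hx)

theorem hasDerivAt_cent {x : ℝ} (hx : x ∈ S.X) :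
    HasDerivAt (fun x => 1 / (2 * S.f (S.ofX x) ^ 2)) (S.centDeriv x) x := by
  have hf := f_pos' (ofX_mem hx)
  have h1 := (hasDerivAt_f (ofX_mem hx)).comp x (hasDerivAt_ofX hx)
  have h2 := (hasDerivAt_const x (1 : ℝ)).div ((h1.pow 2).const_mul 2) (by simp; positivity)
  refine h2.congr_deriv ?_
  simp only [centDeriv, Function.comp, Pi.pow_apply]
  field_simp
  ring

theorem orbitDeriv_eq {K x : ℝ} (hK : K ≠ 0) (hx : x ∈ S.X) :
    S.orbitDeriv V K x = S.potDeriv V x / K ^ 2 + S.centDeriv x := by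
  have hf := f_pos' (ofX_mem hx)
  simp only [orbitDeriv, potDeriv, centDeriv, effDeriv]
  field_simp
  ring

theorem deriv_eq_of_eq_on_X {F w g : ℝ → ℝ} {a : ℝ} (hw : ContDiffOn ℝ ∞ w S.X)
    (hg : ContDiffOn ℝ ∞ g S.X) (h : ∀ x ∈ S.X, F x = w x / a + g x) :
    ∀ x ∈ S.X, deriv F x = deriv w x / a + deriv g x := by
  intro x hx
  have h1 : F =ᶠ[𝓝 x] fun x => w x / a + g x := by
    filter_upwards [isOpen_X.mem_nhds hx] with y hy using h y hy
  rw [h1.deriv_eq]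
  exact (((hasDerivAt_of_smooth_X hw hx).div_const a).add (hasDerivAt_of_smooth_X hg hx)).deriv

/-- The points `x` at which the circle is strongly stable for some momentum. -/
def stableSet (S : RevSurface) (V : ℝ → ℝ) : Set ℝ :=
  {x | x ∈ S.X ∧ S.potDeriv V x ≠ 0 ∧ 0 < -S.centDeriv x / S.potDeriv V x ∧
    0 < deriv S.centDeriv x - S.centDeriv x * deriv (S.potDeriv V) x / S.potDeriv V x}

theorem deriv_orbitDeriv_eq (hV : S.SmoothPotential V) {K x : ℝ} (hK : K ≠ 0) (hx : x ∈ S.X) :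
    deriv (S.orbitDeriv V K) x = deriv (S.potDeriv V) x / K ^ 2 + deriv S.centDeriv x :=
  deriv_eq_of_eq_on_X (contDiffOn_potDeriv hV) contDiffOn_centDeriv
    (fun _ hy => orbitDeriv_eq hK hy) x hx

/-- Since `f` has no critical points, `centDeriv` does not vanish. The circular orbit condition then
gives `potDeriv ≠ 0` and `1 / K² = -centDeriv / potDeriv`, which eliminates the momentum from the
stability conditions. -/
theorem mem_stableSet (hV : S.SmoothPotential V) (hf : ∀ r ∈ S.I, deriv S.f r ≠ 0) {K x : ℝ}
    (hx : x ∈ S.X) (h : S.StronglyStableAt V (S.ofX x) K) : x ∈ S.stableSet V := by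
  have hK := h.2.1
  obtain ⟨h1, h2⟩ := (stronglyStableAt_ofX_iff hV hx hK).1 h
  rw [orbitDeriv_eq hK hx] at h1
  rw [deriv_orbitDeriv_eq hV hK hx] at h2
  have hg : S.centDeriv x ≠ 0 :=
    div_ne_zero (neg_ne_zero.2 (hf _ (ofX_mem hx))) (f_pos' (ofX_mem hx)).ne'
  have hw : S.potDeriv V x ≠ 0 := fun hw => hg (by rw [hw] at h1; simpa using h1)
  have hz : -S.centDeriv x / S.potDeriv V x = 1 / K ^ 2 := by
    rw [div_eq_div_iff hw (by positivity)]
    field_simp at h1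
    linarith
  refine ⟨hx, hw, ?_, ?_⟩
  · rw [hz]
    positivity
  · have : deriv S.centDeriv x - S.centDeriv x * deriv (S.potDeriv V) x / S.potDeriv V x =
      deriv S.centDeriv x + (-S.centDeriv x / S.potDeriv V x) * deriv (S.potDeriv V) x := by ring
    rw [this, hz]
    linarith [h2, show deriv (S.potDeriv V) x / K ^ 2 = 1 / K ^ 2 * deriv (S.potDeriv V) x by ring]

theorem exists_momentum_of_mem_stableSet (hV : S.SmoothPotential V) {x : ℝ}
    (h : x ∈ S.stableSet V) :
    ∃ K, K ≠ 0 ∧ 1 / K ^ 2 = -S.centDeriv x / S.potDeriv V x ∧ S.StronglyStableAt V (S.ofX x) K := by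
  obtain ⟨hx, hw, hz, hD⟩ := h
  set z := -S.centDeriv x / S.potDeriv V x with hzd
  have hK : 1 / √z ≠ 0 := by positivity
  have hK2 : 1 / (1 / √z) ^ 2 = z := by
    rw [div_pow, Real.sq_sqrt hz.le]
    simp
  refine ⟨1 / √z, hK, hK2, (stronglyStableAt_ofX_iff hV hx hK).2 ⟨?_, ?_⟩⟩
  · rw [orbitDeriv_eq hK hx, div_eq_mul_one_div, hK2, hzd]
    field_simp
    ring
  · rw [deriv_orbitDeriv_eq hV hK hx, div_eq_mul_one_div, hK2, hzd]
    have : deriv (S.potDeriv V) x * (-S.centDeriv x / S.potDeriv V x) + deriv S.centDeriv x =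
      deriv S.centDeriv x - S.centDeriv x * deriv (S.potDeriv V) x / S.potDeriv V x := by ring
    rw [this]
    exact hD

theorem isOpen_stableSet (hV : S.SmoothPotential V) : IsOpen (S.stableSet V) := by
  rw [isOpen_iff_mem_nhds]
  rintro x ⟨hx, hw, hz, hD⟩
  have hX := isOpen_X.mem_nhds hx
  have c1 := (contDiffOn_potDeriv hV).continuousOn.continuousAt hX
  have c2 := (contDiffOn_centDeriv (S := S)).continuousOn.continuousAt hX
  have c3 := (contDiffOn_deriv isOpen_X (contDiffOn_potDeriv hV)).continuousOn.continuousAt hX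
  have c4 := (contDiffOn_deriv isOpen_X (contDiffOn_centDeriv (S := S))).continuousOn.continuousAt hX
  filter_upwards [hX, c1.eventually_ne hw, (c2.neg.div c1 hw).eventually_const_lt hz,
    (c4.sub ((c2.mul c3).div c1 hw)).eventually_const_lt hD] with y h1 h2 h3 h4
  exact ⟨h1, h2, h3, h4⟩

/-- The relations satisfied at the points of the stable set by a locally closing potential. -/
theorem closing_relations_stableSet (hV : S.SmoothPotential V)
    (hcl : S.LocallyClosesAt V (S.StronglyStableAt V)) {x : ℝ} (h : x ∈ S.stableSet V) :
    (∃ β : ℚ, √(deriv S.centDeriv x -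
      S.centDeriv x * deriv (S.potDeriv V) x / S.potDeriv V x) = β) ∧
    5 * (deriv (deriv S.centDeriv) x * S.potDeriv V x -
        S.centDeriv x * deriv (deriv (S.potDeriv V)) x) ^ 2 =
      3 * (deriv S.centDeriv x - S.centDeriv x * deriv (S.potDeriv V) x / S.potDeriv V x) *
        S.potDeriv V x * (deriv (deriv (deriv S.centDeriv)) x * S.potDeriv V x -
          S.centDeriv x * deriv (deriv (deriv (S.potDeriv V))) x) := by
  obtain ⟨K, hK, hz, hst⟩ := exists_momentum_of_mem_stableSet hV h
  obtain ⟨hx, hw, -, -⟩ := h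
  obtain ⟨ε, hε, hc⟩ := hcl _ (ofX_mem hx) K hst
  obtain ⟨h1, h2⟩ := (stronglyStableAt_ofX_iff hV hx hK).1 hst
  obtain ⟨r1, r2⟩ := closing_relations hV hK hx h1 h2 hε fun r φ hb hm hin =>
    hc r φ K hb hm hK hin ⟨by linarith, by linarith⟩
  have w0 := contDiffOn_potDeriv hV
  have g0 := contDiffOn_centDeriv (S := S)
  have w1 := contDiffOn_deriv isOpen_X w0
  have g1 := contDiffOn_deriv isOpen_X g0
  have w2 := contDiffOn_deriv isOpen_X w1
  have g2 := contDiffOn_deriv isOpen_X g1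
  have d1 := deriv_eq_of_eq_on_X w0 g0 (fun _ hy => orbitDeriv_eq (V := V) hK hy)
  have d2 := deriv_eq_of_eq_on_X w1 g1 d1
  have d3 := deriv_eq_of_eq_on_X w2 g2 d2
  rw [d1 x hx] at r1
  rw [d1 x hx, d2 x hx, d3 x hx] at r2
  have e : ∀ a b : ℝ, a / K ^ 2 + b = (b * S.potDeriv V x - S.centDeriv x * a) / S.potDeriv V x := by
    intro a b
    rw [div_eq_mul_one_div, hz]
    field_simp
    ring
  have e' : ∀ a b : ℝ, a / K ^ 2 + b = b - S.centDeriv x * a / S.potDeriv V x := by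
    intro a b
    rw [div_eq_mul_one_div, hz]
    ring
  refine ⟨by rwa [e'] at r1, ?_⟩
  rw [← e']
  rw [e (deriv (deriv (S.potDeriv V)) x), e (deriv (deriv (deriv (S.potDeriv V))) x)] at r2
  field_simp at r2
  have hK2 : K ^ 2 ≠ 0 := by positivity
  have e3 : deriv (S.potDeriv V) x / K ^ 2 + deriv S.centDeriv x =
    (deriv (S.potDeriv V) x + K ^ 2 * deriv S.centDeriv x) / K ^ 2 := by field_simp
  rw [e3]
  field_simp
  linear_combination r2

/-- The structure of locally closing potentials. -/
theorem exists_affine_of_locallyClosing (hV : S.SmoothPotential V)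
    (hf : ∀ r ∈ S.I, deriv S.f r ≠ 0) (hl : S.IsLocallyClosing V) :
    ∃ (β : ℚ) (σ m n : ℝ), 0 < β ∧ (σ = 1 ∨ σ = -1) ∧ ∀ x ∈ S.X, 0 < m * x + n ∧
      (m * x + n) ^ 3 * S.potDeriv V x = σ ∧ σ * S.centDeriv x < 0 ∧
      deriv S.centDeriv x + 3 * m * S.centDeriv x / (m * x + n) = (β : ℝ) ^ 2 := by
  obtain ⟨⟨r₀, hr₀, K₀, hK₀⟩, hcl⟩ := hl
  set N := S.stableSet V with hN
  set D : ℝ → ℝ := fun x => deriv S.centDeriv x -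
    S.centDeriv x * deriv (S.potDeriv V) x / S.potDeriv V x with hD
  have hx₀ : S.toX r₀ ∈ N := by
    refine mem_stableSet hV hf (toX_mem hr₀) (K := K₀) ?_
    rwa [ofX_toX hr₀]
  -- The relations are integrated first on one component of the stable set, which is then shown to
  -- be all of `X`.
  set C := connectedComponentIn N (S.toX r₀) with hC
  have hCN : C ⊆ N := connectedComponentIn_subset _ _
  have hCo : IsOpen C := (isOpen_stableSet hV).connectedComponentIn
  have hCp : IsPreconnected C := isPreconnected_connectedComponentIn
  have hxC : S.toX r₀ ∈ C := mem_connectedComponentIn hx₀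
  have hCX : C ⊆ S.X := fun x hx => (hCN hx).1
  have w0 := contDiffOn_potDeriv hV
  have g0 := contDiffOn_centDeriv (S := S)
  have w1 := contDiffOn_deriv isOpen_X w0
  have g1 := contDiffOn_deriv isOpen_X g0
  have hDc : ∀ x ∈ S.X, S.potDeriv V x ≠ 0 → ContinuousAt D x := fun x hx hw => by
    have hX := isOpen_X.mem_nhds hx
    exact (g1.continuousOn.continuousAt hX).sub (((g0.continuousOn.continuousAt hX).mul
      (w1.continuousOn.continuousAt hX)).div (w0.continuousOn.continuousAt hX) hw)
  obtain ⟨⟨β, hβ⟩, -⟩ := closing_relations_stableSet hV hcl hx₀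
  have hsq : ∀ x ∈ C, √(D x) = β := fun x hx => by
    rw [← hβ]
    exact eqOn_of_continuousOn_rat hCp (g := fun x => √(D x))
      (fun y hy => ((hDc y (hCX hy) (hCN hy).2.1).sqrt).continuousWithinAt)
      (fun y hy => (closing_relations_stableSet hV hcl (hCN hy)).1) hx hxC
  have hβ0 : (0 : ℝ) < β := by
    rw [← hβ]
    exact Real.sqrt_pos.2 hx₀.2.2.2
  have hDC : ∀ x ∈ C, D x = (β : ℝ) ^ 2 := fun x hx => by
    rw [← hsq x hx, Real.sq_sqrt (hCN hx).2.2.2.le]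
  have hode : ∀ x ∈ C, 4 * deriv (S.potDeriv V) x ^ 2 =
      3 * S.potDeriv V x * deriv (deriv (S.potDeriv V)) x := fun x hx =>
    four_mul_sq_eq_of_isochronous (D := (β : ℝ) ^ 2) hCo (w0.mono hCX) (g0.mono hCX) (by positivity)
      (fun y hy => by
        have h1 := hDC y hy
        have h2 := (hCN hy).2.1
        simp only [hD] at h1
        rw [← h1]
        field_simp)
      (fun y hy => by
        have h1 := hDC y hy
        simp only [hD] at h1
        rw [← h1]
        exact (closing_relations_stableSet hV hcl (hCN hy)).2) hx
  obtain ⟨σ, m, n, hσ, hmn⟩ := exists_affine_of_ne_zero hCo hCp (w0.mono hCX)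
    (fun x hx => (hCN hx).2.1) hode
  have hσ0 : σ ≠ 0 := by rcases hσ with rfl | rfl <;> norm_num
  -- `C` is relatively closed: at a limit point the formula for `potDeriv` prevents it from
  -- vanishing, `D` keeps the positive value `β²`, and the squared inverse momentum is nonnegative
  -- and nonzero because `centDeriv` does not vanish. The limit point is therefore again stable.
  have hcl' : closure C ∩ S.X ⊆ C := by
    rintro x ⟨hxc, hxX⟩
    have hX := isOpen_X.mem_nhds hxX
    have hmem : x ∈ closure C := hxc
    have : (𝓝[C] x).NeBot := mem_closure_iff_nhdsWithin_neBot.1 hmem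
    have hwc := w0.continuousOn.continuousAt hX
    have hgc := g0.continuousOn.continuousAt hX
    have hself : ∀ᶠ y in 𝓝[C] x, y ∈ C := self_mem_nhdsWithin
    have e1 : (m * x + n) ^ 3 * S.potDeriv V x = σ := by
      have hc : ContinuousAt (fun y => (m * y + n) ^ 3 * S.potDeriv V y) x :=
        ContinuousAt.mul (by fun_prop) hwc
      refine tendsto_nhds_unique (l := 𝓝[C] x) (hc.tendsto.mono_left nhdsWithin_le_nhds)
        (tendsto_const_nhds.congr' ?_)
      filter_upwards [hself] with y hy using (hmn y hy).2.symm
    have hw : S.potDeriv V x ≠ 0 := fun h => hσ0 (by rw [← e1, h, mul_zero])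
    have hg : S.centDeriv x ≠ 0 :=
      div_ne_zero (neg_ne_zero.2 (hf _ (ofX_mem hxX))) (f_pos' (ofX_mem hxX)).ne'
    have e2 : D x = (β : ℝ) ^ 2 := by
      refine tendsto_nhds_unique (l := 𝓝[C] x) ((hDc x hxX hw).tendsto.mono_left nhdsWithin_le_nhds)
        (tendsto_const_nhds.congr' ?_)
      filter_upwards [hself] with y hy using (hDC y hy).symm
    have e3 : 0 ≤ -S.centDeriv x / S.potDeriv V x := by
      have hc : Tendsto (fun y => -S.centDeriv y / S.potDeriv V y) (𝓝[C] x)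
          (𝓝 (-S.centDeriv x / S.potDeriv V x)) :=
        (hgc.neg.div hwc hw).tendsto.mono_left nhdsWithin_le_nhds
      refine ge_of_tendsto hc ?_
      filter_upwards [hself] with y hy using (hCN hy).2.2.1.le
    have hxN : x ∈ N := by
      refine ⟨hxX, hw, lt_of_le_of_ne e3 (div_ne_zero (neg_ne_zero.2 hg) hw).symm, ?_⟩
      change 0 < D x
      rw [e2]
      positivity
    have hpre : IsPreconnected (insert x C) :=
      hCp.subset_closure (subset_insert _ _) (insert_subset hmem subset_closure)
    exact hpre.subset_connectedComponentIn (mem_insert_of_mem _ hxC) (insert_subset hxN hCN)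
      (mem_insert _ _)
  have hXC : S.X ⊆ C := ordConnected_X.isPreconnected.subset_of_closure_inter_subset hCo
    ⟨_, hCX hxC, hxC⟩ hcl'
  refine ⟨β, σ, m, n, by exact_mod_cast hβ0, hσ, fun x hx => ?_⟩
  have hxC' := hXC hx
  obtain ⟨h1, h2⟩ := hmn x hxC'
  obtain ⟨-, hw, hz, -⟩ := hCN hxC'
  refine ⟨h1, h2, ?_, ?_⟩
  · have h3 : 0 < (-S.centDeriv x / S.potDeriv V x) * (S.potDeriv V x ^ 2 * (m * x + n) ^ 3) := by
      positivity
    have h4 : (-S.centDeriv x / S.potDeriv V x) * (S.potDeriv V x ^ 2 * (m * x + n) ^ 3) =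
        -S.centDeriv x * ((m * x + n) ^ 3 * S.potDeriv V x) := by
      field_simp
    rw [h4, h2] at h3
    linarith
  · have h3 := hDC x hxC'
    simp only [hD] at h3
    rw [← h3]
    -- Differentiating `(m x + n)³ w = σ` gives the logarithmic derivative of `w`, which turns the
    -- constancy of `D` into a linear equation for `centDeriv`.
    have h5 : deriv (S.potDeriv V) x * (m * x + n) + 3 * m * S.potDeriv V x = 0 := by
      have e1 := ((((hasDerivAt_id x).const_mul m).add_const n).pow 3).mul
        (hasDerivAt_of_smooth_X w0 hx)
      have e2 : HasDerivAt (fun y => (m * id y + n) ^ 3 * S.potDeriv V y) 0 x := by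
        refine (hasDerivAt_const x σ).congr_of_eventuallyEq ?_
        filter_upwards [hCo.mem_nhds hxC'] with y hy using (hmn y hy).2
      have e3 := e1.unique e2
      simp at e3
      have e4 : (m * x + n) ^ 2 * (deriv (S.potDeriv V) x * (m * x + n) + 3 * m * S.potDeriv V x) = 0 := by
        linear_combination e3
      exact (mul_eq_zero.1 e4).resolve_left (by positivity)
    field_simp
    linear_combination S.centDeriv x * h5

/-- With positive `θ'` the metric form amounts to `θ' = Q(θ) = 1 / (μ² f²)`. In particular `θ`
differs from `x / μ²` by a constant. -/
theorem hasMetricForm_of_hasDerivAt {μ c d : ℝ} (hμ : 0 < μ) {θ : ℝ → ℝ}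
    (h0 : ∀ r ∈ S.I, θ r ≠ 0) (hd : ∀ r ∈ S.I, HasDerivAt θ (1 / (μ ^ 2 * S.f r ^ 2)) r)
    (hQ : ∀ r ∈ S.I, bertrandQ c d (θ r) = 1 / (μ ^ 2 * S.f r ^ 2)) : S.HasMetricForm μ c d θ := by
  refine ⟨?_, fun r hr => ?_⟩
  · rw [contDiffOn_infty_iff_deriv_of_isOpen S.isOpen_I]
    refine ⟨fun r hr => (hd r hr).differentiableAt.differentiableWithinAt, ?_⟩
    have : ContDiffOn ℝ ∞ (fun r => 1 / (μ ^ 2 * S.f r ^ 2)) S.I :=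
      contDiffOn_const.div (contDiffOn_const.mul (contDiffOn_f.pow 2)) fun r hr => by
        have := f_pos' hr
        positivity
    exact this.congr fun r hr => (hd r hr).deriv
  · have hf := f_pos' hr
    rw [(hd r hr).deriv, hQ r hr]
    refine ⟨h0 r hr, by positivity, by field_simp, ?_⟩
    field_simp

/-- A surface without critical points of `f` that has a locally closing potential is a Bertrand
surface, and the potential is a Bertrand potential. -/
theorem exists_bertrandPotential_of_locallyClosing (hV : S.SmoothPotential V)
    (hf : ∀ r ∈ S.I, deriv S.f r ≠ 0) (hl : S.IsLocallyClosing V) :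
    ∃ (μ : ℚ) (c d : ℝ) (θ : ℝ → ℝ) (i : ℕ) (A B : ℝ), 0 < μ ∧ S.HasMetricForm (μ : ℝ) c d θ ∧
      S.IsBertrandPotential d θ i A B V := by
  obtain ⟨β, σ, m, n, hβ, hσ, h⟩ := exists_affine_of_locallyClosing hV hf hl
  have hβ' : (0 : ℝ) < β := by exact_mod_cast hβ
  have hσ2 : σ ^ 2 = 1 := by rcases hσ with rfl | rfl <;> norm_num
  have hXp : IsPreconnected S.X := ordConnected_X.isPreconnected
  have g0 := contDiffOn_centDeriv (S := S)
  obtain ⟨rb, hrb⟩ := S.nonempty_I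
  have hxb : S.toX rb ∈ S.X := toX_mem hrb
  -- For `m = 0` the derivative of `V` in `x` is constant and that of `centDeriv` is `β²`. So
  -- `centDeriv` itself serves as `θ`, with `μ = 1 / β` and `d = 0`, and `V` is linear in it: the
  -- case `i = 1`.
  by_cases hm : m = 0
  · subst hm
    have hn : 0 < n := by simpa using (h _ hxb).1
    have hg1 : ∀ x ∈ S.X, HasDerivAt S.centDeriv ((β : ℝ) ^ 2) x := fun x hx => by
      have := (h x hx).2.2.2
      simp only [mul_zero, zero_mul, zero_div, add_zero] at this
      rw [← this]
      exact hasDerivAt_of_smooth_X g0 hx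
    have hG : ∀ x ∈ S.X, HasDerivAt (fun x => 2 * (β : ℝ) ^ 2 * (1 / (2 * S.f (S.ofX x) ^ 2)) -
        S.centDeriv x ^ 2) 0 x := fun x hx => by
      refine (((hasDerivAt_cent hx).const_mul _).sub ((hg1 x hx).pow 2)).congr_deriv ?_
      simp
      ring
    set c := 2 * (β : ℝ) ^ 2 * (1 / (2 * S.f (S.ofX (S.toX rb)) ^ 2)) - S.centDeriv (S.toX rb) ^ 2
      with hc
    set A := 1 / (n ^ 3 * (β : ℝ) ^ 2) with hA
    have hAp : 0 < A := by positivity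
    have hU : ∀ x ∈ S.X, HasDerivAt (fun x => V (S.ofX x) - A * σ * S.centDeriv x) 0 x :=
      fun x hx => by
        refine ((hasDerivAt_pot hV hx).sub ((hg1 x hx).const_mul (A * σ))).congr_deriv ?_
        have h1 := (h x hx).2.1
        simp only [zero_mul, zero_add] at h1
        rw [hA]
        field_simp
        linarith
    refine ⟨1 / β, c, 0, fun r => S.centDeriv (S.toX r), 1, A,
      V (S.ofX (S.toX rb)) - A * σ * S.centDeriv (S.toX rb), by positivity,
      hasMetricForm_of_hasDerivAt (by push_cast; positivity) (fun r hr h0 => ?_) (fun r hr => ?_)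
        fun r hr => ?_, Or.inl rfl, by simp, fun _ => hAp, by simp, fun r hr => ?_⟩
    · have := (h _ (toX_mem hr)).2.2.1
      rw [h0, mul_zero] at this
      exact this.false
    · have := (hg1 _ (toX_mem hr)).comp r (hasDerivAt_toX hr)
      refine this.congr_deriv ?_
      have := f_pos' hr
      push_cast
      field_simp
    · have := eq_of_hasDerivAt_zero isOpen_X hXp hG (toX_mem hr) hxb
      rw [← hc, ofX_toX hr] at this
      have hfp := f_pos' hr
      simp only [bertrandQ, zero_div, sub_zero]
      rw [← this]
      push_cast
      field_simp
      ring
    · have := eq_of_hasDerivAt_zero isOpen_X hXp hU (toX_mem hr) hxb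
      rw [← this, ofX_toX hr]
      have habs : |S.centDeriv (S.toX r)| = -σ * S.centDeriv (S.toX r) := by
        have h3 := (h _ (toX_mem hr)).2.2.1
        rcases hσ with rfl | rfl
        · rw [abs_of_neg (by linarith)]; ring
        · rw [abs_of_pos (by linarith)]; ring
      norm_num [habs]
      ring
  -- For `m ≠ 0` the factor `y³` integrates the linear equation for `centDeriv`, with constant `e`.
  -- The coordinate is `q y` with `q = β² / (4m)`, and `μ = 2 / β`, because `q m / f²` must be `1 /
  -- (μ² f²)`; then `d = e q³`. The potential is proportional to `y⁻²`: the case `i = 2`.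
  · set y : ℝ → ℝ := fun x => m * x + n with hy
    have hyd : ∀ x, HasDerivAt y m x := fun x => by
      exact (((hasDerivAt_id x).const_mul m).add_const n).congr_deriv (mul_one m)
    have hyp : ∀ x ∈ S.X, 0 < y x := fun x hx => (h x hx).1
    have hE : ∀ x ∈ S.X, HasDerivAt (fun x => y x ^ 3 * S.centDeriv x -
        (β : ℝ) ^ 2 * y x ^ 4 / (4 * m)) 0 x := fun x hx => by
      have e := (((hyd x).pow 3).mul (hasDerivAt_of_smooth_X g0 hx)).sub
        ((((hyd x).pow 4).const_mul ((β : ℝ) ^ 2)).div_const (4 * m))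
      refine e.congr_deriv ?_
      have h4 := (h x hx).2.2.2
      have h1 := hyp x hx
      change _ + 3 * m * S.centDeriv x / y x = _ at h4
      rw [← h4]
      simp
      field_simp
      ring
    set e := y (S.toX rb) ^ 3 * S.centDeriv (S.toX rb) -
      (β : ℝ) ^ 2 * y (S.toX rb) ^ 4 / (4 * m) with he
    have hge : ∀ x ∈ S.X, y x ^ 3 * S.centDeriv x = (β : ℝ) ^ 2 * y x ^ 4 / (4 * m) + e :=
      fun x hx => by
        have := eq_of_hasDerivAt_zero isOpen_X hXp hE hx hxb
        rw [← he] at this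
        linarith
    set q := (β : ℝ) ^ 2 / (4 * m) with hq
    have hq0 : q ≠ 0 := by positivity
    set d := e * q ^ 3 with hd
    have hG : ∀ x ∈ S.X, HasDerivAt (fun x => (β : ℝ) ^ 2 / 2 * (1 / (2 * S.f (S.ofX x) ^ 2)) -
        (q * y x) ^ 2 + d / (q * y x) ^ 2) 0 x := fun x hx => by
      have h1 := hyp x hx
      have e1 := (((hasDerivAt_cent hx).const_mul ((β : ℝ) ^ 2 / 2)).sub
        (((hyd x).const_mul q).pow 2)).add
        ((hasDerivAt_const x d).div (((hyd x).const_mul q).pow 2) (by simp [hq0, h1.ne']))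
      refine e1.congr_deriv ?_
      have h2 := hge x hx
      have h3 : S.centDeriv x = ((β : ℝ) ^ 2 * y x ^ 4 / (4 * m) + e) / y x ^ 3 := by
        rw [← h2]
        field_simp
      rw [h3]
      simp [hd, hq]
      field_simp
      ring
    set c := (β : ℝ) ^ 2 / 2 * (1 / (2 * S.f (S.ofX (S.toX rb)) ^ 2)) -
        (q * y (S.toX rb)) ^ 2 + d / (q * y (S.toX rb)) ^ 2 with hc
    set A := -(σ * (β : ℝ) ^ 4 / (16 * m ^ 3)) with hA
    have hU : ∀ x ∈ S.X, HasDerivAt (fun x => V (S.ofX x) - A / 2 * (1 / (q * y x) ^ 2)) 0 x :=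
      fun x hx => by
        have h1 := hyp x hx
        have e1 := (hasDerivAt_pot hV hx).sub (((hasDerivAt_const x (1 : ℝ)).div
          (((hyd x).const_mul q).pow 2) (by simp [hq0, h1.ne'])).const_mul (A / 2))
        refine e1.congr_deriv ?_
        have h2 : S.potDeriv V x = σ / y x ^ 3 := by
          rw [← (h x hx).2.1]
          simp only [hy] at h1 ⊢
          field_simp
        rw [h2]
        simp [hA, hq]
        field_simp
        ring
    refine ⟨2 / β, c, d, fun r => q * y (S.toX r), 2, A,
      V (S.ofX (S.toX rb)) - A / 2 * (1 / (q * y (S.toX rb)) ^ 2), by positivity,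
      hasMetricForm_of_hasDerivAt (by push_cast; positivity)
        (fun r hr => mul_ne_zero hq0 (hyp _ (toX_mem hr)).ne') (fun r hr => ?_) fun r hr => ?_,
      Or.inr rfl, fun _ => rfl, by simp, fun _ r hr => ?_, fun r hr => ?_⟩
    · have := ((hyd (S.toX r)).comp r (hasDerivAt_toX hr)).const_mul q
      refine this.congr_deriv ?_
      have := f_pos' hr
      simp only [hq]
      push_cast
      field_simp
      norm_num
    · have := eq_of_hasDerivAt_zero isOpen_X hXp hG (toX_mem hr) hxb
      rw [← hc, ofX_toX hr] at this
      have hfp := f_pos' hr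
      simp only [bertrandQ]
      rw [← this]
      push_cast
      field_simp
      ring
    · have hx := toX_mem hr
      have h1 := hyp _ hx
      have h2 := hge _ hx
      have h3 := (h _ hx).2.2.1
      -- The sign condition on `A` is the condition `σ * centDeriv < 0`, that is, positivity of the
      -- squared momentum of the circular orbits.
      have h4 : A * ((q * y (S.toX r)) ^ 4 + d) =
          (-(σ * S.centDeriv (S.toX r))) * (y (S.toX r) ^ 3 * (β : ℝ) ^ 10 / (1024 * m ^ 6)) := by
        have h5 : (q * y (S.toX r)) ^ 4 + d = q ^ 3 * (y (S.toX r) ^ 3 * S.centDeriv (S.toX r)) := by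
          rw [h2]
          simp only [hd, hq]
          ring
        rw [h5]
        simp only [hA, hq]
        field_simp
        ring
      rw [h4]
      have : 0 < m ^ 6 := by positivity
      exact mul_pos (by linarith) (by positivity)
    · have := eq_of_hasDerivAt_zero isOpen_X hXp hU (toX_mem hr) hxb
      rw [← this, ofX_toX hr]
      norm_num [zpow_neg]
      rw [mul_pow, sq_abs, sq_abs, ← mul_pow]
      ring

end RevSurface

/-! ### The intervals of the Bertrand surfaces -/

theorem hasDerivAt_bertrandQ (c d : ℝ) {θ : ℝ} (hθ : θ ≠ 0) :
    HasDerivAt (bertrandQ c d) (2 * (θ ^ 4 + d) / θ ^ 3) θ := by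
  have h1 := ((hasDerivAt_pow 2 θ).add_const c).sub
    ((hasDerivAt_const θ d).div (hasDerivAt_pow 2 θ) (by positivity))
  refine h1.congr_deriv ?_
  simp
  field_simp
  ring

theorem mem_bertrandDomain_iff {c d θ : ℝ} :
    θ ∈ bertrandDomain c d ↔ θ < 0 ∧ 0 < bertrandQ c d θ ∧ θ ^ 4 + d ≠ 0 := by
  simp only [bertrandDomain, mem_ofPred_eq]
  refine and_congr_right fun h => and_congr_right fun _ => ?_
  rw [(hasDerivAt_bertrandQ c d h.ne).deriv]
  simp [h.ne]

theorem bertrandQ_sub {c d θ θ' : ℝ} (hθ : θ ≠ 0) (hθ' : θ' ≠ 0) :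
    bertrandQ c d θ' - bertrandQ c d θ =
      (θ' ^ 2 - θ ^ 2) * (θ ^ 2 * θ' ^ 2 + d) / (θ ^ 2 * θ' ^ 2) := by
  simp only [bertrandQ]
  field_simp
  ring

theorem bertrandQ_le {c d θ θ' : ℝ} (hθ' : θ' < 0) (hθ : θ < 0)
    (h : 0 ≤ (θ' - θ) * (θ ^ 2 * θ' ^ 2 + d)) : bertrandQ c d θ' ≤ bertrandQ c d θ := by
  have h1 := bertrandQ_sub (c := c) (d := d) hθ.ne hθ'.ne
  have h2 : 0 < θ ^ 2 * θ' ^ 2 := mul_pos (sq_pos_of_neg hθ) (sq_pos_of_neg hθ')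
  have h3 : (θ' ^ 2 - θ ^ 2) * (θ ^ 2 * θ' ^ 2 + d) / (θ ^ 2 * θ' ^ 2) ≤ 0 := by
    refine div_nonpos_of_nonpos_of_nonneg ?_ h2.le
    have : (θ' ^ 2 - θ ^ 2) * (θ ^ 2 * θ' ^ 2 + d) =
      (θ' + θ) * ((θ' - θ) * (θ ^ 2 * θ' ^ 2 + d)) := by ring
    rw [this]
    exact mul_nonpos_of_nonpos_of_nonneg (by linarith) h
  linarith

/-- The sign of `θ⁴ + d` on the interval with number `k`. -/
def bertrandSign (k : ℕ) : ℝ := if k = 1 then 1 else -1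

theorem exists_root_of_sign {d a b : ℝ} (hab : a ≤ b) (h : (a ^ 4 + d) * (b ^ 4 + d) ≤ 0) :
    ∃ x ∈ Icc a b, x ^ 4 + d = 0 := by
  have hc : ContinuousOn (fun x : ℝ => x ^ 4 + d) (Icc a b) := by fun_prop
  have h1 : (0 : ℝ) ∈ uIcc (a ^ 4 + d) (b ^ 4 + d) := by
    rw [mem_uIcc]
    by_contra! hcon
    rcases le_or_gt (a ^ 4 + d) 0 with h3 | h3
    · have := hcon.1 h3
      have h4 : a ^ 4 + d ≠ 0 := fun h5 => by
        rcases le_or_gt (b ^ 4 + d) 0 with h6 | h6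
        · have := hcon.2 h6
          linarith
        · linarith
      nlinarith [lt_of_le_of_ne h3 h4]
    · have := fun h6 => hcon.2 h6
      rcases le_or_gt (b ^ 4 + d) 0 with h6 | h6
      · linarith [this h6]
      · nlinarith
  rw [← uIcc_of_le hab] at hc ⊢
  obtain ⟨x, hx, hx0⟩ := intermediate_value_uIcc hc h1
  exact ⟨x, hx, hx0⟩

/-- For `θ < 0` the sign of `Q'` is opposite to that of `θ⁴ + d`. If `θ⁴ + d > 0`, then `Q` grows as
`θ` decreases and positivity spreads to the whole left ray; if `θ⁴ + d < 0`, it spreads to `[θ, 0)`.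
The intervals are thus described by conditions at the single point `θ`. -/
theorem mem_bertrandInterval_iff {c d θ : ℝ} {k : ℕ} (hk : k = 1 ∨ k = bertrandCount d) :
    θ ∈ bertrandInterval c d k ↔
      θ < 0 ∧ 0 < bertrandQ c d θ ∧ 0 < bertrandSign k * (θ ^ 4 + d) := by
  by_cases hk1 : k = 1
  · subst hk1
    simp only [bertrandInterval, bertrandSign, if_true, mem_ofPred_eq, one_mul]
    constructor
    · intro h
      have h0 := mem_bertrandDomain_iff.1 (h (mem_Iic.2 le_rfl))
      refine ⟨h0.1, h0.2.1, ?_⟩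
      by_contra hcon
      -- At this point, far enough to the left, `x⁴ + d` is nonnegative, so a wrong sign at `θ`
      -- would produce a critical point of `Q` on the ray.
      have hlow : θ - |d| - 1 ≤ θ := by linarith [abs_nonneg d]
      have hbig : 0 ≤ (θ - |d| - 1) ^ 4 + d := by
        have h1 : 1 + |d| ≤ (θ - |d| - 1) ^ 2 := by nlinarith [abs_nonneg d, h0.1]
        nlinarith [neg_abs_le d, abs_nonneg d]
      obtain ⟨x, hx, hx0⟩ := exists_root_of_sign hlow
        (mul_nonpos_of_nonneg_of_nonpos hbig (not_lt.1 hcon))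
      exact (mem_bertrandDomain_iff.1 (h (mem_Iic.2 hx.2))).2.2 hx0
    · rintro ⟨h1, h2, h3⟩ x hx
      rw [mem_Iic] at hx
      have hsq : θ ^ 2 ≤ x ^ 2 := by nlinarith
      have h4 : θ ^ 4 ≤ θ ^ 2 * x ^ 2 := by nlinarith [sq_nonneg θ]
      refine mem_bertrandDomain_iff.2 ⟨hx.trans_lt h1, h2.trans_le ?_, ?_⟩
      · refine bertrandQ_le h1 (hx.trans_lt h1) ?_
        exact mul_nonneg (by linarith) (by nlinarith)
      · have : θ ^ 4 ≤ x ^ 4 := by nlinarith [sq_nonneg θ, sq_nonneg x]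
        linarith
  · have hc := hk.resolve_left hk1
    have hd : d < 0 := by
      by_contra hd
      rw [bertrandCount, if_neg hd] at hc
      exact hk1 hc
    simp only [bertrandInterval, bertrandSign, if_neg hk1, mem_ofPred_eq]
    constructor
    · rintro ⟨hθ, h⟩
      have h0 := mem_bertrandDomain_iff.1 (h ⟨le_rfl, hθ⟩)
      refine ⟨h0.1, h0.2.1, ?_⟩
      by_contra hcon
      obtain ⟨x, hx, hx0⟩ := exists_root_of_sign (a := θ) (b := 0) (d := d) hθ.le
        (mul_nonpos_of_nonneg_of_nonpos (by linarith) (by norm_num; exact hd.le))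
      have hx' : x < 0 := lt_of_le_of_ne hx.2 (by rintro rfl; norm_num at hx0; exact hd.ne hx0)
      exact (mem_bertrandDomain_iff.1 (h ⟨hx.1, hx'⟩)).2.2 hx0
    · rintro ⟨h1, h2, h3⟩
      refine ⟨h1, fun x hx => ?_⟩
      have hsq : x ^ 2 ≤ θ ^ 2 := by nlinarith [hx.1, hx.2]
      have h4 : θ ^ 2 * x ^ 2 ≤ θ ^ 4 := by nlinarith [sq_nonneg θ]
      refine mem_bertrandDomain_iff.2 ⟨hx.2, h2.trans_le ?_, ?_⟩
      · refine bertrandQ_le h1 hx.2 ?_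
        exact mul_nonneg_of_nonpos_of_nonpos (by linarith [hx.1]) (by nlinarith)
      · have : x ^ 4 ≤ θ ^ 4 := by nlinarith [sq_nonneg θ, sq_nonneg x]
        linarith

theorem ordConnected_bertrandInterval {c d : ℝ} {k : ℕ} :
    (bertrandInterval c d k).OrdConnected := by
  refine ⟨fun x hx y hy z hz => ?_⟩
  unfold bertrandInterval at *
  split_ifs at * with h1
  · exact (Iic_subset_Iic.2 hz.2).trans hy
  · exact ⟨hz.2.trans_lt hy.1, (Ico_subset_Ico_left hz.1).trans hx.2⟩

theorem bertrandInterval_subset {c d : ℝ} {k : ℕ} (hk : k = 1 ∨ k = bertrandCount d) :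
    bertrandInterval c d k ⊆ bertrandDomain c d := fun θ hθ => by
  rw [mem_bertrandInterval_iff hk] at hθ
  refine mem_bertrandDomain_iff.2 ⟨hθ.1, hθ.2.1, fun h => ?_⟩
  rw [h, mul_zero] at hθ
  exact hθ.2.2.false

theorem strictMonoOn_bertrandPrimitive {R : ℝ → ℝ → ℝ → ℝ} (hR : IsBertrandPrimitive R) {c d : ℝ}
    {k : ℕ} (hk : k = 1 ∨ k = bertrandCount d) :
    StrictMonoOn (R c d) (bertrandInterval c d k) := by
  have hs := bertrandInterval_subset (c := c) hk
  refine strictMonoOn_of_deriv_pos ordConnected_bertrandInterval.convex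
    (HasDerivAt.continuousOn fun x hx => hR c d x (hs hx)) fun x hx => ?_
  have hx' := hs (interior_subset hx)
  rw [(hR c d x hx').deriv]
  exact div_pos one_pos hx'.2.1

theorem bertrandTheta_mem {R : ℝ → ℝ → ℝ → ℝ} {c d x : ℝ} {k : ℕ} (hx : x ∈ bertrandRange R c d k) :
    bertrandTheta R c d k x ∈ bertrandInterval c d k := Function.invFunOn_mem hx

theorem bertrandPrimitive_theta {R : ℝ → ℝ → ℝ → ℝ} {c d x : ℝ} {k : ℕ}
    (hx : x ∈ bertrandRange R c d k) : R c d (bertrandTheta R c d k x) = x :=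
  Function.invFunOn_eq hx

theorem bertrandTheta_primitive {R : ℝ → ℝ → ℝ → ℝ} (hR : IsBertrandPrimitive R) {c d θ : ℝ}
    {k : ℕ} (hk : k = 1 ∨ k = bertrandCount d) (hθ : θ ∈ bertrandInterval c d k) :
    bertrandTheta R c d k (R c d θ) = θ :=
  (strictMonoOn_bertrandPrimitive hR hk).injOn (bertrandTheta_mem (mem_image_of_mem _ hθ)) hθ
    (bertrandPrimitive_theta (mem_image_of_mem _ hθ))

theorem isOpen_bertrandInterval {c d : ℝ} {k : ℕ} (hk : k = 1 ∨ k = bertrandCount d) :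
    IsOpen (bertrandInterval c d k) := by
  rw [isOpen_iff_mem_nhds]
  intro θ hθ
  have h := (mem_bertrandInterval_iff hk).1 hθ
  have hQ := (hasDerivAt_bertrandQ c d h.1.ne).continuousAt
  have h4 : ContinuousAt (fun θ => bertrandSign k * (θ ^ 4 + d)) θ := by fun_prop
  filter_upwards [Iio_mem_nhds h.1, hQ.eventually_const_lt h.2.1, h4.eventually_const_lt h.2.2]
    with y h1 h2 h3
  exact (mem_bertrandInterval_iff hk).2 ⟨h1, h2, h3⟩

theorem hasDerivAt_bertrandTheta {R : ℝ → ℝ → ℝ → ℝ} (hR : IsBertrandPrimitive R) {c d x : ℝ}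
    {k : ℕ} (hk : k = 1 ∨ k = bertrandCount d) (hx : x ∈ bertrandRange R c d k) :
    HasDerivAt (bertrandTheta R c d k) (bertrandQ c d (bertrandTheta R c d k x)) x := by
  have hmono := strictMonoOn_bertrandPrimitive hR (c := c) hk
  have hopen : IsOpen (bertrandRange R c d k) := by
    rw [isOpen_iff_mem_nhds]
    rintro _ ⟨θ, hθ, rfl⟩
    obtain ⟨u, v, hu, hv, huv⟩ := RevSurface.exists_Icc_nhds (isOpen_bertrandInterval hk) hθ
    have hum := huv ⟨le_rfl, (hu.trans hv).le⟩
    have hvm := huv ⟨(hu.trans hv).le, le_rfl⟩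
    refine mem_of_superset (Icc_mem_nhds (hmono hum hθ hu) (hmono hθ hvm hv)) ?_
    have hc : ContinuousOn (R c d) (Icc u v) := HasDerivAt.continuousOn fun y hy =>
      hR c d y (bertrandInterval_subset hk (huv hy))
    exact (intermediate_value_Icc (hu.trans hv).le hc).trans (image_mono huv)
  have hmono' : StrictMonoOn (bertrandTheta R c d k) (bertrandRange R c d k) := by
    rintro y hy z hz hyz
    by_contra hcon
    have := hmono.monotoneOn (bertrandTheta_mem hz) (bertrandTheta_mem hy) (not_lt.1 hcon)
    rw [bertrandPrimitive_theta hy, bertrandPrimitive_theta hz] at this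
    linarith
  have himg : bertrandTheta R c d k '' bertrandRange R c d k = bertrandInterval c d k := by
    ext θ
    constructor
    · rintro ⟨y, hy, rfl⟩
      exact bertrandTheta_mem hy
    · exact fun hθ => ⟨R c d θ, mem_image_of_mem _ hθ, bertrandTheta_primitive hR hk hθ⟩
  have hc : ContinuousAt (bertrandTheta R c d k) x := by
    refine hmono'.continuousAt_of_image_mem_nhds (hopen.mem_nhds hx) ?_
    rw [himg]
    exact (isOpen_bertrandInterval hk).mem_nhds (bertrandTheta_mem hx)
  have hm := bertrandInterval_subset hk (bertrandTheta_mem hx)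
  have := HasDerivAt.of_local_left_inverse hc (hR c d _ hm) (one_div_ne_zero hm.2.1.ne') (by
    filter_upwards [hopen.mem_nhds hx] with y hy using bertrandPrimitive_theta hy)
  simpa using this

/-- Negative `l` are included, so the same rule covers both the dilations and the reflection `θ ↦
-θ`. -/
theorem bertrandQ_scale {l : ℝ} (hl : l ≠ 0) (c d θ : ℝ) :
    bertrandQ (l ^ 2 * c) (l ^ 4 * d) (l * θ) = l ^ 2 * bertrandQ c d θ := by
  simp only [bertrandQ]
  by_cases hθ : θ = 0
  · simp [hθ]
  · field_simp

theorem eq_zero_of_sum_mul_pow_eq_zero {n : ℕ} {a : ℕ → ℝ} {s : Set ℝ} (hs : s.Infinite)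
    (h : ∀ x ∈ s, ∑ i ∈ Finset.range n, a i * x ^ i = 0) {i : ℕ} (hi : i < n) : a i = 0 := by
  set P : Polynomial ℝ := ∑ i ∈ Finset.range n, Polynomial.monomial i (a i) with hP
  have h0 : P = 0 := by
    refine Polynomial.eq_of_infinite_eval_eq P 0 (hs.mono fun x hx => ?_)
    rw [mem_ofPred_eq, hP, Polynomial.eval_finsetSum, Polynomial.eval_zero, ← h x hx]
    exact Finset.sum_congr rfl fun i _ => Polynomial.eval_monomial
  have h1 : P.coeff i = a i := by
    rw [hP, Polynomial.finsetSum_coeff]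
    simp [Polynomial.coeff_monomial, hi]
  rw [← h1, h0, Polynomial.coeff_zero]

/-! ### Bertrand metrics: uniqueness of the parameters and representation by pieces of Bertrand
surfaces. -/

namespace RevSurface

variable {S : RevSurface}

theorem HasMetricForm.spec {μ c d : ℝ} {θ : ℝ → ℝ} (hμ : 0 < μ) (h : S.HasMetricForm μ c d θ) {r : ℝ}
    (hr : r ∈ S.I) : θ r ≠ 0 ∧ 0 < bertrandQ c d (θ r) ∧ HasDerivAt θ (bertrandQ c d (θ r)) r ∧
      bertrandQ c d (θ r) = 1 / (μ ^ 2 * S.f r ^ 2) := by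
  obtain ⟨h0, h1, h2, h3⟩ := h.2 r hr
  have hf := f_pos' hr
  have hQ0 : bertrandQ c d (θ r) ≠ 0 := fun h => by simp [h] at h2
  have hQ : bertrandQ c d (θ r) = 1 / (μ ^ 2 * S.f r ^ 2) := by
    rw [h3]
    field_simp
  have hQp : 0 < bertrandQ c d (θ r) := by
    rw [hQ]
    positivity
  refine ⟨h0, hQp, ?_, hQ⟩
  rw [div_eq_one_iff_eq (by positivity)] at h2
  have : deriv θ r = bertrandQ c d (θ r) := by
    rcases sq_eq_sq_iff_eq_or_eq_neg.1 h2 with h | h <;> linarith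
  rw [← this]
  exact hasDerivAt_of_smooth h.1 hr

theorem HasMetricForm.of_spec {μ c d : ℝ} {θ : ℝ → ℝ} (hμ : 0 < μ)
    (h : ∀ r ∈ S.I, θ r ≠ 0 ∧ HasDerivAt θ (bertrandQ c d (θ r)) r ∧
      bertrandQ c d (θ r) = 1 / (μ ^ 2 * S.f r ^ 2)) : S.HasMetricForm μ c d θ :=
  hasMetricForm_of_hasDerivAt hμ (fun r hr => (h r hr).1)
    (fun r hr => by
      have := (h r hr).2
      rw [← this.2]
      exact this.1) fun r hr => (h r hr).2.2

theorem HasMetricForm.congr {μ c d : ℝ} {θ θ' : ℝ → ℝ} (hμ : 0 < μ) (h : S.HasMetricForm μ c d θ)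
    (he : EqOn θ' θ S.I) : S.HasMetricForm μ c d θ' := by
  refine HasMetricForm.of_spec hμ fun r hr => ?_
  obtain ⟨h0, -, h2, h3⟩ := h.spec hμ hr
  rw [he hr]
  refine ⟨h0, h2.congr_of_eventuallyEq ?_, h3⟩
  filter_upwards [S.isOpen_I.mem_nhds hr] with s hs using he hs

/-- The parameters and the coordinate of a Bertrand metric are unique. -/
theorem HasMetricForm.unique {μ₁ c₁ d₁ μ₂ c₂ d₂ : ℝ} {θ₁ θ₂ : ℝ → ℝ} (hμ₁ : 0 < μ₁) (hμ₂ : 0 < μ₂)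
    (h₁ : S.HasMetricForm μ₁ c₁ d₁ θ₁) (h₂ : S.HasMetricForm μ₂ c₂ d₂ θ₂) :
    μ₁ = μ₂ ∧ c₁ = c₂ ∧ d₁ = d₂ ∧ EqOn θ₁ θ₂ S.I := by
  obtain ⟨rb, hrb⟩ := S.nonempty_I
  -- Both `μ₁² θ₁` and `μ₂² θ₂` have derivative `1 / f²`, so the two coordinates are affinely
  -- related: `θ₂ = α θ₁ + ε`.
  set E := μ₂ ^ 2 * θ₂ rb - μ₁ ^ 2 * θ₁ rb with hE
  set α := μ₁ ^ 2 / μ₂ ^ 2 with hα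
  have hα0 : 0 < α := by positivity
  set ε := E / μ₂ ^ 2 with hε
  have hlin : ∀ r ∈ S.I, θ₂ r = α * θ₁ r + ε := by
    intro r hr
    have := eq_of_hasDerivAt_zero S.isOpen_I S.isPreconnected_I
      (g := fun r => μ₂ ^ 2 * θ₂ r - μ₁ ^ 2 * θ₁ r) (fun r hr => by
        obtain ⟨-, -, e1, e2⟩ := h₁.spec hμ₁ hr
        obtain ⟨-, -, e3, e4⟩ := h₂.spec hμ₂ hr
        refine ((e3.const_mul _).sub (e1.const_mul _)).congr_deriv ?_
        have hf := f_pos' hr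
        rw [e2, e4]
        field_simp
        ring) hr hrb
    rw [← hE] at this
    rw [hα, hε]
    field_simp
    linarith
  have hinf : (θ₁ '' S.I).Infinite := by
    obtain ⟨u, v, hu, hv, huv⟩ := exists_Icc_nhds S.isOpen_I hrb
    have hmono : StrictMonoOn θ₁ S.I := by
      refine strictMonoOn_of_deriv_pos S.ordConnected_I.convex h₁.1.continuousOn fun r hr => ?_
      rw [S.isOpen_I.interior_eq] at hr
      exact (h₁.2 r hr).2.1
    exact ((Icc_infinite (hu.trans hv)).mono huv).image hmono.injOn
  -- This is `α Q₁(u) = Q₂(α u + ε)` with denominators cleared. It holds on an infinite set, hence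
  -- coefficientwise.
  have hid : ∀ u ∈ θ₁ '' S.I, α * (u ^ 4 + c₁ * u ^ 2 - d₁) * (α * u + ε) ^ 2 =
      ((α * u + ε) ^ 4 + c₂ * (α * u + ε) ^ 2 - d₂) * u ^ 2 := by
    rintro _ ⟨r, hr, rfl⟩
    obtain ⟨a1, -, -, e2⟩ := h₁.spec hμ₁ hr
    obtain ⟨a2, -, -, e4⟩ := h₂.spec hμ₂ hr
    have hf := f_pos' hr
    rw [← hlin r hr]
    have e5 : α * bertrandQ c₁ d₁ (θ₁ r) = bertrandQ c₂ d₂ (θ₂ r) := by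
      rw [e2, e4, hα]
      field_simp
    simp only [bertrandQ] at e5
    field_simp at e5
    linarith
  set a : ℕ → ℝ := fun i => match i with
    | 0 => -α * d₁ * ε ^ 2
    | 1 => -2 * α ^ 2 * d₁ * ε
    | 2 => -α ^ 3 * d₁ + α * c₁ * ε ^ 2 - ε ^ 4 - c₂ * ε ^ 2 + d₂
    | 3 => 2 * α ^ 2 * ε * c₁ - 4 * α * ε ^ 3 - 2 * c₂ * α * ε
    | 4 => α ^ 3 * c₁ + α * ε ^ 2 - 6 * α ^ 2 * ε ^ 2 - c₂ * α ^ 2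
    | 5 => 2 * α ^ 2 * ε - 4 * α ^ 3 * ε
    | 6 => α ^ 3 - α ^ 4
    | _ => 0 with ha
  have hz : ∀ {i : ℕ}, i < 7 → a i = 0 := fun hi =>
    eq_zero_of_sum_mul_pow_eq_zero hinf (fun u hu => by
      have := hid u hu
      simp only [Finset.sum_range_succ, Finset.sum_range_zero, ha]
      linear_combination this) hi
  -- Degree 6 gives `α = 1`, then degree 5 gives `ε = 0`, and degrees 4 and 2 identify `c` and `d`.
  have z6 : α ^ 3 - α ^ 4 = 0 := hz (i := 6) (by norm_num)
  have z5 : 2 * α ^ 2 * ε - 4 * α ^ 3 * ε = 0 := hz (i := 5) (by norm_num)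
  have z4 : α ^ 3 * c₁ + α * ε ^ 2 - 6 * α ^ 2 * ε ^ 2 - c₂ * α ^ 2 = 0 := hz (i := 4) (by norm_num)
  have z2 : -α ^ 3 * d₁ + α * c₁ * ε ^ 2 - ε ^ 4 - c₂ * ε ^ 2 + d₂ = 0 := hz (i := 2) (by norm_num)
  have hα1 : α = 1 := by
    have : α ^ 3 * (1 - α) = 0 := by linarith
    have := (mul_eq_zero.1 this).resolve_left (by positivity)
    linarith
  rw [hα1] at z5 z4 z2
  have hε0 : ε = 0 := by linarith
  rw [hε0] at z4 z2
  refine ⟨?_, by linarith, by linarith, fun r hr => ?_⟩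
  · rw [hα, div_eq_one_iff_eq (by positivity)] at hα1
    exact (sq_eq_sq₀ hμ₁.le hμ₂.le).1 hα1
  · rw [hlin r hr, hα1, hε0]
    ring

/-- The surface, dilated by `|l|`, is a part of a Bertrand surface, possibly reflected. -/
def ScaledRep (S : RevSurface) (R : ℝ → ℝ → ℝ → ℝ) (μ l c d r₀ : ℝ) (k : ℕ) : Prop :=
  0 < μ ∧ l ≠ 0 ∧ (k = 1 ∨ k = bertrandCount d) ∧
  ∀ r ∈ S.I, l * (r - r₀) ∈ bertrandRange R c d k ∧
    S.f r = 1 / (μ * |l|) * bertrandF R c d k (l * (r - r₀))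

theorem IsBertrandRep.scaledRep {R : ℝ → ℝ → ℝ → ℝ} {μ : ℚ} {c d r₀ η : ℝ} {k : ℕ} {θ : ℝ → ℝ}
    (h : S.IsBertrandRep R μ c d r₀ η k θ) : S.ScaledRep R μ η c d r₀ k := by
  obtain ⟨hμ, hη, hk, h⟩ := h
  have hη1 : |η| = 1 := by rcases hη with rfl | rfl <;> simp
  refine ⟨by exact_mod_cast hμ, fun h0 => by simp [h0] at hη1, hk, fun r hr => ⟨(h r hr).1, ?_⟩⟩
  rw [hη1, mul_one]
  exact (h r hr).2.1

theorem IsNormalizedRep.scaledRep {R : ℝ → ℝ → ℝ → ℝ} {γ : ℝ → ℝ × ℝ} {μ : ℚ} {l τ r₀ : ℝ} {k : ℕ}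
    (h : S.IsNormalizedRep R γ μ l τ r₀ k) :
    S.ScaledRep R μ l (γ τ).1 (γ τ).2 r₀ k :=
  ⟨by exact_mod_cast h.1.1, h.1.2.1, h.1.2.2.2.1, h.2⟩

/-- The inverse of an antiderivative of `1 / Q` solves `θ' = Q(θ)`, and the homogeneity of `Q`
absorbs the dilation `l` into the parameters. -/
theorem ScaledRep.hasMetricForm {R : ℝ → ℝ → ℝ → ℝ} (hR : IsBertrandPrimitive R)
    {μ l c d r₀ : ℝ} {k : ℕ} (h : S.ScaledRep R μ l c d r₀ k) :
    S.HasMetricForm μ (l ^ 2 * c) (l ^ 4 * d)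
      (fun r => l * bertrandTheta R c d k (l * (r - r₀))) := by
  obtain ⟨hμ, hl, hk, h⟩ := h
  refine HasMetricForm.of_spec hμ fun r hr => ?_
  obtain ⟨h1, h2⟩ := h r hr
  have hm := bertrandInterval_subset hk (bertrandTheta_mem h1)
  rw [bertrandQ_scale hl]
  refine ⟨mul_ne_zero hl hm.1.ne, ?_, ?_⟩
  · have e := ((hasDerivAt_bertrandTheta hR hk h1).comp r
      (((hasDerivAt_id r).sub_const r₀).const_mul l)).const_mul l
    refine e.congr_deriv ?_
    ring
  · rw [h2, bertrandF]
    have hs := Real.sq_sqrt hm.2.1.le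
    have hs0 := Real.sqrt_pos.2 hm.2.1
    have hl2 := sq_abs l
    have hl0 : 0 < |l| := abs_pos.2 hl
    rw [mul_pow, div_pow, div_pow, mul_pow, hs, hl2]
    have := hm.2.1
    field_simp

/-- A Bertrand metric without critical points of `f` is a part of a Bertrand surface. -/
theorem HasMetricForm.exists_scaledRep {R : ℝ → ℝ → ℝ → ℝ} (hR : IsBertrandPrimitive R)
    (hf : ∀ r ∈ S.I, deriv S.f r ≠ 0)
    {μ l c d : ℝ} {θ : ℝ → ℝ} (hμ : 0 < μ) (h : S.HasMetricForm μ (l ^ 2 * c) (l ^ 4 * d) θ)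
    (hsign : ∀ r ∈ S.I, l * θ r < 0) :
    ∃ (r₀ : ℝ) (k : ℕ), S.ScaledRep R μ l c d r₀ k ∧
      ∀ r ∈ S.I, θ r = l * bertrandTheta R c d k (l * (r - r₀)) := by
  obtain ⟨rb, hrb⟩ := S.nonempty_I
  have hl : l ≠ 0 := fun h0 => by
    have := hsign rb hrb
    rw [h0, zero_mul] at this
    exact this.false
  have hl2 : 0 < l ^ 2 := by positivity
  set ϑ : ℝ → ℝ := fun r => θ r / l with hϑ
  have hθϑ : ∀ r, θ r = l * ϑ r := fun r => by rw [hϑ]; field_simp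
  have hneg : ∀ r ∈ S.I, ϑ r < 0 := fun r hr => by
    have := hsign r hr
    rw [hθϑ r] at this
    nlinarith
  have hQ : ∀ r ∈ S.I, 0 < bertrandQ c d (ϑ r) ∧ HasDerivAt ϑ (l * bertrandQ c d (ϑ r)) r ∧
      l ^ 2 * bertrandQ c d (ϑ r) = 1 / (μ ^ 2 * S.f r ^ 2) := fun r hr => by
    obtain ⟨-, e1, e2, e3⟩ := h.spec hμ hr
    rw [hθϑ r, bertrandQ_scale hl] at e1 e3
    rw [hθϑ r, bertrandQ_scale hl] at e2
    refine ⟨pos_of_mul_pos_right e1 hl2.le, ?_, e3⟩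
    refine (e2.div_const l).congr_deriv ?_
    field_simp
  -- A zero of `ϑ⁴ + d` is a critical point of `Q`, and therefore of `f`. As there are none, the
  -- sign of `ϑ⁴ + d` is constant and selects the number `k` of the interval.
  have hcrit : ∀ r ∈ S.I, ϑ r ^ 4 + d ≠ 0 := by
    intro r hr h0
    obtain ⟨e1, e2, -⟩ := hQ r hr
    have hfr := f_pos' hr
    have d1 := (hasDerivAt_bertrandQ c d (hneg r hr).ne).comp r e2
    have d2 := ((d1.const_mul (μ ^ 2 * l ^ 2)).mul ((hasDerivAt_f hr).pow 2))
    have d3 : HasDerivAt (fun r => (μ ^ 2 * l ^ 2 * bertrandQ c d (ϑ r)) * S.f r ^ 2) 0 r := by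
      refine (hasDerivAt_const r (1 : ℝ)).congr_of_eventuallyEq ?_
      filter_upwards [S.isOpen_I.mem_nhds hr] with s hs
      have := (hQ s hs).2.2
      have hfs := f_pos' hs
      rw [mul_assoc (μ ^ 2), this]
      field_simp
    have d4 := d2.unique d3
    rw [h0] at d4
    simp [hμ.ne', hl, hfr.ne', e1.ne', hf r hr] at d4
  have hcont : ContinuousOn ϑ S.I := HasDerivAt.continuousOn fun r hr => (hQ r hr).2.1
  obtain ⟨k, hk, hmem⟩ : ∃ k : ℕ, (k = 1 ∨ k = bertrandCount d) ∧
      ∀ r ∈ S.I, ϑ r ∈ bertrandInterval c d k := by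
    by_cases hall : ∀ r ∈ S.I, 0 < ϑ r ^ 4 + d
    · refine ⟨1, Or.inl rfl, fun r hr => (mem_bertrandInterval_iff (Or.inl rfl)).2
        ⟨hneg r hr, (hQ r hr).1, ?_⟩⟩
      simpa [bertrandSign] using hall r hr
    · push Not at hall
      obtain ⟨r₁, hr₁, hle⟩ := hall
      have hall : ∀ r ∈ S.I, ϑ r ^ 4 + d < 0 := fun r hr => by
        by_contra hcon
        obtain ⟨z, hz, hz0⟩ := S.isPreconnected_I.intermediate_value hr₁ hr
          (f := fun r => ϑ r ^ 4 + d) ((hcont.pow 4).add continuousOn_const)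
          (show (0 : ℝ) ∈ Icc _ _ from ⟨hle, not_lt.1 hcon⟩)
        exact hcrit z hz hz0
      have hd : d < 0 := by
        have := hall rb hrb
        nlinarith [sq_nonneg (ϑ rb ^ 2)]
      have hk2 : (2 : ℕ) = 1 ∨ 2 = bertrandCount d := Or.inr (by simp [bertrandCount, hd])
      refine ⟨2, hk2, fun r hr => (mem_bertrandInterval_iff hk2).2
        ⟨hneg r hr, (hQ r hr).1, ?_⟩⟩
      have := hall r hr
      simp only [bertrandSign]
      norm_num
      linarith
  -- Since `R c d (ϑ r)` has derivative `l`, it is `l (r - r₀)`; the shift is the constant of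
  -- integration at the base point.
  set r₀ := rb - R c d (ϑ rb) / l with hr₀
  have hlin : ∀ r ∈ S.I, R c d (ϑ r) = l * (r - r₀) := by
    intro r hr
    have := eq_of_hasDerivAt_zero S.isOpen_I S.isPreconnected_I
      (g := fun r => R c d (ϑ r) - l * r) (fun r hr => by
        obtain ⟨e1, e2, -⟩ := hQ r hr
        have e3 := ((hR c d _ (bertrandInterval_subset hk (hmem r hr))).comp r e2).sub
          ((hasDerivAt_id r).const_mul l)
        refine e3.congr_deriv ?_
        field_simp
        ring) hr hrb
    rw [hr₀]
    field_simp
    linarith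
  have hth : ∀ r ∈ S.I, bertrandTheta R c d k (l * (r - r₀)) = ϑ r := fun r hr => by
    rw [← hlin r hr, bertrandTheta_primitive hR hk (hmem r hr)]
  refine ⟨r₀, k, ⟨hμ, hl, hk, fun r hr => ⟨?_, ?_⟩⟩, fun r hr => ?_⟩
  · rw [← hlin r hr]
    exact mem_image_of_mem _ (hmem r hr)
  · rw [bertrandF, hth r hr]
    obtain ⟨e1, -, e3⟩ := hQ r hr
    have hfr := f_pos' hr
    have hs0 := Real.sqrt_pos.2 e1
    have hs := Real.sq_sqrt e1.le
    have hl0 : 0 < |l| := abs_pos.2 hl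
    rw [← sq_eq_sq₀ hfr.le (by positivity), mul_pow, div_pow, div_pow, mul_pow, hs, sq_abs]
    field_simp at e3 ⊢
    linarith
  · rw [hth r hr, hθϑ]

theorem ScaledRep.mem {R : ℝ → ℝ → ℝ → ℝ} {μ l c d r₀ : ℝ} {k : ℕ}
    (h : S.ScaledRep R μ l c d r₀ k) {r : ℝ} (hr : r ∈ S.I) :
    bertrandTheta R c d k (l * (r - r₀)) ∈ bertrandInterval c d k ∧
      R c d (bertrandTheta R c d k (l * (r - r₀))) = l * (r - r₀) :=
  ⟨bertrandTheta_mem (h.2.2.2 r hr).1, bertrandPrimitive_theta (h.2.2.2 r hr).1⟩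

/-- Two representations of the same surface: everything scales. -/
theorem ScaledRep.unique {R : ℝ → ℝ → ℝ → ℝ} (hR : IsBertrandPrimitive R)
    {μ l c d r₀ μ' l' c' d' r₀' : ℝ} {k k' : ℕ}
    (h : S.ScaledRep R μ l c d r₀ k) (h' : S.ScaledRep R μ' l' c' d' r₀' k') :
    μ = μ' ∧ l ^ 2 * c = l' ^ 2 * c' ∧ l ^ 4 * d = l' ^ 4 * d' ∧ 0 < l * l' ∧ k = k' ∧
      ∀ r ∈ S.I, l * bertrandTheta R c d k (l * (r - r₀)) =
        l' * bertrandTheta R c' d' k' (l' * (r - r₀')) := by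
  obtain ⟨e1, e2, e3, e4⟩ := (h.hasMetricForm hR).unique h.1 h'.1 (h'.hasMetricForm hR)
  obtain ⟨rb, hrb⟩ := S.nonempty_I
  have m := (mem_bertrandInterval_iff h.2.2.1).1 (h.mem hrb).1
  have m' := (mem_bertrandInterval_iff h'.2.2.1).1 (h'.mem hrb).1
  have hb := e4 hrb
  simp only at hb
  set t := bertrandTheta R c d k (l * (rb - r₀)) with ht
  set t' := bertrandTheta R c' d' k' (l' * (rb - r₀')) with ht'
  have hl := h.2.1
  have hl' := h'.2.1
  refine ⟨e1, e2, e3, ?_, ?_, e4⟩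
  -- The standard coordinates `t`, `t'` are both negative, so `l t = l' t'` forces `l` and `l'` to
  -- have the same sign.
  · have h1 : 0 < l ^ 2 * (t * t') := by
      have := mul_pos_of_neg_of_neg m.1 m'.1
      positivity
    have h2 : l ^ 2 * (t * t') = (l * l') * (t' * t') := by
      linear_combination l * t' * hb
    rw [h2] at h1
    exact pos_of_mul_pos_left h1 (mul_self_nonneg _)
  -- The sign of `t⁴ + d` is invariant under scaling and determines `k`.
  · have h1 : l ^ 4 * (t ^ 4 + d) = l' ^ 4 * (t' ^ 4 + d') := by
      have : (l * t) ^ 4 = (l' * t') ^ 4 := by rw [hb]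
      linear_combination this + e3
    have h2 : bertrandSign k = bertrandSign k' := by
      have p1 : 0 < l ^ 4 := by positivity
      have p2 : 0 < l' ^ 4 := by positivity
      have q1 := mul_pos p1 m.2.2
      have q2 := mul_pos p2 m'.2.2
      unfold bertrandSign at q1 q2 ⊢
      split_ifs at q1 q2 ⊢ <;> nlinarith
    by_cases hk : k = 1 <;> by_cases hk' : k' = 1
    · rw [hk, hk']
    · simp [bertrandSign, hk, hk'] at h2
      norm_num at h2
    · simp [bertrandSign, hk, hk'] at h2
      norm_num at h2
    · have hc := h.2.2.1.resolve_left hk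
      have hc' := h'.2.2.1.resolve_left hk'
      have hcount : ∀ d : ℝ, bertrandCount d ≠ 1 → bertrandCount d = 2 := fun d hd => by
        unfold bertrandCount at hd ⊢
        split_ifs at hd ⊢ <;> simp_all
      rw [hc, hc', hcount d (hc ▸ hk), hcount d' (hc' ▸ hk')]

/-! ### Embeddings -/

/-- The radial direction is stretched by `l` for any `f` and `g`, so isometry is a comparison of the
lengths of the rotation field. What has to be shown is that an arbitrary smooth lift maps the
rotation field to itself. -/
theorem isEquivariantIsometricEmbedding_iff {I : Set ℝ} (hI : IsOpen I) {f g : ℝ → ℝ} {l r₀ : ℝ}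
    {J : Set ℝ} (hl : l ≠ 0) :
    IsEquivariantIsometricEmbedding I f l J g (fun p => (l * (p.1 - r₀), p.2)) ↔
      ∀ r ∈ I, l * (r - r₀) ∈ J ∧ g (l * (r - r₀)) ^ 2 = l ^ 2 * f r ^ 2 := by
  constructor
  · rintro ⟨h1, -, -, G, hG, hlift, hiso⟩ r hr
    refine ⟨(h1 (show (r, (0 : Real.Angle)) ∈ I ×ˢ univ from ⟨hr, trivial⟩)).1, ?_⟩
    have hopen : IsOpen (I ×ˢ (univ : Set ℝ)) := hI.prod isOpen_univ
    have hmem : ∀ s : ℝ, (r, s) ∈ I ×ˢ (univ : Set ℝ) := fun s => ⟨hr, trivial⟩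
    have hd : HasFDerivAt G (fderiv ℝ G (r, 0)) (r, 0) :=
      ((hG.differentiableOn (by simp)).differentiableAt (hopen.mem_nhds (hmem 0))).hasFDerivAt
    have hcurve : HasDerivAt (fun s : ℝ => (r, s)) ((0 : ℝ), (1 : ℝ)) 0 :=
      (hasDerivAt_const 0 r).prodMk (hasDerivAt_id 0)
    have hGs : HasDerivAt (fun s : ℝ => G (r, s)) (fderiv ℝ G (r, 0) (0, 1)) 0 :=
      hd.comp_hasDerivAt (0 : ℝ) hcurve
    have e1 : ∀ s, (G (r, s)).1 = l * (r - r₀) := fun s => (congrArg Prod.fst (hlift _ (hmem s))).symm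
    -- The lifted angle differs from `s` by a multiple of `2π`. Divided by `2π`, the difference is
    -- continuous with integral values, hence constant.
    have e2 : ∀ s, (G (r, s)).2 - s = (G (r, 0)).2 - 0 := by
      intro s
      have hc : ContinuousOn (fun s : ℝ => ((G (r, s)).2 - s) / (2 * Real.pi)) univ := by
        have : Continuous fun s : ℝ => G (r, s) :=
          hG.continuousOn.comp_continuous (by fun_prop) hmem
        exact (((continuous_snd.comp this).sub continuous_id).div_const _).continuousOn
      have := eqOn_of_continuousOn_rat isPreconnected_univ hc (fun t _ => by
        have h3 : (t : Real.Angle) = ((G (r, t)).2 : Real.Angle) :=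
          congrArg Prod.snd (hlift _ (hmem t))
        obtain ⟨n, hn⟩ := Real.Angle.angle_eq_iff_two_pi_dvd_sub.1 h3.symm
        refine ⟨n, ?_⟩
        rw [hn]
        field_simp
        push_cast
        rfl) (mem_univ s) (mem_univ 0)
      field_simp at this
      linarith
    have d1 : (fderiv ℝ G (r, 0) (0, 1)).1 = 0 := by
      have : HasDerivAt (fun s : ℝ => (G (r, s)).1) (fderiv ℝ G (r, 0) (0, 1)).1 0 :=
        (ContinuousLinearMap.fst ℝ ℝ ℝ).hasFDerivAt.comp_hasDerivAt (0 : ℝ) hGs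
      refine this.unique ?_
      rw [show (fun s : ℝ => (G (r, s)).1) = fun _ => l * (r - r₀) from funext e1]
      exact hasDerivAt_const _ _
    have d2 : (fderiv ℝ G (r, 0) (0, 1)).2 = 1 := by
      have : HasDerivAt (fun s : ℝ => (G (r, s)).2) (fderiv ℝ G (r, 0) (0, 1)).2 0 :=
        (ContinuousLinearMap.snd ℝ ℝ ℝ).hasFDerivAt.comp_hasDerivAt (0 : ℝ) hGs
      refine this.unique ?_
      rw [show (fun s : ℝ => (G (r, s)).2) = fun s => s + ((G (r, 0)).2 - 0) from
        funext fun s => by linarith [e2 s]]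
      exact (hasDerivAt_id _).add_const _
    have := hiso (r, 0) (hmem 0) (0, 1) (0, 1)
    simp only [revMetric, d1, d2, e1] at this
    simpa using this
  · intro h
    refine ⟨fun p hp => ⟨(h p.1 hp.1).1, trivial⟩, ?_, fun _ _ _ _ => rfl, fun p => (l * (p.1 - r₀), p.2),
      ?_, fun _ _ => rfl, ?_⟩
    · rintro ⟨a, x⟩ _ ⟨b, y⟩ _ hab
      simp only [Prod.mk.injEq] at hab
      have := mul_left_cancel₀ hl hab.1
      ext
      · simpa using this
      · exact hab.2
    · have : ContDiff ℝ ∞ fun p : ℝ × ℝ => (l * (p.1 - r₀), p.2) := by fun_prop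
      exact this.contDiffOn
    · rintro ⟨r, s⟩ ⟨hr, -⟩ u v
      have hd : HasFDerivAt (fun p : ℝ × ℝ => (l * (p.1 - r₀), p.2))
          ((l • (ContinuousLinearMap.fst ℝ ℝ ℝ)).prod (ContinuousLinearMap.snd ℝ ℝ ℝ)) (r, s) :=
        ((hasFDerivAt_fst.sub_const r₀).const_mul l).prodMk hasFDerivAt_snd
      rw [hd.fderiv]
      simp only [revMetric, ContinuousLinearMap.prod_apply, smul_apply,
        ContinuousLinearMap.coe_fst', ContinuousLinearMap.coe_snd', smul_eq_mul, (h r hr).2]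
      ring

theorem scaledRep_iff_embedding {R : ℝ → ℝ → ℝ → ℝ} {μ l c d r₀ : ℝ} {k : ℕ} (hμ : 0 < μ)
    (hl : l ≠ 0) (hk : k = 1 ∨ k = bertrandCount d) :
    (∀ r ∈ S.I, l * (r - r₀) ∈ bertrandRange R c d k ∧
      S.f r = 1 / (μ * |l|) * bertrandF R c d k (l * (r - r₀))) ↔
    IsEquivariantIsometricEmbedding S.I S.f l (bertrandRange R c d k)
      (fun x => 1 / μ * bertrandF R c d k x) (fun p => (l * (p.1 - r₀), p.2)) := by
  rw [isEquivariantIsometricEmbedding_iff S.isOpen_I hl]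
  refine forall₂_congr fun r hr => and_congr_right fun hm => ?_
  have hf := f_pos' hr
  have hQ := (bertrandInterval_subset hk (bertrandTheta_mem hm)).2.1
  have hF : 0 < bertrandF R c d k (l * (r - r₀)) := one_div_pos.2 (Real.sqrt_pos.2 hQ)
  have hl0 : 0 < |l| := abs_pos.2 hl
  rw [← sq_abs l, ← mul_pow, sq_eq_sq₀ (by positivity) (by positivity)]
  constructor
  · intro h
    rw [h]
    field_simp
  · intro h
    rw [one_div_mul_eq_div] at h ⊢
    field_simp at h ⊢
    linarith

end RevSurface

/-! ### Harmonic oscillations -/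

/-- `F` and `G` are the deviation from the equilibrium and its normalised velocity, rotated back by
the angle `ν s`; they are constant. -/
theorem harmonic_solution {y z : ℝ → ℝ} {κ ν : ℝ} (hν : 0 < ν) (hy : ∀ s, HasDerivAt y (z s) s)
    (hz : ∀ s, HasDerivAt z (κ - ν ^ 2 * y s) s) :
    ∃ a b : ℝ, ∀ s, y s = κ / ν ^ 2 + a * Real.cos (ν * s) + b * Real.sin (ν * s) := by
  set C := κ / ν ^ 2 with hC
  have hκ : κ = ν ^ 2 * C := by rw [hC]; field_simp
  have hcos : ∀ s, HasDerivAt (fun s => Real.cos (ν * s)) (-Real.sin (ν * s) * ν) s := fun s => by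
    have := ((hasDerivAt_id s).const_mul ν).cos
    exact this.congr_deriv (by simp)
  have hsin : ∀ s, HasDerivAt (fun s => Real.sin (ν * s)) (Real.cos (ν * s) * ν) s := fun s => by
    have := ((hasDerivAt_id s).const_mul ν).sin
    exact this.congr_deriv (by simp)
  set F : ℝ → ℝ := fun s => (y s - C) * Real.cos (ν * s) - z s / ν * Real.sin (ν * s) with hF
  set G : ℝ → ℝ := fun s => (y s - C) * Real.sin (ν * s) + z s / ν * Real.cos (ν * s) with hG
  have hFd : ∀ s, HasDerivAt F 0 s := fun s => by
    refine ((((hy s).sub_const C).mul (hcos s)).sub (((hz s).div_const ν).mul (hsin s))).congr_deriv ?_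
    rw [hκ]
    field_simp
    ring
  have hGd : ∀ s, HasDerivAt G 0 s := fun s => by
    refine ((((hy s).sub_const C).mul (hsin s)).add (((hz s).div_const ν).mul (hcos s))).congr_deriv ?_
    rw [hκ]
    field_simp
    ring
  refine ⟨F 0, G 0, fun s => ?_⟩
  have h1 : F 0 = F s := eq_of_hasDerivAt_zero isOpen_univ isPreconnected_univ (fun s _ => hFd s)
    (mem_univ 0) (mem_univ s)
  have h2 : G 0 = G s := eq_of_hasDerivAt_zero isOpen_univ isPreconnected_univ (fun s _ => hGd s)
    (mem_univ 0) (mem_univ s)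
  rw [h1, h2]
  have h3 := Real.sin_sq_add_cos_sq (ν * s)
  simp only [hF, hG]
  linear_combination (C - y s) * h3

theorem isLeast_period_harmonic {y z : ℝ → ℝ} {κ ν : ℝ} (hν : 0 < ν)
    (hy : ∀ s, HasDerivAt y (z s) s) (hz : ∀ s, HasDerivAt z (κ - ν ^ 2 * y s) s) :
    Function.Periodic y (2 * Real.pi / ν) ∧
    ((∃ s t, y s ≠ y t) → ∀ T, 0 < T → Function.Periodic y T → 2 * Real.pi / ν ≤ T) := by
  obtain ⟨a, b, hab⟩ := harmonic_solution hν hy hz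
  refine ⟨fun s => ?_, fun ⟨s, t, hne⟩ T hT hper => ?_⟩
  · rw [hab, hab]
    have : ν * (s + 2 * Real.pi / ν) = ν * s + 2 * Real.pi := by field_simp
    rw [this, Real.cos_add_two_pi, Real.sin_add_two_pi]
  · by_contra! hlt
    have hx : ν * T < 2 * Real.pi := by
      rw [lt_div_iff₀ hν] at hlt
      linarith
    have hx0 : 0 < ν * T := by positivity
    have e1 := hper 0
    have e2 := hper (Real.pi / 2 / ν)
    rw [hab, hab] at e1 e2
    have h2 : ν * (Real.pi / 2 / ν + T) = ν * T + Real.pi / 2 := by field_simp; ring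
    have h3 : ν * (Real.pi / 2 / ν) = Real.pi / 2 := by field_simp
    rw [h2, h3, Real.cos_add_pi_div_two, Real.sin_add_pi_div_two] at e2
    simp at e1 e2
    -- The conditions at phases 0 and `π / 2` say that the rotation by `ν T` fixes the vector of
    -- amplitudes. A nonzero vector is fixed only by a full turn.
    have h4 : (a ^ 2 + b ^ 2) * (1 - Real.cos (ν * T)) = 0 := by
      linear_combination -a * e1 - b * e2
    rcases mul_eq_zero.1 h4 with h | h
    · have ha : a = 0 := by nlinarith [sq_nonneg a, sq_nonneg b]
      have hb : b = 0 := by nlinarith [sq_nonneg a, sq_nonneg b]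
      exact hne (by rw [hab, hab, ha, hb]; ring)
    · have := (Real.cos_eq_one_iff_of_lt_of_lt (by linarith) hx).1 (by linarith)
      linarith

theorem sub_le_of_le_deriv {g g' : ℝ → ℝ} {r₀ q : ℝ} (hg : ∀ r ≤ r₀, HasDerivAt g (g' r) r)
    (hq : ∀ r ≤ r₀, q ≤ g' r) {r : ℝ} (hr : r ≤ r₀) : g r ≤ g r₀ - q * (r₀ - r) := by
  have hd : ∀ r ≤ r₀, HasDerivAt (fun r => g r - q * r) (g' r - q) r := fun r hr => by
    have := (hg r hr).sub ((hasDerivAt_id r).const_mul q)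
    exact this.congr_deriv (by simp)
  have hm : MonotoneOn (fun r => g r - q * r) (Iic r₀) := by
    refine monotoneOn_of_deriv_nonneg (convex_Iic r₀) (HasDerivAt.continuousOn hd)
      (fun x hx => (hd x (mem_Iic.1 (interior_subset hx))).differentiableAt.differentiableWithinAt)
      fun x hx => ?_
    rw [(hd x (mem_Iic.1 (interior_subset hx))).deriv]
    linarith [hq x (mem_Iic.1 (interior_subset hx))]
  have := hm hr (mem_Iic.2 le_rfl) hr
  simp only at this
  linarith

/-- The Bertrand coordinate leaves its domain in finite time in the direction in which `Q` stays
away from zero. -/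
theorem bertrand_incomplete {c d q r₀ : ℝ} {θ : ℝ → ℝ}
    (h : ∀ r ≤ r₀, HasDerivAt θ (bertrandQ c d (θ r)) r) (h0 : ∀ r ≤ r₀, θ r ≠ 0) (hq : 0 < q)
    (hQ : ∀ r ≤ r₀, q ≤ bertrandQ c d (θ r)) : False := by
  have hle : ∀ r ≤ r₀, θ r ≤ θ r₀ - q * (r₀ - r) := fun r hr => sub_le_of_le_deriv h hQ hr
  have hneg : ∀ r ≤ r₀, θ r < 0 := by
    intro r hr
    set r' := min r (r₀ - (|θ r₀| + 1) / q) with hr'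
    have hr'₀ : r' ≤ r₀ := (min_le_left _ _).trans hr
    have h1 : θ r' < 0 := by
      have := hle r' hr'₀
      have h2 : (|θ r₀| + 1) / q ≤ r₀ - r' := by linarith [min_le_right r (r₀ - (|θ r₀| + 1) / q)]
      rw [div_le_iff₀ hq] at h2
      nlinarith [le_abs_self (θ r₀)]
    by_contra hcon
    have hc : ContinuousOn θ (Iic r₀) := HasDerivAt.continuousOn h
    obtain ⟨z, hz, hz0⟩ := (convex_Iic r₀).isPreconnected.intermediate_value
      (mem_Iic.2 hr'₀) (mem_Iic.2 hr) hc (show (0 : ℝ) ∈ Icc _ _ from ⟨h1.le, not_lt.1 hcon⟩)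
    exact h0 z hz hz0
  -- Going left, `θ` tends to `-∞` at least linearly. Once `θ ≤ -M`, one has `Q ≥ θ² / 2`, so `-1 /
  -- θ` has derivative at least 1/2 and would lose its positive value within a finite distance.
  set M := 1 + 4 * (|c| + |d|) with hM
  have hM1 : 1 ≤ M := by linarith [abs_nonneg c, abs_nonneg d]
  set r₁ := r₀ - (M + |θ r₀|) / q with hr₁
  have hr₁₀ : r₁ ≤ r₀ := by
    have : 0 ≤ (M + |θ r₀|) / q := by positivity
    linarith
  have hbig : ∀ r ≤ r₁, θ r ≤ -M := fun r hr => by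
    have h1 := hle r (hr.trans hr₁₀)
    have h2 : (M + |θ r₀|) / q ≤ r₀ - r := by linarith
    rw [div_le_iff₀ hq] at h2
    nlinarith [le_abs_self (θ r₀)]
  have hd : ∀ r ≤ r₁, HasDerivAt (fun r => -(θ r)⁻¹) (bertrandQ c d (θ r) / θ r ^ 2) r := fun r hr => by
    have hr0 := hr.trans hr₁₀
    have := ((h r hr0).inv (h0 r hr0)).neg
    exact this.congr_deriv (by ring)
  have hhalf : ∀ r ≤ r₁, 1 / 2 ≤ bertrandQ c d (θ r) / θ r ^ 2 := fun r hr => by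
    have h1 := hbig r hr
    have hθ0 := h0 r (hr.trans hr₁₀)
    have h2 : M ≤ θ r ^ 2 := by nlinarith
    have h3 : 0 < θ r ^ 2 := by positivity
    rw [le_div_iff₀ h3, bertrandQ]
    have h4 : d / θ r ^ 2 ≤ |d| := by
      rw [div_le_iff₀ h3]
      nlinarith [le_abs_self d, abs_nonneg d]
    nlinarith [neg_abs_le c, abs_nonneg c, abs_nonneg d]
  set r₂ := r₁ - 2 * (-(θ r₁)⁻¹) with hr₂
  have hv1 : 0 < -(θ r₁)⁻¹ := by
    have := inv_lt_zero.2 (hneg r₁ hr₁₀)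
    linarith
  have hr₂₁ : r₂ ≤ r₁ := by linarith
  have h5 := sub_le_of_le_deriv hd hhalf hr₂₁
  have h6 := inv_lt_zero.2 (hneg r₂ (hr₂₁.trans hr₁₀))
  linarith

namespace RevSurface

variable {S : RevSurface} {V : ℝ → ℝ}

/-! ### Motions parametrized by the angle -/

/-- On a compact ring the angular speed `|K| / f²` is bounded away from zero, so the angle, oriented
by the sign `ε` of `K`, maps the time axis bijectively onto the line. Its inverse `σ` is the time as
a function of the angle. -/
theorem exists_time_of_angle {r φ : ℝ → ℝ} {K : ℝ} (hb : S.IsBoundedTrajectory V r φ)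
    (hk : S.HasMomentum univ r φ K) (hK : K ≠ 0) :
    ∃ (ε : ℝ) (σ : ℝ → ℝ), (ε = 1 ∨ ε = -1) ∧ (∀ t, σ (ε * φ t) = t) ∧ (∀ s, ε * φ (σ s) = s) ∧
      ∀ s, HasDerivAt σ (S.f (r (σ s)) ^ 2 / |K|) s := by
  obtain ⟨hm, r₁, hr₁, r₂, hr₂, hin⟩ := hb
  have hI : Icc r₁ r₂ ⊆ S.I := S.ordConnected_I.out hr₁ hr₂
  obtain ⟨M, hM⟩ := isCompact_Icc.exists_bound_of_continuousOn
    (((contDiffOn_f (S := S)).continuousOn.pow 2).mono hI)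
  have hMb : ∀ t, S.f (r t) ^ 2 ≤ M := fun t => (le_abs_self _).trans (hM _ (hin t))
  have hf : ∀ t, 0 < S.f (r t) := fun t => f_pos' (hI (hin t))
  have hM0 : 0 < M := (pow_pos (hf 0) 2).trans_le (hMb 0)
  have hKa : 0 < |K| := abs_pos.2 hK
  obtain ⟨ε, hε, hεK⟩ : ∃ ε : ℝ, (ε = 1 ∨ ε = -1) ∧ ε * K = |K| := by
    rcases abs_choice K with h | h
    · exact ⟨1, Or.inl rfl, by rw [h, one_mul]⟩
    · exact ⟨-1, Or.inr rfl, by rw [h, neg_one_mul]⟩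
  have hd : ∀ t, HasDerivAt (fun t => ε * φ t) (|K| / S.f (r t) ^ 2) t := fun t => by
    have := (hasDerivAt_momentum isOpen_univ hm hk (mem_univ t)).const_mul ε
    exact this.congr_deriv (by rw [← hεK]; ring)
  obtain ⟨σ, h1, h2, h3⟩ := exists_inverse_of_hasDerivAt (c := |K| / M) (by positivity) hd
    fun t => div_le_div_of_nonneg_left hKa.le (pow_pos (hf t) 2) (hMb t)
  exact ⟨ε, σ, hε, h2, h1, fun s => by simpa using h3 s⟩

/-- A bounded motion whose radius has a period in the angle commensurable with `2π` is closed. -/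
theorem isClosedOrbit_of_periodic {r φ σ : ℝ → ℝ} {K ε L : ℝ} (hb : S.IsBoundedTrajectory V r φ)
    (hK : K ≠ 0) (hε : ε = 1 ∨ ε = -1) (h1 : ∀ t, σ (ε * φ t) = t) (h2 : ∀ s, ε * φ (σ s) = s)
    (h3 : ∀ s, HasDerivAt σ (S.f (r (σ s)) ^ 2 / |K|) s) (hL : 0 < L)
    (hper : Function.Periodic (fun s => r (σ s)) L) {n m : ℕ} (hn : 0 < n)
    (hnm : n * L = 2 * Real.pi * m) : IsClosedOrbit r φ := by
  have hKa : 0 < |K| := abs_pos.2 hK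
  have hf : ∀ t, 0 < S.f (r t) := fun t => f_pos' (hb.1.mem t trivial)
  have hmono : StrictMono σ := strictMono_of_hasDerivAt_pos h3 fun s => by
    have := hf (σ s)
    positivity
  have hn' : (0 : ℝ) < n := by exact_mod_cast hn
  have hperN : ∀ s, r (σ (s + n * L)) = r (σ s) := hper.nat_mul n
  -- The time needed for the angle `n L` does not depend on the starting angle, since `dσ/ds`
  -- depends only on the periodic radius. As `n L = 2π m`, this time is a period of the motion on
  -- the surface.
  have hshift : ∀ s, σ (s + n * L) - σ s = σ (0 + n * L) - σ 0 := fun s => by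
    refine eq_of_hasDerivAt_zero isOpen_univ isPreconnected_univ
      (g := fun s => σ (s + n * L) - σ s) (fun s _ => ?_) (mem_univ s) (mem_univ 0)
    have e := ((h3 (s + n * L)).comp s ((hasDerivAt_id s).add_const (n * L))).sub (h3 s)
    refine e.congr_deriv ?_
    rw [hperN s]
    ring
  refine ⟨σ (0 + n * L) - σ 0, sub_pos.2 (hmono (by
    have := mul_pos hn' hL
    linarith)), fun t => ?_⟩
  set s := ε * φ t with hs
  have ht : σ s = t := h1 t
  have htT : t + (σ (0 + n * L) - σ 0) = σ (s + n * L) := by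
    have := hshift s
    linarith
  rw [htT]
  refine ⟨by rw [hperN, ht], ?_⟩
  have e1 := h2 (s + n * L)
  have hεε : ε * ε = 1 := by rcases hε with rfl | rfl <;> norm_num
  have e2 : φ (σ (s + n * L)) = φ t + ε * (2 * Real.pi * m) := by
    have : ε * (ε * φ (σ (s + n * L))) = ε * (s + n * L) := by rw [e1]
    rw [← mul_assoc, hεε, one_mul] at this
    rw [this, hs, hnm, mul_add, ← mul_assoc, hεε, one_mul]
  rw [e2, Real.Angle.angle_eq_iff_two_pi_dvd_sub]
  rcases hε with rfl | rfl
  · exact ⟨m, by push_cast; ring⟩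
  · exact ⟨-m, by push_cast; ring⟩

/-! ### Bertrand potentials -/

/-- A Bertrand potential on a Bertrand surface; `ς` is the sign of `θ`. -/
structure BertrandData (S : RevSurface) (μ c d : ℝ) (θ : ℝ → ℝ) (i : ℕ) (A B : ℝ) (V : ℝ → ℝ)
    (ς : ℝ) : Prop where
  pos : 0 < μ
  form : S.HasMetricForm μ c d θ
  crit : ∀ r ∈ S.I, deriv S.f r ≠ 0
  pot : S.IsBertrandPotential d θ i A B V
  sign : ς = 1 ∨ ς = -1
  abs_eq : ∀ r ∈ S.I, |θ r| = ς * θ r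

theorem HasMetricForm.exists_sign {μ c d : ℝ} {θ : ℝ → ℝ} (h : S.HasMetricForm μ c d θ) :
    ∃ ς : ℝ, (ς = 1 ∨ ς = -1) ∧ ∀ r ∈ S.I, |θ r| = ς * θ r := by
  by_cases hp : ∀ r ∈ S.I, 0 < θ r
  · exact ⟨1, Or.inl rfl, fun r hr => by rw [abs_of_pos (hp r hr), one_mul]⟩
  · push Not at hp
    obtain ⟨r₁, hr₁, hle⟩ := hp
    refine ⟨-1, Or.inr rfl, fun r hr => ?_⟩
    rw [neg_one_mul, abs_of_nonpos]
    by_contra hcon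
    obtain ⟨z, hz, hz0⟩ := S.isPreconnected_I.intermediate_value hr₁ hr h.1.continuousOn
      (show (0 : ℝ) ∈ Icc _ _ from ⟨hle, (not_le.1 hcon).le⟩)
    exact (h.2 z hz).1 hz0

namespace BertrandData

variable {μ c d A B ς : ℝ} {θ : ℝ → ℝ} {i : ℕ}

theorem sign_mul (h : S.BertrandData μ c d θ i A B V ς) : ς * ς = 1 := by
  rcases h.sign with h | h <;> rw [h] <;> norm_num

theorem abs_pos' (h : S.BertrandData μ c d θ i A B V ς) {r : ℝ} (hr : r ∈ S.I) : 0 < |θ r| :=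
  abs_pos.2 (h.form.spec h.pos hr).1

theorem Q_pos (h : S.BertrandData μ c d θ i A B V ς) {r : ℝ} (hr : r ∈ S.I) :
    0 < bertrandQ c d (θ r) := (h.form.spec h.pos hr).2.1

theorem d_eq_zero (h : S.BertrandData μ c d θ i A B V ς) (hi : i = 1) : d = 0 := by
  by_contra hd
  have := h.pot.2.1 hd
  omega

theorem hasDerivAt_abs (h : S.BertrandData μ c d θ i A B V ς) {r : ℝ} (hr : r ∈ S.I) :
    HasDerivAt (fun r => |θ r|) (ς * bertrandQ c d (θ r)) r := by
  refine ((h.form.spec h.pos hr).2.2.1.const_mul ς).congr_of_eventuallyEq ?_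
  filter_upwards [S.isOpen_I.mem_nhds hr] with s hs using h.abs_eq s hs

theorem coeff_pos (h : S.BertrandData μ c d θ i A B V ς) {r : ℝ} (hr : r ∈ S.I) :
    0 < A * (|θ r| ^ (i ^ 2) + d) := by
  rcases h.pot.1 with hi | hi
  · have hd := h.d_eq_zero hi
    subst hi
    simp only [hd]
    norm_num
    exact mul_pos (h.pot.2.2.1 rfl) (h.abs_pos' hr)
  · have := h.pot.2.2.2.1 hi r hr
    subst hi
    norm_num
    rwa [show |θ r| ^ 4 = θ r ^ 4 from (by norm_num : Even 4).pow_abs _]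

theorem potential_eq (h : S.BertrandData μ c d θ i A B V ς) {r : ℝ} (hr : r ∈ S.I) :
    (i = 1 → V r = -A * |θ r| + B) ∧ (i = 2 → V r = A / 2 * (|θ r| ^ 2)⁻¹ + B) := by
  have hV := h.pot.2.2.2.2 r hr
  constructor <;> rintro rfl
  · rw [hV]
    norm_num
  · rw [hV]
    norm_num
    ring

theorem hasDerivAt_potential (h : S.BertrandData μ c d θ i A B V ς) {r : ℝ} (hr : r ∈ S.I) :
    HasDerivAt V (-(A * (ς * bertrandQ c d (θ r))) / |θ r| ^ (i ^ 2 - 1)) r := by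
  have ht := h.abs_pos' hr
  have hd := h.hasDerivAt_abs hr
  rcases h.pot.1 with hi | hi
  · have e := ((hd.const_mul (-A)).add_const B)
    have e2 : HasDerivAt V (-A * (ς * bertrandQ c d (θ r))) r := e.congr_of_eventuallyEq (by
      filter_upwards [S.isOpen_I.mem_nhds hr] with s hs using (h.potential_eq hs).1 hi)
    refine e2.congr_deriv ?_
    subst hi
    simp
  · have e : HasDerivAt (fun r => A / 2 * (|θ r| ^ 2)⁻¹ + B) _ r :=
      (((hd.pow 2).inv (pow_pos ht 2).ne').const_mul (A / 2)).add_const B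
    have e2 := e.congr_of_eventuallyEq (f₁ := V) (by
      filter_upwards [S.isOpen_I.mem_nhds hr] with s hs using (h.potential_eq hs).2 hi)
    refine e2.congr_deriv ?_
    subst hi
    simp only [Pi.pow_apply]
    generalize |θ r| = u at ht ⊢
    norm_num
    field_simp

theorem smooth (h : S.BertrandData μ c d θ i A B V ς) : S.SmoothPotential V := by
  have ht : ContDiffOn ℝ ∞ (fun r => |θ r|) S.I :=
    (contDiffOn_const.mul h.form.1).congr h.abs_eq
  rcases h.pot.1 with hi | hi
  · exact ((contDiffOn_const.mul ht).add contDiffOn_const).congr fun r hr => (h.potential_eq hr).1 hi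
  · refine ((contDiffOn_const.mul ((ht.pow 2).inv fun r hr => ?_)).add contDiffOn_const).congr
      fun r hr => (h.potential_eq hr).2 hi
    exact (pow_pos (h.abs_pos' hr) 2).ne'

/-- The formula is the derivative of `1 / f² = μ² Q(θ)`. The exponent `i²` unites the two cases:
`|θ| ^ (i²) + d` is `|θ|` for `i = 1`, where `d = 0`, and `θ⁴ + d` for `i = 2`. -/
theorem deriv_f_eq (h : S.BertrandData μ c d θ i A B V ς) {r : ℝ} (hr : r ∈ S.I) :
    -deriv S.f r / S.f r ^ 3 =
      μ ^ 2 * (ς * bertrandQ c d (θ r)) * (|θ r| ^ (i ^ 2) + d) / |θ r| ^ (i ^ 2 - 1) := by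
  obtain ⟨h0, h1, h2, h3⟩ := h.form.spec h.pos hr
  have hf := f_pos' hr
  have hμ := h.pos
  have d1 := ((hasDerivAt_bertrandQ c d h0).comp r h2).const_mul (μ ^ 2)
  have d2 := (hasDerivAt_const r (1 : ℝ)).div ((hasDerivAt_f hr).pow 2) (by simp [hf.ne'])
  have d3 := d2.unique (d1.congr_of_eventuallyEq (by
    filter_upwards [S.isOpen_I.mem_nhds hr] with s hs
    have hfs := f_pos' hs
    simp only [Function.comp, (h.form.spec h.pos hs).2.2.2, Pi.div_apply, Pi.pow_apply]
    field_simp))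
  simp at d3
  have e1 : -deriv S.f r / S.f r ^ 3 = μ ^ 2 * bertrandQ c d (θ r) * ((θ r ^ 4 + d) / θ r ^ 3) := by
    field_simp at d3 ⊢
    linarith
  rw [e1]
  have ha := h.abs_eq r hr
  rcases h.pot.1 with hi | hi
  · rw [h.d_eq_zero hi, hi, ha]
    have e5 : (θ r ^ 4 + 0) / θ r ^ 3 = θ r := by
      field_simp
      simp
    rw [e5]
    norm_num
    linear_combination -(μ ^ 2 * bertrandQ c 0 (θ r) * θ r) * h.sign_mul
  · rw [hi]
    norm_num
    rw [show |θ r| ^ 4 = θ r ^ 4 from (by norm_num : Even 4).pow_abs _, ha]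
    have := h.sign
    rcases this with rfl | rfl
    · ring
    · field_simp

theorem effDeriv_eq (h : S.BertrandData μ c d θ i A B V ς) (K : ℝ) {r : ℝ} (hr : r ∈ S.I) :
    S.effDeriv V K r = ς * bertrandQ c d (θ r) / |θ r| ^ (i ^ 2 - 1) *
      (K ^ 2 * μ ^ 2 * (|θ r| ^ (i ^ 2) + d) - A) := by
  have e := h.deriv_f_eq hr
  rw [effDeriv, (h.hasDerivAt_potential hr).deriv]
  have e2 : K ^ 2 * deriv S.f r / S.f r ^ 3 = -(K ^ 2 * (-deriv S.f r / S.f r ^ 3)) := by ring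
  rw [e2, e]
  ring

theorem effDeriv_eq_zero_iff (h : S.BertrandData μ c d θ i A B V ς) (K : ℝ) {r : ℝ} (hr : r ∈ S.I) :
    S.effDeriv V K r = 0 ↔ K ^ 2 * μ ^ 2 * (|θ r| ^ (i ^ 2) + d) = A := by
  rw [h.effDeriv_eq K hr, mul_eq_zero, or_iff_right, sub_eq_zero]
  have h1 := h.Q_pos hr
  have h2 := h.abs_pos' hr
  have h3 : ς ≠ 0 := fun h0 => by simpa [h0] using h.sign_mul
  positivity

theorem ratio_pos (h : S.BertrandData μ c d θ i A B V ς) {r : ℝ} (hr : r ∈ S.I) :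
    0 < A / (|θ r| ^ (i ^ 2) + d) := by
  have h1 := h.coeff_pos hr
  have h2 : |θ r| ^ (i ^ 2) + d ≠ 0 := fun h0 => by simp [h0] at h1
  have : A / (|θ r| ^ (i ^ 2) + d) = A * (|θ r| ^ (i ^ 2) + d) / (|θ r| ^ (i ^ 2) + d) ^ 2 := by
    field_simp
  rw [this]
  positivity

theorem circularAt_iff (h : S.BertrandData μ c d θ i A B V ς) {r : ℝ} (hr : r ∈ S.I) (K : ℝ) :
    S.CircularAt V r K ↔ (K = 1 / μ * √(A / (|θ r| ^ (i ^ 2) + d)) ∨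
      K = -(1 / μ * √(A / (|θ r| ^ (i ^ 2) + d)))) := by
  have hp := h.ratio_pos hr
  have hμ := h.pos
  have h2 : |θ r| ^ (i ^ 2) + d ≠ 0 := fun h0 => by simp [h0] at hp
  rw [RevSurface.circularAt_iff h.smooth hr, h.effDeriv_eq_zero_iff K hr, ← sq_eq_sq_iff_eq_or_eq_neg,
    mul_pow, Real.sq_sqrt hp.le]
  constructor
  · rintro ⟨-, h3⟩
    rw [← h3]
    field_simp
  · intro h3
    refine ⟨?_, ?_⟩
    · rintro rfl
      have : 0 < (1 / μ) ^ 2 * (A / (|θ r| ^ (i ^ 2) + d)) := by positivity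
      rw [← h3] at this
      simp at this
    · rw [h3]
      field_simp

/-- At a circular orbit the last factor of `effDeriv_eq` vanishes, so only its derivative
contributes. The second derivative of the effective potential is `K² μ² i² Q²`, which is positive.
-/
theorem stronglyStableAt (h : S.BertrandData μ c d θ i A B V ς) {r K : ℝ} (hr : r ∈ S.I)
    (hK : S.CircularAt V r K) : S.StronglyStableAt V r K := by
  obtain ⟨hK0, hz⟩ := (RevSurface.circularAt_iff h.smooth hr).1 hK
  refine (stronglyStableAt_iff h.smooth hr).2 ⟨hK0, hz, ?_⟩
  rw [h.effDeriv_eq_zero_iff K hr] at hz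
  obtain ⟨h0, h1, h2, -⟩ := h.form.spec h.pos hr
  have ht := h.abs_pos' hr
  have hμ := h.pos
  have hi : 0 < i := by rcases h.pot.1 with h | h <;> omega
  have d1 : HasDerivAt (fun r => ς * bertrandQ c d (θ r) / |θ r| ^ (i ^ 2 - 1) *
      (K ^ 2 * μ ^ 2 * (|θ r| ^ (i ^ 2) + d) - A)) _ r :=
    ((((hasDerivAt_bertrandQ c d h0).comp r h2).const_mul ς).div
      ((h.hasDerivAt_abs hr).pow (i ^ 2 - 1)) (pow_pos ht _).ne').mul
    (((((h.hasDerivAt_abs hr).pow (i ^ 2)).add_const d).const_mul (K ^ 2 * μ ^ 2)).sub_const A)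
  have d2 := d1.congr_of_eventuallyEq (f₁ := S.effDeriv V K) (by
    filter_upwards [S.isOpen_I.mem_nhds hr] with s hs using h.effDeriv_eq K hs)
  rw [d2.deriv]
  simp only [Pi.pow_apply, Function.comp, Pi.div_apply, hz, sub_self, mul_zero, zero_add]
  have : ς * bertrandQ c d (θ r) / |θ r| ^ (i ^ 2 - 1) *
      (K ^ 2 * μ ^ 2 * (((i ^ 2 : ℕ) : ℝ) * |θ r| ^ (i ^ 2 - 1) * (ς * bertrandQ c d (θ r)))) =
      (ς * ς) * (K ^ 2 * μ ^ 2 * ((i ^ 2 : ℕ) : ℝ) * bertrandQ c d (θ r) ^ 2) := by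
    field_simp
  rw [this, h.sign_mul, one_mul]
  have : (0 : ℝ) < ((i ^ 2 : ℕ) : ℝ) := by positivity
  positivity

theorem exists_stronglyStableAt (h : S.BertrandData μ c d θ i A B V ς) {r : ℝ} (hr : r ∈ S.I) :
    ∃ K, S.StronglyStableAt V r K :=
  ⟨_, h.stronglyStableAt hr ((h.circularAt_iff hr _).2 (Or.inl rfl))⟩

theorem strictMonoOn_theta (h : S.BertrandData μ c d θ i A B V ς) : StrictMonoOn θ S.I := by
  refine strictMonoOn_of_deriv_pos S.ordConnected_I.convex h.form.1.continuousOn fun r hr => ?_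
  rw [S.isOpen_I.interior_eq] at hr
  exact (h.form.2 r hr).2.1

theorem injOn_abs_pow (h : S.BertrandData μ c d θ i A B V ς) : InjOn (fun r => |θ r| ^ i) S.I := by
  intro r hr s hs hrs
  have hi : i ≠ 0 := by rcases h.pot.1 with h | h <;> omega
  simp only at hrs
  rw [pow_left_inj₀ (abs_nonneg _) (abs_nonneg _) hi, h.abs_eq r hr, h.abs_eq s hs] at hrs
  have h3 : ς ≠ 0 := fun h0 => by simpa [h0] using h.sign_mul
  exact h.strictMonoOn_theta.injOn hr hs (mul_left_cancel₀ h3 hrs)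

/-- As a function of the angle, `|θ|` or `θ²` oscillates harmonically. -/
theorem harmonic (h : S.BertrandData μ c d θ i A B V ς) {r φ σ : ℝ → ℝ} {K : ℝ}
    (hb : S.IsBoundedTrajectory V r φ) (hk : S.HasMomentum univ r φ K) (hK : K ≠ 0)
    (hσ : ∀ s, HasDerivAt σ (S.f (r (σ s)) ^ 2 / |K|) s) :
    ∃ (z : ℝ → ℝ) (κ : ℝ), (∀ s, HasDerivAt (fun s => |θ (r (σ s))| ^ i) (z s) s) ∧
      ∀ s, HasDerivAt z (κ - (i / μ) ^ 2 * |θ (r (σ s))| ^ i) s := by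
  have hμ := h.pos
  have hKa : 0 < |K| := abs_pos.2 hK
  have hI : ∀ s, r (σ s) ∈ S.I := fun s => hb.1.mem _ trivial
  have hQf : ∀ s, bertrandQ c d (θ (r (σ s))) * S.f (r (σ s)) ^ 2 = 1 / μ ^ 2 := fun s => by
    rw [(h.form.spec hμ (hI s)).2.2.2]
    have := f_pos' (hI s)
    field_simp
  -- By `Q f² = 1 / μ²` this is the derivative of `|θ|` with respect to the oriented angle.
  set p : ℝ → ℝ := fun s => ς * deriv r (σ s) / (μ ^ 2 * |K|) with hp
  have ht : ∀ s, HasDerivAt (fun s => |θ (r (σ s))|) (p s) s := fun s => by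
    have e := ((h.hasDerivAt_abs (hI s)).comp (σ s)
      (hasDerivAt_radius isOpen_univ hb.1 (mem_univ (σ s)))).comp s (hσ s)
    refine e.congr_deriv ?_
    have := hQf s
    rw [hp]
    field_simp
    field_simp at this
    linear_combination ς * deriv r (σ s) * this
  have hpd : ∀ s, HasDerivAt p (-(K ^ 2 * μ ^ 2 * (|θ (r (σ s))| ^ (i ^ 2) + d) - A) /
      (|θ (r (σ s))| ^ (i ^ 2 - 1) * (μ ^ 4 * K ^ 2))) s := fun s => by
    have e := (((hasDerivAt_velocity isOpen_univ hb.1 hk (mem_univ (σ s))).comp s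
      (hσ s)).const_mul ς).div_const (μ ^ 2 * |K|)
    refine e.congr_deriv ?_
    have e1 := hQf s
    have e2 := h.sign_mul
    have e3 := h.abs_pos' (hI s)
    have e4 := sq_abs K
    rw [h.effDeriv_eq K (hI s)]
    set N := K ^ 2 * μ ^ 2 * (|θ (r (σ s))| ^ (i ^ 2) + d) - A with hN
    set T := |θ (r (σ s))| ^ (i ^ 2 - 1) with hT
    have hT0 : 0 < T := by positivity
    have : ς * (-(ς * bertrandQ c d (θ (r (σ s))) / T * N) * (S.f (r (σ s)) ^ 2 / |K|)) /
        (μ ^ 2 * |K|) = -((ς * ς) * (bertrandQ c d (θ (r (σ s))) * S.f (r (σ s)) ^ 2) * N) /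
          (T * μ ^ 2 * |K| ^ 2) := by
      field_simp
    rw [this, e1, e2, e4]
    field_simp
  rcases h.pot.1 with hi | hi
  · refine ⟨p, A / (μ ^ 4 * K ^ 2), fun s => ?_, fun s => ?_⟩
    · simp only [hi, pow_one]
      exact ht s
    · refine (hpd s).congr_deriv ?_
      rw [h.d_eq_zero hi, hi]
      simp
      field_simp
  -- For `i = 2` the second derivative of `θ²` is `2 (p² + |θ| p')`. With `p²` taken from the energy
  -- integral, all terms in `θ⁻²` cancel, and a linear equation of frequency `2 / μ` remains.
  · set E := deriv r (σ 0) ^ 2 / 2 + S.effPotential V K (r (σ 0)) with hE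
    have hen : ∀ s, μ ^ 4 * K ^ 2 * p s ^ 2 = 2 * (E - (A / 2 * (|θ (r (σ s))| ^ 2)⁻¹ + B) -
        K ^ 2 * μ ^ 2 / 2 * bertrandQ c d (θ (r (σ s)))) := fun s => by
      have e1 := energy_eq h.smooth isOpen_univ isPreconnected_univ hb.1 hk (mem_univ (σ 0))
        (mem_univ (σ s))
      rw [← hE, effPotential, (h.potential_eq (hI s)).2 hi] at e1
      have e2 := h.sign_mul
      have e3 : p s ^ 2 = (ς * ς) * deriv r (σ s) ^ 2 / (μ ^ 4 * |K| ^ 2) := by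
        rw [hp]
        ring
      rw [e3, e2, sq_abs, e1, (h.form.spec hμ (hI s)).2.2.2]
      have := f_pos' (hI s)
      field_simp
      ring
    refine ⟨fun s => 2 * (|θ (r (σ s))| * p s), (4 * (E - B) - 2 * K ^ 2 * μ ^ 2 * c) / (μ ^ 4 * K ^ 2),
      fun s => ?_, fun s => ?_⟩
    · simp only [hi]
      exact ((ht s).pow 2).congr_deriv (by simp; ring)
    · refine (((ht s).mul (hpd s)).const_mul 2).congr_deriv ?_
      have e1 := hen s
      have e3 := h.abs_pos' (hI s)
      rw [hi]
      norm_num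
      have e2 : p s * p s = 2 * (E - (A / 2 * (|θ (r (σ s))| ^ 2)⁻¹ + B) -
        K ^ 2 * μ ^ 2 / 2 * bertrandQ c d (θ (r (σ s)))) / (μ ^ 4 * K ^ 2) := by
        rw [← e1]
        field_simp
      rw [e2, bertrandQ, ← sq_abs (θ (r (σ s)))]
      field_simp
      ring

theorem periods (h : S.BertrandData μ c d θ i A B V ς) {r φ σ : ℝ → ℝ} {K : ℝ}
    (hb : S.IsBoundedTrajectory V r φ) (hk : S.HasMomentum univ r φ K) (hK : K ≠ 0)
    (hσ : ∀ s, HasDerivAt σ (S.f (r (σ s)) ^ 2 / |K|) s) :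
    Function.Periodic (fun s => r (σ s)) (2 * Real.pi * μ / i) ∧
    ((∃ s t, r (σ s) ≠ r (σ t)) → ∀ T, 0 < T → Function.Periodic (fun s => r (σ s)) T →
      2 * Real.pi * μ / i ≤ T) := by
  obtain ⟨z, κ, h1, h2⟩ := h.harmonic hb hk hK hσ
  have hI : ∀ s, r (σ s) ∈ S.I := fun s => hb.1.mem _ trivial
  have hi : (0 : ℝ) < i := by
    have : 0 < i := by rcases h.pot.1 with h | h <;> omega
    exact_mod_cast this
  have hμ := h.pos
  obtain ⟨h3, h4⟩ := isLeast_period_harmonic (by positivity) h1 h2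
  have e : 2 * Real.pi / (i / μ) = 2 * Real.pi * μ / i := by field_simp
  rw [e] at h3 h4
  refine ⟨fun s => h.injOn_abs_pow (hI _) (hI _) (h3 s), fun ⟨s, t, hne⟩ T hT hper => ?_⟩
  refine h4 ⟨s, t, fun heq => hne (h.injOn_abs_pow (hI _) (hI _) heq)⟩ T hT fun s => ?_
  have := hper s
  simp only at this ⊢
  rw [this]

theorem isClosedOrbit {q : ℚ} (h : S.BertrandData q c d θ i A B V ς) {r φ : ℝ → ℝ} {K : ℝ}
    (hb : S.IsBoundedTrajectory V r φ) (hk : S.HasMomentum univ r φ K) (hK : K ≠ 0) :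
    IsClosedOrbit r φ := by
  obtain ⟨ε, σ, hε, h1, h2, h3⟩ := exists_time_of_angle hb hk hK
  have hi : 0 < i := by rcases h.pot.1 with h | h <;> omega
  have hi' : (0 : ℝ) < i := by exact_mod_cast hi
  have hq : 0 < q := by exact_mod_cast h.pos
  have hq' := h.pos
  -- After `i * q.den` periods of length `2π q / i` the angle has advanced by `2π` times the
  -- numerator of `q`.
  refine isClosedOrbit_of_periodic hb hK hε h1 h2 h3 (by positivity) (h.periods hb hk hK h3).1
    (n := i * q.den) (m := q.num.natAbs) (Nat.mul_pos hi q.den_pos) ?_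
  have e1 : ((q.num.natAbs : ℕ) : ℝ) = q * q.den := by
    have e2 : ((q.num.natAbs : ℤ) : ℚ) = q.num := by
      rw [Int.natAbs_of_nonneg (Rat.num_nonneg.2 hq.le)]
    have e3 : ((q.num.natAbs : ℕ) : ℚ) = q * q.den := by
      rw [Rat.mul_den_eq_num, ← e2, Int.cast_natCast]
    exact_mod_cast congrArg (fun x : ℚ => (x : ℝ)) e3
  rw [e1]
  push_cast
  field_simp

theorem isClosing {q : ℚ} (h : S.BertrandData q c d θ i A B V ς) : S.IsClosing V := by
  refine ⟨?_, fun r φ K hb hk hK => h.isClosedOrbit hb hk hK⟩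
  obtain ⟨r₀, hr₀⟩ := S.nonempty_I
  obtain ⟨K, hK⟩ := h.exists_stronglyStableAt hr₀
  rw [← ofX_toX hr₀] at hK
  have hK0 := hK.2.1
  obtain ⟨h1, h2⟩ := (stronglyStableAt_ofX_iff h.smooth (toX_mem hr₀) hK0).1 hK
  obtain ⟨g, a₁, a₂, hX, w, -, -⟩ := exists_well_near h.smooth (toX_mem hr₀) h1 h2 one_pos
  obtain ⟨r, φ, ho, -⟩ := oscillation_of_well h.smooth hK0 w hX ⟨le_rfl, w.lt₁⟩ ⟨w.lt₂, le_rfl⟩ w.ends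
  exact ⟨r, φ, K, ho⟩

theorem isStronglyClosing {q : ℚ} (h : S.BertrandData q c d θ i A B V ς) : S.IsStronglyClosing V :=
  ⟨fun _ hr => h.exists_stronglyStableAt hr, fun _ _ _ _ => ⟨1, one_pos, fun _ _ _ hb hk hK _ _ =>
    h.isClosedOrbit hb hk hK⟩⟩

/-- The radius is a periodic function of the angle with minimal period `2πμ / i`. -/
theorem exists_periodic (h : S.BertrandData μ c d θ i A B V ς) {r φ : ℝ → ℝ} {K : ℝ}
    (ho : S.IsOscillation V r φ K) :
    ∃ ρ : ℝ → ℝ, (∀ t, r t = ρ (φ t)) ∧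
      IsLeast {T : ℝ | 0 < T ∧ Function.Periodic ρ T} (2 * Real.pi * μ / i) := by
  obtain ⟨hb, hk, hK, hnc⟩ := ho
  obtain ⟨ε, σ, hε, h1, h2, h3⟩ := exists_time_of_angle hb hk hK
  obtain ⟨hp, hmin⟩ := h.periods hb hk hK h3
  have hi : (0 : ℝ) < i := by
    have : 0 < i := by rcases h.pot.1 with h | h <;> omega
    exact_mod_cast this
  have hμ := h.pos
  have hne : ∃ s t, r (σ s) ≠ r (σ t) := by
    by_contra! hcon
    refine hnc (isCircularOrbit_of_const hb.1 hk hK (r₀ := r 0) fun t => ?_)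
    have := hcon (ε * φ t) (ε * φ 0)
    rwa [h1, h1] at this
  have hεε : ε * ε = 1 := by rcases hε with rfl | rfl <;> norm_num
  -- Reversing the orientation of the angle does not change the set of periods.
  have hiff : ∀ T, Function.Periodic (fun s => r (σ (ε * s))) T ↔
      Function.Periodic (fun s => r (σ s)) T := by
    intro T
    rcases hε with rfl | rfl
    · simp
    · constructor
      · intro hT s
        have := hT (-s - T)
        simp only [neg_mul, one_mul] at this
        rw [show -(-s - T) = s + T by ring, show -(-s - T + T) = s by ring] at this
        exact this.symm
      · intro hT s
        have := hT (-s - T)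
        simp only at this
        simp only [neg_mul, one_mul]
        rw [show -(s + T) = -s - T by ring, ← this]
        congr 2
        ring
  refine ⟨fun s => r (σ (ε * s)), fun t => by simp only [h1], ⟨by positivity, (hiff _).2 hp⟩,
    fun T hT => hmin hne T hT.1 ((hiff T).1 hT.2)⟩

end BertrandData

/-! ### The attracting centre -/

theorem tendsto_iInf_of_eventually_le {h : ℝ → EReal} {I : Set ℝ} {F : Filter ℝ}
    (h1 : ∀ᶠ r in F, r ∈ I) (h2 : ∀ r₁ ∈ I, ∀ᶠ r in F, h r ≤ h r₁) :
    Tendsto h F (𝓝 (⨅ r ∈ I, h r)) := by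
  refine tendsto_order.2 ⟨fun m hm => ?_, fun M hM => ?_⟩
  · filter_upwards [h1] with r hr using hm.trans_le (iInf₂_le r hr)
  · simp only [iInf_lt_iff] at hM
    obtain ⟨r₁, hr₁, h3⟩ := hM
    filter_upwards [h2 r₁ hr₁] with r hr using hr.trans_lt h3

theorem tendsto_iSup_of_eventually_le {h : ℝ → EReal} {I : Set ℝ} {F : Filter ℝ}
    (h1 : ∀ᶠ r in F, r ∈ I) (h2 : ∀ r₁ ∈ I, ∀ᶠ r in F, h r₁ ≤ h r) :
    Tendsto h F (𝓝 (⨆ r ∈ I, h r)) := by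
  refine tendsto_order.2 ⟨fun m hm => ?_, fun M hM => ?_⟩
  · simp only [lt_iSup_iff] at hm
    obtain ⟨r₁, hr₁, h3⟩ := hm
    filter_upwards [h2 r₁ hr₁] with r hr using h3.trans_le hr
  · filter_upwards [h1] with r hr using (le_iSup₂ (f := fun r (_ : r ∈ I) => h r) r hr).trans_lt hM

theorem not_tendsto_iInf {h : ℝ → EReal} {I : Set ℝ} {F : Filter ℝ} [F.NeBot] {r₁ r₂ : ℝ}
    (hr₁ : r₁ ∈ I) (h12 : h r₁ < h r₂) (h2 : ∀ᶠ r in F, h r₂ ≤ h r) :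
    ¬ Tendsto h F (𝓝 (⨅ r ∈ I, h r)) := fun ht =>
  absurd ((ge_of_tendsto ht h2).trans (iInf₂_le r₁ hr₁)) (not_le.2 h12)

theorem not_tendsto_iSup {h : ℝ → EReal} {I : Set ℝ} {F : Filter ℝ} [F.NeBot] {r₁ r₂ : ℝ}
    (hr₁ : r₁ ∈ I) (h12 : h r₂ < h r₁) (h2 : ∀ᶠ r in F, h r ≤ h r₂) :
    ¬ Tendsto h F (𝓝 (⨆ r ∈ I, h r)) := fun ht =>
  absurd ((le_iSup₂ (f := fun r (_ : r ∈ I) => h r) r₁ hr₁).trans (le_of_tendsto ht h2))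
    (not_le.2 h12)

theorem eventually_lt_of_left {e : ℝ} (he : (e : EReal) = S.a) {r₁ : ℝ} (hr₁ : r₁ ∈ S.I) :
    ∀ᶠ r in 𝓝[>] e, r ∈ S.I ∧ r < r₁ := by
  have h1 : e < r₁ := EReal.coe_lt_coe_iff.1 (he ▸ hr₁.1)
  filter_upwards [Ioo_mem_nhdsGT h1] with r hr
  exact ⟨⟨he ▸ EReal.coe_lt_coe_iff.2 hr.1, (EReal.coe_lt_coe_iff.2 hr.2).trans hr₁.2⟩, hr.2⟩

theorem eventually_gt_of_right {e : ℝ} (he : (e : EReal) = S.b) {r₁ : ℝ} (hr₁ : r₁ ∈ S.I) :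
    ∀ᶠ r in 𝓝[<] e, r ∈ S.I ∧ r₁ < r := by
  have h1 : r₁ < e := EReal.coe_lt_coe_iff.1 (he ▸ hr₁.2)
  filter_upwards [Ioo_mem_nhdsLT h1] with r hr
  exact ⟨⟨hr₁.1.trans (EReal.coe_lt_coe_iff.2 hr.1), he ▸ EReal.coe_lt_coe_iff.2 hr.2⟩, hr.1⟩

theorem exists_lt_in_I (S : RevSurface) : ∃ r₁ ∈ S.I, ∃ r₂ ∈ S.I, r₁ < r₂ := by
  obtain ⟨r, hr⟩ := S.nonempty_I
  obtain ⟨u, v, hu, hv, huv⟩ := exists_Icc_nhds S.isOpen_I hr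
  exact ⟨u, huv ⟨le_rfl, (hu.trans hv).le⟩, v, huv ⟨(hu.trans hv).le, le_rfl⟩, hu.trans hv⟩

theorem infAt_left_of_strictMonoOn {g : ℝ → ℝ} (hg : StrictMonoOn g S.I) {e : ℝ}
    (he : (e : EReal) = S.a) : S.InfAt g (𝓝[>] e) := by
  obtain ⟨r, hr⟩ := S.nonempty_I
  refine tendsto_iInf_of_eventually_le ((eventually_lt_of_left he hr).mono fun _ h => h.1)
    fun r₁ hr₁ => ?_
  filter_upwards [eventually_lt_of_left he hr₁] with r hr
  exact EReal.coe_le_coe_iff.2 (hg hr.1 hr₁ hr.2).le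

theorem not_infAt_right_of_strictMonoOn {g : ℝ → ℝ} (hg : StrictMonoOn g S.I) {e : ℝ}
    (he : (e : EReal) = S.b) : ¬ S.InfAt g (𝓝[<] e) := by
  obtain ⟨r₁, hr₁, r₂, hr₂, h12⟩ := S.exists_lt_in_I
  refine not_tendsto_iInf hr₁ (EReal.coe_lt_coe_iff.2 (hg hr₁ hr₂ h12)) ?_
  filter_upwards [eventually_gt_of_right he hr₂] with r hr
  exact EReal.coe_le_coe_iff.2 (hg hr₂ hr.1 hr.2).le

theorem infAt_right_of_strictAntiOn {g : ℝ → ℝ} (hg : StrictAntiOn g S.I) {e : ℝ}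
    (he : (e : EReal) = S.b) : S.InfAt g (𝓝[<] e) := by
  obtain ⟨r, hr⟩ := S.nonempty_I
  refine tendsto_iInf_of_eventually_le ((eventually_gt_of_right he hr).mono fun _ h => h.1)
    fun r₁ hr₁ => ?_
  filter_upwards [eventually_gt_of_right he hr₁] with r hr
  exact EReal.coe_le_coe_iff.2 (hg hr₁ hr.1 hr.2).le

theorem not_infAt_left_of_strictAntiOn {g : ℝ → ℝ} (hg : StrictAntiOn g S.I) {e : ℝ}
    (he : (e : EReal) = S.a) : ¬ S.InfAt g (𝓝[>] e) := by
  obtain ⟨r₁, hr₁, r₂, hr₂, h12⟩ := S.exists_lt_in_I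
  refine not_tendsto_iInf hr₂ (EReal.coe_lt_coe_iff.2 (hg hr₁ hr₂ h12)) ?_
  filter_upwards [eventually_lt_of_left he hr₁] with r hr
  exact EReal.coe_le_coe_iff.2 (hg hr.1 hr₁ hr.2).le

theorem supAt_left_of_strictAntiOn {g : ℝ → ℝ} (hg : StrictAntiOn g S.I) {e : ℝ}
    (he : (e : EReal) = S.a) : S.SupAt g (𝓝[>] e) := by
  obtain ⟨r, hr⟩ := S.nonempty_I
  refine tendsto_iSup_of_eventually_le ((eventually_lt_of_left he hr).mono fun _ h => h.1)
    fun r₁ hr₁ => ?_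
  filter_upwards [eventually_lt_of_left he hr₁] with r hr
  exact EReal.coe_le_coe_iff.2 (hg hr.1 hr₁ hr.2).le

theorem not_supAt_right_of_strictAntiOn {g : ℝ → ℝ} (hg : StrictAntiOn g S.I) {e : ℝ}
    (he : (e : EReal) = S.b) : ¬ S.SupAt g (𝓝[<] e) := by
  obtain ⟨r₁, hr₁, r₂, hr₂, h12⟩ := S.exists_lt_in_I
  refine not_tendsto_iSup hr₁ (EReal.coe_lt_coe_iff.2 (hg hr₁ hr₂ h12)) ?_
  filter_upwards [eventually_gt_of_right he hr₂] with r hr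
  exact EReal.coe_le_coe_iff.2 (hg hr₂ hr.1 hr.2).le

theorem supAt_right_of_strictMonoOn {g : ℝ → ℝ} (hg : StrictMonoOn g S.I) {e : ℝ}
    (he : (e : EReal) = S.b) : S.SupAt g (𝓝[<] e) := by
  obtain ⟨r, hr⟩ := S.nonempty_I
  refine tendsto_iSup_of_eventually_le ((eventually_gt_of_right he hr).mono fun _ h => h.1)
    fun r₁ hr₁ => ?_
  filter_upwards [eventually_gt_of_right he hr₁] with r hr
  exact EReal.coe_le_coe_iff.2 (hg hr₁ hr.1 hr.2).le

theorem not_supAt_left_of_strictMonoOn {g : ℝ → ℝ} (hg : StrictMonoOn g S.I) {e : ℝ}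
    (he : (e : EReal) = S.a) : ¬ S.SupAt g (𝓝[>] e) := by
  obtain ⟨r₁, hr₁, r₂, hr₂, h12⟩ := S.exists_lt_in_I
  refine not_tendsto_iSup hr₂ (EReal.coe_lt_coe_iff.2 (hg hr₁ hr₂ h12)) ?_
  filter_upwards [eventually_lt_of_left he hr₁] with r hr
  exact EReal.coe_le_coe_iff.2 (hg hr.1 hr₁ hr.2).le

theorem strictMonoOn_I {g g' : ℝ → ℝ} (hg : ∀ r ∈ S.I, HasDerivAt g (g' r) r)
    (hpos : ∀ r ∈ S.I, 0 < g' r) : StrictMonoOn g S.I := by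
  refine strictMonoOn_of_deriv_pos S.ordConnected_I.convex (HasDerivAt.continuousOn hg)
    fun r hr => ?_
  rw [S.isOpen_I.interior_eq] at hr
  rw [(hg r hr).deriv]
  exact hpos r hr

theorem strictAntiOn_I {g g' : ℝ → ℝ} (hg : ∀ r ∈ S.I, HasDerivAt g (g' r) r)
    (hneg : ∀ r ∈ S.I, g' r < 0) : StrictAntiOn g S.I := by
  refine strictAntiOn_of_deriv_neg S.ordConnected_I.convex (HasDerivAt.continuousOn hg)
    fun r hr => ?_
  rw [S.isOpen_I.interior_eq] at hr
  rw [(hg r hr).deriv]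
  exact hneg r hr

namespace BertrandData

variable {μ c d A B ς : ℝ} {θ : ℝ → ℝ} {i : ℕ}

/-- The signs of the derivatives of `f`, `A |θ|` and `V`. -/
theorem deriv_signs (h : S.BertrandData μ c d θ i A B V ς) {r : ℝ} (hr : r ∈ S.I) :
    deriv S.f r * (A * (ς * bertrandQ c d (θ r))) < 0 ∧
      0 < deriv S.f r * (-(A * (ς * bertrandQ c d (θ r))) / |θ r| ^ (i ^ 2 - 1)) := by
  have hf := f_pos' hr
  have ht := h.abs_pos' hr
  have hμ := h.pos
  have hQ := h.Q_pos hr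
  have hc := h.coeff_pos hr
  have e := h.deriv_f_eq hr
  have hT : 0 < |θ r| ^ (i ^ 2 - 1) := by positivity
  have e1 : deriv S.f r * (A * (ς * bertrandQ c d (θ r))) =
      -(S.f r ^ 3 * μ ^ 2 * (ς * ς) * bertrandQ c d (θ r) ^ 2 * (A * (|θ r| ^ (i ^ 2) + d)) /
        |θ r| ^ (i ^ 2 - 1)) := by
    have e2 : deriv S.f r = -(S.f r ^ 3 * (-deriv S.f r / S.f r ^ 3)) := by field_simp
    rw [e2, e]
    ring
  have e3 : deriv S.f r * (A * (ς * bertrandQ c d (θ r))) < 0 := by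
    rw [e1, h.sign_mul]
    have : 0 < S.f r ^ 3 * μ ^ 2 * 1 * bertrandQ c d (θ r) ^ 2 * (A * (|θ r| ^ (i ^ 2) + d)) /
        |θ r| ^ (i ^ 2 - 1) := by positivity
    linarith
  refine ⟨e3, ?_⟩
  have e4 : deriv S.f r * (-(A * (ς * bertrandQ c d (θ r))) / |θ r| ^ (i ^ 2 - 1)) =
      -(deriv S.f r * (A * (ς * bertrandQ c d (θ r)))) / |θ r| ^ (i ^ 2 - 1) := by ring
  rw [e4]
  exact div_pos (by linarith) hT

/-- The derivative of `f` has no zeros, hence a constant sign; `A |θ|` varies in the opposite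
direction and `V` in the same one. -/
theorem monotonicity (h : S.BertrandData μ c d θ i A B V ς) :
    (StrictMonoOn S.f S.I ∧ StrictAntiOn (fun r => A * |θ r|) S.I ∧ StrictMonoOn V S.I) ∨
    (StrictAntiOn S.f S.I ∧ StrictMonoOn (fun r => A * |θ r|) S.I ∧ StrictAntiOn V S.I) := by
  have hfd : ∀ r ∈ S.I, HasDerivAt S.f (deriv S.f r) r := fun r hr => hasDerivAt_f hr
  have htd : ∀ r ∈ S.I, HasDerivAt (fun r => A * |θ r|) (A * (ς * bertrandQ c d (θ r))) r :=
    fun r hr => (h.hasDerivAt_abs hr).const_mul A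
  have hVd := fun r (hr : r ∈ S.I) => h.hasDerivAt_potential hr
  by_cases hp : ∀ r ∈ S.I, 0 < deriv S.f r
  · left
    exact ⟨strictMonoOn_I hfd hp, strictAntiOn_I htd fun r hr => by
        have := (h.deriv_signs hr).1
        exact neg_of_mul_neg_right this (hp r hr).le, strictMonoOn_I hVd fun r hr =>
        pos_of_mul_pos_right (h.deriv_signs hr).2 (hp r hr).le⟩
  · right
    push Not at hp
    obtain ⟨r₁, hr₁, hle⟩ := hp
    have hn : ∀ r ∈ S.I, deriv S.f r < 0 := fun r hr => by
      by_contra hcon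
      obtain ⟨z, hz, hz0⟩ := S.isPreconnected_I.intermediate_value hr₁ hr
        (contDiffOn_deriv S.isOpen_I (contDiffOn_f (S := S))).continuousOn
        (show (0 : ℝ) ∈ Icc _ _ from ⟨hle, not_lt.1 hcon⟩)
      exact h.crit z hz hz0
    refine ⟨strictAntiOn_I hfd hn, strictMonoOn_I htd fun r hr => ?_, strictAntiOn_I hVd fun r hr => ?_⟩
    · by_contra hcon
      have := (h.deriv_signs hr).1
      linarith [mul_nonneg_of_nonpos_of_nonpos (hn r hr).le (not_lt.1 hcon)]
    · by_contra hcon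
      have := (h.deriv_signs hr).2
      linarith [mul_nonpos_of_nonpos_of_nonneg (hn r hr).le (not_lt.1 hcon)]

/-- Towards the end where the monotone function `f` decreases, `Q = 1 / (μ² f²)` stays bounded away
from zero. By `bertrand_incomplete` the coordinate `θ` cannot exist on an infinite interval there,
so this end is finite. -/
theorem exists_centre (h : S.BertrandData μ c d θ i A B V ς) :
    ∃ (e : ℝ) (F : Filter ℝ), S.IsBoundaryCircle e F ∧ S.InfAt S.f F := by
  obtain ⟨r₀, hr₀⟩ := S.nonempty_I
  have hμ := h.pos
  have hQle : ∀ r ∈ S.I, S.f r ≤ S.f r₀ → bertrandQ c d (θ r₀) ≤ bertrandQ c d (θ r) := by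
    intro r hr hle
    rw [(h.form.spec hμ hr).2.2.2, (h.form.spec hμ hr₀).2.2.2]
    have h1 := f_pos' hr
    have h2 := f_pos' hr₀
    refine one_div_le_one_div_of_le (by positivity) ?_
    gcongr
  rcases h.monotonicity with ⟨hf, -, -⟩ | ⟨hf, -, -⟩
  · have hbot : S.a ≠ ⊥ := by
      intro hbot
      have hI : ∀ r ≤ r₀, r ∈ S.I := fun r hr =>
        ⟨hbot ▸ EReal.bot_lt_coe r, (EReal.coe_le_coe_iff.2 hr).trans_lt hr₀.2⟩
      exact bertrand_incomplete (fun r hr => (h.form.spec hμ (hI r hr)).2.2.1)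
        (fun r hr => (h.form.spec hμ (hI r hr)).1) (h.Q_pos hr₀)
        fun r hr => hQle r (hI r hr) (hf.monotoneOn (hI r hr) hr₀ hr)
    have htop : S.a ≠ ⊤ := (S.a_lt_b.trans_le le_top).ne
    have he : ((S.a.toReal : ℝ) : EReal) = S.a := EReal.coe_toReal htop hbot
    exact ⟨S.a.toReal, 𝓝[>] S.a.toReal, Or.inl ⟨he, rfl⟩, infAt_left_of_strictMonoOn hf he⟩
  · have htop : S.b ≠ ⊤ := by
      intro htop
      have hI : ∀ r ≤ -r₀, -r ∈ S.I := fun r hr =>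
        ⟨hr₀.1.trans_le (EReal.coe_le_coe_iff.2 (by linarith)), htop ▸ EReal.coe_lt_top _⟩
      have hQn : ∀ x, bertrandQ c d (-x) = bertrandQ c d x := fun x => by simp [bertrandQ]
      -- `Q` is even, so reflecting both `r` and `θ` preserves the differential equation and reduces
      -- the right end to the left one.
      refine bertrand_incomplete (θ := fun r => -θ (-r)) (c := c) (d := d) (r₀ := -r₀)
        (fun r hr => ?_) (fun r hr => neg_ne_zero.2 (h.form.spec hμ (hI r hr)).1) (h.Q_pos hr₀)
        fun r hr => ?_
      · have := (((h.form.spec hμ (hI r hr)).2.2.1).comp r (hasDerivAt_neg r)).neg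
        refine this.congr_deriv ?_
        rw [hQn]
        ring
      · rw [hQn]
        exact hQle _ (hI r hr) (hf.antitoneOn hr₀ (hI r hr) (by linarith))
    have hbot : S.b ≠ ⊥ := (bot_le.trans_lt S.a_lt_b).ne'
    have he : ((S.b.toReal : ℝ) : EReal) = S.b := EReal.coe_toReal htop hbot
    exact ⟨S.b.toReal, 𝓝[<] S.b.toReal, Or.inr ⟨he, rfl⟩, infAt_right_of_strictAntiOn hf he⟩

theorem centre_iff (h : S.BertrandData μ c d θ i A B V ς) {e : ℝ} {F : Filter ℝ}
    (hF : S.IsBoundaryCircle e F) :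
    (S.InfAt S.f F ↔ S.SupAt (fun r => A * |θ r|) F) ∧ (S.InfAt S.f F ↔ S.InfAt V F) := by
  rcases h.monotonicity with ⟨h1, h2, h3⟩ | ⟨h1, h2, h3⟩ <;> rcases hF with ⟨he, rfl⟩ | ⟨he, rfl⟩
  · exact ⟨iff_of_true (infAt_left_of_strictMonoOn h1 he) (supAt_left_of_strictAntiOn h2 he),
      iff_of_true (infAt_left_of_strictMonoOn h1 he) (infAt_left_of_strictMonoOn h3 he)⟩
  · exact ⟨iff_of_false (not_infAt_right_of_strictMonoOn h1 he) (not_supAt_right_of_strictAntiOn h2 he),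
      iff_of_false (not_infAt_right_of_strictMonoOn h1 he) (not_infAt_right_of_strictMonoOn h3 he)⟩
  · exact ⟨iff_of_false (not_infAt_left_of_strictAntiOn h1 he) (not_supAt_left_of_strictMonoOn h2 he),
      iff_of_false (not_infAt_left_of_strictAntiOn h1 he) (not_infAt_left_of_strictAntiOn h3 he)⟩
  · exact ⟨iff_of_true (infAt_right_of_strictAntiOn h1 he) (supAt_right_of_strictMonoOn h2 he),
      iff_of_true (infAt_right_of_strictAntiOn h1 he) (infAt_right_of_strictAntiOn h3 he)⟩

end BertrandData

end RevSurface

/-! ### The classification -/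

theorem IsEquivariantIsometricEmbedding.congr_factor {I J : Set ℝ} {f g : ℝ → ℝ} {l l' : ℝ}
    {F : ℝ × Real.Angle → ℝ × Real.Angle} (hl : l ^ 2 = l' ^ 2)
    (h : IsEquivariantIsometricEmbedding I f l J g F) :
    IsEquivariantIsometricEmbedding I f l' J g F :=
  ⟨h.mapsTo, h.injOn, h.equivariant, hl ▸ h.isometric⟩

/-- A scale section meets each class, at a point `(l⁻² c, l⁻⁴ d)` with `l` of prescribed sign. -/
theorem IsScaleSection.exists_scale {γ : ℝ → ℝ × ℝ} (hγ : IsScaleSection γ) (c d : ℝ) {η : ℝ}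
    (hη : η = 1 ∨ η = -1) :
    ∃ (τ l : ℝ), τ ∈ Icc 0 (2 * Real.pi) ∧ 0 < η * l ∧ c = l ^ 2 * (γ τ).1 ∧ d = l ^ 4 * (γ τ).2 ∧
      (γ τ = (0, 0) → |l| = 1) := by
  obtain ⟨p, ⟨⟨τ, hτ, rfl⟩, s, hs, hp⟩, -⟩ := hγ c d
  have hη2 : η * η = 1 := by rcases hη with rfl | rfl <;> norm_num
  -- The class of the origin is fixed by every dilation, so there `|l| = 1` is imposed. In all other
  -- classes `l = η / √s`, because `c` scales with `l²`.
  by_cases h0 : γ τ = (0, 0)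
  · rw [h0, Prod.mk.injEq] at hp
    have hc : c = 0 := (mul_eq_zero.1 hp.1.symm).resolve_left hs.ne'
    have hd : d = 0 := (mul_eq_zero.1 hp.2.symm).resolve_left (pow_pos hs 2).ne'
    refine ⟨τ, η, hτ, hη2 ▸ one_pos, by simp [h0, hc], by simp [h0, hd], fun _ => ?_⟩
    rcases hη with rfl | rfl <;> simp
  · have hq := Real.sqrt_pos.2 hs
    have hqq := Real.sq_sqrt hs.le
    have hl2 : (η * (√s)⁻¹) ^ 2 = s⁻¹ := by
      rw [mul_pow, inv_pow, hqq, sq, hη2, one_mul]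
    refine ⟨τ, η * (√s)⁻¹, hτ, ?_, ?_, ?_, fun h => absurd h h0⟩
    · rw [← mul_assoc, hη2, one_mul]
      positivity
    · rw [hl2, hp]
      field_simp
    · rw [show (4 : ℕ) = 2 * 2 from rfl, pow_mul, hl2, hp]
      field_simp

namespace RevSurface

variable {S : RevSurface} {R : ℝ → ℝ → ℝ → ℝ} {γ : ℝ → ℝ × ℝ}

theorem IsBertrandRep.hasMetricForm (hR : IsBertrandPrimitive R) {μ : ℚ} {c d r₀ η : ℝ} {k : ℕ}
    {θ : ℝ → ℝ} (h : S.IsBertrandRep R μ c d r₀ η k θ) : S.HasMetricForm (μ : ℝ) c d θ := by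
  have h2 : η ^ 2 = 1 := by rcases h.2.1 with h | h <;> norm_num [h]
  have h4 : η ^ 4 = 1 := by rcases h.2.1 with h | h <;> norm_num [h]
  have := h.scaledRep.hasMetricForm hR
  rw [h2, h4, one_mul, one_mul] at this
  exact this.congr h.scaledRep.1 fun r hr => (h.2.2.2 r hr).2.2

theorem HasMetricForm.exists_bertrandRep (hR : IsBertrandPrimitive R)
    (hf : ∀ r ∈ S.I, deriv S.f r ≠ 0) {μ : ℚ} {c d : ℝ} {θ : ℝ → ℝ} (hμ : 0 < μ)
    (h : S.HasMetricForm (μ : ℝ) c d θ) :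
    ∃ (r₀ η : ℝ) (k : ℕ), S.IsBertrandRep R μ c d r₀ η k θ := by
  have hμ' : (0 : ℝ) < μ := by exact_mod_cast hμ
  obtain ⟨ς, hς, habs⟩ := h.exists_sign
  have h2 : (-ς) ^ 2 = 1 := by rcases hς with h | h <;> norm_num [h]
  have h4 : (-ς) ^ 4 = 1 := by rcases hς with h | h <;> norm_num [h]
  have h1 : |-ς| = 1 := by rcases hς with h | h <;> norm_num [h]
  -- Standard coordinates on Bertrand surfaces are negative, so the reflection must have the sign
  -- opposite to that of `θ`.
  obtain ⟨r₀, k, hrep, hθ⟩ := HasMetricForm.exists_scaledRep (l := -ς) (c := c) (d := d) hR hf hμ'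
    (by rwa [h2, h4, one_mul, one_mul]) fun r hr => by
      have := abs_pos.2 (h.2 r hr).1
      rw [habs r hr] at this
      linarith
  refine ⟨r₀, -ς, k, hμ, ?_, hrep.2.2.1, fun r hr => ⟨(hrep.2.2.2 r hr).1, ?_, hθ r hr⟩⟩
  · rcases hς with h | h <;> simp [h]
  · have := (hrep.2.2.2 r hr).2
    rwa [h1, mul_one] at this

theorem HasMetricForm.exists_normalizedRep (hR : IsBertrandPrimitive R) (hγ : IsScaleSection γ)
    (hf : ∀ r ∈ S.I, deriv S.f r ≠ 0) {μ : ℚ} {c d : ℝ} {θ : ℝ → ℝ} (hμ : 0 < μ)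
    (h : S.HasMetricForm (μ : ℝ) c d θ) :
    ∃ (l τ r₀ : ℝ) (k : ℕ), S.IsNormalizedRep R γ μ l τ r₀ k := by
  have hμ' : (0 : ℝ) < μ := by exact_mod_cast hμ
  obtain ⟨ς, hς, habs⟩ := h.exists_sign
  obtain ⟨τ, l, hτ, hl, rfl, rfl, hl1⟩ := hγ.exists_scale c d (η := -ς)
    (by rcases hς with h | h <;> simp [h])
  obtain ⟨r₀, k, hrep, -⟩ := HasMetricForm.exists_scaledRep hR hf hμ' h fun r hr => by
    have := abs_pos.2 (h.2 r hr).1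
    rw [habs r hr] at this
    rcases hς with rfl | rfl <;> nlinarith
  exact ⟨l, τ, r₀, k, ⟨hμ, hrep.2.1, hτ, hrep.2.2.1, hl1⟩, hrep.2.2.2⟩

theorem exists_bertrandRep_iff_embedsInBertrand {μ : ℚ} {c d r₀ η : ℝ} {k : ℕ} :
    (∃ θ : ℝ → ℝ, S.IsBertrandRep R μ c d r₀ η k θ) ↔ S.EmbedsInBertrand R μ c d r₀ η k := by
  have key : 0 < μ → (η = 1 ∨ η = -1) → (k = 1 ∨ k = bertrandCount d) →
      ((∀ r ∈ S.I, η * (r - r₀) ∈ bertrandRange R c d k ∧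
        S.f r = 1 / (μ : ℝ) * bertrandF R c d k (η * (r - r₀))) ↔
      IsEquivariantIsometricEmbedding S.I S.f 1 (bertrandRange R c d k)
        (fun x => 1 / (μ : ℝ) * bertrandF R c d k x) (fun p => (η * (p.1 - r₀), p.2))) := by
    intro hμ hη hk
    have h0 : η ≠ 0 := by rcases hη with h | h <;> norm_num [h]
    have h1 : |η| = 1 := by rcases hη with h | h <;> norm_num [h]
    have h2 : η ^ 2 = 1 ^ 2 := by rcases hη with h | h <;> norm_num [h]
    have := scaledRep_iff_embedding (S := S) (R := R) (c := c) (r₀ := r₀)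
      (show (0 : ℝ) < μ by exact_mod_cast hμ) h0 hk
    rw [h1, mul_one] at this
    exact this.trans ⟨fun h => h.congr_factor h2, fun h => h.congr_factor h2.symm⟩
  constructor
  · rintro ⟨θ, hμ, hη, hk, h⟩
    exact ⟨hμ, hη, hk, (key hμ hη hk).1 fun r hr => ⟨(h r hr).1, (h r hr).2.1⟩⟩
  · rintro ⟨hμ, hη, hk, h⟩
    have := (key hμ hη hk).2 h
    exact ⟨fun r => η * bertrandTheta R c d k (η * (r - r₀)), hμ, hη, hk,
      fun r hr => ⟨(this r hr).1, (this r hr).2, rfl⟩⟩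

theorem isNormalizedRep_iff_embedsInNormalized {μ : ℚ} {l τ r₀ : ℝ} {k : ℕ} :
    S.IsNormalizedRep R γ μ l τ r₀ k ↔ S.EmbedsInNormalized R γ μ l τ r₀ k :=
  and_congr_right fun h =>
    scaledRep_iff_embedding (by exact_mod_cast h.1) h.2.1 h.2.2.2.1

/-- The shift in a representation is determined by the other parameters. -/
theorem ScaledRep.shift_unique (hR : IsBertrandPrimitive R) {μ l c d r₀ μ' r₀' : ℝ} {k k' : ℕ}
    (h : S.ScaledRep R μ l c d r₀ k) (h' : S.ScaledRep R μ' l c d r₀' k') : r₀ = r₀' := by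
  obtain ⟨rb, hrb⟩ := S.nonempty_I
  have e := (h.unique hR h').2.2.2.2.2 rb hrb
  have e1 := (h.mem hrb).2
  rw [mul_left_cancel₀ h.2.1 e, (h'.mem hrb).2] at e1
  linarith [mul_left_cancel₀ h.2.1 e1]

theorem eq_of_sign {η η' : ℝ} (h : η = 1 ∨ η = -1) (h' : η' = 1 ∨ η' = -1) (hp : 0 < η * η') :
    η = η' := by
  rcases h with rfl | rfl <;> rcases h' with rfl | rfl <;> first | rfl | norm_num at hp

theorem IsBertrandRep.unique (hR : IsBertrandPrimitive R) {μ μ' : ℚ}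
    {c d r₀ η c' d' r₀' η' : ℝ} {k k' : ℕ} {θ θ' : ℝ → ℝ}
    (h : S.IsBertrandRep R μ c d r₀ η k θ) (h' : S.IsBertrandRep R μ' c' d' r₀' η' k' θ') :
    μ = μ' ∧ c = c' ∧ d = d' ∧ r₀ = r₀' ∧ η = η' ∧ k = k' ∧ EqOn θ θ' S.I := by
  obtain ⟨e1, e2, e3, e4⟩ := (h.hasMetricForm hR).unique h.scaledRep.1 h'.scaledRep.1
    (h'.hasMetricForm hR)
  obtain ⟨-, -, -, e5, e6, -⟩ := h.scaledRep.unique hR h'.scaledRep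
  have e7 := eq_of_sign h.2.1 h'.2.1 e5
  subst e2 e3 e7
  exact ⟨by exact_mod_cast e1, rfl, rfl, h.scaledRep.shift_unique hR h'.scaledRep, rfl, e6, e4⟩

theorem IsNormalizedRep.unique (hR : IsBertrandPrimitive R) (hγ : IsScaleSection γ) {μ μ' : ℚ}
    {l τ r₀ l' τ' r₀' : ℝ} {k k' : ℕ} (h : S.IsNormalizedRep R γ μ l τ r₀ k)
    (h' : S.IsNormalizedRep R γ μ' l' τ' r₀' k') :
    μ = μ' ∧ l = l' ∧ γ τ = γ τ' ∧ (InjOn γ (Icc 0 (2 * Real.pi)) → τ = τ') ∧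
      r₀ = r₀' ∧ k = k' := by
  have s := h.scaledRep
  have s' := h'.scaledRep
  obtain ⟨e1, e2, e3, e4, e5, -⟩ := s.unique hR s'
  obtain ⟨⟨-, hl, hτ, -, hl1⟩, -⟩ := h
  obtain ⟨⟨-, hl', hτ', -, hl1'⟩, -⟩ := h'
  -- Both points of the curve lie in the same scaling class, with ratio `(l / l')²`, and a section
  -- meets each class once.
  have eγ : γ τ = γ τ' := by
    obtain ⟨p, -, hp⟩ := hγ (γ τ).1 (γ τ).2
    rw [hp (γ τ) ⟨mem_image_of_mem γ hτ, 1, one_pos, by simp⟩,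
      hp (γ τ') ⟨mem_image_of_mem γ hτ', (l / l') ^ 2, by positivity, ?_⟩]
    ext
    · field_simp
      linarith
    · field_simp
      linarith
  have el : l = l' := by
    -- Outside the origin a nonzero coordinate of `γ τ` determines the dilation; at the origin the
    -- normalisation `|l| = 1` does.
    have habs : l ^ 2 = l' ^ 2 := by
      by_cases h0 : γ τ = (0, 0)
      · rw [← sq_abs l, ← sq_abs l', hl1 h0, hl1' (eγ ▸ h0)]
      · rw [← eγ] at e2 e3
        by_cases hc : (γ τ).1 = 0
        · have hd : (γ τ).2 ≠ 0 := fun hd => h0 (Prod.ext hc hd)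
          have := mul_right_cancel₀ hd e3
          have h2 : (l ^ 2) ^ 2 = (l' ^ 2) ^ 2 := by linear_combination this
          exact (sq_eq_sq₀ (sq_nonneg _) (sq_nonneg _)).1 h2
        · exact mul_right_cancel₀ hc e2
    rcases sq_eq_sq_iff_eq_or_eq_neg.1 habs with h | h
    · exact h
    · rw [h] at e4
      nlinarith [sq_nonneg l']
  subst el
  rw [← eγ] at s'
  exact ⟨by exact_mod_cast e1, rfl, eγ, fun hinj => hinj hτ hτ' eγ, s.shift_unique hR s', e5⟩

theorem IsBertrandRep.relations (hR : IsBertrandPrimitive R) {μ μ' : ℚ}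
    {c d r₀ η l τ r₀' : ℝ} {k k' : ℕ} {θ : ℝ → ℝ} (h : S.IsBertrandRep R μ c d r₀ η k θ)
    (h' : S.IsNormalizedRep R γ μ' l τ r₀' k') :
    μ = μ' ∧ η = l / |l| ∧ k = k' ∧ (IsScaleCompatible R → r₀ = r₀') ∧
      c = l ^ 2 * (γ τ).1 ∧ d = l ^ 4 * (γ τ).2 ∧
      ∀ r ∈ S.I, θ r = l * bertrandTheta R (γ τ).1 (γ τ).2 k' (l * (r - r₀')) := by
  have s := h.scaledRep
  have s' := h'.scaledRep
  obtain ⟨e1, e2, e3, e4⟩ := (h.hasMetricForm hR).unique s.1 s'.1 (s'.hasMetricForm hR)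
  obtain ⟨-, -, -, e5, e6, e7⟩ := s.unique hR s'
  have hl := s'.2.1
  have hl0 : 0 < |l| := abs_pos.2 hl
  have hη : η = l / |l| := by
    rcases h.2.1 with rfl | rfl
    · rw [abs_of_pos (by linarith), div_self hl]
    · rw [abs_of_neg (by linarith), div_neg, div_self hl]
  refine ⟨by exact_mod_cast e1, hη, e6, fun hs => ?_, e2, e3, e4⟩
  obtain ⟨rb, hrb⟩ := S.nonempty_I
  have m' := s'.mem hrb
  have m := s.mem hrb
  have e8 := e7 rb hrb
  set t := bertrandTheta R c d k (η * (rb - r₀))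
  set t' := bertrandTheta R (γ τ).1 (γ τ).2 k' (l * (rb - r₀'))
  have hlη : l = η * |l| := by
    rw [hη]
    field_simp
  -- The two standard coordinates differ by the positive factor `|l|`, so compatible antiderivatives
  -- differ by `|l|⁻¹`, and the shifts coincide.
  have ht : t = |l| * t' := by
    refine mul_left_cancel₀ s.2.1 ?_
    rw [e8, ← mul_assoc, ← hlη]
  have := hs |l| hl0 (γ τ).1 (γ τ).2 t' (bertrandInterval_subset s'.2.2.1 m'.1)
  rw [sq_abs, (by norm_num : Even 4).pow_abs, ← e2, ← e3, ← ht, m.2, m'.2] at this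
  rw [hη] at this
  field_simp at this
  linarith

theorem BertrandData.mk' (hf : ∀ r ∈ S.I, deriv S.f r ≠ 0) {μ c d : ℝ} {θ : ℝ → ℝ}
    {i : ℕ} {A B : ℝ} {V : ℝ → ℝ} (hμ : 0 < μ) (h : S.HasMetricForm μ c d θ)
    (hV : S.IsBertrandPotential d θ i A B V) : ∃ ς, S.BertrandData μ c d θ i A B V ς := by
  obtain ⟨ς, hς, habs⟩ := h.exists_sign
  exact ⟨ς, hμ, h, hf, hV, hς, habs⟩

theorem IsLocallyClosing.isClosing_and_isStronglyClosing (hf : ∀ r ∈ S.I, deriv S.f r ≠ 0)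
    {V : ℝ → ℝ} (hV : S.SmoothPotential V) (h : S.IsLocallyClosing V) :
    S.IsClosing V ∧ S.IsStronglyClosing V := by
  obtain ⟨μ, c, d, θ, i, A, B, hμ, hform, hpot⟩ :=
    exists_bertrandPotential_of_locallyClosing hV hf h
  obtain ⟨ς, D⟩ := BertrandData.mk' hf (by exact_mod_cast hμ) hform hpot
  exact ⟨D.isClosing, D.isStronglyClosing⟩

/-- The potential with `i = 2` is admissible for every `d`; its sign condition holds with `A` the
sign of `θ⁴ + d` on the interval with number `k`. -/
theorem IsBertrandRep.exists_isClosing (hR : IsBertrandPrimitive R)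
    (hf : ∀ r ∈ S.I, deriv S.f r ≠ 0) {μ : ℚ} {c d r₀ η : ℝ} {k : ℕ} {θ : ℝ → ℝ}
    (h : S.IsBertrandRep R μ c d r₀ η k θ) : ∃ V, S.SmoothPotential V ∧ S.IsClosing V := by
  have hpot : S.IsBertrandPotential d θ 2 (bertrandSign k) 0
      (fun r => (-1) ^ 2 * bertrandSign k * |θ r| ^ (2 - ((2 : ℕ) : ℤ) ^ 2) / (2 : ℕ) + 0) := by
    refine ⟨Or.inr rfl, fun _ => rfl, fun h => by norm_num at h, fun _ r hr => ?_, fun _ _ => rfl⟩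
    have h4 : η ^ 4 = 1 := by rcases h.2.1 with h | h <;> norm_num [h]
    rw [(h.2.2.2 r hr).2.2, mul_pow, h4, one_mul]
    exact ((mem_bertrandInterval_iff h.2.2.1).1 (h.scaledRep.mem hr).1).2.2
  obtain ⟨ς, D⟩ := BertrandData.mk' hf h.scaledRep.1 (h.hasMetricForm hR) hpot
  exact ⟨_, D.smooth, D.isClosing⟩

/-- A closing potential produces some Bertrand form of the metric together with its own formula.
Uniqueness of the form transfers this formula to the prescribed `d` and `θ`. -/
theorem isClosing_iff_isBertrandPotential (hf : ∀ r ∈ S.I, deriv S.f r ≠ 0) {μ : ℚ} {c d : ℝ}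
    {θ : ℝ → ℝ} (hμ : 0 < μ) (h : S.HasMetricForm (μ : ℝ) c d θ) {V : ℝ → ℝ} :
    (S.SmoothPotential V ∧ S.IsClosing V) ↔
      ∃ (i : ℕ) (A B : ℝ), S.IsBertrandPotential d θ i A B V := by
  have hμ0 : (0 : ℝ) < μ := by exact_mod_cast hμ
  constructor
  · rintro ⟨hV, hc⟩
    obtain ⟨μ', c', d', θ', i, A, B, hμ', hform, hpot⟩ := exists_bertrandPotential_of_locallyClosing
      hV hf (hc.isSemilocallyClosing.isLocallyClosing hV)
    obtain ⟨-, -, e3, e4⟩ := h.unique hμ0 (by exact_mod_cast hμ') hform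
    obtain ⟨p1, p2, p3, p4, p5⟩ := hpot
    refine ⟨i, A, B, p1, e3 ▸ p2, p3, fun hi r hr => ?_, fun r hr => ?_⟩
    · rw [e4 hr, e3]
      exact p4 hi r hr
    · rw [e4 hr]
      exact p5 r hr
  · rintro ⟨i, A, B, hpot⟩
    obtain ⟨ς, D⟩ := BertrandData.mk' hf hμ0 h hpot
    exact ⟨D.smooth, D.isClosing⟩

end RevSurface

end

/-! ### Assembly of the theorem. -/

theorem mainTheorem4 (S : RevSurface)
    (R : ℝ → ℝ → ℝ → ℝ) (hR : IsBertrandPrimitive R)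
    (γ : ℝ → ℝ × ℝ) (hγ : IsScaleSection γ) :
    -- Part A
    (∀ V : ℝ → ℝ, S.SmoothPotential V →
      (S.IsClosing V → S.IsSemilocallyClosing V) ∧
      (S.IsStronglyClosing V → S.IsWeaklyClosing V) ∧
      (S.IsWeaklyClosing V → S.IsSemilocallyClosing V) ∧
      (S.IsSemilocallyClosing V → S.IsLocallyClosing V)) ∧
    -- Parts B and C
    ((∀ r ∈ S.I, deriv S.f r ≠ 0) →
      (∀ V : ℝ → ℝ, S.SmoothPotential V → S.IsLocallyClosing V →
        S.IsClosing V ∧ S.IsStronglyClosing V) ∧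
      -- the equivalent conditions
      List.TFAE
        [∃ V : ℝ → ℝ, S.SmoothPotential V ∧ S.IsClosing V,
         ∃ (μ : ℚ) (c d : ℝ) (θ : ℝ → ℝ), 0 < μ ∧ S.HasMetricForm (μ : ℝ) c d θ,
         ∃ (μ : ℚ) (c d r₀ η : ℝ) (k : ℕ) (θ : ℝ → ℝ), S.IsBertrandRep R μ c d r₀ η k θ,
         ∃ (μ : ℚ) (c d r₀ η : ℝ) (k : ℕ), S.EmbedsInBertrand R μ c d r₀ η k,
         ∃ (μ : ℚ) (l τ r₀ : ℝ) (k : ℕ), S.IsNormalizedRep R γ μ l τ r₀ k,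
         ∃ (μ : ℚ) (l τ r₀ : ℝ) (k : ℕ), S.EmbedsInNormalized R γ μ l τ r₀ k] ∧
      -- with the same parameters, the three forms of the second condition,
      -- and the two forms of the third one, say the same
      (∀ (μ : ℚ) (c d : ℝ) (θ : ℝ → ℝ), 0 < μ →
        (S.HasMetricForm (μ : ℝ) c d θ ↔
          ∃ (r₀ η : ℝ) (k : ℕ), S.IsBertrandRep R μ c d r₀ η k θ)) ∧
      (∀ (μ : ℚ) (c d r₀ η : ℝ) (k : ℕ),
        (∃ θ : ℝ → ℝ, S.IsBertrandRep R μ c d r₀ η k θ) ↔ S.EmbedsInBertrand R μ c d r₀ η k) ∧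
      (∀ (μ : ℚ) (l τ r₀ : ℝ) (k : ℕ),
        S.IsNormalizedRep R γ μ l τ r₀ k ↔ S.EmbedsInNormalized R γ μ l τ r₀ k) ∧
      -- uniqueness of the parameters and of the function `θ`
      (∀ (μ μ' : ℚ) (c d r₀ η c' d' r₀' η' : ℝ) (k k' : ℕ) (θ θ' : ℝ → ℝ),
        S.IsBertrandRep R μ c d r₀ η k θ → S.IsBertrandRep R μ' c' d' r₀' η' k' θ' →
        μ = μ' ∧ c = c' ∧ d = d' ∧ r₀ = r₀' ∧ η = η' ∧ k = k' ∧ EqOn θ θ' S.I) ∧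
      (∀ (μ μ' : ℚ) (l τ r₀ l' τ' r₀' : ℝ) (k k' : ℕ),
        S.IsNormalizedRep R γ μ l τ r₀ k → S.IsNormalizedRep R γ μ' l' τ' r₀' k' →
        μ = μ' ∧ l = l' ∧ γ τ = γ τ' ∧ (InjOn γ (Icc 0 (2 * Real.pi)) → τ = τ') ∧
          r₀ = r₀' ∧ k = k') ∧
      -- relations between the two sets of parameters
      (∀ (μ μ' : ℚ) (c d r₀ η l τ r₀' : ℝ) (k k' : ℕ) (θ : ℝ → ℝ),
        S.IsBertrandRep R μ c d r₀ η k θ → S.IsNormalizedRep R γ μ' l τ r₀' k' →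
        μ = μ' ∧ η = l / |l| ∧ k = k' ∧ (IsScaleCompatible R → r₀ = r₀') ∧
          c = l ^ 2 * (γ τ).1 ∧ d = l ^ 4 * (γ τ).2 ∧
          ∀ r ∈ S.I, θ r = l * bertrandTheta R (γ τ).1 (γ τ).2 k' (l * (r - r₀'))) ∧
      ∀ (μ : ℚ) (c d r₀ η : ℝ) (k : ℕ) (θ : ℝ → ℝ), S.IsBertrandRep R μ c d r₀ η k θ →
        -- all closing potentials
        (∀ V : ℝ → ℝ, (S.SmoothPotential V ∧ S.IsClosing V) ↔
          ∃ (i : ℕ) (A B : ℝ), S.IsBertrandPotential d θ i A B V) ∧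
        -- Part C
        ∀ (i : ℕ) (A B : ℝ) (V : ℝ → ℝ), S.IsBertrandPotential d θ i A B V →
          -- periods of the bounded nonsingular noncircular orbits
          (∀ (r φ : ℝ → ℝ) (K : ℝ), S.IsOscillation V r φ K →
            ∃ ρ : ℝ → ℝ, (∀ t, r t = ρ (φ t)) ∧
              IsLeast {T : ℝ | 0 < T ∧ Function.Periodic ρ T} (2 * Real.pi * μ / i)) ∧
          -- angular momenta of the circular orbits
          (∀ r ∈ S.I, ∀ K : ℝ, S.CircularAt V r K ↔
            (K = 1 / (μ : ℝ) * √(A / (|θ r| ^ (i ^ 2) + d)) ∨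
              K = -(1 / (μ : ℝ) * √(A / (|θ r| ^ (i ^ 2) + d))))) ∧
          -- the attracting centre
          (∃ (e : ℝ) (F : Filter ℝ), S.IsBoundaryCircle e F ∧ S.InfAt S.f F) ∧
          ∀ (e : ℝ) (F : Filter ℝ), S.IsBoundaryCircle e F →
            (S.InfAt S.f F ↔ S.SupAt (fun r => A * |θ r|) F) ∧
            (S.InfAt S.f F ↔ S.InfAt V F)) := by
  refine ⟨fun V hV => ⟨fun h => h.isSemilocallyClosing, fun h => h.isWeaklyClosing hV,
    fun h => h.isSemilocallyClosing hV, fun h => h.isLocallyClosing hV⟩, fun hf => ?_⟩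
  refine ⟨fun V hV h => h.isClosing_and_isStronglyClosing hf hV, ?_,
    fun μ c d θ hμ => ⟨fun h => h.exists_bertrandRep hR hf hμ,
      fun ⟨_, _, _, h⟩ => h.hasMetricForm hR⟩,
    fun μ c d r₀ η k => RevSurface.exists_bertrandRep_iff_embedsInBertrand,
    fun μ l τ r₀ k => RevSurface.isNormalizedRep_iff_embedsInNormalized,
    fun _ _ _ _ _ _ _ _ _ _ _ _ _ _ h h' => h.unique hR h',
    fun _ _ _ _ _ _ _ _ _ _ h h' => h.unique hR hγ h',
    fun _ _ _ _ _ _ _ _ _ _ _ _ h h' => h.relations hR h', fun μ c d r₀ η k θ h => ?_⟩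
  · tfae_have 1 → 2 := fun ⟨V, hV, hc⟩ => by
      obtain ⟨μ, c, d, θ, -, -, -, hμ, h, -⟩ :=
        RevSurface.exists_bertrandPotential_of_locallyClosing hV hf
          (hc.isSemilocallyClosing.isLocallyClosing hV)
      exact ⟨μ, c, d, θ, hμ, h⟩
    tfae_have 2 → 3 := fun ⟨μ, c, d, θ, hμ, h⟩ => by
      obtain ⟨r₀, η, k, h⟩ := h.exists_bertrandRep hR hf hμ
      exact ⟨μ, c, d, r₀, η, k, θ, h⟩
    tfae_have 3 → 1 := fun ⟨_, _, _, _, _, _, _, h⟩ => h.exists_isClosing hR hf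
    tfae_have 3 ↔ 4 := by
      simp only [RevSurface.exists_bertrandRep_iff_embedsInBertrand]
    tfae_have 2 → 5 := fun ⟨μ, c, d, θ, hμ, h⟩ => ⟨μ, h.exists_normalizedRep hR hγ hf hμ⟩
    tfae_have 5 → 2 := fun ⟨μ, _, _, _, _, h⟩ =>
      ⟨μ, _, _, _, h.1.1, h.scaledRep.hasMetricForm hR⟩
    tfae_have 5 ↔ 6 := by
      simp only [RevSurface.isNormalizedRep_iff_embedsInNormalized]
    tfae_finish
  · have hform := h.hasMetricForm hR
    refine ⟨fun V => RevSurface.isClosing_iff_isBertrandPotential hf h.1 hform,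
      fun i A B V hV => ?_⟩
    obtain ⟨ς, D⟩ := RevSurface.BertrandData.mk' hf h.scaledRep.1 hform hV
    exact ⟨fun r φ K ho => D.exists_periodic ho, fun r hr K => D.circularAt_iff hr K,
      D.exists_centre, fun e F hF => D.centre_iff hF⟩
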